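/- Conventions. $G=(V,E)$ is a simple graph on $V=\{0,\dots,n-1\}$ with $m\ge 1$ edges, and $H$ is a simple graph with at least one edge and no isolated vertices. $\#H$ is the number of subgraphs of $G$ isomorphic to $H$. The fractional edge-cover number $\rho(H)$ is the minimum of $\sum_{e\in E(H)}x_e$ over all $x\ge 0$ with $\sum_{e\ni a}x_e\ge 1$ for every vertex $a$ of $H$. A number $a$ is a $(1\pm\varepsilon)$-approximation to $b$ if $(1-\varepsilon)b\le a\le(1+\varepsilon)b$. An algorithm is a program of a randomized word RAM (unit-cost arithmetic on words, uniform random integers below a given word) that accesses $G$ only through degree queries (the degree $d_v$ of $v$), neighbor queries (the $i$-th neighbor of $v$, $i\le d_v$, in an arbitrary fixed order), pair queries (is $\{u,v\}$ an edge?) and edge-sample queries (a uniformly random edge of $G$). It is given $n$, $m$, $H$ and the precision parameter $\varepsilon$ (in the form $\lceil 1/\varepsilon\rceil$). Words have $O(\log(n/\varepsilon))$ bits, with a constant depending on $H$ and on the exponent $c$ below (and are long enough to hold the colors, if there are any). In the bounds below, $\#H=0$ is read as $\#H=1$. Theorem. For every $c\in\mathbb{N}$ there are a randomized algorithm and an exponent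 $k$ such that for every $H$ there is a constant $C$ (depending only on $c$ and $H$) with the following property. For every $\varepsilon\in(0,1)$ and every input graph $G$, with probability at least $1-n^{-c}$ the algorithm outputs a $(1\pm\varepsilon)$-approximation to $\#H$, makes at most $$C\left(\frac{\log n}{\varepsilon}\right)^{k}\min\left\{m,\frac{m^{\rho(H)}}{\#H}\right\}\text{ queries}\quad\text{and halts within time}\quad C\left(\frac{\log n}{\varepsilon}\right)^{k}\frac{m^{\rho(H)}}{\#H}.$$ The same holds for the edge-colored version (join size estimation for binary relations): the edges of $H$ and of $G$ carry colors $c_H:E(H)\to\mathbb{N}$ and $c_G:E\to\mathbb{N}$, the coloring $c_H$ is given with $H$, every neighbor, pair and edge-sample query that returns an edge also reveals its color, and $\#H$ is replaced throughout by the number $\#H_c$ of subgraphs $H'$ of $G$ that admit an isomorphism $H\to H'$ preserving the colors of all edges. The constant $C$ does not depend on the colorings. -/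

import Mathlib

namespace SubgraphCounting

/-! ## Graph-theoretic notions -/

open Classical in
/-- The fractional edge-cover number `ρ(H)`: the optimal value of the linear program
minimize `∑ x_e` over edge weights `x_e ≥ 0` such that every vertex `a` satisfies
`∑_{e ∋ a} x_e ≥ 1`. -/
noncomputable def fractionalEdgeCoverNumber {V : Type*} [Fintype V] (H : SimpleGraph V) : ℝ :=
  sInf {s : ℝ | ∃ x : Sym2 V → ℝ, (∀ e ∈ H.edgeSet, 0 ≤ x e) ∧
    (∀ a : V, 1 ≤ ∑ e ∈ H.incidenceFinset a, x e) ∧ s = ∑ e ∈ H.edgeFinset, x e}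

/-- The number of colorful copies of `H` in `G`: subgraphs `H'` of `G` for which there is an
isomorphism from `H` onto `H'` that maps every edge of `H` to an edge of `G` of the same color.
(Only the colors of edges matter.) -/
noncomputable def colorfulCopyCount {V W : Type*} (G : SimpleGraph V) (cG : Sym2 V → ℕ)
    (H : SimpleGraph W) (cH : Sym2 W → ℕ) : ℕ :=
  {H' : G.Subgraph | ∃ φ : H ≃g H'.coe, ∀ a b : W, H.Adj a b →
    cG s((φ a : V), (φ b : V)) = cH s(a, b)}.ncard

/-- `a` is a `(1 ± ε)`-approximation to `b`. -/
def IsApprox (ε a b : ℝ) : Prop := (1 - ε) * b ≤ a ∧ a ≤ (1 + ε) * b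

/-! ## Query access -/

/-- An edge-colored graph on the vertex set `{0, …, n-1}`, together with an (arbitrary) order of
the neighbors of each vertex. The uncolored case is `color = fun _ => 0`. -/
structure InputGraph (n : ℕ) where
  graph : SimpleGraph (Fin n)
  nbr : ∀ v : Fin n, Fin (graph.neighborSet v).ncard ≃ graph.neighborSet v
  color : Sym2 (Fin n) → ℕ

namespace InputGraph

variable {n : ℕ} (X : InputGraph n)

/-- The number `m` of edges. -/
noncomputable def numEdges : ℕ := X.graph.edgeSet.ncard

/-- Answer to a degree query: the degree of `v` (and `0` if `v` is not a vertex). -/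
noncomputable def degreeAnswer (v : ℕ) : ℕ :=
  if hv : v < n then (X.graph.neighborSet ⟨v, hv⟩).ncard else 0

/-- Answer to a neighbor query: the `i`-th neighbor of `v`, counted from `0`, and the color of the
edge to it (`(0, 0)` if `v` is not a vertex or `i` is not smaller than its degree). -/
noncomputable def neighborAnswer (v i : ℕ) : ℕ × ℕ :=
  if hv : v < n then
    if hi : i < (X.graph.neighborSet ⟨v, hv⟩).ncard then
      let u : Fin n := (X.nbr ⟨v, hv⟩ ⟨i, hi⟩ : Fin n)
      (u, X.color s(⟨v, hv⟩, u))
    else (0, 0)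
  else (0, 0)

open Classical in
/-- Answer to a pair query: `1` and the color of the edge if `u` and `v` are adjacent, `(0, 0)`
otherwise. -/
noncomputable def pairAnswer (u v : ℕ) : ℕ × ℕ :=
  if h : u < n ∧ v < n then
    if X.graph.Adj ⟨u, h.1⟩ ⟨v, h.2⟩ then (1, X.color s(⟨u, h.1⟩, ⟨v, h.2⟩)) else (0, 0)
  else (0, 0)

open Classical in
/-- Answer to an edge-sample query: a uniformly random edge, given as its smaller endpoint, its
larger endpoint and its color (`(0, 0, 0)` if there is no edge). -/
noncomputable def edgeSample : PMF (ℕ × ℕ × ℕ) :=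
  if h : X.graph.edgeFinset.Nonempty then
    (PMF.uniformOfFinset X.graph.edgeFinset h).map
      fun e => ((e.inf : ℕ), (e.sup : ℕ), X.color e)
  else PMF.pure (0, 0, 0)

end InputGraph

/-! ## Randomized word RAM with query access to a graph

The machine has registers and a random-access memory whose cells are `w`-bit words. A program is a
finite list of instructions; executing any one instruction takes one unit of time. -/

inductive Instr where
  /-- `reg[dst] := k` -/
  | const (dst k : ℕ)
  /-- `reg[dst] := reg[a] + reg[b]` -/
  | add (dst a b : ℕ)
  /-- `reg[dst] := reg[a] - reg[b]`, truncated at `0` -/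
  | sub (dst a b : ℕ)
  /-- `reg[dst] := reg[a] * reg[b]` -/
  | mul (dst a b : ℕ)
  /-- `reg[dst] := reg[a] / reg[b]`, integer division (`0` for a zero divisor) -/
  | div (dst a b : ℕ)
  /-- `reg[dst] := mem[reg[a]]` -/
  | load (dst a : ℕ)
  /-- `mem[reg[a]] := reg[src]` -/
  | store (a src : ℕ)
  /-- continue at instruction `target` if `reg[a] = 0` -/
  | jumpIfZero (a target : ℕ)
  /-- `reg[dst] :=` a uniformly random element of `{0, …, reg[a] - 1}` (`0` if `reg[a] = 0`) -/
  | rand (dst a : ℕ)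
  /-- degree query for the vertex `reg[v]` -/
  | degreeQuery (dst v : ℕ)
  /-- neighbor query `(reg[v], reg[i])`, answered by a neighbor and the color of the edge to it -/
  | neighborQuery (dst col v i : ℕ)
  /-- pair query `(reg[u], reg[v])`, answered by a truth value and the color -/
  | pairQuery (dst col u v : ℕ)
  /-- edge-sample query, answered by the two endpoints and the color -/
  | edgeQuery (dst₁ dst₂ col : ℕ)

/-- A program; it halts when the program counter leaves the list. -/
abbrev Program := List Instr

/-- A configuration of the machine, with the number of queries made so far. -/
structure Config where
  pc : ℕ
  reg : ℕ → ℕ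
  mem : ℕ → ℕ
  queries : ℕ

namespace Config

/-- Write the `w`-bit word `k mod 2 ^ w` into register `dst`. -/
def set (w : ℕ) (s : Config) (dst k : ℕ) : Config :=
  { s with reg := Function.update s.reg dst (k % 2 ^ w) }

/-- Proceed to the next instruction. -/
def next (s : Config) : Config := { s with pc := s.pc + 1 }

/-- Count one query. -/
def tick (s : Config) : Config := { s with queries := s.queries + 1 }

end Config

/-- A uniformly random element of `{0, …, k - 1}` (`0` if `k = 0`). -/
noncomputable def randBelow (k : ℕ) : PMF ℕ :=
  if h : (Finset.range k).Nonempty then PMF.uniformOfFinset (Finset.range k) h else PMF.pure 0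

/-- The effect of one instruction. -/
noncomputable def exec {n : ℕ} (X : InputGraph n) (w : ℕ) (s : Config) : Instr → PMF Config
  | .const dst k => PMF.pure (s.set w dst k).next
  | .add dst a b => PMF.pure (s.set w dst (s.reg a + s.reg b)).next
  | .sub dst a b => PMF.pure (s.set w dst (s.reg a - s.reg b)).next
  | .mul dst a b => PMF.pure (s.set w dst (s.reg a * s.reg b)).next
  | .div dst a b => PMF.pure (s.set w dst (s.reg a / s.reg b)).next
  | .load dst a => PMF.pure (s.set w dst (s.mem (s.reg a))).next
  | .store a src =>
      PMF.pure ({ s with mem := Function.update s.mem (s.reg a) (s.reg src) } : Config).next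
  | .jumpIfZero a target =>
      PMF.pure (if s.reg a = 0 then { s with pc := target } else s.next)
  | .rand dst a => (randBelow (s.reg a)).map fun k => (s.set w dst k).next
  | .degreeQuery dst v => PMF.pure (s.set w dst (X.degreeAnswer (s.reg v))).next.tick
  | .neighborQuery dst col v i =>
      let r := X.neighborAnswer (s.reg v) (s.reg i)
      PMF.pure ((s.set w dst r.1).set w col r.2).next.tick
  | .pairQuery dst col u v =>
      let r := X.pairAnswer (s.reg u) (s.reg v)
      PMF.pure ((s.set w dst r.1).set w col r.2).next.tick
  | .edgeQuery dst₁ dst₂ col =>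
      X.edgeSample.map fun r =>
        (((s.set w dst₁ r.1).set w dst₂ r.2.1).set w col r.2.2).next.tick

/-- One step of the program `P`; a halted configuration does not change. -/
noncomputable def step {n : ℕ} (P : Program) (X : InputGraph n) (w : ℕ) (s : Config) :
    PMF Config :=
  match P[s.pc]? with
  | some I => exec X w s I
  | none => PMF.pure s

/-- The distribution of the configuration after `t` steps. -/
noncomputable def run {n : ℕ} (P : Program) (X : InputGraph n) (w : ℕ) : ℕ → Config → PMF Config
  | 0, s => PMF.pure s
  | t + 1, s => (step P X w s).bind (run P X w t)

/-- The program has halted. -/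
def Halted (P : Program) (s : Config) : Prop := P.length ≤ s.pc

open Classical in
/-- The initial configuration. Registers `0, 1, 2, 3` hold the number `n` of vertices and the number
`m` of edges of the input graph, the precision parameter in the form `r = ⌈1/ε⌉`, and the number `h`
of vertices of `H`; the memory holds the `h × h` adjacency matrix of `H`, followed by the `h × h`
matrix of the colors of the edges of `H`. Everything else is `0`. -/
noncomputable def initConfig (n m r h : ℕ) (H : SimpleGraph (Fin h)) (cH : Sym2 (Fin h) → ℕ) :
    Config where
  pc := 0
  reg := fun i => if i = 0 then n else if i = 1 then m else if i = 2 then r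
    else if i = 3 then h else 0
  mem := fun i =>
    if hi : i < h * h then
      if H.Adj (finProdFinEquiv.symm ⟨i, hi⟩).1 (finProdFinEquiv.symm ⟨i, hi⟩).2 then 1 else 0
    else if hi : i - h * h < h * h then
      if H.Adj (finProdFinEquiv.symm ⟨i - h * h, hi⟩).1 (finProdFinEquiv.symm ⟨i - h * h, hi⟩).2
      then cH s((finProdFinEquiv.symm ⟨i - h * h, hi⟩).1, (finProdFinEquiv.symm ⟨i - h * h, hi⟩).2)
      else 0
    else 0
  queries := 0

/-- The event that a run is successful: the program has halted, it has made at most `Q` queries, and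
the number it outputs, the fraction `reg[0] / reg[1]`, is a `(1 ± ε)`-approximation to `N`. -/
def Success (P : Program) (Q ε : ℝ) (N : ℕ) : Set Config :=
  {s | Halted P s ∧ (s.queries : ℝ) ≤ Q ∧
    s.reg 1 ≠ 0 ∧ IsApprox ε ((s.reg 0 : ℝ) / (s.reg 1 : ℝ)) N}

/-- The probability that the program `P`, on word size `w`, precision parameter `ε`, target graph
`H` with edge coloring `cH` and query access to `X`, halts within `T` units of time, makes at most
`Q` queries and outputs a `(1 ± ε)`-approximation to `N`. -/
noncomputable def successProb (P : Program) (w : ℕ) (ε : ℝ) {h : ℕ} (H : SimpleGraph (Fin h))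
    (cH : Sym2 (Fin h) → ℕ) {n : ℕ} (X : InputGraph n) (T Q : ℝ) (N : ℕ) : ENNReal :=
  (run P X w ⌊T⌋₊ (initConfig n X.numEdges ⌈1 / ε⌉₊ h H cH)).toOuterMeasure (Success P Q ε N)

/-- The quantity `m ^ ρ(H) / N`, where `N` is the number of copies (`N = 0` is replaced by `1`). -/
noncomputable def ratio (m : ℕ) {h : ℕ} (H : SimpleGraph (Fin h)) (N : ℕ) : ℝ :=
  (m : ℝ) ^ fractionalEdgeCoverNumber H / (max N 1 : ℕ)

end SubgraphCounting

/-! Color-preserving embeddings of `H` into `G` are counted by the copies times the color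
automorphisms of `H` (`card_colorEmbeddings`), so it suffices to estimate the number of embeddings.
One trial draws an image for every vertex `i` of `H` in turn. A random vertex `j` of `H` is chosen
as partner; the image of `i` is a random endpoint of a random edge if `i < j` (each vertex of degree
`d` has probability `d / 2m`), and a random neighbor of the image of `j` if `j < i` (probability `1
/ d`, with `d` the degree of the image of `j`). For a given embedding one edge at `i` is best, in
that it gives the image of `i` the highest probability, with ties broken by the index. Samples are
kept only if every vertex used its best edge; then each embedding has exactly one code. A final
rejection step cancels the draw probabilities, so that every embedding is produced with probability
exactly `1 / M` (`trial_apply_true`).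

Rejection requires that the inverse draw probability never exceeds `M`, and this is where the
fractional edge-cover number enters. Let `r i j` be the inverse probability of the image of `i`
along the edge `ij`, apart from the choice of the partner. The two orientations of an edge satisfy
`r i j * r j i = 2m`. If the bipartite double cover of `H` is covered by `D` edges, multiplying
these identities over the cover shows that the product of the minima over `j` of `r i j` is at most
`(2m) ^ (D / 2)` (`prod_sq_le_of_dart_cover`, `acceptNum_le`). Hall's theorem provides such a cover,
with `D` the largest weight of a labeling by 0, 1, 2 (`exists_dart_cover`), and weak duality gives
`D ≤ 2ρ` (`labeling_le_fractionalEdgeCoverNumber`). Hence `M = O(m ^ ρ)`.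

Trials are repeated until there are `τ` successes, with `τ` of order `log n / ε²`, or until `2τM`
trials are made. With success probability `p = N / M`, two exponential martingales and optional
stopping show that the number `t` of trials satisfies `pt ≈ τ` when the target is reached
(`badness_step`, `one_le_badness`). So `τM / t` approximates `N`, and `t = O(τM / N)` is the
required time although `N` is unknown. To limit the queries, the program collects all edges by
coupon collecting once `m` trials have been made (`one_le_collect`), stores them in tables, and
continues without queries. The tables reproduce the distributions of the query answers, so the
martingales run through both phases (`one_le_mean_estimate`).

On the side of the machine, programs are written in a small structured language whose compilation
preserves success probabilities (`compile_sound`, `run_compiled`). `Always` expresses what holds for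
all outcomes, and `Refines` compares the outcomes of a program with an abstract distribution. The
semantics carries a clock, which yields the bounds on time and queries. -/

namespace SubgraphCounting

/-! ## A structured language for the word RAM

Registers below `100` are program variables, the others serve to evaluate terms. -/

/-- Arithmetic terms over registers and memory. -/
inductive Term where
  | lit (k : ℕ)
  | reg (i : ℕ)
  | add (a b : Term)
  | sub (a b : Term)
  | mul (a b : Term)
  | div (a b : Term)
  | get (a : Term)

namespace Term

/-- The value of a term, with `w`-bit arithmetic. -/
def val (w : ℕ) (s : Config) : Term → ℕ
  | lit k => k % 2 ^ w
  | reg i => s.reg i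
  | add a b => (a.val w s + b.val w s) % 2 ^ w
  | sub a b => a.val w s - b.val w s
  | mul a b => (a.val w s * b.val w s) % 2 ^ w
  | div a b => a.val w s / b.val w s
  | get a => s.mem (a.val w s)

/-- Code that evaluates a term into register `t`, using only registers from `t` on. -/
def code (t : ℕ) : Term → List Instr
  | lit k => [.const t k]
  | reg i => [.const t 0, .add t t i]
  | add a b => a.code t ++ (b.code (t + 1) ++ [.add t t (t + 1)])
  | sub a b => a.code t ++ (b.code (t + 1) ++ [.sub t t (t + 1)])
  | mul a b => a.code t ++ (b.code (t + 1) ++ [.mul t t (t + 1)])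
  | div a b => a.code t ++ (b.code (t + 1) ++ [.div t t (t + 1)])
  | get a => a.code t ++ [.load t t]

def size : Term → ℕ
  | lit _ => 1
  | reg _ => 2
  | add a b => a.size + b.size + 1
  | sub a b => a.size + b.size + 1
  | mul a b => a.size + b.size + 1
  | div a b => a.size + b.size + 1
  | get a => a.size + 1

/-- The term mentions program variables only. -/
def inScope : Term → Bool
  | lit _ => true
  | reg i => i < 100
  | add a b => a.inScope && b.inScope
  | sub a b => a.inScope && b.inScope
  | mul a b => a.inScope && b.inScope
  | div a b => a.inScope && b.inScope
  | get a => a.inScope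

theorem length_code (e : Term) (t : ℕ) : (e.code t).length = e.size := by
  induction e generalizing t <;> simp_all [code, size] <;> omega

end Term

/-- All words are below `2 ^ w`. -/
def Config.Bounded (w : ℕ) (s : Config) : Prop :=
  (∀ i, s.reg i < 2 ^ w) ∧ ∀ i, s.mem i < 2 ^ w

/-- The two configurations differ in registers from `100` on only. -/
def Config.Agree (s t : Config) : Prop :=
  (∀ i < 100, s.reg i = t.reg i) ∧ s.mem = t.mem ∧ s.queries = t.queries ∧ s.pc = t.pc

/-- Advance the clock, which is kept in the field `pc`. -/
def Config.bump (k : ℕ) (s : Config) : Config := { s with pc := s.pc + k }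

def Config.put (s : Config) (a v : ℕ) : Config := { s with mem := Function.update s.mem a v }

namespace Config

variable (w : ℕ) (s : Config) (d v k a : ℕ)

@[simp] theorem reg_bump : (s.bump k).reg = s.reg := rfl
@[simp] theorem mem_bump : (s.bump k).mem = s.mem := rfl
@[simp] theorem queries_bump : (s.bump k).queries = s.queries := rfl
@[simp] theorem pc_bump : (s.bump k).pc = s.pc + k := rfl
@[simp] theorem reg_set (i : ℕ) :
    (s.set w d v).reg i = if i = d then v % 2 ^ w else s.reg i := by
  simp [set, Function.update_apply]
@[simp] theorem mem_set : (s.set w d v).mem = s.mem := rfl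
@[simp] theorem queries_set : (s.set w d v).queries = s.queries := rfl
@[simp] theorem pc_set : (s.set w d v).pc = s.pc := rfl
@[simp] theorem reg_put : (s.put a v).reg = s.reg := rfl
@[simp] theorem mem_put (i : ℕ) :
    (s.put a v).mem i = if i = a then v else s.mem i := by
  simp [put, Function.update_apply]
@[simp] theorem queries_put : (s.put a v).queries = s.queries := rfl
@[simp] theorem pc_put : (s.put a v).pc = s.pc := rfl
@[simp] theorem reg_tick : s.tick.reg = s.reg := rfl
@[simp] theorem mem_tick : s.tick.mem = s.mem := rfl
@[simp] theorem queries_tick : s.tick.queries = s.queries + 1 := rfl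
@[simp] theorem pc_tick : s.tick.pc = s.pc := rfl

variable {w s d v k a}

theorem Bounded.bump (h : s.Bounded w) : (s.bump k).Bounded w := h
theorem Bounded.tick (h : s.Bounded w) : s.tick.Bounded w := h
theorem Bounded.set (h : s.Bounded w) : (s.set w d v).Bounded w := by
  refine ⟨fun i => ?_, h.2⟩
  rw [reg_set]
  split
  · exact Nat.mod_lt _ (by positivity)
  · exact h.1 i
theorem Bounded.put (h : s.Bounded w) (hv : v < 2 ^ w) : (s.put a v).Bounded w := by
  refine ⟨h.1, fun i => ?_⟩
  rw [mem_put]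
  split
  · exact hv
  · exact h.2 i

theorem Agree.refl (s : Config) : s.Agree s := ⟨fun _ _ => rfl, rfl, rfl, rfl⟩

end Config

theorem Term.val_lt {w : ℕ} {s : Config} (h : s.Bounded w) (e : Term) : e.val w s < 2 ^ w := by
  have : 0 < 2 ^ w := by positivity
  induction e with
  | lit k => exact Nat.mod_lt _ this
  | reg i => exact h.1 i
  | add a b => exact Nat.mod_lt _ this
  | sub a b iha _ => exact lt_of_le_of_lt (Nat.sub_le _ _) iha
  | mul a b => exact Nat.mod_lt _ this
  | div a b iha _ => exact lt_of_le_of_lt (Nat.div_le_self _ _) iha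
  | get a => exact h.2 _

theorem Term.val_congr {w : ℕ} {s s' : Config} (h : ∀ i < 100, s.reg i = s'.reg i)
    (hm : s.mem = s'.mem) (e : Term) (he : e.inScope) : e.val w s = e.val w s' := by
  induction e <;> simp_all [Term.val, Term.inScope]

/-- Structured programs. -/
inductive Stmt where
  | skip
  | asg (d : ℕ) (e : Term)
  | sto (a e : Term)
  | rnd (d : ℕ) (e : Term)
  | dg (d : ℕ) (v : Term)
  | nb (d col : ℕ) (v i : Term)
  | pr (d col : ℕ) (u v : Term)
  | edge (d₁ d₂ col : ℕ)
  | seq (c d : Stmt)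
  | ite (e : Term) (c d : Stmt)
  /-- `i := 0; while i < b ∧ e ≠ 0 do (c; i := i + 1)` -/
  | loop (i b : ℕ) (e : Term) (c : Stmt)

namespace Stmt

def size : Stmt → ℕ
  | skip => 0
  | asg _ e => e.size + 2
  | sto a e => a.size + e.size + 1
  | rnd _ e => e.size + 1
  | dg _ v => v.size + 1
  | nb _ _ v i => v.size + i.size + 1
  | pr _ _ u v => u.size + v.size + 1
  | edge _ _ _ => 1
  | seq c d => c.size + d.size
  | ite e c d => e.size + 1 + c.size + 2 + d.size
  | loop _ _ e c => 1 + 6 + (e.size + 1) + c.size + 4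

/-- Compilation, for code placed at position `p`. -/
def code (p : ℕ) : Stmt → List Instr
  | skip => []
  | asg d e => e.code 100 ++ [.const 101 0, .add d 100 101]
  | sto a e => a.code 100 ++ (e.code 101 ++ [.store 100 101])
  | rnd d e => e.code 100 ++ [.rand d 100]
  | dg d v => v.code 100 ++ [.degreeQuery d 100]
  | nb d col v i => v.code 100 ++ (i.code 101 ++ [.neighborQuery d col 100 101])
  | pr d col u v => u.code 100 ++ (v.code 101 ++ [.pairQuery d col 100 101])
  | edge d₁ d₂ col => [.edgeQuery d₁ d₂ col]
  | seq c d => c.code p ++ d.code (p + c.size)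
  | ite e c d => e.code 100 ++ (.jumpIfZero 100 (p + e.size + 1 + c.size + 2) ::
      (c.code (p + e.size + 1) ++ ([.const 100 0,
        .jumpIfZero 100 (p + e.size + 1 + c.size + 2 + d.size)] ++
          d.code (p + e.size + 1 + c.size + 2))))
  | loop i b e c => .const i 0 :: ((Term.sub (.reg b) (.reg i)).code 100 ++
      (.jumpIfZero 100 (p + (1 + 6 + (e.size + 1) + c.size + 4)) :: (e.code 100 ++
        (.jumpIfZero 100 (p + (1 + 6 + (e.size + 1) + c.size + 4)) ::
          (c.code (p + 1 + 6 + (e.size + 1)) ++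
            [.const 100 1, .add i i 100, .const 100 0, .jumpIfZero 100 (p + 1)])))))

theorem length_code (c : Stmt) (p : ℕ) : (c.code p).length = c.size := by
  induction c generalizing p <;> simp_all [code, size, Term.length_code, Term.size] <;> omega

/-- The registers that a statement assigns to. -/
def writes : Stmt → List ℕ
  | skip => []
  | asg d _ => [d]
  | sto _ _ => []
  | rnd d _ => [d]
  | dg d _ => [d]
  | nb d col _ _ => [d, col]
  | pr d col _ _ => [d, col]
  | edge d₁ d₂ col => [d₁, d₂, col]
  | seq c d => c.writes ++ d.writes
  | ite _ c d => c.writes ++ d.writes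
  | loop i _ _ c => i :: c.writes

/-- Only program variables are used, and loop bodies do not assign to the counter or bound. -/
def inScope : Stmt → Bool
  | skip => true
  | asg d e => d < 100 && e.inScope
  | sto a e => a.inScope && e.inScope
  | rnd d e => d < 100 && e.inScope
  | dg d v => d < 100 && v.inScope
  | nb d col v i => d < 100 && col < 100 && v.inScope && i.inScope
  | pr d col u v => d < 100 && col < 100 && u.inScope && v.inScope
  | edge d₁ d₂ col => d₁ < 100 && d₂ < 100 && col < 100
  | seq c d => c.inScope && d.inScope
  | ite e c d => e.inScope && c.inScope && d.inScope
  | loop i b e c => i < 100 && b < 100 && i != b && e.inScope && c.inScope &&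
      !c.writes.contains i && !c.writes.contains b

end Stmt

/-- Loop semantics; the first argument bounds the number of iterations. -/
noncomputable def loopSem (w i : ℕ) (e : Term) (body : Config → PMF Config) :
    ℕ → Config → PMF Config
  | 0, s => PMF.pure (s.bump 6)
  | k + 1, s =>
    if e.val w s = 0 then PMF.pure (s.bump (6 + (e.size + 1)))
    else (body (s.bump (6 + (e.size + 1)))).bind fun s' =>
      loopSem w i e body k ((s'.set w i (s'.reg i + 1)).bump 4)

/-- The semantics of statements. The field `pc` is a clock here. -/
noncomputable def sem {n : ℕ} (X : InputGraph n) (w : ℕ) : Stmt → Config → PMF Config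
  | .skip, s => PMF.pure s
  | .asg d e, s => PMF.pure ((s.set w d (e.val w s)).bump (e.size + 2))
  | .sto a e, s => PMF.pure ((s.put (a.val w s) (e.val w s)).bump (a.size + e.size + 1))
  | .rnd d e, s => (randBelow (e.val w s)).map fun k => (s.set w d k).bump (e.size + 1)
  | .dg d v, s => PMF.pure ((s.set w d (X.degreeAnswer (v.val w s))).tick.bump (v.size + 1))
  | .nb d col v i, s =>
      PMF.pure (((s.set w d (X.neighborAnswer (v.val w s) (i.val w s)).1).set w col
        (X.neighborAnswer (v.val w s) (i.val w s)).2).tick.bump (v.size + i.size + 1))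
  | .pr d col u v, s =>
      PMF.pure (((s.set w d (X.pairAnswer (u.val w s) (v.val w s)).1).set w col
        (X.pairAnswer (u.val w s) (v.val w s)).2).tick.bump (u.size + v.size + 1))
  | .edge d₁ d₂ col, s => X.edgeSample.map fun r =>
      (((s.set w d₁ r.1).set w d₂ r.2.1).set w col r.2.2).tick.bump 1
  | .seq c d, s => (sem X w c s).bind (sem X w d)
  | .ite e c d, s =>
      if e.val w s = 0 then sem X w d (s.bump (e.size + 1))
      else (sem X w c (s.bump (e.size + 1))).map fun s' => s'.bump 2
  | .loop i b e c, s =>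
      loopSem w i e (sem X w c) (s.reg b) ((s.set w i 0).bump 1)

/-! ### Properties of all outcomes -/

section support

variable {n : ℕ} {X : InputGraph n} {w : ℕ}

/-- Boundedness, untouched registers and untouched memory all survive the updates of clock and
counter, so for them the number of iterations is irrelevant. -/
theorem loopSem_invariant {i : ℕ} {e : Term} {body : Config → PMF Config}
    (I : Config → Prop) (hbump : ∀ s k, I s → I (s.bump k))
    (hbody : ∀ s, I s → ∀ s' ∈ (body s).support, I s')
    (hset : ∀ s v, I s → I (s.set w i v)) (k : ℕ) (s : Config) (hs : I s) :
    ∀ s' ∈ (loopSem w i e body k s).support, I s' := by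
  induction k generalizing s with
  | zero =>
    intro s' h
    simp only [loopSem, PMF.support_pure, Set.mem_singleton_iff] at h
    exact h ▸ hbump _ _ hs
  | succ k ih =>
    intro s' h
    simp only [loopSem] at h
    split at h
    · simp only [PMF.support_pure, Set.mem_singleton_iff] at h
      exact h ▸ hbump _ _ hs
    · rw [PMF.mem_support_bind_iff] at h
      obtain ⟨s₁, h₁, h₂⟩ := h
      exact ih _ (hbump _ _ (hset _ _ (hbody _ (hbump _ _ hs) _ h₁))) _ h₂

theorem sem_bounded (c : Stmt) (s : Config) (hs : s.Bounded w) :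
    ∀ s' ∈ (sem X w c s).support, s'.Bounded w := by
  induction c generalizing s with
  | skip => simpa [sem] using hs
  | asg d e => simpa [sem] using hs.set.bump
  | sto a e => simpa [sem] using (hs.put (Term.val_lt hs _)).bump
  | rnd d e => simp only [sem, PMF.mem_support_map_iff]; rintro _ ⟨k, -, rfl⟩; exact hs.set.bump
  | dg d v => simpa [sem] using hs.set.tick.bump
  | nb d col v i => simpa [sem] using hs.set.set.tick.bump
  | pr d col v i => simpa [sem] using hs.set.set.tick.bump
  | edge a b c =>
    simp only [sem, PMF.mem_support_map_iff]; rintro _ ⟨k, -, rfl⟩; exact hs.set.set.set.tick.bump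
  | seq c d ihc ihd =>
    simp only [sem, PMF.mem_support_bind_iff]
    rintro s' ⟨s₁, h₁, h₂⟩
    exact ihd _ (ihc _ hs _ h₁) _ h₂
  | ite e c d ihc ihd =>
    intro s' h
    simp only [sem] at h
    split at h
    · exact ihd _ hs.bump _ h
    · rw [PMF.mem_support_map_iff] at h
      obtain ⟨s₁, h₁, rfl⟩ := h
      exact (ihc _ hs.bump _ h₁).bump
  | loop i b e c ih =>
    exact loopSem_invariant (Config.Bounded w) (fun _ _ h => h.bump) ih (fun _ _ h => h.set) _ _
      hs.set.bump

theorem sem_reg (c : Stmt) (s : Config) (r : ℕ) (hr : r ∉ c.writes) :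
    ∀ s' ∈ (sem X w c s).support, s'.reg r = s.reg r := by
  induction c generalizing s with
  | skip => simp [sem]
  | asg d e => simp_all [sem, Stmt.writes]
  | sto a e => simp_all [sem, Stmt.writes]
  | rnd d e =>
    simp only [sem, PMF.mem_support_map_iff]; rintro _ ⟨k, -, rfl⟩; simp_all [Stmt.writes]
  | dg d v => simp_all [sem, Stmt.writes]
  | nb d col v i => simp_all [sem, Stmt.writes]
  | pr d col v i => simp_all [sem, Stmt.writes]
  | edge a b c =>
    simp only [sem, PMF.mem_support_map_iff]; rintro _ ⟨k, -, rfl⟩; simp_all [Stmt.writes]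
  | seq c d ihc ihd =>
    simp only [sem, PMF.mem_support_bind_iff]
    simp only [Stmt.writes, List.mem_append, not_or] at hr
    rintro s' ⟨s₁, h₁, h₂⟩
    rw [ihd _ hr.2 _ h₂, ihc _ hr.1 _ h₁]
  | ite e c d ihc ihd =>
    intro s' h
    simp only [Stmt.writes, List.mem_append, not_or] at hr
    simp only [sem] at h
    split at h
    · exact ihd (s.bump (e.size + 1)) hr.2 _ h
    · rw [PMF.mem_support_map_iff] at h
      obtain ⟨s₁, h₁, rfl⟩ := h
      exact (ihc (s.bump (e.size + 1)) hr.1 _ h₁ :)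
  | loop i b e c ih =>
    simp only [Stmt.writes, List.mem_cons, not_or] at hr
    refine loopSem_invariant (fun s' => s'.reg r = s.reg r) (fun _ _ h => h)
      (fun s₁ h s' hs' => (ih _ hr.2 _ hs').trans h) (fun s' v h => by simpa [hr.1] using h) _ _ ?_
    simp [hr.1]

end support

/-! ### Expectations -/

open scoped ENNReal

/-- The mean of `g` under `μ`. -/
noncomputable def mean {α : Type*} (μ : PMF α) (g : α → ℝ≥0∞) : ℝ≥0∞ := ∑' a, μ a * g a

section mean

variable {α β : Type*}

@[simp] theorem mean_pure (a : α) (g : α → ℝ≥0∞) : mean (PMF.pure a) g = g a := by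
  rw [mean, tsum_eq_single a]
  · simp
  · intro b hb; simp [PMF.pure_apply, hb]

theorem mean_bind (μ : PMF α) (f : α → PMF β) (g : β → ℝ≥0∞) :
    mean (μ.bind f) g = mean μ fun a => mean (f a) g := by
  simp only [mean, PMF.bind_apply, ← ENNReal.tsum_mul_right, ← ENNReal.tsum_mul_left]
  rw [ENNReal.tsum_comm]
  simp only [mul_assoc]

theorem mean_map (μ : PMF α) (f : α → β) (g : β → ℝ≥0∞) :
    mean (μ.map f) g = mean μ fun a => g (f a) := by
  simp only [PMF.map, mean_bind, Function.comp_apply, mean_pure]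

theorem mean_mono {μ : PMF α} {g g' : α → ℝ≥0∞} (h : ∀ a ∈ μ.support, g a ≤ g' a) :
    mean μ g ≤ mean μ g' := by
  refine ENNReal.tsum_le_tsum fun a => ?_
  by_cases ha : a ∈ μ.support
  · gcongr; exact h a ha
  · simp [(PMF.apply_eq_zero_iff μ a).2 ha]

theorem mean_congr {μ : PMF α} {g g' : α → ℝ≥0∞} (h : ∀ a ∈ μ.support, g a = g' a) :
    mean μ g = mean μ g' :=
  le_antisymm (mean_mono fun a ha => (h a ha).le) (mean_mono fun a ha => (h a ha).ge)

@[simp] theorem mean_const (μ : PMF α) (r : ℝ≥0∞) : (mean μ fun _ => r) = r := by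
  simp [mean, ENNReal.tsum_mul_right, μ.tsum_coe]

theorem mean_add (μ : PMF α) (g g' : α → ℝ≥0∞) :
    (mean μ fun a => g a + g' a) = mean μ g + mean μ g' := by
  simp [mean, mul_add, ENNReal.tsum_add]

theorem mean_mul_right (μ : PMF α) (g : α → ℝ≥0∞) (r : ℝ≥0∞) :
    (mean μ fun a => g a * r) = mean μ g * r := by
  simp [mean, ← mul_assoc, ENNReal.tsum_mul_right]

theorem mean_indicator (μ : PMF α) (S : Set α) :
    mean μ (S.indicator 1) = μ.toOuterMeasure S := by
  rw [PMF.toOuterMeasure_apply, mean]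
  refine tsum_congr fun a => ?_
  by_cases h : a ∈ S <;> simp [h]

end mean

/-! ### Correctness of the compilation -/

/-- The list `l` of instructions is found at position `p` of the program. -/
def CodeAt (P : Program) (p : ℕ) (l : List Instr) : Prop :=
  ∀ i (hi : i < l.length), P[p + i]? = some l[i]

theorem CodeAt.left {P : Program} {p : ℕ} {l l' : List Instr} (h : CodeAt P p (l ++ l')) :
    CodeAt P p l := by
  intro i hi
  rw [h i (by simp; omega), List.getElem_append_left hi]

theorem CodeAt.right {P : Program} {p : ℕ} {l l' : List Instr} (h : CodeAt P p (l ++ l')) :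
    CodeAt P (p + l.length) l' := by
  intro i hi
  have := h (l.length + i) (by simp; omega)
  rw [List.getElem_append_right (by omega)] at this
  simpa [add_assoc] using this

theorem CodeAt.head {P : Program} {p : ℕ} {I : Instr} {l : List Instr} (h : CodeAt P p (I :: l)) :
    P[p]? = some I := h 0 (by simp)

theorem CodeAt.tail {P : Program} {p : ℕ} {I : Instr} {l : List Instr} (h : CodeAt P p (I :: l)) :
    CodeAt P (p + 1) l := CodeAt.right (l := [I]) h

def Instr.isJump : Instr → Bool
  | .jumpIfZero _ _ => true
  | _ => false

section compile

variable {n : ℕ} (P : Program) (X : InputGraph n) (w : ℕ) (S : Set Config) (T : ℕ)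

/-- The probability that the machine, continued at position `p`, is in `S` at time `T`. -/
noncomputable def value (p : ℕ) (s : Config) : ℝ≥0∞ :=
  if s.pc ≤ T then (run P X w (T - s.pc) { s with pc := p }).toOuterMeasure S else 0

variable {P X w S T}

/-- The field `pc` has two readings, a position for the machine and a clock for the semantics.
Instructions other than jumps never look at it, so one reading can be exchanged for the other before
or after execution. -/
theorem exec_clock {I : Instr} (hI : I.isJump = false) (p : ℕ) (s : Config) :
    exec X w { s with pc := p } I =
      (exec X w s I).map fun s' => { s' with pc := p + 1 } := by
  cases I <;> simp [exec, Instr.isJump, PMF.map_comp, PMF.pure_map, Config.set, Config.next,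
    Config.tick] at hI ⊢ <;> rfl

theorem exec_pc {I : Instr} (hI : I.isJump = false) (s : Config) :
    ∀ s' ∈ (exec X w s I).support, s'.pc = s.pc + 1 := by
  cases I <;> simp [exec, Instr.isJump, Config.set, Config.next, Config.tick] at hI ⊢
  rintro _ _ _ _ _ rfl
  rfl

/-- The tick of the clock matches the step taken off the remaining time `T - s.pc`. Only an
inequality holds: `value` is 0 once the clock has passed `T`, even if the machine was in `S` at time
`T`. -/
theorem value_step {I : Instr} (hI : I.isJump = false) {p : ℕ} (hp : P[p]? = some I) (s : Config) :
    mean (exec X w s I) (value P X w S T (p + 1)) ≤ value P X w S T p s := by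
  by_cases hT : s.pc + 1 ≤ T
  · have h1 : s.pc ≤ T := by omega
    obtain ⟨k, hk⟩ : ∃ k, T - s.pc = k + 1 := ⟨T - s.pc - 1, by omega⟩
    rw [value, if_pos h1, hk, run, step]
    simp only [hp]
    rw [exec_clock hI p s, PMF.toOuterMeasure_bind_apply, ← mean, mean_map]
    refine mean_mono fun s' hs' => ?_
    have h2 := exec_pc hI s s' hs'
    rw [value, if_pos (by omega), show T - s'.pc = k by omega]
  · refine le_trans (mean_mono (g' := fun _ => 0) fun s' hs' => ?_) (by simp)
    have h2 := exec_pc hI s s' hs'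
    rw [value, if_neg (by omega)]

theorem value_jump {a t p : ℕ} (hp : P[p]? = some (.jumpIfZero a t)) (s : Config) :
    value P X w S T (if s.reg a = 0 then t else p + 1) (s.bump 1) ≤ value P X w S T p s := by
  by_cases hT : s.pc + 1 ≤ T
  · have h1 : s.pc ≤ T := by omega
    obtain ⟨k, hk⟩ : ∃ k, T - s.pc = k + 1 := ⟨T - s.pc - 1, by omega⟩
    rw [value, value, if_pos h1, hk, run, step]
    simp only [hp, exec, PMF.pure_bind]
    rw [if_pos (by simpa using hT), Config.pc_bump, show T - (s.pc + 1) = k by omega]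
    split <;> rfl
  · rw [value, if_neg (by simpa using hT)]; exact zero_le

theorem value_pure {I : Instr} {s' : Config} {p : ℕ} (hI : I.isJump = false)
    (hp : P[p]? = some I) (s : Config) (h : exec X w s I = PMF.pure s') :
    value P X w S T (p + 1) s' ≤ value P X w S T p s := by
  simpa [h] using value_step (X := X) (w := w) (S := S) (T := T) hI hp s

/-- A halted configuration no longer changes, so finishing before time `T` does no harm. -/
theorem value_halted {s : Config} {p : ℕ} (hp : P.length ≤ p) (hT : s.pc ≤ T)
    (hS : ({ s with pc := p } : Config) ∈ S) : value P X w S T p s = 1 := by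
  have : ∀ k, run P X w k { s with pc := p } = PMF.pure { s with pc := p } := by
    intro k
    induction k with
    | zero => rfl
    | succ k ih =>
      rw [run, step]
      simp only [List.getElem?_eq_none hp, PMF.pure_bind, ih]
  rw [value, if_pos hT, this, PMF.toOuterMeasure_pure_apply, if_pos hS]

theorem next_eq_bump (s : Config) : s.next = s.bump 1 := rfl

/-- The registers serve as a stack: the first operand stays in register `t` while the second is
evaluated from `t + 1` on. Hence the registers below `t`, and with them all program variables,
survive. -/
theorem term_sound (e : Term) (t p : ℕ) (s : Config) (ht : 100 ≤ t) (he : e.inScope)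
    (hs : s.Bounded w) (hc : CodeAt P p (e.code t)) :
    ∃ s' : Config, s'.pc = s.pc + e.size ∧ s'.mem = s.mem ∧ s'.queries = s.queries ∧
      (∀ i < t, s'.reg i = s.reg i) ∧ s'.reg t = e.val w s ∧ s'.Bounded w ∧
      value P X w S T (p + e.size) s' ≤ value P X w S T p s := by
  -- The four binary operations differ only in the function `f` and are treated together.
  -- Subtraction and division drop the reduction modulo `2 ^ w` afterwards, since they do not exceed
  -- their first operand.
  have bin : ∀ (t p : ℕ) (s : Config), 100 ≤ t → s.Bounded w →
      ∀ (a b : Term) (f : ℕ → ℕ → ℕ) (I : Instr), I.isJump = false →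
      (∀ s, exec X w s I = PMF.pure (s.set w t (f (s.reg t) (s.reg (t + 1)))).next) →
      CodeAt P p (a.code t ++ (b.code (t + 1) ++ [I])) → a.inScope → b.inScope →
      (∀ (t p : ℕ) (s : Config), 100 ≤ t → s.Bounded w → CodeAt P p (a.code t) →
        ∃ s' : Config, s'.pc = s.pc + a.size ∧ s'.mem = s.mem ∧ s'.queries = s.queries ∧
        (∀ i < t, s'.reg i = s.reg i) ∧ s'.reg t = a.val w s ∧ s'.Bounded w ∧
        value P X w S T (p + a.size) s' ≤ value P X w S T p s) →
      (∀ (t p : ℕ) (s : Config), 100 ≤ t → s.Bounded w → CodeAt P p (b.code t) →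
        ∃ s' : Config, s'.pc = s.pc + b.size ∧ s'.mem = s.mem ∧ s'.queries = s.queries ∧
        (∀ i < t, s'.reg i = s.reg i) ∧ s'.reg t = b.val w s ∧ s'.Bounded w ∧
        value P X w S T (p + b.size) s' ≤ value P X w S T p s) →
      ∃ s' : Config, s'.pc = s.pc + (a.size + b.size + 1) ∧ s'.mem = s.mem ∧
        s'.queries = s.queries ∧ (∀ i < t, s'.reg i = s.reg i) ∧
        s'.reg t = f (a.val w s) (b.val w s) % 2 ^ w ∧ s'.Bounded w ∧
        value P X w S T (p + (a.size + b.size + 1)) s' ≤ value P X w S T p s := by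
    clear hc hs s p ht t he e
    intro t p s ht hs a b f I hI hex hc ha hb iha ihb
    obtain ⟨s₁, p₁, m₁, q₁, r₁, v₁, b₁, l₁⟩ := iha t p s ht hs hc.left
    have hc2 := hc.right
    rw [Term.length_code] at hc2
    obtain ⟨s₂, p₂, m₂, q₂, r₂, v₂, b₂, l₂⟩ := ihb (t + 1) (p + a.size) s₁ (by omega) b₁ hc2.left
    have hc3 := hc2.right.head
    rw [Term.length_code] at hc3
    refine ⟨(s₂.set w t (f (s₂.reg t) (s₂.reg (t + 1)))).next, ?_, ?_, ?_, ?_, ?_, ?_, ?_⟩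
    · simp [next_eq_bump, p₁, p₂]; omega
    · simp [next_eq_bump, m₁, m₂]
    · simp [next_eq_bump, q₁, q₂]
    · intro i hi
      simp [next_eq_bump, hi.ne, r₂ i (by omega), r₁ i hi]
    · simp only [next_eq_bump, Config.reg_bump, Config.reg_set, if_true]
      rw [v₂, r₂ t (by omega), v₁]
      rw [Term.val_congr (fun i hi => r₁ i (by omega)) m₁ b hb]
    · exact b₂.set.bump
    · refine le_trans ?_ (l₂.trans l₁)
      have := value_pure (X := X) (w := w) (S := S) (T := T) hI hc3 s₂ (hex s₂)
      simpa [add_assoc] using this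
  induction e generalizing t p s with
  | lit k =>
    refine ⟨(s.set w t k).next, by simp [next_eq_bump, Term.size], rfl, rfl, ?_, ?_, hs.set.bump, ?_⟩
    · intro i hi; simp [next_eq_bump, hi.ne]
    · simp [next_eq_bump, Term.val]
    · exact value_pure rfl hc.head s rfl
  | reg i =>
    simp only [Term.inScope, decide_eq_true_eq] at he
    refine ⟨((s.set w t 0).next.set w t (s.reg i)).next, by simp [next_eq_bump, Term.size], rfl,
      rfl, ?_, ?_, hs.set.bump.set.bump, ?_⟩
    · intro j hj; simp [next_eq_bump, hj.ne]
    · simp [next_eq_bump, Term.val, Nat.mod_eq_of_lt (hs.1 i)]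
    · refine le_trans ?_ (value_pure rfl hc.head s rfl)
      refine value_pure (I := .add t t i) rfl hc.tail.head _ ?_
      simp only [exec]
      have : i ≠ t := by omega
      simp [next_eq_bump, this]
  | add a b iha ihb =>
    simp only [Term.inScope, Bool.and_eq_true] at he
    exact bin t p s ht hs a b (· + ·) _ rfl (fun _ => rfl) hc he.1 he.2
      (fun t p s h1 h2 h3 => iha t p s h1 he.1 h2 h3) (fun t p s h1 h2 h3 => ihb t p s h1 he.2 h2 h3)
  | sub a b iha ihb =>
    simp only [Term.inScope, Bool.and_eq_true] at he
    obtain ⟨s', h⟩ := bin t p s ht hs a b (· - ·) _ rfl (fun _ => rfl) hc he.1 he.2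
      (fun t p s h1 h2 h3 => iha t p s h1 he.1 h2 h3) (fun t p s h1 h2 h3 => ihb t p s h1 he.2 h2 h3)
    rw [Nat.mod_eq_of_lt (lt_of_le_of_lt (Nat.sub_le _ _) (Term.val_lt hs a))] at h
    exact ⟨s', h⟩
  | mul a b iha ihb =>
    simp only [Term.inScope, Bool.and_eq_true] at he
    exact bin t p s ht hs a b (· * ·) _ rfl (fun _ => rfl) hc he.1 he.2
      (fun t p s h1 h2 h3 => iha t p s h1 he.1 h2 h3) (fun t p s h1 h2 h3 => ihb t p s h1 he.2 h2 h3)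
  | div a b iha ihb =>
    simp only [Term.inScope, Bool.and_eq_true] at he
    obtain ⟨s', h⟩ := bin t p s ht hs a b (· / ·) _ rfl (fun _ => rfl) hc he.1 he.2
      (fun t p s h1 h2 h3 => iha t p s h1 he.1 h2 h3) (fun t p s h1 h2 h3 => ihb t p s h1 he.2 h2 h3)
    rw [Nat.mod_eq_of_lt (lt_of_le_of_lt (Nat.div_le_self _ _) (Term.val_lt hs a))] at h
    exact ⟨s', h⟩
  | get a iha =>
    obtain ⟨s₁, p₁, m₁, q₁, r₁, v₁, b₁, l₁⟩ := iha t p s ht he hs hc.left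
    have hc2 := hc.right.head
    rw [Term.length_code] at hc2
    refine ⟨(s₁.set w t (s₁.mem (s₁.reg t))).next, ?_, ?_, ?_, ?_, ?_, b₁.set.bump, ?_⟩
    · simp [next_eq_bump, p₁, Term.size]; omega
    · simp [next_eq_bump, m₁]
    · simp [next_eq_bump, q₁]
    · intro i hi; simp [next_eq_bump, hi.ne, r₁ i hi]
    · simp [next_eq_bump, v₁, m₁, Term.val, Nat.mod_eq_of_lt (hs.2 _)]
    · exact le_trans (value_pure rfl hc2 s₁ rfl) l₁

variable (P X w S T) in
/-- The worst value over all contents of the registers used for evaluation. -/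
noncomputable def lowerValue (p : ℕ) (s : Config) : ℝ≥0∞ :=
  ⨅ (s' : Config) (_ : s'.Agree s ∧ s'.Bounded w), value P X w S T p s'

theorem lowerValue_le {p : ℕ} {s s' : Config} (h : s'.Agree s) (hb : s'.Bounded w) :
    lowerValue P X w S T p s ≤ value P X w S T p s' := iInf₂_le s' ⟨h, hb⟩

theorem Config.Agree.set {s s' : Config} (h : s.Agree s') (d v : ℕ) :
    (s.set w d v).Agree (s'.set w d v) :=
  ⟨fun i hi => by simp [h.1 i hi], h.2.1, h.2.2.1, h.2.2.2⟩

theorem Config.Agree.tick {s s' : Config} (h : s.Agree s') : s.tick.Agree s'.tick :=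
  ⟨h.1, h.2.1, congrArg (· + 1) h.2.2.1, h.2.2.2⟩

theorem Config.Agree.of_eval {s s₁ s₂ : Config} {k t : ℕ} (h : s₁.Agree s) (ht : 100 ≤ t)
    (h2 : s₂.pc = s₁.pc + k)
    (h3 : s₂.mem = s₁.mem) (h4 : s₂.queries = s₁.queries) (h5 : ∀ i < t, s₂.reg i = s₁.reg i) :
    s₂.Agree (s.bump k) :=
  ⟨fun i hi => by simp [h5 i (by omega), h.1 i hi], by simp [h3, h.2.1], by simp [h4, h.2.2.1],
    by simp [h2, h.2.2.2]⟩

theorem Config.Agree.bump {s s' : Config} (h : s.Agree s') (k : ℕ) :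
    (s.bump k).Agree (s'.bump k) :=
  ⟨h.1, h.2.1, h.2.2.1, congrArg (· + k) h.2.2.2⟩

theorem Config.Agree.put {s s' : Config} (h : s.Agree s') (a v : ℕ) :
    (s.put a v).Agree (s'.put a v) :=
  ⟨h.1, by simp [Config.put, h.2.1], h.2.2.1, h.2.2.2⟩

theorem Config.bump_bump (s : Config) (a b : ℕ) : (s.bump a).bump b = s.bump (a + b) := by
  simp [Config.bump, add_assoc]

theorem mean_lowerValue_map_le {α : Type*} {μ : PMF α} {f g : α → Config} {p : ℕ}
    (h : ∀ a ∈ μ.support, (f a).Agree (g a) ∧ (f a).Bounded w) :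
    mean (μ.map g) (lowerValue P X w S T p) ≤ mean (μ.map f) (value P X w S T p) := by
  rw [mean_map, mean_map]
  exact mean_mono fun a ha => lowerValue_le (h a ha).1 (h a ha).2

theorem eval_sound {e : Term} {p : ℕ} {s s₁ : Config} (h : s₁.Agree s) (hb : s₁.Bounded w)
    (he : e.inScope) {t : ℕ} (ht : 100 ≤ t) (hc : CodeAt P p (e.code t)) :
    ∃ s₂ : Config, s₂.Agree (s.bump e.size) ∧ s₂.Bounded w ∧ s₂.reg t = e.val w s ∧
      (∀ i < t, s₂.reg i = s₁.reg i) ∧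
      value P X w S T (p + e.size) s₂ ≤ value P X w S T p s₁ := by
  obtain ⟨s₂, p₂, m₂, q₂, r₂, v₂, b₂, l₂⟩ :=
    term_sound (X := X) (S := S) (T := T) e t p s₁ ht he hb hc
  exact ⟨s₂, h.of_eval ht p₂ m₂ q₂ r₂, b₂, v₂.trans (Term.val_congr h.1 h.2.1 e he), r₂, l₂⟩

theorem Term.val_bump (e : Term) (s : Config) (k : ℕ) : e.val w (s.bump k) = e.val w s := by
  induction e <;> simp_all [Term.val]

/-- Induction on the number `k` of iterations left, which is the bound minus the counter. The body
assigns to neither, and the jump back leads to `p + 1`, just behind the initialization of the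
counter. -/
theorem loop_sound {i b : ℕ} {e : Term} {c : Stmt} (hsc : (Stmt.loop i b e c).inScope)
    (ih : ∀ (p : ℕ) (s : Config), s.Bounded w → CodeAt P p (c.code p) →
      mean (sem X w c s) (lowerValue P X w S T (p + c.size)) ≤ lowerValue P X w S T p s)
    {p : ℕ} (hc : CodeAt P p ((Stmt.loop i b e c).code p)) (k : ℕ) (s : Config)
    (hs : s.Bounded w) (hk : s.reg b = s.reg i + k) :
    mean (loopSem w i e (sem X w c) k s)
      (lowerValue P X w S T (p + (1 + 6 + (e.size + 1) + c.size + 4))) ≤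
      lowerValue P X w S T (p + 1) s := by
  simp only [Stmt.inScope, Bool.and_eq_true, decide_eq_true_eq, bne_iff_ne, Bool.not_eq_true',
    List.contains_eq_mem, decide_eq_false_iff_not] at hsc
  obtain ⟨⟨⟨⟨⟨⟨hi, hb⟩, hib⟩, he⟩, -⟩, hwi⟩, hwb⟩ := hsc
  have c1 := hc.tail
  have ctest := c1.left
  have c2 := c1.right
  simp only [Term.length_code] at c2
  have cj1 := c2.head
  have c3 := c2.tail
  have cev := c3.left
  have c4 := c3.right
  rw [Term.length_code] at c4
  have cj2 := c4.head
  have c5 := c4.tail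
  have cbody := c5.left
  have c6 := c5.right
  rw [Stmt.length_code] at c6
  have k1 := c6.head
  have k2 := c6.tail.head
  have k3 := c6.tail.tail.head
  have k4 := c6.tail.tail.tail.head
  clear c1 c2 c3 c4 c5 c6
  have h0 : 0 < 2 ^ w := by positivity
  induction k generalizing s with
  | zero =>
    refine le_iInf₂ fun s₁ hs₁ => ?_
    obtain ⟨s₂, a₂, b₂, v₂, -, l₂⟩ := eval_sound (X := X) (S := S) (T := T) hs₁.1 hs₁.2
      (e := .sub (.reg b) (.reg i)) (by simp [Term.inScope, hi, hb]) le_rfl ctest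
    have : s₂.reg 100 = 0 := by rw [v₂]; simp [Term.val, hk]
    refine le_trans ?_ ((value_jump cj1 s₂).trans l₂)
    rw [if_pos this, loopSem, mean_pure]
    refine lowerValue_le ?_ b₂.bump
    rw [show s.bump 6 = (s.bump 5).bump 1 by rw [Config.bump_bump]]
    exact a₂.bump 1
  | succ k ihk =>
    refine le_iInf₂ fun s₁ hs₁ => ?_
    obtain ⟨s₂, a₂, b₂, v₂, -, l₂⟩ := eval_sound (X := X) (S := S) (T := T) hs₁.1 hs₁.2
      (e := .sub (.reg b) (.reg i)) (by simp [Term.inScope, hi, hb]) le_rfl ctest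
    have : s₂.reg 100 ≠ 0 := by rw [v₂]; simp [Term.val, hk]
    refine le_trans ?_ ((value_jump cj1 s₂).trans l₂)
    rw [if_neg this]
    have a₂' : (s₂.bump 1).Agree (s.bump 6) := by
      rw [show s.bump 6 = (s.bump 5).bump 1 by rw [Config.bump_bump]]
      exact a₂.bump 1
    obtain ⟨s₃, a₃, b₃, v₃, -, l₃⟩ := eval_sound (X := X) (S := S) (T := T) a₂' b₂.bump he le_rfl cev
    refine le_trans ?_ ((value_jump cj2 s₃).trans l₃)
    have a₃' : (s₃.bump 1).Agree (s.bump (6 + (e.size + 1))) := by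
      have := a₃.bump 1
      rwa [Config.bump_bump, Config.bump_bump] at this
    rw [loopSem]
    rw [Term.val_bump] at v₃
    by_cases h : e.val w s = 0
    · rw [if_pos h, if_pos (v₃.trans h), mean_pure]
      exact lowerValue_le a₃' b₃.bump
    · rw [if_neg h, if_neg (by rwa [v₃]), mean_bind]
      refine le_trans ?_ (lowerValue_le a₃' b₃.bump)
      refine le_trans (mean_mono ?_) (le_trans (ih (p + 1 + 6 + (e.size + 1)) _ hs.bump ?_) ?_)
      · intro s₄ hs₄
        have b₄ := sem_bounded c _ hs.bump _ hs₄
        have ri := sem_reg c _ i hwi _ hs₄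
        have rb := sem_reg c _ b hwb _ hs₄
        simp only [Config.reg_bump] at ri rb
        -- The counter is still below its bound, which is itself a word, so the increment does not
        -- wrap around.
        have hlt : s₄.reg i + 1 < 2 ^ w := by
          have := hs.1 b
          omega
        refine le_trans (ihk _ b₄.set.bump ?_) ?_
        · rw [ri] at hlt
          simp only [Config.reg_bump, Config.reg_set, if_true, hib.symm, if_false, ri, rb, hk,
            Nat.mod_eq_of_lt hlt]
          omega
        · refine le_iInf₂ fun s₅ hs₅ => ?_
          have hP : p + 1 + 6 + (e.size + 1) + c.size = p + 1 + 5 + 1 + e.size + 1 + c.size := by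
            omega
          rw [hP]
          refine le_trans ?_ (value_pure rfl k1 s₅ rfl)
          refine le_trans ?_ (value_pure rfl k2 _ rfl)
          refine le_trans ?_ (value_pure rfl k3 _ rfl)
          refine le_trans ?_ (value_jump k4 _)
          rw [if_pos (by simp [next_eq_bump])]
          refine lowerValue_le ?_ ?_
          · have hi' : i ≠ 100 := by omega
            refine ⟨fun j hj => ?_, ?_, ?_, ?_⟩
            · have : j ≠ 100 := by omega
              simp [next_eq_bump, this, hi', hs₅.1.1 j hj, hs₅.1.1 i hi]
            · simp [next_eq_bump, hs₅.1.2.1]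
            · simp [next_eq_bump, hs₅.1.2.2.1]
            · simp [next_eq_bump, hs₅.1.2.2.2, add_assoc]
          · exact ((hs₅.2.set.bump.set.bump).set.bump).bump
      · have hP : p + 1 + 6 + (e.size + 1) = p + 1 + 5 + 1 + e.size + 1 := by omega
        rw [hP] at cbody ⊢
        exact cbody
      · exact le_of_eq (congrArg (lowerValue P X w S T · _) (by simp [Term.size]; omega))

/-- Every statement leaves unspecified contents in the evaluation registers, so the induction needs
a quantity that does not depend on them. The infimum `lowerValue` on both sides makes consecutive
statements fit together. -/
theorem compile_sound (c : Stmt) (hsc : c.inScope) (p : ℕ) (s : Config) (hs : s.Bounded w)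
    (hc : CodeAt P p (c.code p)) :
    mean (sem X w c s) (lowerValue P X w S T (p + c.size)) ≤ lowerValue P X w S T p s := by
  induction c generalizing p s with
  | skip => simp [sem, Stmt.size]
  | asg d e =>
    simp only [Stmt.inScope, Bool.and_eq_true, decide_eq_true_eq] at hsc
    refine le_iInf₂ fun s₁ hs₁ => ?_
    obtain ⟨s₂, a₂, b₂, v₂, -, l₂⟩ := eval_sound (X := X) (S := S) (T := T) hs₁.1 hs₁.2
      hsc.2 le_rfl hc.left
    have c2 := hc.right
    rw [Term.length_code] at c2
    refine le_trans ?_ l₂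
    refine le_trans ?_ (value_pure rfl c2.head s₂ rfl)
    refine le_trans ?_ (value_pure rfl c2.tail.head _ rfl)
    rw [sem, mean_pure, Stmt.size]
    refine lowerValue_le ⟨fun j hj => ?_, ?_, ?_, ?_⟩ b₂.set.bump.set.bump
    · have : j ≠ 101 := by omega
      have hr := a₂.1 j hj
      rw [Config.reg_bump] at hr
      simp [next_eq_bump, this, v₂, hr]
    · simp [next_eq_bump, a₂.2.1]
    · simp [next_eq_bump, a₂.2.2.1]
    · simp [next_eq_bump, a₂.2.2.2, add_assoc]
  | sto a e =>
    simp only [Stmt.inScope, Bool.and_eq_true] at hsc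
    refine le_iInf₂ fun s₁ hs₁ => ?_
    obtain ⟨s₂, a₂, b₂, v₂, -, l₂⟩ := eval_sound (X := X) (S := S) (T := T) hs₁.1 hs₁.2
      hsc.1 le_rfl hc.left
    have c2 := hc.right
    rw [Term.length_code] at c2
    obtain ⟨s₃, a₃, b₃, v₃, r₃, l₃⟩ := eval_sound (X := X) (S := S) (T := T) a₂ b₂
      hsc.2 (t := 101) (by omega) c2.left
    have c3 := c2.right.head
    rw [Term.length_code] at c3
    refine le_trans ?_ (l₃.trans l₂)
    refine le_trans ?_ (value_pure rfl c3 s₃ rfl)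
    have h100 := r₃ 100 (by omega)
    rw [sem, mean_pure, Stmt.size, h100, v₂, v₃, Term.val_bump, ← add_assoc, ← add_assoc]
    rw [Config.bump_bump] at a₃
    have := (a₃.put (a.val w s) (e.val w s)).bump 1
    exact lowerValue_le this (b₃.put (Term.val_lt hs _)).bump
  | rnd d e =>
    simp only [Stmt.inScope, Bool.and_eq_true, decide_eq_true_eq] at hsc
    refine le_iInf₂ fun s₁ hs₁ => ?_
    obtain ⟨s₂, a₂, b₂, v₂, -, l₂⟩ := eval_sound (X := X) (S := S) (T := T) hs₁.1 hs₁.2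
      hsc.2 le_rfl hc.left
    have c2 := hc.right.head
    rw [Term.length_code] at c2
    refine le_trans ?_ ((value_step rfl c2 s₂).trans l₂)
    rw [sem, exec, Stmt.size, v₂]
    exact mean_lowerValue_map_le fun k _ => ⟨(a₂.set d k).bump 1, b₂.set.bump⟩
  | dg d e =>
    simp only [Stmt.inScope, Bool.and_eq_true, decide_eq_true_eq] at hsc
    refine le_iInf₂ fun s₁ hs₁ => ?_
    obtain ⟨s₂, a₂, b₂, v₂, -, l₂⟩ := eval_sound (X := X) (S := S) (T := T) hs₁.1 hs₁.2
      hsc.2 le_rfl hc.left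
    have c2 := hc.right.head
    rw [Term.length_code] at c2
    refine le_trans ?_ ((value_step rfl c2 s₂).trans l₂)
    rw [sem, exec, Stmt.size, v₂, mean_pure, mean_pure]
    exact lowerValue_le ((a₂.set d _).bump 1).tick (b₂.set.bump (k := 1))
  | nb d col u v =>
    simp only [Stmt.inScope, Bool.and_eq_true, decide_eq_true_eq] at hsc
    refine le_iInf₂ fun s₁ hs₁ => ?_
    obtain ⟨s₂, a₂, b₂, v₂, -, l₂⟩ := eval_sound (X := X) (S := S) (T := T) hs₁.1 hs₁.2
      hsc.1.2 le_rfl hc.left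
    have c2 := hc.right
    rw [Term.length_code] at c2
    obtain ⟨s₃, a₃, b₃, v₃, r₃, l₃⟩ := eval_sound (X := X) (S := S) (T := T) a₂ b₂
      hsc.2 (t := 101) (by omega) c2.left
    have c3 := c2.right.head
    rw [Term.length_code] at c3
    refine le_trans ?_ (l₃.trans l₂)
    refine le_trans ?_ (value_pure rfl c3 s₃ rfl)
    have h100 := r₃ 100 (by omega)
    rw [sem, mean_pure, Stmt.size, h100, v₂, v₃, Term.val_bump, ← add_assoc, ← add_assoc]
    rw [Config.bump_bump] at a₃
    exact lowerValue_le (((a₃.set d _).set col _).bump 1).tick (b₃.set.set.bump (k := 1))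
  | pr d col u v =>
    simp only [Stmt.inScope, Bool.and_eq_true, decide_eq_true_eq] at hsc
    refine le_iInf₂ fun s₁ hs₁ => ?_
    obtain ⟨s₂, a₂, b₂, v₂, -, l₂⟩ := eval_sound (X := X) (S := S) (T := T) hs₁.1 hs₁.2
      hsc.1.2 le_rfl hc.left
    have c2 := hc.right
    rw [Term.length_code] at c2
    obtain ⟨s₃, a₃, b₃, v₃, r₃, l₃⟩ := eval_sound (X := X) (S := S) (T := T) a₂ b₂
      hsc.2 (t := 101) (by omega) c2.left
    have c3 := c2.right.head
    rw [Term.length_code] at c3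
    refine le_trans ?_ (l₃.trans l₂)
    refine le_trans ?_ (value_pure rfl c3 s₃ rfl)
    have h100 := r₃ 100 (by omega)
    rw [sem, mean_pure, Stmt.size, h100, v₂, v₃, Term.val_bump, ← add_assoc, ← add_assoc]
    rw [Config.bump_bump] at a₃
    exact lowerValue_le (((a₃.set d _).set col _).bump 1).tick (b₃.set.set.bump (k := 1))
  | edge d₁ d₂ col =>
    refine le_iInf₂ fun s₁ hs₁ => ?_
    refine le_trans ?_ (value_step rfl hc.head s₁)
    rw [sem, exec, Stmt.size]
    exact mean_lowerValue_map_le fun k _ =>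
      ⟨((((hs₁.1.set d₁ _).set d₂ _).set col _).bump 1).tick, hs₁.2.set.set.set.bump (k := 1)⟩
  | seq c d ihc ihd =>
    simp only [Stmt.inScope, Bool.and_eq_true] at hsc
    rw [sem, mean_bind, Stmt.size]
    refine le_trans (mean_mono fun s₁ hs₁ => ?_) (ihc hsc.1 p s hs hc.left)
    rw [← add_assoc]
    have c2 := hc.right
    rw [Stmt.length_code] at c2
    exact ihd hsc.2 _ _ (sem_bounded c s hs _ hs₁) c2
  | ite e c d ihc ihd =>
    simp only [Stmt.inScope, Bool.and_eq_true] at hsc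
    have c1 := hc.right
    rw [Term.length_code] at c1
    have cj := c1.head
    have c2 := c1.tail
    have cthen := c2.left
    have c3 := c2.right
    rw [Stmt.length_code] at c3
    have k1 := c3.head
    have k2 := c3.tail.head
    have celse := c3.tail.tail
    refine le_iInf₂ fun s₁ hs₁ => ?_
    obtain ⟨s₂, a₂, b₂, v₂, -, l₂⟩ := eval_sound (X := X) (S := S) (T := T) hs₁.1 hs₁.2
      hsc.1.1 le_rfl hc.left
    refine le_trans ?_ ((value_jump cj s₂).trans l₂)
    have a₂' : (s₂.bump 1).Agree (s.bump (e.size + 1)) := by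
      have := a₂.bump 1
      rwa [Config.bump_bump] at this
    rw [sem, v₂]
    split
    · refine le_trans ?_ (lowerValue_le a₂' b₂.bump)
      refine le_trans (le_of_eq ?_) (ihd hsc.2 _ _ hs.bump ?_)
      · rw [Stmt.size, show p + (e.size + 1 + c.size + 2 + d.size) =
          p + e.size + 1 + c.size + 2 + d.size by omega]
      · exact celse
    · refine le_trans ?_ (lowerValue_le a₂' b₂.bump)
      refine le_trans ?_ (ihc hsc.1.2 _ _ hs.bump cthen)
      rw [mean_map]
      refine mean_mono fun s₃ _ => le_iInf₂ fun s₄ hs₄ => ?_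
      refine le_trans ?_ (value_pure rfl k1 s₄ rfl)
      refine le_trans ?_ (value_jump k2 _)
      rw [if_pos (by simp [next_eq_bump])]
      refine le_trans (le_of_eq ?_) (lowerValue_le (s := s₃.bump 2) ?_ ?_)
      · rw [Stmt.size, show p + (e.size + 1 + c.size + 2 + d.size) =
          p + e.size + 1 + c.size + 2 + d.size by omega]
      · refine ⟨fun j hj => ?_, ?_, ?_, ?_⟩
        · have : j ≠ 100 := by omega
          simp [next_eq_bump, this, hs₄.1.1 j hj]
        · simp [next_eq_bump, hs₄.1.2.1]
        · simp [next_eq_bump, hs₄.1.2.2.1]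
        · simp [next_eq_bump, hs₄.1.2.2.2]
      · exact hs₄.2.set.bump.bump
  | loop i b e c ih =>
    have h := hsc
    simp only [Stmt.inScope, Bool.and_eq_true, decide_eq_true_eq, bne_iff_ne] at h
    refine le_iInf₂ fun s₁ hs₁ => ?_
    refine le_trans ?_ (value_pure rfl hc.head s₁ rfl)
    refine le_trans ?_ (lowerValue_le (s := (s.set w i 0).bump 1) ?_ hs₁.2.set.bump)
    · rw [sem, Stmt.size]
      refine loop_sound hsc (ih h.1.1.2) hc _ _ hs.set.bump ?_
      simp [h.1.1.1.1.2.symm]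
    · exact (hs₁.1.set i 0).bump 1

/-- The compiled program succeeds at least as often as the structured one. -/
theorem run_compiled (c : Stmt) (hsc : c.inScope) (s : Config) (hs : s.Bounded w)
    (h0 : s.pc = 0) {T : ℕ} {S : Set Config}
    (hS : ∀ s s' : Config, s'.Agree s → ({ s with pc := c.size } : Config) ∈ S →
      ({ s' with pc := c.size } : Config) ∈ S) :
    (sem X w c s).toOuterMeasure {s' | s'.pc ≤ T ∧ ({ s' with pc := c.size } : Config) ∈ S} ≤
      (run (c.code 0) X w T s).toOuterMeasure S := by
  have h := compile_sound (P := c.code 0) (X := X) (w := w) (S := S) (T := T) c hsc 0 s hs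
    (fun i hi => by simp [hi])
  have h1 : lowerValue (c.code 0) X w S T 0 s ≤ (run (c.code 0) X w T s).toOuterMeasure S := by
    refine (lowerValue_le (Config.Agree.refl s) hs).trans ?_
    rw [value, if_pos (by omega), h0, Nat.sub_zero, ← h0]
  refine le_trans ?_ (h.trans h1)
  rw [← mean_indicator]
  refine mean_mono fun s' _ => ?_
  rw [zero_add]
  by_cases hs' : s'.pc ≤ T ∧ ({ s' with pc := c.size } : Config) ∈ S
  swap
  · rw [Set.indicator_of_notMem (by exact hs')]; exact zero_le
  rw [Set.indicator_of_mem (by exact hs')]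
  refine le_iInf₂ fun s₁ hs₁ => ?_
  rw [value_halted (by rw [Stmt.length_code]) (hs₁.1.2.2.2.trans_le hs'.1)
    (hS _ _ hs₁.1 hs'.2)]
  simp

end compile

end SubgraphCounting

namespace SubgraphCounting

open scoped ENNReal

/-! ## Reasoning about structured programs -/

namespace Stmt

/-- An upper bound on the running time, where `β b` bounds the contents of register `b`. -/
def cost (β : ℕ → ℕ) : Stmt → ℕ
  | seq c d => c.cost β + d.cost β
  | ite e c d => e.size + 1 + (c.cost β + 2 + d.cost β)
  | loop _ b e c => β b * (e.size + 11 + c.cost β) + (e.size + 8)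
  | c => c.size

/-- The registers that bound loops. -/
def bounds : Stmt → List ℕ
  | seq c d => c.bounds ++ d.bounds
  | ite _ c d => c.bounds ++ d.bounds
  | loop _ b _ c => b :: c.bounds
  | _ => []

/-- There are no queries. -/
def queryFree : Stmt → Bool
  | dg _ _ => false
  | nb _ _ _ _ => false
  | pr _ _ _ _ => false
  | edge _ _ _ => false
  | seq c d => c.queryFree && d.queryFree
  | ite _ c d => c.queryFree && d.queryFree
  | loop _ _ _ c => c.queryFree
  | _ => true

end Stmt

section support

variable {n : ℕ} {X : InputGraph n} {w : ℕ}

/-- A bound for every outcome, not only in the mean. The registers that bound loops are never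
assigned to, so their initial contents limit all loops, nested ones included. -/
theorem sem_cost {β : ℕ → ℕ} (c : Stmt) (s : Config) (hb : ∀ b ∈ c.bounds, b ∉ c.writes)
    (hβ : ∀ b ∈ c.bounds, s.reg b ≤ β b) :
    ∀ s' ∈ (sem X w c s).support, s'.pc ≤ s.pc + c.cost β := by
  induction c generalizing s with
  | skip => simp [sem]
  | asg d e => simp [sem, Stmt.cost, Stmt.size]
  | sto a e => simp [sem, Stmt.cost, Stmt.size]
  | rnd d e =>
    simp only [sem, PMF.mem_support_map_iff]; rintro _ ⟨k, -, rfl⟩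
    simp [Stmt.cost, Stmt.size]
  | dg d v => simp [sem, Stmt.cost, Stmt.size]
  | nb d col v i => simp [sem, Stmt.cost, Stmt.size]
  | pr d col v i => simp [sem, Stmt.cost, Stmt.size]
  | edge a b c =>
    simp only [sem, PMF.mem_support_map_iff]; rintro _ ⟨k, -, rfl⟩
    simp [Stmt.cost, Stmt.size]
  | seq c d ihc ihd =>
    simp only [Stmt.bounds, Stmt.writes, List.mem_append, not_or] at hb hβ
    simp only [sem, PMF.mem_support_bind_iff]
    rintro s' ⟨s₁, h₁, h₂⟩
    have t1 := ihc s (fun b h => (hb b (Or.inl h)).1) (fun b h => hβ b (Or.inl h)) _ h₁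
    have t2 := ihd s₁ (fun b h => (hb b (Or.inr h)).2) (fun b h => by
      rw [sem_reg c s b (hb b (Or.inr h)).1 _ h₁]; exact hβ b (Or.inr h)) _ h₂
    simp only [Stmt.cost]
    omega
  | ite e c d ihc ihd =>
    simp only [Stmt.bounds, Stmt.writes, List.mem_append, not_or] at hb hβ
    intro s' h
    simp only [Stmt.cost]
    simp only [sem] at h
    split at h
    · have := ihd (s.bump (e.size + 1)) (fun b h => (hb b (Or.inr h)).2)
        (fun b h => hβ b (Or.inr h)) _ h
      simp only [Config.pc_bump] at this
      omega
    · rw [PMF.mem_support_map_iff] at h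
      obtain ⟨s₁, h₁, rfl⟩ := h
      have := ihc (s.bump (e.size + 1)) (fun b h => (hb b (Or.inl h)).1)
        (fun b h => hβ b (Or.inl h)) _ h₁
      simp only [Config.pc_bump] at this ⊢
      omega
  | loop i b e c ih =>
    simp only [Stmt.bounds, Stmt.writes, List.mem_cons, not_or] at hb hβ
    have key : ∀ (k : ℕ) (s : Config), (∀ a, a = b ∨ a ∈ c.bounds → s.reg a ≤ β a) →
        ∀ s' ∈ (loopSem w i e (sem X w c) k s).support,
        s'.pc ≤ s.pc + (k * (e.size + 11 + c.cost β) + (e.size + 7)) := by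
      intro k
      induction k with
      | zero => intro s _ s' h; simp [loopSem] at h; subst h; simp
      | succ k ihk =>
        intro s hs s' h
        simp only [loopSem] at h
        split at h
        · simp only [PMF.support_pure, Set.mem_singleton_iff] at h
          subst h
          simp; omega
        · rw [PMF.mem_support_bind_iff] at h
          obtain ⟨s₁, h₁, h₂⟩ := h
          have t1 := ih (s.bump (6 + (e.size + 1))) (fun a ha => (hb a (Or.inr ha)).2)
            (fun a ha => hs a (Or.inr ha)) _ h₁
          have t2 := ihk _ (fun a ha => by
            have h3 := sem_reg c _ a (hb a ha).2 _ h₁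
            rw [Config.reg_bump, Config.reg_set, if_neg (hb a ha).1, h3]
            exact hs a ha) _ h₂
          simp only [Config.pc_bump, Config.pc_set] at t1 t2
          rw [Nat.succ_mul]
          omega
    intro s' h
    have := key _ _ (fun a ha => by
      rw [Config.reg_bump, Config.reg_set, if_neg (hb a ha).1]; exact hβ a ha) s' h
    have h2 : s.reg b * (e.size + 11 + c.cost β) ≤ β b * (e.size + 11 + c.cost β) :=
      Nat.mul_le_mul_right _ (hβ b (Or.inl rfl))
    simp only [Config.pc_bump, Config.pc_set] at this
    simp only [Stmt.cost]
    omega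

/-- Every query takes at least one unit of time, so a bound on the elapsed time is one on the
queries. -/
theorem sem_queries_le (c : Stmt) (s : Config) :
    ∀ s' ∈ (sem X w c s).support, s'.queries + s.pc ≤ s.queries + s'.pc := by
  induction c generalizing s with
  | skip => simp [sem]
  | asg d e => simp [sem]
  | sto a e => simp [sem]
  | rnd d e =>
    simp only [sem, PMF.mem_support_map_iff]; rintro _ ⟨k, -, rfl⟩; simp
  | dg d v => simp [sem]; omega
  | nb d col v i => simp [sem]; omega
  | pr d col v i => simp [sem]; omega
  | edge a b c =>
    simp only [sem, PMF.mem_support_map_iff]; rintro _ ⟨k, -, rfl⟩; simp; omega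
  | seq c d ihc ihd =>
    simp only [sem, PMF.mem_support_bind_iff]
    rintro s' ⟨s₁, h₁, h₂⟩
    have := ihc _ _ h₁
    have := ihd _ _ h₂
    omega
  | ite e c d ihc ihd =>
    intro s' h
    simp only [sem] at h
    split at h
    · have := ihd _ _ h
      simp at this; omega
    · rw [PMF.mem_support_map_iff] at h
      obtain ⟨s₁, h₁, rfl⟩ := h
      have := ihc _ _ h₁
      simp at this ⊢; omega
  | loop i b e c ih =>
    refine loopSem_invariant (fun s' => s'.queries + s.pc ≤ s.queries + s'.pc)
      (fun s₁ k h => ?_) (fun s₁ h s' hs' => ?_) (fun s' v h => by simpa using h) _ _ ?_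
    · simp; omega
    · have := ih _ _ hs'; omega
    · simp

theorem sem_queryFree (c : Stmt) (hc : c.queryFree) (s : Config) :
    ∀ s' ∈ (sem X w c s).support, s'.queries = s.queries := by
  induction c generalizing s with
  | skip => simp [sem]
  | asg d e => simp [sem]
  | sto a e => simp [sem]
  | rnd d e =>
    simp only [sem, PMF.mem_support_map_iff]; rintro _ ⟨k, -, rfl⟩; simp
  | dg d v => simp [Stmt.queryFree] at hc
  | nb d col v i => simp [Stmt.queryFree] at hc
  | pr d col v i => simp [Stmt.queryFree] at hc
  | edge a b c => simp [Stmt.queryFree] at hc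
  | seq c d ihc ihd =>
    simp only [Stmt.queryFree, Bool.and_eq_true] at hc
    simp only [sem, PMF.mem_support_bind_iff]
    rintro s' ⟨s₁, h₁, h₂⟩
    rw [ihd hc.2 _ _ h₂, ihc hc.1 _ _ h₁]
  | ite e c d ihc ihd =>
    simp only [Stmt.queryFree, Bool.and_eq_true] at hc
    intro s' h
    simp only [sem] at h
    split at h
    · exact (ihd hc.2 _ _ h :)
    · rw [PMF.mem_support_map_iff] at h
      obtain ⟨s₁, h₁, rfl⟩ := h
      exact (ihc hc.1 _ _ h₁ :)
  | loop i b e c ih =>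
    simp only [Stmt.queryFree] at hc
    exact loopSem_invariant (fun s' => s'.queries = s.queries)
      (fun s₁ k h => h) (fun s₁ h s' hs' => (ih hc _ _ hs').trans h) (fun s' v h => h) _ _ rfl

/-- The running time of a loop in terms of the final value of its counter. -/
theorem loop_clock {i b : ℕ} {e : Term} {c : Stmt} {s : Config} (hs : s.Bounded w) (B : ℕ)
    (hi : i ∉ c.writes) (hb : b ∉ c.writes) (hib : i ≠ b)
    (hc : ∀ s₁ : Config, (∀ r ∉ (Stmt.loop i b e c).writes, s₁.reg r = s.reg r) →
      ∀ s' ∈ (sem X w c s₁).support, s'.pc ≤ s₁.pc + B) :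
    ∀ s' ∈ (sem X w (.loop i b e c) s).support,
      s'.pc ≤ s.pc + (s'.reg i * (e.size + 11 + B) + (e.size + 8)) := by
  have key : ∀ (k : ℕ) (s₁ : Config), s₁.Bounded w → s₁.reg b = s₁.reg i + k →
      (∀ r ∉ (Stmt.loop i b e c).writes, s₁.reg r = s.reg r) →
      ∀ s' ∈ (loopSem w i e (sem X w c) k s₁).support, s₁.reg i ≤ s'.reg i ∧
      s'.pc ≤ s₁.pc + ((s'.reg i - s₁.reg i) * (e.size + 11 + B) + (e.size + 7)) := by
    intro k
    induction k with
    | zero => intro s₁ _ _ _ s' h; simp [loopSem] at h; subst h; simp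
    | succ k ihk =>
      intro s₁ hs₁ hk hfr s' h
      simp only [loopSem] at h
      split at h
      · simp only [PMF.support_pure, Set.mem_singleton_iff] at h
        subst h
        simp; omega
      · rw [PMF.mem_support_bind_iff] at h
        obtain ⟨s₂, h₁, h₂⟩ := h
        have t1 := hc (s₁.bump (6 + (e.size + 1))) hfr _ h₁
        have ri := sem_reg c _ i hi _ h₁
        have rb := sem_reg c _ b hb _ h₁
        simp only [Config.reg_bump] at ri rb
        have hlt : s₂.reg i + 1 < 2 ^ w := by
          have := hs₁.1 b
          omega
        rw [ri] at hlt
        have t2 := ihk ((s₂.set w i (s₂.reg i + 1)).bump 4) (sem_bounded c _ hs₁.bump _ h₁).set.bump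
          (by simp [hib.symm, Nat.mod_eq_of_lt hlt, ri, rb, hk]; omega)
          (fun r hr => by
            have hr' := hr
            simp only [Stmt.writes, List.mem_cons, not_or] at hr'
            rw [Config.reg_bump, Config.reg_set, if_neg hr'.1, sem_reg c _ r hr'.2 _ h₁]
            exact hfr r hr) _ h₂
        simp only [Config.pc_bump, Config.pc_set, Config.reg_bump, Config.reg_set, if_true,
          Nat.mod_eq_of_lt hlt, ri] at t1 t2
        obtain ⟨t2, t3⟩ := t2
        refine ⟨by omega, ?_⟩
        obtain ⟨d, hd⟩ : ∃ d, s'.reg i = s₁.reg i + 1 + d := ⟨_, (Nat.add_sub_of_le t2).symm⟩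
        rw [hd] at t3 ⊢
        rw [show s₁.reg i + 1 + d - (s₁.reg i + 1) = d by omega] at t3
        rw [show s₁.reg i + 1 + d - s₁.reg i = d + 1 by omega, Nat.succ_mul]
        omega
  intro s' h
  have := (key _ _ (hs.set.bump) (by simp [hib.symm]) (fun r hr => by
    simp only [Stmt.writes, List.mem_cons, not_or] at hr
    simp [hr.1]) s' h).2
  simp at this
  omega

end support

/-! ### Term macros -/

namespace Term

/-- `1` if `a ≤ b`, else `0`. -/
def le (a b : Term) : Term := .sub (.lit 1) (.sub a b)
/-- `1` if `a < b`, else `0`. -/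
def lt (a b : Term) : Term := .sub (.lit 1) (le b a)
/-- `1` if `a = b`, else `0`. -/
def eq (a b : Term) : Term := .mul (le a b) (le b a)
/-- The address of cell `x` of array `k`. The arrays are interleaved, starting at the address in
register `5`. -/
def addr (k : ℕ) (x : Term) : Term := .add (.reg 5) (.add (.mul (.lit 8) x) (.lit k))
/-- The contents of cell `x` of array `k`. -/
def arr (k : ℕ) (x : Term) : Term := .get (addr k x)

variable {w : ℕ} {s : Config}

theorem val_one (hw : 1 < 2 ^ w) : (lit 1).val w s = 1 := Nat.mod_eq_of_lt hw

end Term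

/-! ### Properties of all outcomes, and refinement of abstract distributions -/

variable {n : ℕ} (X : InputGraph n) (w : ℕ)

/-- All outcomes of `c` started in `s` satisfy `Q`. -/
def Always (c : Stmt) (s : Config) (Q : Config → Prop) : Prop := ∀ s' ∈ (sem X w c s).support, Q s'

/-- The distribution `ν` of configurations implements the abstract distribution `μ`. -/
def Refines {Y : Type*} (ν : PMF Config) (μ : PMF Y) (Q : Y → Config → Prop) : Prop :=
  ∀ (g : Config → ℝ≥0∞) (G : Y → ℝ≥0∞), (∀ y s, Q y s → G y ≤ g s) → mean μ G ≤ mean ν g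

variable {X w}

section always

variable {c d : Stmt} {s : Config} {Q Q' : Config → Prop}

theorem Always.mono (h : Always X w c s Q) (hQ : ∀ s', Q s' → Q' s') : Always X w c s Q' :=
  fun s' hs' => hQ s' (h s' hs')

theorem Always.and (h : Always X w c s Q) (h' : Always X w c s Q') :
    Always X w c s fun s' => Q s' ∧ Q' s' := fun s' hs' => ⟨h s' hs', h' s' hs'⟩

theorem always_skip : Always X w .skip s Q ↔ Q s := by simp [Always, sem]

theorem always_seq : Always X w (.seq c d) s Q ↔ Always X w c s fun s' => Always X w d s' Q := by
  simp only [Always, sem, PMF.mem_support_bind_iff]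
  exact ⟨fun h a ha b hb => h b ⟨a, ha, hb⟩, fun h b ⟨a, ha, hb⟩ => h a ha b hb⟩

theorem always_asg {a : ℕ} {e : Term} :
    Always X w (.asg a e) s Q ↔ Q ((s.set w a (e.val w s)).bump (e.size + 2)) := by
  simp [Always, sem]

theorem always_sto {a e : Term} :
    Always X w (.sto a e) s Q ↔ Q ((s.put (a.val w s) (e.val w s)).bump (a.size + e.size + 1)) := by
  simp [Always, sem]

theorem always_ite {e : Term} :
    Always X w (.ite e c d) s Q ↔
      if e.val w s = 0 then Always X w d (s.bump (e.size + 1)) Q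
      else Always X w c (s.bump (e.size + 1)) fun s' => Q (s'.bump 2) := by
  simp only [Always, sem]
  split
  · rfl
  · simp only [PMF.mem_support_map_iff]
    exact ⟨fun h a ha => h _ ⟨a, ha, rfl⟩, fun h b ⟨a, ha, hb⟩ => hb ▸ h a ha⟩

/-- The invariant is indexed by the number of completed iterations. What the loop does not assign to
is known to be unchanged and need not be part of the invariant. -/
theorem always_loop {i b : ℕ} {e : Term} (Inv : ℕ → Config → Prop)
    (hs : s.Bounded w) (hi : i ∉ c.writes) (hb : b ∉ c.writes) (hib : i ≠ b)
    (hbump : ∀ k s t, Inv k s → Inv k (s.bump t))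
    (h0 : Inv 0 (s.set w i 0))
    (hstep : ∀ (k : ℕ) (s₁ : Config), k < s.reg b → s₁.Bounded w → s₁.reg i = k → Inv k s₁ →
      (∀ r ∉ (Stmt.loop i b e c).writes, s₁.reg r = s.reg r) → e.val w s₁ ≠ 0 →
      Always X w c s₁ fun s₂ => Inv (k + 1) (s₂.set w i (k + 1)))
    (hQ : ∀ (k : ℕ) (s₁ : Config), k ≤ s.reg b → s₁.Bounded w → s₁.reg i = k → Inv k s₁ →
      (∀ r ∉ (Stmt.loop i b e c).writes, s₁.reg r = s.reg r) →
      k = s.reg b ∨ e.val w s₁ = 0 → Q s₁) :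
    Always X w (.loop i b e c) s Q := by
  have hbw : b ∉ (Stmt.loop i b e c).writes := by simp [Stmt.writes, hb, hib.symm]
  have key : ∀ (k : ℕ) (s₁ : Config), s₁.reg i + k = s.reg b → s₁.Bounded w → Inv (s₁.reg i) s₁ →
      (∀ r ∉ (Stmt.loop i b e c).writes, s₁.reg r = s.reg r) →
      ∀ s' ∈ (loopSem w i e (sem X w c) k s₁).support, Q s' := by
    intro k
    induction k with
    | zero =>
      intro s₁ hk h1 h2 h3 s' h
      simp only [loopSem, PMF.support_pure, Set.mem_singleton_iff] at h
      subst h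
      exact hQ (s₁.reg i) _ (by omega) h1.bump rfl (hbump _ _ _ h2) h3 (Or.inl (by omega))
    | succ k ih =>
      intro s₁ hk h1 h2 h3 s' h
      simp only [loopSem] at h
      split at h
      · rename_i he
        simp only [PMF.support_pure, Set.mem_singleton_iff] at h
        subst h
        exact hQ (s₁.reg i) _ (by omega) h1.bump rfl (hbump _ _ _ h2) h3
          (Or.inr (by rwa [Term.val_bump]))
      · rename_i he
        rw [PMF.mem_support_bind_iff] at h
        obtain ⟨s₂, h₁, h₂⟩ := h
        have ri := sem_reg c _ i hi _ h₁
        simp only [Config.reg_bump] at ri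
        have hlt : s₂.reg i + 1 < 2 ^ w := by
          have := hs.1 b
          omega
        have := hstep (s₁.reg i) _ (by omega) (h1.bump (k := 6 + (e.size + 1))) rfl
          (hbump _ _ _ h2) h3 (by rwa [Term.val_bump]) _ h₁
        have hreg : ((s₂.set w i (s₂.reg i + 1)).bump 4).reg i = s₁.reg i + 1 := by
          rw [Config.reg_bump, Config.reg_set, if_pos rfl, Nat.mod_eq_of_lt hlt, ri]
        refine ih _ (by rw [hreg]; omega) (sem_bounded c _ h1.bump _ h₁).set.bump ?_ ?_ _ h₂
        · rw [hreg, ri]; exact hbump _ _ _ this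
        · intro r hr
          have hr' := hr
          simp only [Stmt.writes, List.mem_cons, not_or] at hr'
          rw [Config.reg_bump, Config.reg_set, if_neg hr'.1, sem_reg c _ r hr'.2 _ h₁]
          exact h3 r hr
  refine key _ _ (by simp) hs.set.bump ?_ ?_
  · simpa using hbump _ _ 1 h0
  · intro r hr
    simp only [Stmt.writes, List.mem_cons, not_or] at hr
    simp [hr.1]

end always

section refines

variable {Y Z : Type*} {ν : PMF Config} {μ : PMF Y} {Q Q' : Y → Config → Prop}

theorem Refines.mono (h : Refines ν μ Q) (hQ : ∀ y s, Q y s → Q' y s) : Refines ν μ Q' :=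
  fun g G hG => h g G fun y s hy => hG y s (hQ y s hy)

theorem Refines.and_support {R : Config → Prop} (h : Refines ν μ Q) (hR : ∀ s ∈ ν.support, R s) :
    Refines ν μ fun y s => Q y s ∧ R s := by
  classical
  intro g G hG
  -- Outside `R` the test function may be raised to `⊤`: such configurations have probability zero,
  -- so the mean stays the same.
  refine (h (fun s => if R s then g s else ⊤) G fun y s hy => ?_).trans
    (mean_mono fun s hs => by rw [if_pos (hR s hs)])
  split
  · exact hG y s ⟨hy, ‹_›⟩
  · exact le_top

/-- The abstract outcomes may be restricted to the support as well. -/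
theorem Refines.and_abstract {R : Y → Prop} (h : Refines ν μ Q) (hR : ∀ y ∈ μ.support, R y) :
    Refines ν μ fun y s => Q y s ∧ R y := by
  classical
  intro g G hG
  -- Dually, outside `R` the abstract test function may be lowered to `0`.
  refine le_trans (mean_mono fun y hy => ?_) (h g (fun y => if R y then G y else 0) fun y s hy => ?_)
  · rw [if_pos (hR y hy)]
  · split
    · exact hG y s ⟨hy, ‹_›⟩
    · exact zero_le

theorem refines_pure {y : Y} (h : ∀ s ∈ ν.support, Q y s) : Refines ν (PMF.pure y) Q := by
  intro g G hG
  rw [mean_pure, ← mean_const ν (G y)]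
  exact mean_mono fun s hs => hG y s (h s hs)

/-- This is the reason to phrase refinement with test functions rather than with couplings: the mean
over the second stage serves as the test function for the first stage, and nothing has to be
constructed. -/
theorem Refines.bind {f : Config → PMF Config} {f' : Y → PMF Z} {R : Z → Config → Prop}
    (h : Refines ν μ Q) (hf : ∀ y s, Q y s → Refines (f s) (f' y) R) :
    Refines (ν.bind f) (μ.bind f') R := by
  intro g G hG
  rw [mean_bind, mean_bind]
  exact h _ _ fun y s hy => hf y s hy g G hG

/-- Postprocessing that always succeeds. -/
theorem Refines.bind_always {f : Config → PMF Config} {R : Y → Config → Prop}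
    (h : Refines ν μ Q) (hf : ∀ y s, Q y s → ∀ s' ∈ (f s).support, R y s') :
    Refines (ν.bind f) μ R := by
  have := h.bind (f := f) (f' := PMF.pure) (R := R) fun y s hy => refines_pure (hf y s hy)
  rwa [PMF.bind_pure] at this

theorem Refines.map {f : Y → Z} {R : Z → Config → Prop} (h : Refines ν μ fun y s => R (f y) s) :
    Refines ν (μ.map f) R := by
  intro g G hG
  rw [mean_map]
  exact h _ _ fun y s hy => hG _ s hy

theorem refines_map {f : Y → Config} (h : ∀ y ∈ μ.support, Q y (f y)) : Refines (μ.map f) μ Q := by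
  intro g G hG
  rw [mean_map]
  exact mean_mono fun y hy => hG y _ (h y hy)

theorem Refines.map_config {f : Config → Config} {R : Y → Config → Prop} (h : Refines ν μ Q)
    (hf : ∀ y s, Q y s → R y (f s)) : Refines (ν.map f) μ R := by
  intro g G hG
  rw [mean_map]
  exact h _ _ fun y s hy => hG y _ (hf y s hy)

theorem refines_seq {c d : Stmt} {s : Config} {f' : Y → PMF Z} {R : Z → Config → Prop}
    (h : Refines (sem X w c s) μ Q) (hf : ∀ y s, Q y s → Refines (sem X w d s) (f' y) R) :
    Refines (sem X w (.seq c d) s) (μ.bind f') R := h.bind hf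

theorem refines_seq_always {c d : Stmt} {s : Config} {R : Y → Config → Prop}
    (h : Refines (sem X w c s) μ Q) (hf : ∀ y s, Q y s → Always X w d s (R y)) :
    Refines (sem X w (.seq c d) s) μ R := h.bind_always hf

theorem refines_always_seq {c d : Stmt} {s : Config} {Q : Config → Prop} {R : Y → Config → Prop}
    (h : Always X w c s Q) (hf : ∀ s, Q s → Refines (sem X w d s) μ R) :
    Refines (sem X w (.seq c d) s) μ R := by
  have := refines_seq (d := d) (Q := fun (_ : Unit) s => Q s) (f' := fun _ => μ) (R := R)
    (refines_pure (y := ()) h) fun _ s hs => hf s hs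
  rwa [PMF.pure_bind] at this

theorem refines_ite {e : Term} {c d : Stmt} {s : Config}
    (h0 : e.val w s = 0 → Refines (sem X w d (s.bump (e.size + 1))) μ Q)
    (h1 : e.val w s ≠ 0 → Refines (sem X w c (s.bump (e.size + 1))) μ Q)
    (hb : ∀ y s k, Q y s → Q y (s.bump k)) :
    Refines (sem X w (.ite e c d) s) μ Q := by
  rw [sem]
  split
  · exact h0 ‹_›
  · exact (h1 ‹_›).map_config fun y s hy => hb y s _ hy

open Classical in
/-- The abstract counterpart of a loop. -/
noncomputable def absLoop {Y : Type*} (f : ℕ → Y → PMF Y) (halt : Y → Prop) :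
    ℕ → ℕ → Y → PMF (ℕ × Y)
  | 0, i, y => PMF.pure (i, y)
  | k + 1, i, y => if halt y then PMF.pure (i, y) else (f i y).bind (absLoop f halt k (i + 1))

/-- Machine loop and `absLoop` unfold in step, since `hhalt` identifies their stopping conditions.
The draws of a sample, the repeated trials and the collection of edges are all of this form. -/
theorem refines_loop {c : Stmt} {s : Config} {i b : ℕ} {e : Term} {f : ℕ → Y → PMF Y}
    {halt : Y → Prop} {y₀ : Y} (Inv : ℕ → Y → Config → Prop)
    (hs : s.Bounded w) (hi : i ∉ c.writes)
    (hbump : ∀ k y s t, Inv k y s → Inv k y (s.bump t))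
    (h0 : Inv 0 y₀ (s.set w i 0))
    (hhalt : ∀ k y s₁, Inv k y s₁ → (∀ r ∉ (Stmt.loop i b e c).writes, s₁.reg r = s.reg r) →
      (halt y ↔ e.val w s₁ = 0))
    (hstep : ∀ (k : ℕ) (y : Y) (s₁ : Config), k < s.reg b → s₁.Bounded w → s₁.reg i = k →
      Inv k y s₁ → (∀ r ∉ (Stmt.loop i b e c).writes, s₁.reg r = s.reg r) → ¬ halt y →
      Refines (sem X w c s₁) (f k y) fun y' s₂ => Inv (k + 1) y' (s₂.set w i (k + 1))) :
    Refines (sem X w (.loop i b e c) s) (absLoop f halt (s.reg b) 0 y₀) fun p s₁ =>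
      Inv p.1 p.2 s₁ ∧ s₁.reg i = p.1 ∧ s₁.Bounded w ∧
      ∀ r ∉ (Stmt.loop i b e c).writes, s₁.reg r = s.reg r := by
  have key : ∀ (k : ℕ) (y : Y) (s₁ : Config), s₁.reg i + k = s.reg b → s₁.Bounded w →
      Inv (s₁.reg i) y s₁ → (∀ r ∉ (Stmt.loop i b e c).writes, s₁.reg r = s.reg r) →
      Refines (loopSem w i e (sem X w c) k s₁) (absLoop f halt k (s₁.reg i) y) fun p s₁ =>
        Inv p.1 p.2 s₁ ∧ s₁.reg i = p.1 ∧ s₁.Bounded w ∧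
        ∀ r ∉ (Stmt.loop i b e c).writes, s₁.reg r = s.reg r := by
    intro k
    induction k with
    | zero =>
      intro y s₁ hk h1 h2 h3
      rw [loopSem, absLoop]
      refine refines_pure fun s' h => ?_
      simp only [PMF.support_pure, Set.mem_singleton_iff] at h
      subst h
      exact ⟨hbump _ _ _ _ h2, rfl, h1.bump, h3⟩
    | succ k ih =>
      intro y s₁ hk h1 h2 h3
      rw [loopSem, absLoop]
      by_cases he : e.val w s₁ = 0
      · rw [if_pos he, if_pos ((hhalt _ _ _ h2 h3).2 he)]
        refine refines_pure fun s' h => ?_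
        simp only [PMF.support_pure, Set.mem_singleton_iff] at h
        subst h
        exact ⟨hbump _ _ _ _ h2, rfl, h1.bump, h3⟩
      · have hst : ¬ halt y := fun h => he ((hhalt _ _ _ h2 h3).1 h)
        rw [if_neg he, if_neg hst]
        have hst := hstep (s₁.reg i) y _ (by omega) (h1.bump (k := 6 + (e.size + 1))) rfl
          (hbump _ _ _ _ h2) h3 hst
        refine (hst.and_support (R := fun s₂ => s₂.reg i = s₁.reg i ∧ s₂.Bounded w ∧
          ∀ r ∉ c.writes, s₂.reg r = s₁.reg r) fun s₂ h₂ => ⟨by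
            simpa using sem_reg c _ i hi _ h₂,
            sem_bounded c _ h1.bump _ h₂, fun r hr => by
              simpa using sem_reg c _ r hr _ h₂⟩).bind ?_
        rintro y' s₂ ⟨h4, ri, h5, h6⟩
        have hlt : s₂.reg i + 1 < 2 ^ w := by
          have := hs.1 b
          omega
        have hreg : ((s₂.set w i (s₂.reg i + 1)).bump 4).reg i = s₁.reg i + 1 := by
          rw [Config.reg_bump, Config.reg_set, if_pos rfl, Nat.mod_eq_of_lt hlt, ri]
        rw [← hreg]
        refine ih y' _ (by rw [hreg]; omega) h5.set.bump ?_ ?_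
        · rw [hreg, ri]; exact hbump _ _ _ _ h4
        · intro r hr
          have hr' := hr
          simp only [Stmt.writes, List.mem_cons, not_or] at hr'
          rw [Config.reg_bump, Config.reg_set, if_neg hr'.1, h6 r hr'.2]
          exact h3 r hr
  have := key (s.reg b) y₀ ((s.set w i 0).bump 1) (by simp) hs.set.bump
    (by simpa using hbump _ _ _ 1 h0) (fun r hr => by
      simp only [Stmt.writes, List.mem_cons, not_or] at hr
      simp [hr.1])
  rw [show ((s.set w i 0).bump 1).reg i = 0 by simp] at this
  exact this

end refines

end SubgraphCounting

namespace SubgraphCounting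

open scoped ENNReal

/-! ## Fractional edge covers -/

section cover

variable {V : Type*} [Fintype V] (H : SimpleGraph V)

/-- Half of such a labeling is a feasible solution of the dual of the edge cover program. -/
def IsLabeling (f : V → ℕ) : Prop := ∀ a b, H.Adj a b → f a + f b ≤ 2

/-- By Hall's theorem there is a cover of the bipartite double cover of `H` by `D` edges, if `D`
bounds the weight of every labeling. -/
theorem exists_dart_cover (hH : ∀ a, ∃ b, H.Adj a b) {D : ℕ}
    (hD : ∀ f : V → ℕ, IsLabeling H f → ∑ a, f a ≤ D) :
    ∃ y : V → V → ℕ, (∀ a b, y a b ≠ 0 → H.Adj a b) ∧ (∀ a, 1 ≤ ∑ b, y a b) ∧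
      (∀ b, 1 ≤ ∑ a, y a b) ∧ ∑ a, ∑ b, y a b ≤ D := by
  classical
  -- The constant labeling 1 shows that `D` is at least the number of vertices. The excess `k`
  -- becomes the number of dummy partners in the matching.
  have h1 : Fintype.card V ≤ D := by
    have := hD (fun _ => 1) (fun _ _ _ => le_rfl)
    simpa using this
  obtain ⟨k, hk⟩ : ∃ k, D = Fintype.card V + k := ⟨_, (Nat.add_sub_of_le h1).symm⟩
  let N : V → Finset V := fun a => Finset.univ.filter (H.Adj a)
  have hall : ∀ S : Finset V, S.card ≤ (S.biUnion N).card + k := by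
    intro S
    -- The label of a vertex is 1, plus 1 if it lies in `S`, minus 1 if it has a neighbor in `S`. An
    -- edge with an end in `S` loses at the other end what it gains, so this is a labeling. Its
    -- weight is at most `D` exactly if the Hall condition holds for `S` with deficiency `k`.
    have hle := hD (fun a => if a ∈ S then (if a ∈ S.biUnion N then 1 else 2) else
      (if a ∈ S.biUnion N then 0 else 1)) (by
      intro a b hab
      have e1 : a ∈ S → b ∈ S.biUnion N := fun h =>
        Finset.mem_biUnion.2 ⟨a, h, by simp [N, hab]⟩
      have e2 : b ∈ S → a ∈ S.biUnion N := fun h =>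
        Finset.mem_biUnion.2 ⟨b, h, by simp [N, hab.symm]⟩
      dsimp only
      split_ifs <;> first | omega | (exfalso; tauto))
    have heq : ∑ a, (if a ∈ S then (if a ∈ S.biUnion N then 1 else 2) else
        (if a ∈ S.biUnion N then 0 else 1)) + (S.biUnion N).card = Fintype.card V + S.card := by
      have c1 : (S.biUnion N).card = ∑ a, if a ∈ S.biUnion N then 1 else 0 := by
        rw [Finset.sum_ite_mem, Finset.univ_inter, Finset.card_eq_sum_ones]
      have c2 : S.card = ∑ a, if a ∈ S then 1 else 0 := by simp
      have c3 : Fintype.card V = ∑ _a : V, 1 := by simp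
      rw [c1, c2, c3, ← Finset.sum_add_distrib, ← Finset.sum_add_distrib]
      refine Finset.sum_congr rfl fun a _ => ?_
      split_ifs <;> rfl
    omega
  -- All vertices get the same `k` dummies as further neighbors, so at most `k` vertices are matched
  -- to no true neighbor.
  obtain ⟨φ, hφ, hmem⟩ := (Finset.all_card_le_biUnion_card_iff_exists_injective
    (fun a => (N a).disjSum (Finset.univ : Finset (Fin k)))).1 (by
      intro S
      rcases S.eq_empty_or_nonempty with rfl | ⟨a₀, ha₀⟩
      · simp
      · have hsub : (S.biUnion N).disjSum (Finset.univ : Finset (Fin k)) ⊆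
            S.biUnion fun a => (N a).disjSum (Finset.univ : Finset (Fin k)) := by
          rintro (b | j) hb
          · simp only [Finset.inl_mem_disjSum, Finset.mem_biUnion] at hb ⊢
            exact hb
          · simp only [Finset.mem_biUnion, Finset.inr_mem_disjSum]
            exact ⟨a₀, ha₀, Finset.mem_univ _⟩
        have := Finset.card_le_card hsub
        rw [Finset.card_disjSum, Finset.card_univ, Fintype.card_fin] at this
        exact (hall S).trans this)
  choose nb hnb using hH
  let F : V → V := fun a => (φ a).elim id fun _ => nb a
  have hF : ∀ a, H.Adj a (F a) := by
    intro a
    have := hmem a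
    rcases h : φ a with b | j
    · simp [h, N] at this; simp [F, h, this]
    · simp [F, h, hnb]
  let U : Finset V := Finset.univ.filter fun b => ∀ a, φ a ≠ Sum.inl b
  -- At most `k` of the distinct values of `φ` are dummies; the others are distinct vertices, so at
  -- most `k` vertices are missed.
  have hU : U.card ≤ k := by
    let M : Finset V := Finset.univ.filter fun b => ∃ a, φ a = Sum.inl b
    have hUM : U.card + M.card = Fintype.card V := by
      have hM : M = Uᶜ := by ext b; simp [U, M]
      rw [hM, Finset.card_add_card_compl]
    have hcount : Fintype.card V ≤ M.card + k := by
      have : (Finset.univ.image φ) ⊆ M.disjSum (Finset.univ : Finset (Fin k)) := by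
        rintro (b | j) hb
        · simp only [Finset.mem_image, Finset.mem_univ, true_and] at hb
          simp [M, hb]
        · simp
      have := Finset.card_le_card this
      rwa [Finset.card_image_of_injective _ hφ, Finset.card_disjSum, Finset.card_univ,
        Finset.card_univ, Fintype.card_fin] at this
    omega
  -- The darts `(a, F a)` cover every row and every column outside `U`. One more dart into each
  -- vertex of `U` covers the remaining columns, which makes at most `card V + k` darts.
  refine ⟨fun a b => (if b = F a then 1 else 0) + if b ∈ U ∧ a = nb b then 1 else 0,
    ?_, ?_, ?_, ?_⟩
  · intro a b h
    by_cases h1 : b = F a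
    · exact h1 ▸ hF a
    · by_cases h2 : b ∈ U ∧ a = nb b
      · rw [h2.2]; exact (hnb b).symm
      · simp [h1, h2] at h
  · intro a
    refine le_trans ?_ (Finset.single_le_sum (fun _ _ => Nat.zero_le _) (Finset.mem_univ (F a)))
    simp
  · intro b
    by_cases hb : b ∈ U
    · refine le_trans ?_ (Finset.single_le_sum (fun _ _ => Nat.zero_le _) (Finset.mem_univ (nb b)))
      simp [hb]
    · simp only [U, Finset.mem_filter, Finset.mem_univ, true_and, not_forall, not_not] at hb
      obtain ⟨a, ha⟩ := hb
      refine le_trans ?_ (Finset.single_le_sum (fun _ _ => Nat.zero_le _) (Finset.mem_univ a))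
      have : F a = b := by simp [F, ha]
      simp [this]
  · simp only [Finset.sum_add_distrib]
    have e1 : ∑ a, ∑ b, (if b = F a then 1 else 0) = Fintype.card V := by simp
    have e2 : ∑ a, ∑ b, (if b ∈ U ∧ a = nb b then 1 else 0) = U.card := by
      rw [Finset.sum_comm]
      have : ∀ b, ∑ a, (if b ∈ U ∧ a = nb b then 1 else 0) = if b ∈ U then 1 else 0 := by
        intro b; by_cases hb : b ∈ U <;> simp [hb]
      simp [this]
    rw [e1, e2]
    omega

/-- Bound `∏ t` once along the rows and once along the columns of the cover. In the product of the
two bounds a dart `(a, b)` contributes `r a b * r b a = q`, so only the number of darts remains. The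
square comes from using the cover twice. -/
theorem prod_sq_le_of_dart_cover {y : V → V → ℕ} (hy : ∀ a b, y a b ≠ 0 → H.Adj a b)
    (hrow : ∀ a, 1 ≤ ∑ b, y a b) (hcol : ∀ b, 1 ≤ ∑ a, y a b) {D : ℕ} (hD : ∑ a, ∑ b, y a b ≤ D)
    {q : ℝ} (hq : 1 ≤ q) {t : V → ℝ} {r : V → V → ℝ} (ht : ∀ a, 1 ≤ t a)
    (htr : ∀ a b, H.Adj a b → t a ≤ r a b) (hr : ∀ a b, H.Adj a b → r a b * r b a = q) :
    (∏ a, t a) ^ 2 ≤ q ^ D := by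
  have hr1 : ∀ a b, H.Adj a b → 1 ≤ r a b := fun a b h => (ht a).trans (htr a b h)
  -- Covering a vertex more than once does no harm, because `t a` is at least 1.
  have key : ∀ (a : V) (z : V → ℕ) (_ : ∀ b, z b ≠ 0 → H.Adj a b) (_ : 1 ≤ ∑ b, z b),
      t a ≤ ∏ b, r a b ^ z b := by
    intro a z hz h1
    calc t a = t a ^ 1 := (pow_one _).symm
      _ ≤ t a ^ ∑ b, z b := pow_le_pow_right₀ (ht a) h1
      _ = ∏ b, t a ^ z b := (Finset.prod_pow_eq_pow_sum _ _ _).symm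
      _ ≤ ∏ b, r a b ^ z b := by
          refine Finset.prod_le_prod (fun b _ => by have := ht a; positivity) fun b _ => ?_
          by_cases hb : z b = 0
          · simp [hb]
          · exact pow_le_pow_left₀ (by linarith [ht a]) (htr a b (hz b hb)) _
  have hpos : 0 ≤ ∏ a, t a := Finset.prod_nonneg fun a _ => by linarith [ht a]
  have b1 : ∏ a, t a ≤ ∏ a, ∏ b, r a b ^ y a b :=
    Finset.prod_le_prod (fun a _ => by linarith [ht a]) fun a _ => key a _ (fun b => hy a b) (hrow a)
  have b2 : ∏ a, t a ≤ ∏ a, ∏ b, r b a ^ y a b := by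
    rw [Finset.prod_comm]
    exact Finset.prod_le_prod (fun a _ => by linarith [ht a]) fun a _ =>
      key a (fun b => y b a) (fun b h => (hy b a h).symm) (hcol a)
  calc (∏ a, t a) ^ 2 = (∏ a, t a) * ∏ a, t a := sq _
    _ ≤ (∏ a, ∏ b, r a b ^ y a b) * ∏ a, ∏ b, r b a ^ y a b :=
        mul_le_mul b1 b2 hpos (hpos.trans b1)
    _ = ∏ a, ∏ b, q ^ y a b := by
        simp only [← Finset.prod_mul_distrib]
        refine Finset.prod_congr rfl fun a _ => Finset.prod_congr rfl fun b _ => ?_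
        by_cases hb : y a b = 0
        · simp [hb]
        · rw [← mul_pow, hr a b (hy a b hb)]
    _ = q ^ ∑ a, ∑ b, y a b := by simp only [Finset.prod_pow_eq_pow_sum]
    _ ≤ q ^ D := pow_le_pow_right₀ hq hD

/-- Weak duality of linear programming. -/
theorem labeling_le_fractionalEdgeCoverNumber (hH : ∀ a, ∃ b, H.Adj a b) {f : V → ℕ}
    (hf : IsLabeling H f) : (∑ a, (f a : ℝ)) ≤ 2 * fractionalEdgeCoverNumber H := by
  classical
  have hne : ({s : ℝ | ∃ x : Sym2 V → ℝ, (∀ e ∈ H.edgeSet, 0 ≤ x e) ∧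
      (∀ a : V, 1 ≤ ∑ e ∈ H.incidenceFinset a, x e) ∧ s = ∑ e ∈ H.edgeFinset, x e}).Nonempty := by
    refine ⟨_, fun _ => 1, fun _ _ => zero_le_one, fun a => ?_, rfl⟩
    obtain ⟨b, hb⟩ := hH a
    have : s(a, b) ∈ H.incidenceFinset a := by simpa using hb
    have h := Finset.card_pos.2 ⟨_, this⟩
    simpa using (Nat.one_le_cast (α := ℝ)).2 h
  suffices h : (∑ a, (f a : ℝ)) / 2 ≤ fractionalEdgeCoverNumber H by linarith
  rw [fractionalEdgeCoverNumber]
  refine le_csInf ?_ ?_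
  · convert hne
  rintro s ⟨x, hx0, hx, rfl⟩
  -- Multiply the constraint at `a` by the label of `a` and sum. After exchanging the sums every
  -- edge carries the labels of its two ends, hence at most `2 * x e`.
  have step1 : (∑ a, (f a : ℝ)) ≤ ∑ a, (f a : ℝ) * ∑ e ∈ H.incidenceFinset a, x e := by
    refine Finset.sum_le_sum fun a _ => le_mul_of_one_le_right (Nat.cast_nonneg _) ?_
    convert hx a
  have step2 : ∑ a, (f a : ℝ) * ∑ e ∈ H.incidenceFinset a, x e =
      ∑ e ∈ H.edgeFinset, ∑ a, if a ∈ e then (f a : ℝ) * x e else 0 := by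
    rw [Finset.sum_comm]
    refine Finset.sum_congr rfl fun a _ => ?_
    rw [Finset.mul_sum, ← Finset.sum_filter]
    refine Finset.sum_congr ?_ fun _ _ => rfl
    ext e
    simp [SimpleGraph.incidenceSet]
  have step3 : ∑ e ∈ H.edgeFinset, ∑ a, (if a ∈ e then (f a : ℝ) * x e else 0) ≤
      ∑ e ∈ H.edgeFinset, 2 * x e := by
    refine Finset.sum_le_sum fun e he => ?_
    have hxe := hx0 e (by simpa using he)
    rw [SimpleGraph.mem_edgeFinset] at he
    induction e with
    | _ a b =>
      have hab : H.Adj a b := he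
      have hsum : ∑ c, (if c ∈ s(a, b) then (f c : ℝ) * x s(a, b) else 0) =
          f a * x s(a, b) + f b * x s(a, b) := by
        rw [← Finset.sum_filter]
        have : Finset.univ.filter (fun c => c ∈ s(a, b)) = {a, b} := by ext c; simp
        rw [this, Finset.sum_pair hab.ne]
      rw [hsum, ← add_mul]
      have h2 : (f a : ℝ) + f b ≤ 2 := by exact_mod_cast hf a b hab
      exact mul_le_mul_of_nonneg_right h2 hxe
  rw [← Finset.mul_sum] at step3
  have h4 : (∑ a, (f a : ℝ)) / 2 ≤ ∑ e ∈ H.edgeFinset, x e := by linarith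
  convert h4

end cover

/-! ### An integer form of twice the fractional edge-cover number -/

section labelWeight

variable {h : ℕ} (H : SimpleGraph (Fin h))

open Classical in
/-- The maximum weight of a labeling, which is `2 ρ(H)`. -/
noncomputable def labelWeight : ℕ :=
  (Finset.univ.filter fun f : Fin h → Fin h => IsLabeling H fun a => (f a : ℕ)).sup
    fun f => ∑ a, (f a : ℕ)

variable {H}

theorem two_le_of_no_isolated (h0 : 0 < h) (hH : ∀ a, ∃ b, H.Adj a b) : 2 ≤ h := by
  obtain ⟨b, hb⟩ := hH ⟨0, h0⟩
  have := Fintype.one_lt_card_iff.2 ⟨_, _, hb.ne⟩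
  rwa [Fintype.card_fin] at this

/-- In `labelWeight` the labels are below `h`, so that maps from the vertices to themselves can be
searched. Without isolated vertices labels are at most 2, so nothing is lost for `h > 2`. For `h =
2` the graph is a single edge and the constant labeling 1 is optimal. -/
theorem labeling_le_labelWeight (h0 : 0 < h) (hH : ∀ a, ∃ b, H.Adj a b) {f : Fin h → ℕ}
    (hf : IsLabeling H f) : ∑ a, f a ≤ labelWeight H := by
  classical
  have key : ∀ g : Fin h → Fin h, (IsLabeling H fun a => (g a : ℕ)) →
      ∑ a, (g a : ℕ) ≤ labelWeight H := by
    intro g hg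
    rw [labelWeight]
    exact Finset.le_sup (f := fun f : Fin h → Fin h => ∑ a, (f a : ℕ)) (by simpa using hg)
  have h2 := two_le_of_no_isolated h0 hH
  have hf2 : ∀ a, f a ≤ 2 := fun a => by
    obtain ⟨b, hb⟩ := hH a
    have := hf a b hb
    omega
  rcases Nat.lt_or_ge 2 h with h3 | h3
  · exact key (fun a => ⟨f a, (hf2 a).trans_lt h3⟩) hf
  · obtain rfl : h = 2 := by omega
    have h1 := key (fun _ => 1) (fun a b _ => by simp)
    refine le_trans ?_ h1
    have h01 : H.Adj 0 1 := by
      obtain ⟨b, hb⟩ := hH 0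
      have := hb.ne
      have : b = 1 := by omega
      exact this ▸ hb
    simpa [Fin.sum_univ_two] using hf 0 1 h01

/-- Only this half of the equality with `2ρ` is needed; it makes the rejection constant `O(m ^ ρ)`.
-/
theorem labelWeight_le (h0 : 0 < h) (hH : ∀ a, ∃ b, H.Adj a b) :
    (labelWeight H : ℝ) ≤ 2 * fractionalEdgeCoverNumber H := by
  classical
  rw [labelWeight]
  have hne : (Finset.univ.filter fun f : Fin h → Fin h =>
      IsLabeling H fun a => (f a : ℕ)).Nonempty :=
    ⟨fun _ => ⟨0, h0⟩, by
      rw [Finset.mem_filter]; exact ⟨Finset.mem_univ _, fun _ _ _ => by simp⟩⟩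
  obtain ⟨f, hf, heq⟩ := Finset.exists_mem_eq_sup _ hne fun f : Fin h → Fin h => ∑ a, (f a : ℕ)
  rw [heq]
  have := labeling_le_fractionalEdgeCoverNumber H hH (by simpa using hf : IsLabeling H _)
  simpa using this

theorem labelWeight_le_sq : labelWeight H ≤ h * h := by
  classical
  rw [labelWeight]
  refine Finset.sup_le fun f _ => ?_
  calc ∑ a, (f a : ℕ) ≤ ∑ _a : Fin h, h := Finset.sum_le_sum fun a _ => (f a).2.le
    _ = h * h := by simp

theorem two_le_labelWeight (h0 : 0 < h) (hH : ∀ a, ∃ b, H.Adj a b) : 2 ≤ labelWeight H := by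
  have := labeling_le_labelWeight h0 hH (f := fun _ => 1) (fun _ _ _ => le_rfl)
  have h2 := two_le_of_no_isolated h0 hH
  simp at this
  omega

end labelWeight

end SubgraphCounting

namespace SubgraphCounting

open scoped ENNReal

/-! ## Embeddings and copies -/

section embeddings

variable {V W : Type*} (G : SimpleGraph V) (cG : Sym2 V → ℕ) (H : SimpleGraph W) (cH : Sym2 W → ℕ)

/-- `f` embeds `H` into `G` as a subgraph and preserves the colors of edges. -/
def IsColorEmbedding (f : W → V) : Prop :=
  Function.Injective f ∧ ∀ a b, H.Adj a b → G.Adj (f a) (f b) ∧ cG s(f a, f b) = cH s(a, b)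

open Classical in
/-- The set of embeddings. -/
noncomputable def colorEmbeddings [Fintype V] [Fintype W] : Finset (W → V) :=
  Finset.univ.filter (IsColorEmbedding G cG H cH)

/-- The image of `H` under a map, as a subgraph. -/
def IsColorEmbedding.copy {G : SimpleGraph V} {cG : Sym2 V → ℕ} {H : SimpleGraph W}
    {cH : Sym2 W → ℕ} {f : W → V} (hf : IsColorEmbedding G cG H cH f) : H.Copy G :=
  ⟨⟨f, fun h => (hf.2 _ _ h).1⟩, hf.1⟩

variable {G cG H cH}

theorem IsColorEmbedding.comp {f : W → V} (hf : IsColorEmbedding G cG H cH f) {σ : W → W}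
    (hσ : IsColorEmbedding H cH H cH σ) : IsColorEmbedding G cG H cH (f ∘ σ) :=
  ⟨hf.1.comp hσ.1, fun a b hab =>
    ⟨(hf.2 _ _ (hσ.2 a b hab).1).1,
      (hf.2 _ _ (hσ.2 a b hab).1).2.trans (hσ.2 a b hab).2⟩⟩

/-- An embedding of `H` into itself acts injectively on the finite set of darts, hence permutes it.
-/
theorem IsColorEmbedding.surj_adj [Finite W] {σ : W → W} (hσ : IsColorEmbedding H cH H cH σ)
    {a b : W} (hab : H.Adj a b) : ∃ a' b', H.Adj a' b' ∧ σ a' = a ∧ σ b' = b := by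
  let g : {p : W × W // H.Adj p.1 p.2} → {p : W × W // H.Adj p.1 p.2} :=
    fun p => ⟨(σ p.1.1, σ p.1.2), (hσ.2 _ _ p.2).1⟩
  have hg : Function.Injective g := by
    rintro ⟨⟨x, y⟩, h⟩ ⟨⟨x', y'⟩, h'⟩ he
    simp only [g, Subtype.mk.injEq, Prod.mk.injEq] at he ⊢
    exact ⟨hσ.1 he.1, hσ.1 he.2⟩
  obtain ⟨⟨⟨a', b'⟩, h'⟩, he⟩ := Finite.surjective_of_injective hg ⟨(a, b), hab⟩
  simp only [g, Subtype.mk.injEq, Prod.mk.injEq] at he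
  exact ⟨a', b', h', he⟩

theorem toSubgraph_comp_eq [Finite W] {f : W → V} (hf : IsColorEmbedding G cG H cH f) {σ : W → W}
    (hσ : IsColorEmbedding H cH H cH σ) :
    (hf.comp hσ).copy.toSubgraph = hf.copy.toSubgraph := by
  have hs : Function.Surjective σ := Finite.surjective_of_injective hσ.1
  refine SimpleGraph.Subgraph.ext ?_ ?_
  · ext v
    simp only [SimpleGraph.Copy.toSubgraph, SimpleGraph.Subgraph.map_verts,
      SimpleGraph.Subgraph.verts_top, Set.image_univ, Set.mem_range]
    exact ⟨fun ⟨a, ha⟩ => ⟨σ a, ha⟩, fun ⟨a, ha⟩ => by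
      obtain ⟨a', rfl⟩ := hs a; exact ⟨a', ha⟩⟩
  · ext u v
    simp only [SimpleGraph.Copy.toSubgraph, SimpleGraph.Subgraph.map_adj,
      SimpleGraph.Subgraph.top_adj, Relation.Map]
    constructor
    · rintro ⟨a, b, hab, h1, h2⟩
      exact ⟨σ a, σ b, (hσ.2 a b hab).1, h1, h2⟩
    · rintro ⟨a, b, hab, h1, h2⟩
      obtain ⟨a', b', h', rfl, rfl⟩ := hσ.surj_adj hab
      exact ⟨a', b', h', h1, h2⟩

/-- Every vertex of the common image has a unique preimage under `f`, which defines `σ`. Edges of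
the image come from edges of `H`, so `σ` maps edges to edges, and both embeddings read the colors
off the same edges of `G`. -/
theorem exists_of_toSubgraph_eq {f f' : W → V} (hf : IsColorEmbedding G cG H cH f)
    (hf' : IsColorEmbedding G cG H cH f') (h : hf'.copy.toSubgraph = hf.copy.toSubgraph) :
    ∃ σ, IsColorEmbedding H cH H cH σ ∧ f ∘ σ = f' := by
  have hv : ∀ a, ∃ b, f b = f' a := by
    intro a
    have : f' a ∈ hf'.copy.toSubgraph.verts := by
      simp only [SimpleGraph.Copy.toSubgraph, SimpleGraph.Subgraph.map_verts,
        SimpleGraph.Subgraph.verts_top, Set.image_univ, Set.mem_range]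
      exact ⟨a, rfl⟩
    rw [h] at this
    simpa [SimpleGraph.Copy.toSubgraph, IsColorEmbedding.copy] using this
  choose σ hσ using hv
  refine ⟨σ, ⟨fun a b hab => hf'.1 ?_, fun a b hab => ?_⟩, funext hσ⟩
  · rw [← hσ a, ← hσ b, hab]
  · have h1 : hf'.copy.toSubgraph.Adj (f' a) (f' b) := by
      simp only [SimpleGraph.Copy.toSubgraph, SimpleGraph.Subgraph.map_adj,
        SimpleGraph.Subgraph.top_adj, Relation.Map]
      exact ⟨a, b, hab, rfl, rfl⟩
    rw [h] at h1
    simp only [SimpleGraph.Copy.toSubgraph, SimpleGraph.Subgraph.map_adj,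
      SimpleGraph.Subgraph.top_adj, Relation.Map] at h1
    obtain ⟨a', b', hab', ha, hb⟩ := h1
    have ea : a' = σ a := hf.1 (Eq.trans ha (hσ a).symm)
    have eb : b' = σ b := hf.1 (Eq.trans hb (hσ b).symm)
    subst ea eb
    refine ⟨hab', ?_⟩
    rw [← (hf.2 _ _ hab').2, hσ, hσ, (hf'.2 _ _ hab).2]

/-- The color automorphisms of `H` act freely on the embeddings by precomposition, and the orbits
are the fibers of the map from embeddings to image subgraphs. -/
theorem card_colorEmbeddings [Fintype V] [Fintype W] :
    (colorEmbeddings G cG H cH).card =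
      colorfulCopyCount G cG H cH * (colorEmbeddings H cH H cH).card := by
  classical
  let img : (W → V) → G.Subgraph := fun f =>
    if hf : IsColorEmbedding G cG H cH f then hf.copy.toSubgraph else ⊥
  have himg : ∀ {f} (hf : IsColorEmbedding G cG H cH f), img f = hf.copy.toSubgraph :=
    fun hf => dif_pos hf
  have hcopies : colorfulCopyCount G cG H cH = ((colorEmbeddings G cG H cH).image img).card := by
    rw [colorfulCopyCount, ← Set.ncard_coe_finset]
    congr 1
    ext H'
    simp only [Set.mem_ofPred_eq, Finset.coe_image, Set.mem_image, Finset.mem_coe, colorEmbeddings,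
      Finset.mem_filter, Finset.mem_univ, true_and]
    constructor
    · rintro ⟨φ, hφ⟩
      have hf : IsColorEmbedding G cG H cH fun a => (φ a : V) :=
        ⟨Subtype.val_injective.comp φ.injective, fun a b hab =>
          ⟨H'.coe_adj_sub _ _ (φ.map_adj_iff.2 hab), hφ a b hab⟩⟩
      refine ⟨_, hf, ?_⟩
      rw [himg hf]
      refine SimpleGraph.Subgraph.ext ?_ ?_
      · ext v
        simp only [SimpleGraph.Copy.toSubgraph, SimpleGraph.Subgraph.map_verts,
          SimpleGraph.Subgraph.verts_top, Set.image_univ, Set.mem_range]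
        exact ⟨fun ⟨a, ha⟩ => ha ▸ (φ a).2, fun hv => ⟨φ.symm ⟨v, hv⟩, by
          simp [IsColorEmbedding.copy]⟩⟩
      · ext u v
        simp only [SimpleGraph.Copy.toSubgraph, SimpleGraph.Subgraph.map_adj,
          SimpleGraph.Subgraph.top_adj, Relation.Map]
        constructor
        · rintro ⟨a, b, hab, rfl, rfl⟩
          exact (φ.map_adj_iff.2 hab : H'.coe.Adj (φ a) (φ b))
        · intro huv
          have hu := H'.edge_vert huv
          have hv := H'.edge_vert huv.symm
          refine ⟨φ.symm ⟨u, hu⟩, φ.symm ⟨v, hv⟩, ?_, ?_, ?_⟩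
          · rw [← φ.map_adj_iff]; simpa using huv
          · simp [IsColorEmbedding.copy]
          · simp [IsColorEmbedding.copy]
    · rintro ⟨f, hf, rfl⟩
      rw [himg hf]
      exact ⟨hf.copy.isoToSubgraph, fun a b hab => (hf.2 a b hab).2⟩
  rw [hcopies, ← smul_eq_mul, ← Finset.sum_const,
    Finset.card_eq_sum_card_image img (colorEmbeddings G cG H cH)]
  refine Finset.sum_congr rfl fun H' hH' => ?_
  simp only [Finset.mem_image, colorEmbeddings, Finset.mem_filter, Finset.mem_univ, true_and] at hH'
  obtain ⟨f, hf, rfl⟩ := hH'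
  symm
  refine Finset.card_bij (fun σ _ => f ∘ σ) ?_ ?_ ?_
  · intro σ hσ
    simp only [colorEmbeddings, Finset.mem_filter, Finset.mem_univ, true_and] at hσ ⊢
    refine ⟨hf.comp hσ, ?_⟩
    rw [himg hf, himg (hf.comp hσ), toSubgraph_comp_eq hf hσ]
  · intro σ _ σ' _ h
    exact hf.1.comp_left h
  · intro f' hf'
    simp only [colorEmbeddings, Finset.mem_filter, Finset.mem_univ, true_and] at hf'
    obtain ⟨hf', he⟩ := hf'
    rw [himg hf, himg hf'] at he
    obtain ⟨σ, hσ, h⟩ := exists_of_toSubgraph_eq hf hf' he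
    exact ⟨σ, by simpa [colorEmbeddings] using hσ, h⟩

theorem copyCount_eq_colorfulCopyCount [Fintype V] :
    G.copyCount H = colorfulCopyCount G (fun _ => 0) H fun _ => 0 := by
  classical
  rw [SimpleGraph.copyCount, colorfulCopyCount, ← Set.ncard_coe_finset]
  congr 1
  ext H'
  simp only [Finset.coe_filter, Finset.mem_univ, true_and, Set.mem_ofPred_eq]
  exact ⟨fun ⟨φ⟩ => ⟨φ, by simp⟩, fun ⟨φ, _⟩ => ⟨φ⟩⟩

theorem card_colorEmbeddings_self_pos [Fintype W] : 0 < (colorEmbeddings H cH H cH).card := by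
  classical
  refine Finset.card_pos.2 ⟨id, ?_⟩
  simp [colorEmbeddings, IsColorEmbedding, Function.injective_id]

end embeddings

end SubgraphCounting

namespace SubgraphCounting

open scoped ENNReal

/-! ## Sampling from the input graph -/

theorem bind_apply_eq_mean {α β : Type*} (μ : PMF α) (f : α → PMF β) (b : β) :
    (μ.bind f) b = mean μ fun a => f a b := PMF.bind_apply _ _ _

theorem map_apply_eq_mean {α β : Type*} [DecidableEq β] (μ : PMF α) (f : α → β) (b : β) :
    (μ.map f) b = mean μ fun a => if f a = b then 1 else 0 := by
  rw [PMF.map_apply, mean]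
  refine tsum_congr fun a => ?_
  simp [eq_comm]

theorem randBelow_zero : randBelow 0 = PMF.pure 0 := by simp [randBelow]

theorem randBelow_apply {k : ℕ} (hk : 0 < k) (x : ℕ) :
    randBelow k x = if x < k then (k : ℝ≥0∞)⁻¹ else 0 := by
  have h : (Finset.range k).Nonempty := Finset.nonempty_range_iff.2 hk.ne'
  rw [randBelow, dif_pos h, PMF.uniformOfFinset_apply]
  simp

theorem mem_support_randBelow {k : ℕ} (hk : 0 < k) {x : ℕ} :
    x ∈ (randBelow k).support ↔ x < k := by
  rw [PMF.mem_support_iff, randBelow_apply hk]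
  simp

theorem mean_randBelow {k : ℕ} (hk : 0 < k) (p : ℕ → Prop) [DecidablePred p] :
    (mean (randBelow k) fun x => if p x then 1 else 0) =
      ((Finset.range k).filter p).card / (k : ℝ≥0∞) := by
  rw [mean, tsum_eq_sum (s := Finset.range k)]
  · rw [Finset.sum_congr rfl (g := fun x => if p x then (k : ℝ≥0∞)⁻¹ else 0)]
    · rw [← Finset.sum_filter, Finset.sum_const, nsmul_eq_mul, ENNReal.div_eq_inv_mul, mul_comm]
    · intro x hx
      rw [randBelow_apply hk, if_pos (Finset.mem_range.1 hx)]
      split_ifs <;> simp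
  · intro x hx
    rw [randBelow_apply hk, if_neg (by simpa using hx), zero_mul]

theorem randBelow_map_apply {α : Type*} [DecidableEq α] {k : ℕ} (hk : 0 < k) (f : ℕ → α) (a : α) :
    ((randBelow k).map f) a = ((Finset.range k).filter (f · = a)).card / (k : ℝ≥0∞) := by
  rw [map_apply_eq_mean, mean_randBelow hk]

namespace InputGraph

variable {n : ℕ} (X : InputGraph n)

/-- A random endpoint of a random edge. -/
noncomputable def sampleEndpoint : PMF ℕ :=
  X.edgeSample.bind fun r => (randBelow 2).map fun t => if t = 0 then r.2.1 else r.1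

/-- A random neighbor. -/
noncomputable def sampleNeighbor (u : ℕ) : PMF ℕ :=
  (randBelow (X.degreeAnswer u)).map fun k => (X.neighborAnswer u k).1

theorem degreeAnswer_le (v : ℕ) : X.degreeAnswer v ≤ n := by
  rw [degreeAnswer]
  split
  · have := Set.ncard_le_ncard (Set.subset_univ (X.graph.neighborSet ⟨v, by assumption⟩))
    simpa [Set.ncard_univ] using this
  · exact Nat.zero_le _

open Classical in
theorem degreeAnswer_eq (v : Fin n) : X.degreeAnswer v = X.graph.degree v := by
  rw [degreeAnswer, dif_pos v.2, ← SimpleGraph.card_neighborSet_eq_degree,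
    Set.ncard_eq_toFinset_card', Set.toFinset_card]

open Classical in
theorem numEdges_eq : X.numEdges = X.graph.edgeFinset.card := by
  rw [numEdges, Set.ncard_eq_toFinset_card']
  rfl

theorem pairAnswer_of_lt (u v : Fin n) [Decidable (X.graph.Adj u v)] : X.pairAnswer u v =
    if X.graph.Adj u v then (1, X.color s(u, v)) else (0, 0) := by
  rw [pairAnswer, dif_pos ⟨u.2, v.2⟩]
  congr

theorem pairAnswer_fst_eq_one {u v : ℕ} : (X.pairAnswer u v).1 = 1 ↔
    ∃ (hu : u < n) (hv : v < n), X.graph.Adj ⟨u, hu⟩ ⟨v, hv⟩ := by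
  classical
  rw [pairAnswer]
  split
  · rename_i h
    split
    · simp only [true_iff]; exact ⟨h.1, h.2, ‹_›⟩
    · simp only [zero_ne_one, false_iff]; rintro ⟨h1, h2, h3⟩; contradiction
  · rename_i h
    simp only [zero_ne_one, false_iff]
    rintro ⟨h1, h2, h3⟩
    exact h ⟨h1, h2⟩

theorem pairAnswer_fst_le (u v : ℕ) : (X.pairAnswer u v).1 = 0 ∨ (X.pairAnswer u v).1 = 1 := by
  classical
  rw [pairAnswer]
  split_ifs <;> simp

theorem degreeAnswer_pos {u v : Fin n} (h : X.graph.Adj u v) : 0 < X.degreeAnswer u := by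
  classical
  rw [degreeAnswer_eq, SimpleGraph.degree_pos_iff_exists_adj]
  exact ⟨v, h⟩

theorem two_mul_numEdges_le : 2 * X.numEdges ≤ n * n := by
  classical
  rw [numEdges_eq, ← SimpleGraph.sum_degrees_eq_twice_card_edges]
  calc ∑ v, X.graph.degree v ≤ ∑ _v : Fin n, n := Finset.sum_le_sum fun v _ => by
        rw [← degreeAnswer_eq]; exact X.degreeAnswer_le v
    _ = n * n := by simp

theorem degreeAnswer_le_numEdges (u : ℕ) : X.degreeAnswer u ≤ 2 * X.numEdges := by
  classical
  by_cases hu : u < n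
  · have h1 := X.degreeAnswer_eq ⟨u, hu⟩
    simp only at h1
    rw [numEdges_eq, ← SimpleGraph.sum_degrees_eq_twice_card_edges, h1]
    exact Finset.single_le_sum (f := fun v => X.graph.degree v) (fun _ _ => Nat.zero_le _)
      (Finset.mem_univ _)
  · simp [degreeAnswer, hu]

variable (hX : X.graph.edgeSet.Nonempty)
include hX

theorem numEdges_pos : 0 < X.numEdges := by
  rw [numEdges, Set.ncard_pos]; exact hX

open Classical in
theorem mean_edgeSample (g : ℕ × ℕ × ℕ → ℝ≥0∞) : mean X.edgeSample g =
    (∑ e ∈ X.graph.edgeFinset, g ((e.inf : ℕ), (e.sup : ℕ), X.color e)) / X.numEdges := by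
  have h : X.graph.edgeFinset.Nonempty := by simpa using hX
  rw [edgeSample, dif_pos (by convert h), mean_map, mean, tsum_fintype]
  simp only [PMF.uniformOfFinset_apply, ite_mul, zero_mul, Finset.sum_ite_mem, Finset.univ_inter]
  rw [← Finset.mul_sum, numEdges_eq, ENNReal.div_eq_inv_mul]

/-- Each edge at `a` is drawn with probability `1 / m`, and then `a` is picked among its two ends
with probability `1 / 2`. -/
theorem sampleEndpoint_apply (a : Fin n) :
    X.sampleEndpoint a = X.degreeAnswer a / ((2 * X.numEdges : ℕ) : ℝ≥0∞) := by
  classical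
  have hcoin : ∀ e ∈ X.graph.edgeFinset,
      ((randBelow 2).map fun t => if t = 0 then (e.sup : ℕ) else (e.inf : ℕ)) (a : ℕ) =
      if a ∈ e then 2⁻¹ else 0 := by
    intro e he
    rw [randBelow_map_apply two_pos]
    have hne : e.inf ≠ e.sup := by
      intro h
      refine X.graph.not_isDiag_of_mem_edgeFinset he ?_
      induction e with
      | _ x y =>
        simp only [Sym2.inf_mk, Sym2.sup_mk] at h
        exact Sym2.mk_isDiag_iff.2 (inf_eq_sup.1 h)
    have hmem : a ∈ e ↔ a = e.inf ∨ a = e.sup := by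
      induction e with
      | _ x y =>
        simp only [Sym2.mem_iff, Sym2.inf_mk, Sym2.sup_mk]
        rcases le_total x y with h | h <;> simp [h, or_comm]
    rw [show Finset.range 2 = {0, 1} from rfl, Finset.filter_insert, Finset.filter_singleton]
    simp only [if_true, one_ne_zero, if_false, Fin.val_inj]
    by_cases h1 : a = e.inf
    · have h2 : e.sup ≠ a := fun h => hne (h1.symm.trans h.symm)
      rw [if_pos (hmem.2 (Or.inl h1)), if_neg h2, if_pos h1.symm]
      simp
    · by_cases h2 : a = e.sup
      · rw [if_pos (hmem.2 (Or.inr h2)), if_pos h2.symm, if_neg (Ne.symm h1)]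
        simp
      · rw [if_neg (Ne.symm h2), if_neg (Ne.symm h1), if_neg (fun h => (hmem.1 h).elim h1 h2)]
        simp
  rw [sampleEndpoint, bind_apply_eq_mean, mean_edgeSample X hX, Finset.sum_congr rfl hcoin,
    ← Finset.sum_filter, Finset.sum_const, nsmul_eq_mul]
  have hcard : (X.graph.edgeFinset.filter fun e => a ∈ e).card = X.degreeAnswer a := by
    rw [degreeAnswer_eq, ← SimpleGraph.card_incidenceFinset_eq_degree,
      SimpleGraph.incidenceFinset_eq_filter]
  rw [hcard]
  push_cast
  rw [ENNReal.div_eq_inv_mul, ENNReal.div_eq_inv_mul,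
    ENNReal.mul_inv (Or.inl (by norm_num)) (Or.inl (by norm_num))]
  ring

omit hX in
theorem sampleNeighbor_apply {u a : Fin n} (h : X.graph.Adj u a) :
    X.sampleNeighbor u a = ((X.degreeAnswer u : ℕ) : ℝ≥0∞)⁻¹ := by
  classical
  rw [sampleNeighbor, randBelow_map_apply (X.degreeAnswer_pos h)]
  have : ((Finset.range (X.degreeAnswer u)).filter
      fun k => (X.neighborAnswer u k).1 = (a : ℕ)).card = 1 := by
    rw [Finset.card_eq_one]
    have hd : X.degreeAnswer u = (X.graph.neighborSet u).ncard := by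
      rw [degreeAnswer, dif_pos u.2]
    refine ⟨((X.nbr u).symm ⟨a, h⟩ : ℕ), ?_⟩
    ext k
    simp only [Finset.mem_filter, Finset.mem_range, Finset.mem_singleton, hd]
    constructor
    · rintro ⟨hk, he⟩
      rw [neighborAnswer, dif_pos u.2, dif_pos hk] at he
      have h2 : X.nbr u ⟨k, hk⟩ = ⟨a, h⟩ := Subtype.ext (Fin.ext he)
      rw [← h2]
      simp
    · rintro rfl
      refine ⟨((X.nbr u).symm ⟨a, h⟩).2, ?_⟩
      rw [neighborAnswer, dif_pos u.2, dif_pos ((X.nbr u).symm ⟨a, h⟩).2]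
      simp
  rw [this]
  simp

end InputGraph

end SubgraphCounting

namespace SubgraphCounting

open scoped ENNReal

/-! ## Sequential sampling -/

section sequential

variable {Z : Type*} (μ : ℕ → (ℕ → Z) → PMF Z)

/-- Sample the entries of a sequence one after the other. -/
noncomputable def sampleSeq (k i : ℕ) (y : ℕ → Z) : PMF (ℕ × (ℕ → Z)) :=
  absLoop (fun i y => (μ i y).map (Function.update y i)) (fun _ => False) k i y

theorem sampleSeq_zero (i : ℕ) (y : ℕ → Z) : sampleSeq μ 0 i y = PMF.pure (i, y) := rfl

theorem sampleSeq_succ (k i : ℕ) (y : ℕ → Z) : sampleSeq μ (k + 1) i y =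
    (μ i y).bind fun z => sampleSeq μ k (i + 1) (Function.update y i z) := by
  rw [sampleSeq, absLoop, if_neg (by simp), PMF.bind_map]
  rfl

theorem mem_support_sampleSeq {k i : ℕ} {y : ℕ → Z} {q : ℕ × (ℕ → Z)}
    (hq : q ∈ (sampleSeq μ k i y).support) :
    q.1 = i + k ∧ ∀ j, j < i ∨ i + k ≤ j → q.2 j = y j := by
  induction k generalizing i y with
  | zero =>
    rw [sampleSeq_zero, PMF.support_pure, Set.mem_singleton_iff] at hq
    subst hq
    exact ⟨rfl, fun _ _ => rfl⟩
  | succ k ih =>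
    rw [sampleSeq_succ, PMF.mem_support_bind_iff] at hq
    obtain ⟨z, -, hz⟩ := hq
    obtain ⟨h1, h2⟩ := ih hz
    refine ⟨by omega, fun j hj => ?_⟩
    rw [h2 j (by omega), Function.update_of_ne (by omega)]

/-- The chain rule: a sequence of outcomes is reached by exactly one history. When entry `i + j` is
drawn, the earlier entries have their final values and the later ones still their initial values. -/
theorem sampleSeq_apply {k i : ℕ} {y t : ℕ → Z} (ht : ∀ j, j < i ∨ i + k ≤ j → t j = y j) :
    sampleSeq μ k i y (i + k, t) = ∏ j ∈ Finset.range k,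
      μ (i + j) (fun l => if l < i + j then t l else y l) (t (i + j)) := by
  classical
  induction k generalizing i y with
  | zero =>
    have : t = y := funext fun j => ht j (by omega)
    simp [sampleSeq_zero, this]
  | succ k ih =>
    rw [sampleSeq_succ, PMF.bind_apply, tsum_eq_single (t i)]
    · have h := ih (i := i + 1) (y := Function.update y i (t i)) fun j hj => by
        by_cases hji : j = i
        · subst hji; simp
        · rw [Function.update_of_ne hji]; exact ht j (by omega)
      rw [show i + (k + 1) = i + 1 + k by omega, h, Finset.prod_range_succ']
      rw [mul_comm]
      congr 1
      · refine Finset.prod_congr rfl fun j _ => ?_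
        rw [show i + 1 + j = i + (j + 1) by omega]
        congr 1
        congr 1
        funext l
        by_cases hl : l = i
        · subst hl; simp
        · simp [Function.update_of_ne hl]
      · congr 1
        congr 1
        funext l
        split_ifs with hl
        · exact (ht l (Or.inl (by omega))).symm
        · rfl
    · intro z hz
      rw [mul_eq_zero]
      right
      rw [PMF.apply_eq_zero_iff]
      intro hmem
      have := (mem_support_sampleSeq μ hmem).2 i (by omega)
      simp only [Function.update_self] at this
      exact hz this.symm

end sequential

/-! ## The sampler for embeddings -/

section trial

variable {n : ℕ} (X : InputGraph n) {h : ℕ} (H : SimpleGraph (Fin h)) (cH : Sym2 (Fin h) → ℕ)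

open Classical in
/-- The adjacency matrix of `H`. -/
noncomputable def adjCode (i j : ℕ) : ℕ :=
  if hij : i < h ∧ j < h then (if H.Adj ⟨i, hij.1⟩ ⟨j, hij.2⟩ then 1 else 0) else 0

open Classical in
/-- The matrix of colors of `H`. -/
noncomputable def colCode (i j : ℕ) : ℕ :=
  if hij : i < h ∧ j < h then
    (if H.Adj ⟨i, hij.1⟩ ⟨j, hij.2⟩ then cH s(⟨i, hij.1⟩, ⟨j, hij.2⟩) else 0) else 0

/-- The distribution of the image of vertex `i`, sampled along the edge to vertex `j`. -/
noncomputable def drawVertex (i j : ℕ) (y : ℕ → ℕ × ℕ) : PMF ℕ :=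
  if adjCode H i j = 0 then PMF.pure 0
  else if i < j then X.sampleEndpoint else X.sampleNeighbor (y j).2

/-- A vertex of `H` chosen for vertex `i`, together with the image of `i`. -/
noncomputable def drawPair (i : ℕ) (y : ℕ → ℕ × ℕ) : PMF (ℕ × ℕ) :=
  (randBelow h).bind fun j => (drawVertex X H i j y).map fun a => (j, a)

/-- The inverse sampling probability of vertex `i` along the edge to `j`, multiplied by the degree
of the image of `i`. -/
noncomputable def weight (y : ℕ → ℕ × ℕ) (i j : ℕ) : ℕ :=
  if i < j then 2 * X.numEdges else X.degreeAnswer (y i).2 * X.degreeAnswer (y j).2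

/-- The condition for the pair `(i, j)` on an accepted sample. -/
def PairCondition (y : ℕ → ℕ × ℕ) (i j : ℕ) : Prop :=
  if adjCode H i j = 0 then i = j ∨ (y i).2 ≠ (y j).2
  else (X.pairAnswer (y i).2 (y j).2).1 = 1 ∧ (X.pairAnswer (y i).2 (y j).2).2 = colCode H cH i j ∧
    weight X y i (y i).1 * h + (y i).1 ≤ weight X y i j * h + j

/-- The sample encodes an embedding, and each vertex was sampled along the best edge. -/
def ValidSample (y : ℕ → ℕ × ℕ) : Prop :=
  (∀ i < h, adjCode H i (y i).1 = 1) ∧ ∀ i < h, ∀ j < h, PairCondition X H cH y i j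

noncomputable def acceptNum (h : ℕ) (y : ℕ → ℕ × ℕ) : ℕ :=
  ∏ i ∈ Finset.range h, h * weight X y i (y i).1

noncomputable def acceptDen (h M : ℕ) (y : ℕ → ℕ × ℕ) : ℕ :=
  M * ∏ i ∈ Finset.range h, X.degreeAnswer (y i).2

open Classical in
/-- One trial. -/
noncomputable def trial (M : ℕ) : PMF Bool :=
  (sampleSeq (drawPair X H) h 0 fun _ => (0, 0)).bind fun q =>
    (randBelow (acceptDen X h M q.2)).map fun z =>
      decide (ValidSample X H cH q.2 ∧ z < acceptNum X h q.2)

variable {X H cH}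

theorem adjCode_coe (i j : Fin h) [Decidable (H.Adj i j)] :
    adjCode H i j = if H.Adj i j then 1 else 0 := by
  rw [adjCode, dif_pos ⟨i.2, j.2⟩]
  congr

theorem adjCode_eq_one {i j : ℕ} : adjCode H i j = 1 ↔
    ∃ (hi : i < h) (hj : j < h), H.Adj ⟨i, hi⟩ ⟨j, hj⟩ := by
  classical
  rw [adjCode]
  split
  · rename_i hij
    simp [hij.1, hij.2]
  · rename_i hij
    simp only [zero_ne_one, false_iff]
    rintro ⟨h1, h2, -⟩
    exact hij ⟨h1, h2⟩

theorem adjCode_le_one (i j : ℕ) : adjCode H i j ≤ 1 := by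
  classical
  rw [adjCode]
  split_ifs <;> simp

theorem adjCode_ne_zero {i j : ℕ} : adjCode H i j ≠ 0 ↔ adjCode H i j = 1 := by
  have := adjCode_le_one (H := H) i j
  omega

theorem colCode_coe {i j : Fin h} (hij : H.Adj i j) : colCode H cH i j = cH s(i, j) := by
  classical
  rw [colCode, dif_pos ⟨i.2, j.2⟩, if_pos hij]

theorem drawPair_apply (h0 : 0 < h) (i : ℕ) (y : ℕ → ℕ × ℕ) {c a : ℕ} (hc : c < h) :
    drawPair X H i y (c, a) = (h : ℝ≥0∞)⁻¹ * drawVertex X H i c y a := by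
  classical
  rw [drawPair, PMF.bind_apply, tsum_eq_single c]
  · rw [randBelow_apply h0, if_pos hc, map_apply_eq_mean, mean]
    congr 1
    rw [tsum_eq_single a]
    · simp
    · intro b hb; simp [hb]
  · intro j hj
    rw [map_apply_eq_mean]
    simp [hj, mean]

/-- Sample weights as a function of an embedding. -/
noncomputable def embWeight (X : InputGraph n) (f : Fin h → Fin n) (i j : Fin h) : ℕ :=
  if i < j then 2 * X.numEdges else X.degreeAnswer (f i) * X.degreeAnswer (f j)

/-- As indices are below `h`, the key `weight * h + index` compares first by weight and then by
index. The tie-break matters: without it an embedding could have several codes and would be counted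
more than once. -/
theorem exists_bestNeighbor (X : InputGraph n) (hH : ∀ a, ∃ b, H.Adj a b) (f : Fin h → Fin n)
    (i : Fin h) : ∃ c, H.Adj i c ∧ ∀ j, H.Adj i j →
      embWeight X f i c * h + c ≤ embWeight X f i j * h + j := by
  classical
  obtain ⟨b, hb⟩ := hH i
  obtain ⟨c, hc, hmin⟩ := Finset.exists_min_image (Finset.univ.filter (H.Adj i))
    (fun j => embWeight X f i j * h + (j : ℕ)) ⟨b, by simpa using hb⟩
  simp only [Finset.mem_filter, Finset.mem_univ, true_and] at hc hmin
  exact ⟨c, hc, hmin⟩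

variable (X) in
/-- The neighbor along which a vertex has the highest sampling probability. -/
noncomputable def bestNeighbor (hH : ∀ a, ∃ b, H.Adj a b) (f : Fin h → Fin n) (i : Fin h) : Fin h :=
  (exists_bestNeighbor X hH f i).choose

theorem bestNeighbor_adj (hH : ∀ a, ∃ b, H.Adj a b) (f : Fin h → Fin n) (i : Fin h) :
    H.Adj i (bestNeighbor X hH f i) := (exists_bestNeighbor X hH f i).choose_spec.1

theorem bestNeighbor_le (hH : ∀ a, ∃ b, H.Adj a b) (f : Fin h → Fin n) (i j : Fin h)
    (hij : H.Adj i j) : embWeight X f i (bestNeighbor X hH f i) * h + bestNeighbor X hH f i ≤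
      embWeight X f i j * h + j := (exists_bestNeighbor X hH f i).choose_spec.2 j hij

theorem eq_of_key_eq {a b c d k : ℕ} (hc : c < k) (hd : d < k) (h : a * k + c = b * k + d) :
    a = b ∧ c = d := by
  have h1 : a = b := by
    have e1 : (a * k + c) / k = a := by
      rw [mul_comm, Nat.mul_add_div (by omega), Nat.div_eq_of_lt hc, add_zero]
    have e2 : (b * k + d) / k = b := by
      rw [mul_comm, Nat.mul_add_div (by omega), Nat.div_eq_of_lt hd, add_zero]
    rw [← e1, ← e2, h]
  subst h1
  exact ⟨rfl, by omega⟩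

variable (X) in
/-- The sample that encodes an embedding. -/
noncomputable def encodeEmbedding (hH : ∀ a, ∃ b, H.Adj a b) (f : Fin h → Fin n) (i : ℕ) : ℕ × ℕ :=
  if hi : i < h then ((bestNeighbor X hH f ⟨i, hi⟩ : ℕ), (f ⟨i, hi⟩ : ℕ)) else (0, 0)

theorem encodeEmbedding_coe (hH : ∀ a, ∃ b, H.Adj a b) (f : Fin h → Fin n) (i : Fin h) :
    encodeEmbedding X hH f i = ((bestNeighbor X hH f i : ℕ), (f i : ℕ)) := dif_pos i.2

theorem encodeEmbedding_injective (hH : ∀ a, ∃ b, H.Adj a b) :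
    Function.Injective (encodeEmbedding X hH) := by
  intro f f' he
  funext i
  have := congrFun he i
  rw [encodeEmbedding_coe, encodeEmbedding_coe, Prod.mk.injEq] at this
  exact Fin.ext this.2

theorem weight_encode (hH : ∀ a, ∃ b, H.Adj a b) (f : Fin h → Fin n) (i j : Fin h) :
    weight X (encodeEmbedding X hH f) i j = embWeight X f i j := by
  simp only [weight, embWeight, encodeEmbedding_coe]
  rfl

theorem validSample_encode (hH : ∀ a, ∃ b, H.Adj a b) {f : Fin h → Fin n}
    (hf : IsColorEmbedding X.graph X.color H cH f) :
    ValidSample X H cH (encodeEmbedding X hH f) := by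
  classical
  constructor
  · intro i hi
    lift i to Fin h using hi
    rw [encodeEmbedding_coe, adjCode_coe, if_pos (bestNeighbor_adj hH f i)]
  · intro i hi j hj
    lift i to Fin h using hi
    lift j to Fin h using hj
    rw [PairCondition, adjCode_coe]
    by_cases hij : H.Adj i j
    · rw [if_neg (by simp [hij])]
      simp only [encodeEmbedding_coe, weight_encode]
      rw [InputGraph.pairAnswer_of_lt, if_pos (hf.2 i j hij).1, colCode_coe hij]
      exact ⟨rfl, (hf.2 i j hij).2, bestNeighbor_le hH f i j hij⟩
    · rw [if_pos (by simp [hij])]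
      simp only [encodeEmbedding_coe]
      by_cases h1 : i = j
      · exact Or.inl (congrArg _ h1)
      · exact Or.inr fun h2 => h1 (hf.1 (Fin.ext h2))

/-- Together with `validSample_encode` this identifies valid samples with embeddings. The second
entries are the embedding, and the first entries are forced by the minimality of the key. -/
theorem exists_of_validSample (hH : ∀ a, ∃ b, H.Adj a b) {y : ℕ → ℕ × ℕ}
    (hy : ValidSample X H cH y) (h0 : ∀ i, h ≤ i → y i = (0, 0)) :
    ∃ f, IsColorEmbedding X.graph X.color H cH f ∧ encodeEmbedding X hH f = y := by
  classical
  have hadj : ∀ i j : Fin h, H.Adj i j → (X.pairAnswer (y i).2 (y j).2).1 = 1 ∧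
      (X.pairAnswer (y i).2 (y j).2).2 = colCode H cH i j ∧
      weight X y i (y i).1 * h + (y i).1 ≤ weight X y i j * h + j := by
    intro i j hij
    have := hy.2 i i.2 j j.2
    rwa [PairCondition, adjCode_coe, if_pos hij, if_neg one_ne_zero] at this
  have hlt : ∀ i : Fin h, (y i).2 < n := by
    intro i
    obtain ⟨j, hj⟩ := hH i
    obtain ⟨hu, -, -⟩ := X.pairAnswer_fst_eq_one.1 (hadj i j hj).1
    exact hu
  have hcl : ∀ i : Fin h, ∃ hc : (y i).1 < h, H.Adj i ⟨(y i).1, hc⟩ := by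
    intro i
    obtain ⟨_, hc, ha⟩ := adjCode_eq_one.1 (hy.1 i i.2)
    exact ⟨hc, ha⟩
  have hw : ∀ i j : Fin h, weight X y i j = embWeight X (fun i => ⟨(y i).2, hlt i⟩) i j :=
    fun i j => rfl
  refine ⟨fun i => ⟨(y i).2, hlt i⟩, ⟨fun i j he => ?_, fun i j hij => ?_⟩, ?_⟩
  · by_cases hij : H.Adj i j
    · obtain ⟨hu, hv, hadj⟩ := X.pairAnswer_fst_eq_one.1 (hadj i j hij).1
      exact absurd he hadj.ne
    · have := hy.2 i i.2 j j.2
      rw [PairCondition, adjCode_coe, if_neg hij, if_pos rfl] at this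
      simp only [Fin.mk.injEq] at he
      rcases this with h | h
      · exact Fin.ext h
      · exact absurd he h
  · obtain ⟨h1, h2, -⟩ := hadj i j hij
    obtain ⟨hu, hv, ha⟩ := X.pairAnswer_fst_eq_one.1 h1
    refine ⟨ha, ?_⟩
    rw [colCode_coe hij] at h2
    rw [← h2]
    have := X.pairAnswer_of_lt ⟨(y i).2, hlt i⟩ ⟨(y j).2, hlt j⟩
    rw [if_pos ha] at this
    exact (congrArg Prod.snd this).symm
  · funext i
    by_cases hi : i < h
    · lift i to Fin h using hi
      rw [encodeEmbedding_coe]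
      obtain ⟨hc, ha⟩ := hcl i
      refine Prod.ext ?_ rfl
      have h1 := bestNeighbor_le (X := X) hH (fun i => ⟨(y i).2, hlt i⟩) i _ ha
      have h2 := (hadj i _ (bestNeighbor_adj (X := X) hH (fun i => ⟨(y i).2, hlt i⟩) i)).2.2
      rw [hw] at h2
      have h3 : weight X y i (y i).1 = embWeight X (fun i => ⟨(y i).2, hlt i⟩) i ⟨(y i).1, hc⟩ := rfl
      rw [h3] at h2
      -- Both neighbors minimize the key, and the key determines the index.
      exact (eq_of_key_eq (Fin.is_lt _) hc (le_antisymm h1 h2)).2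
    · rw [h0 i (by omega), encodeEmbedding, dif_neg hi]

variable (hX : X.graph.edgeSet.Nonempty)
include hX

/-- The draw probability is `d_i / 2m` along an edge to a later vertex and `1 / d_c` along an edge
to an earlier one. `embWeight` is the integer that turns both into the degree `d_i`, which no longer
depends on the edge. -/
theorem drawVertex_encode (hH : ∀ a, ∃ b, H.Adj a b) {f : Fin h → Fin n}
    (hf : IsColorEmbedding X.graph X.color H cH f) (i c : Fin h) (hc : H.Adj i c)
    {y : ℕ → ℕ × ℕ} (hy : ∀ l < (i : ℕ), y l = encodeEmbedding X hH f l) :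
    drawVertex X H i c y (f i) * embWeight X f i c = X.degreeAnswer (f i) := by
  classical
  have hm := X.numEdges_pos hX
  rw [drawVertex, adjCode_coe, if_pos hc, if_neg one_ne_zero, embWeight]
  by_cases hic : (i : ℕ) < c
  · rw [if_pos hic, if_pos (show i < c from hic), X.sampleEndpoint_apply hX]
    refine ENNReal.div_mul_cancel ?_ (ENNReal.natCast_ne_top _)
    simp; omega
  · have hne : (c : ℕ) ≠ i := fun h => hc.ne (Fin.ext h.symm)
    rw [if_neg hic, if_neg (show ¬ i < c from hic), hy c (by omega), encodeEmbedding_coe,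
      X.sampleNeighbor_apply (hf.2 i c hc).1.symm]
    have hd := X.degreeAnswer_pos (hf.2 i c hc).1.symm
    rw [Nat.cast_mul, mul_comm _ ((X.degreeAnswer (f c) : ℕ) : ℝ≥0∞), ← mul_assoc,
      ENNReal.inv_mul_cancel (by simpa using hd.ne') (ENNReal.natCast_ne_top _), one_mul]

/-- This makes the rejection step legitimate: the acceptance probability is at most 1. The ratio `r
i j` of weight and degree is the inverse draw probability along `ij`. Its values in the two
directions multiply to `2m`, the best choice `t i` is below all `r i j`, and the dart cover bounds
`∏ t i`. The factor `h ^ h` in `M` pays for the random partners. -/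
theorem acceptNum_le (h0 : 0 < h) (hH : ∀ a, ∃ b, H.Adj a b) {f : Fin h → Fin n}
    (hf : IsColorEmbedding X.graph X.color H cH f) {s M : ℕ} (hs : 2 * X.numEdges ≤ s * s)
    (hM : M = h ^ h * s ^ labelWeight H) :
    acceptNum X h (encodeEmbedding X hH f) ≤ acceptDen X h M (encodeEmbedding X hH f) := by
  have hm := X.numEdges_pos hX
  obtain ⟨y, hy, hrow, hcol, hsum⟩ := exists_dart_cover H hH
    (fun f hf => labeling_le_labelWeight h0 hH hf)
  have hdpos : ∀ i, 0 < X.degreeAnswer (f i) := fun i => by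
    obtain ⟨j, hj⟩ := hH i
    exact X.degreeAnswer_pos (hf.2 i j hj).1
  let r : Fin h → Fin h → ℝ := fun i j => (embWeight X f i j : ℝ) / X.degreeAnswer (f i)
  have hr : ∀ i j, H.Adj i j → r i j * r j i = (2 * X.numEdges : ℕ) := by
    have key : ∀ i j, i < j → r i j * r j i = (2 * X.numEdges : ℕ) := by
      intro i j hij
      have h1 : (X.degreeAnswer (f i) : ℝ) ≠ 0 := by have := hdpos i; positivity
      have h2 : (X.degreeAnswer (f j) : ℝ) ≠ 0 := by have := hdpos j; positivity
      simp only [r, embWeight, if_pos hij, if_neg hij.asymm]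
      push_cast
      field_simp
    intro i j hij
    rcases lt_or_gt_of_ne hij.ne with h1 | h1
    · exact key i j h1
    · rw [mul_comm]; exact key j i h1
  have hr1 : ∀ i j, H.Adj i j → 1 ≤ r i j := by
    intro i j hij
    rw [le_div_iff₀ (by exact_mod_cast hdpos i), one_mul, embWeight]
    split_ifs
    · exact_mod_cast X.degreeAnswer_le_numEdges _
    · have := hdpos j
      exact_mod_cast Nat.le_mul_of_pos_right _ this
  let t : Fin h → ℝ := fun i => r i (bestNeighbor X hH f i)
  have htr : ∀ i j, H.Adj i j → t i ≤ r i j := by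
    intro i j hij
    have h1 := bestNeighbor_le (X := X) hH f i j hij
    -- One unit of weight outweighs any difference of indices, so a minimal key has minimal weight.
    have h2 : embWeight X f i (bestNeighbor X hH f i) ≤ embWeight X f i j := by
      by_contra hlt
      push Not at hlt
      have h3 : (embWeight X f i j + 1) * h ≤ embWeight X f i (bestNeighbor X hH f i) * h :=
        Nat.mul_le_mul_right _ hlt
      have := j.2
      rw [Nat.succ_mul] at h3
      omega
    exact div_le_div_of_nonneg_right (by exact_mod_cast h2) (Nat.cast_nonneg _)
  have hprod := prod_sq_le_of_dart_cover H hy hrow hcol hsum (q := ((2 * X.numEdges : ℕ) : ℝ))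
    (by exact_mod_cast (by omega : 1 ≤ 2 * X.numEdges)) (t := t)
    (fun i => hr1 _ _ (bestNeighbor_adj hH f i)) htr hr
  have hle : ∏ i, t i ≤ (s : ℝ) ^ labelWeight H := by
    -- Comparing squares avoids a root of `2m`, whose place is taken by the integer `s` with `2m ≤ s
    -- * s`.
    refine le_of_pow_le_pow_left₀ two_ne_zero (by positivity) (hprod.trans ?_)
    rw [pow_right_comm]
    refine pow_le_pow_left₀ (Nat.cast_nonneg _) ?_ _
    rw [sq]
    exact_mod_cast hs
  have hcast : (∏ i, (embWeight X f i (bestNeighbor X hH f i) : ℝ)) ≤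
      (s : ℝ) ^ labelWeight H * ∏ i, (X.degreeAnswer (f i) : ℝ) := by
    rw [← div_le_iff₀ (Finset.prod_pos fun i _ => by exact_mod_cast hdpos i),
      ← Finset.prod_div_distrib]
    exact hle
  have hnat : (∏ i, embWeight X f i (bestNeighbor X hH f i)) ≤
      s ^ labelWeight H * ∏ i, X.degreeAnswer (f i) := by exact_mod_cast hcast
  rw [acceptNum, acceptDen, Finset.prod_range, Finset.prod_range]
  simp only [encodeEmbedding_coe, weight_encode, Finset.prod_mul_distrib, Finset.prod_const,
    Finset.card_univ, Fintype.card_fin]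
  rw [hM, mul_assoc]
  exact Nat.mul_le_mul_left _ hnat

/-- Every embedding contributes exactly `1 / M`: the draw probabilities times the numerator of the
acceptance probability give the product of the degrees of the images, which cancels with the
denominator. A sample that encodes no embedding is invalid or is never drawn. -/
theorem trial_apply_true (h0 : 0 < h) (hH : ∀ a, ∃ b, H.Adj a b) {s M : ℕ}
    (hs : 2 * X.numEdges ≤ s * s) (hM : M = h ^ h * s ^ labelWeight H) :
    trial X H cH M true =
      ((colorEmbeddings X.graph X.color H cH).card : ℝ≥0∞) / (M : ℝ≥0∞) := by
  classical
  have hm := X.numEdges_pos hX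
  have hs0 : 0 < s := Nat.pos_of_ne_zero fun h => by subst h; omega
  have hMpos : 0 < M := by rw [hM]; positivity
  rw [trial, PMF.bind_apply,
    tsum_eq_sum (s := (colorEmbeddings X.graph X.color H cH).image
      fun f => (0 + h, encodeEmbedding X hH f))]
  · rw [Finset.sum_image (fun f _ f' _ he => encodeEmbedding_injective hH (Prod.mk.inj he).2),
      Finset.sum_congr rfl (g := fun _ => (M : ℝ≥0∞)⁻¹)]
    · rw [Finset.sum_const, nsmul_eq_mul, ENNReal.div_eq_inv_mul, mul_comm]
    intro f hf
    simp only [colorEmbeddings, Finset.mem_filter, Finset.mem_univ, true_and] at hf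
    have hdpos : ∀ i, 0 < X.degreeAnswer (f i) := fun i => by
      obtain ⟨j, hj⟩ := hH i
      exact X.degreeAnswer_pos (hf.2 i j hj).1
    have hden : acceptDen X h M (encodeEmbedding X hH f) = M * ∏ i, X.degreeAnswer (f i) := by
      rw [acceptDen, Finset.prod_range]
      simp only [encodeEmbedding_coe]
    have hdenpos : 0 < acceptDen X h M (encodeEmbedding X hH f) := by
      rw [hden]
      exact Nat.mul_pos hMpos (Finset.prod_pos fun i _ => hdpos i)
    have hv := validSample_encode hH hf
    rw [randBelow_map_apply hdenpos, sampleSeq_apply]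
    · have hcount : ((Finset.range (acceptDen X h M (encodeEmbedding X hH f))).filter
          fun z => decide (ValidSample X H cH (encodeEmbedding X hH f) ∧
            z < acceptNum X h (encodeEmbedding X hH f)) = true).card =
          acceptNum X h (encodeEmbedding X hH f) := by
        have hle := acceptNum_le hX h0 hH hf hs hM
        rw [← Finset.card_range (acceptNum X h (encodeEmbedding X hH f))]
        congr 1
        ext z
        simp only [decide_eq_true_eq, Finset.mem_filter, Finset.mem_range, hv, true_and,
          Finset.card_range]
        omega
      rw [hcount, ← mul_div_assoc]
      have hprod : (∏ j ∈ Finset.range h, drawPair X H (0 + j)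
          (fun l => if l < 0 + j then encodeEmbedding X hH f l else (0, 0))
          (encodeEmbedding X hH f (0 + j))) * (acceptNum X h (encodeEmbedding X hH f) : ℝ≥0∞) =
          ((∏ i, X.degreeAnswer (f i) : ℕ) : ℝ≥0∞) := by
        rw [acceptNum, Nat.cast_prod, ← Finset.prod_mul_distrib, Finset.prod_range, Nat.cast_prod]
        refine Finset.prod_congr rfl fun i _ => ?_
        simp only [zero_add]
        rw [encodeEmbedding_coe, drawPair_apply h0 _ _ (Fin.is_lt _), weight_encode, Nat.cast_mul,
          mul_mul_mul_comm, ENNReal.inv_mul_cancel (by simpa using h0.ne')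
            (ENNReal.natCast_ne_top _), one_mul]
        exact drawVertex_encode hX hH hf i _ (bestNeighbor_adj hH f i)
          fun l hl => if_pos hl
      rw [hprod, hden, Nat.cast_mul, ENNReal.div_eq_inv_mul,
        ENNReal.mul_inv (Or.inr (ENNReal.natCast_ne_top _)) (Or.inl (ENNReal.natCast_ne_top _)),
        mul_assoc, ENNReal.inv_mul_cancel _ (ENNReal.natCast_ne_top _), mul_one]
      rw [Nat.cast_ne_zero]
      exact (Finset.prod_pos fun i _ => hdpos i).ne'
    · intro j hj
      rw [encodeEmbedding, dif_neg (by omega)]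
  · rintro ⟨i', y⟩ hy
    rw [mul_eq_zero]
    by_cases hq : (i', y) ∈ (sampleSeq (drawPair X H) h 0 fun _ => (0, 0)).support
    · right
      obtain ⟨h1, h2⟩ := mem_support_sampleSeq _ hq
      have hnv : ¬ ValidSample X H cH y := by
        intro hv
        obtain ⟨f, hf, rfl⟩ := exists_of_validSample hH hv fun i hi => h2 i (Or.inr (by simpa using hi))
        refine hy (Finset.mem_image.2 ⟨f, ?_, by rw [← h1]⟩)
        simpa [colorEmbeddings] using hf
      rw [map_apply_eq_mean]
      simp [hnv]
    · left
      exact (PMF.apply_eq_zero_iff _ _).2 hq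

end trial

end SubgraphCounting

namespace SubgraphCounting

open scoped ENNReal

/-! ## Concentration -/

section absLoop

variable {Y : Type*} {f : ℕ → Y → PMF Y} {halt : Y → Prop}

/-- Optional stopping with boundedly many steps: the mean of the potential does not increase while
the loop runs, and the potential is frozen when it stops. -/
theorem mean_absLoop_le {Φ : ℕ → Y → ℝ≥0∞} (hΦ : ∀ i y, ¬ halt y → mean (f i y) (Φ (i + 1)) ≤ Φ i y)
    (k i : ℕ) (y : Y) : (mean (absLoop f halt k i y) fun q => Φ q.1 q.2) ≤ Φ i y := by
  induction k generalizing i y with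
  | zero => simp [absLoop]
  | succ k ih =>
    rw [absLoop]
    split
    · simp
    · rename_i hs
      rw [mean_bind]
      exact (mean_mono fun y' _ => ih (i + 1) y').trans (hΦ i y hs)

theorem mem_support_absLoop {R : ℕ → Y → Prop}
    (hR : ∀ i y, ¬ halt y → R i y → ∀ y' ∈ (f i y).support, R (i + 1) y') {k i : ℕ} {y : Y}
    (hy : R i y) {q : ℕ × Y} (hq : q ∈ (absLoop f halt k i y).support) :
    R q.1 q.2 ∧ i ≤ q.1 ∧ q.1 ≤ i + k ∧ (q.1 = i + k ∨ halt q.2) := by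
  induction k generalizing i y with
  | zero =>
    rw [absLoop, PMF.support_pure, Set.mem_singleton_iff] at hq
    subst hq
    exact ⟨hy, le_rfl, le_rfl, Or.inl rfl⟩
  | succ k ih =>
    rw [absLoop] at hq
    split at hq
    · rw [PMF.support_pure, Set.mem_singleton_iff] at hq
      subst hq
      exact ⟨hy, le_rfl, by simp, Or.inr ‹_›⟩
    · rename_i hs
      rw [PMF.mem_support_bind_iff] at hq
      obtain ⟨y', h1, h2⟩ := hq
      obtain ⟨h3, h4, h5, h6⟩ := ih (hR i y hs hy y' h1) h2
      exact ⟨h3, by omega, by omega, h6.imp (fun h => by omega) id⟩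

end absLoop

/-! ### Bernoulli trials stopped at a fixed number of successes -/

section stopping

theorem mean_bool (μ : PMF Bool) (g : Bool → ℝ≥0∞) :
    mean μ g = μ false * g false + μ true * g true := by
  rw [mean, tsum_bool]

theorem bool_false_add_true (μ : PMF Bool) : μ false + μ true = 1 := by
  rw [← tsum_bool, μ.tsum_coe]

/-- Count successes until there are `τ`. -/
noncomputable def countSuccesses (μ : PMF Bool) (τ k i x : ℕ) : PMF (ℕ × ℕ) :=
  absLoop (fun _ x => μ.map fun b => x + b.toNat) (fun x => τ ≤ x) k i x

theorem mem_support_countSuccesses {μ : PMF Bool} {τ k i x : ℕ} (hx : x ≤ τ) {q : ℕ × ℕ}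
    (hq : q ∈ (countSuccesses μ τ k i x).support) :
    q.2 ≤ τ ∧ i ≤ q.1 ∧ q.1 ≤ i + k ∧ (q.1 = i + k ∨ τ ≤ q.2) := by
  refine mem_support_absLoop (R := fun _ x => x ≤ τ) (fun i y h1 h2 y' h' => ?_) hx hq
  rw [PMF.mem_support_map_iff] at h'
  obtain ⟨b, -, rfl⟩ := h'
  have := b.toNat_le
  omega

theorem eq_of_mem_support_countSuccesses {μ : PMF Bool} {τ k i x : ℕ} (hμ : μ true = 0) {q : ℕ × ℕ}
    (hq : q ∈ (countSuccesses μ τ k i x).support) : q.2 = x := by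
  refine (mem_support_absLoop (R := fun _ y => y = x) (fun i y h1 h2 y' h' => ?_) rfl hq).1
  rw [PMF.mem_support_map_iff] at h'
  obtain ⟨b, hb, rfl⟩ := h'
  cases b
  · simpa using h2
  · exact absurd hμ hb

/-- The exponential martingale for the number of successes. -/
noncomputable def expMartingale (p lam : ℝ) (x t : ℕ) : ℝ :=
  Real.exp (lam * x) / (1 + p * (Real.exp lam - 1)) ^ t

/-- A martingale that is large on atypical outcomes. -/
noncomputable def badness (p ε : ℝ) (τ x t : ℕ) : ℝ≥0∞ :=
  ENNReal.ofReal (Real.exp (-(τ * ε ^ 2 / 16)) *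
    (expMartingale p (ε / 4) x t + expMartingale p (-(ε / 4)) x t))

variable {p : ℝ} (hp0 : 0 ≤ p) (hp1 : p ≤ 1)
include hp0 hp1

theorem expMartingale_base_pos (lam : ℝ) : 0 < 1 + p * (Real.exp lam - 1) := by
  have := Real.exp_pos lam
  rcases hp1.lt_or_eq with h | h
  · nlinarith [mul_nonneg hp0 this.le]
  · subst h; linarith

theorem expMartingale_nonneg (lam : ℝ) (x t : ℕ) : 0 ≤ expMartingale p lam x t :=
  div_nonneg (Real.exp_pos _).le (pow_nonneg (expMartingale_base_pos hp0 hp1 lam).le _)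

/-- The base of the denominator in `expMartingale` is the moment generating function of a single
trial. -/
theorem expMartingale_step (lam : ℝ) (x t : ℕ) :
    (1 - p) * expMartingale p lam x (t + 1) + p * expMartingale p lam (x + 1) (t + 1) =
      expMartingale p lam x t := by
  have hb := expMartingale_base_pos hp0 hp1 lam
  simp only [expMartingale]
  rw [pow_succ, show lam * ((x + 1 : ℕ) : ℝ) = lam * x + lam by push_cast; ring, Real.exp_add]
  field_simp
  ring

/-- By `1 + u ≤ exp u` the denominator is at most `exp (p * t * (exp lam - 1))`, so that only
exponents have to be compared. -/
theorem expMartingale_lower {lam : ℝ} (x t : ℕ) {c : ℝ}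
    (hc : c ≤ lam * x - p * t * (Real.exp lam - 1)) : Real.exp c ≤ expMartingale p lam x t := by
  have hb := expMartingale_base_pos hp0 hp1 lam
  rw [expMartingale, le_div_iff₀ (pow_pos hb _)]
  calc Real.exp c * (1 + p * (Real.exp lam - 1)) ^ t
      ≤ Real.exp c * Real.exp (p * (Real.exp lam - 1)) ^ t := by
        gcongr
        have := Real.add_one_le_exp (p * (Real.exp lam - 1))
        linarith
    _ = Real.exp (c + t * (p * (Real.exp lam - 1))) := by
        rw [← Real.exp_nat_mul, ← Real.exp_add]
    _ ≤ Real.exp (lam * x) := Real.exp_le_exp.2 (by linarith)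

theorem badness_step {μ : PMF Bool} (hμ : μ true = ENNReal.ofReal p) (ε : ℝ) (τ x t : ℕ) :
    (mean (μ.map fun b => x + b.toNat) fun x => badness p ε τ x (t + 1)) = badness p ε τ x t := by
  have hf : μ false = ENNReal.ofReal (1 - p) := by
    have h := bool_false_add_true μ
    rw [hμ] at h
    rw [ENNReal.ofReal_sub _ hp0, ENNReal.ofReal_one, ← h, ENNReal.add_sub_cancel_right]
    exact ENNReal.ofReal_ne_top
  rw [mean_map, mean_bool, hμ, hf]
  simp only [badness, Bool.toNat_false, Bool.toNat_true, add_zero]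
  have n1 := expMartingale_nonneg hp0 hp1
  rw [← ENNReal.ofReal_mul (by linarith), ← ENNReal.ofReal_mul hp0, ← ENNReal.ofReal_add]
  · congr 1
    rw [← expMartingale_step hp0 hp1 (ε / 4) x t, ← expMartingale_step hp0 hp1 (-(ε / 4)) x t]
    ring
  · exact mul_nonneg (by linarith) (mul_nonneg (Real.exp_pos _).le (add_nonneg (n1 _ _ _) (n1 _ _ _)))
  · exact mul_nonneg hp0 (mul_nonneg (Real.exp_pos _).le (add_nonneg (n1 _ _ _) (n1 _ _ _)))

omit hp0 hp1 in
theorem badness_zero (ε : ℝ) (τ : ℕ) :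
    badness p ε τ 0 0 = ENNReal.ofReal (2 * Real.exp (-(τ * ε ^ 2 / 16))) := by
  rw [badness]
  congr 1
  simp [expMartingale]
  ring

/-- If the target is reached too early, the martingale with positive parameter is large; if there
are too many trials for at most `τ` successes, the one with negative parameter is. Either reaches
`exp (τ ε² / 16)`, the normalization in `badness`. Thus `badness` dominates the indicator of
atypical outcomes, and its mean bounds their probability. -/
theorem one_le_badness {ε : ℝ} (hε0 : 0 < ε) (hε1 : ε < 1) {τ x t : ℕ} (hx : x ≤ τ)
    (h : x = τ ∧ p * t < (1 - ε / 2) * τ ∨ (1 + ε) * τ < p * t) : 1 ≤ badness p ε τ x t := by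
  have key : Real.exp (τ * ε ^ 2 / 16) ≤
      expMartingale p (ε / 4) x t + expMartingale p (-(ε / 4)) x t := by
    have hτ : (0 : ℝ) ≤ τ := Nat.cast_nonneg _
    have hpt : 0 ≤ p * t := mul_nonneg hp0 (Nat.cast_nonneg _)
    rcases h with ⟨rfl, h⟩ | h
    · have he := Real.abs_exp_sub_one_sub_id_le (x := ε / 4) (by rw [abs_le]; constructor <;> linarith)
      have he2 := (abs_le.1 he).2
      have he3 := Real.add_one_le_exp (ε / 4)
      -- With `exp u ≤ 1 + u + u²` at `u = ε / 4` the exponent has a surplus of `x ε³ / 32`.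
      have := expMartingale_lower hp0 hp1 (lam := ε / 4) x t (c := x * ε ^ 2 / 16) (by
        have h1 : p * t * (Real.exp (ε / 4) - 1) ≤ ((1 - ε / 2) * x) * (ε / 4 + (ε / 4) ^ 2) :=
          mul_le_mul h.le (by linarith) (by linarith) (mul_nonneg (by linarith) hτ)
        have h2 : x * ε ^ 2 / 16 ≤ ε / 4 * x - ((1 - ε / 2) * x) * (ε / 4 + (ε / 4) ^ 2) := by
          have : ε / 4 * x - ((1 - ε / 2) * x) * (ε / 4 + (ε / 4) ^ 2) - x * ε ^ 2 / 16 =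
            x * ε ^ 3 / 32 := by ring
          have h3 : 0 ≤ x * ε ^ 3 / 32 := by positivity
          linarith
        linarith)
      linarith [expMartingale_nonneg hp0 hp1 (-(ε / 4)) x t]
    · have he := Real.abs_exp_sub_one_sub_id_le (x := -(ε / 4))
        (by rw [abs_le]; constructor <;> linarith)
      have he2 := (abs_le.1 he).2
      -- Here the surplus is `τ ε² (2 - ε) / 16`. As the parameter is negative, `x` may be replaced
      -- by its upper bound `τ`.
      have := expMartingale_lower hp0 hp1 (lam := -(ε / 4)) x t (c := τ * ε ^ 2 / 16) (by
        have h0 : (x : ℝ) ≤ τ := by exact_mod_cast hx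
        have h4 : 0 ≤ ε / 4 - (ε / 4) ^ 2 := by nlinarith
        have h1 : ((1 + ε) * τ) * (ε / 4 - (ε / 4) ^ 2) ≤ p * t * (1 - Real.exp (-(ε / 4))) :=
          mul_le_mul h.le (by nlinarith) h4 hpt
        have h2 : τ * ε ^ 2 / 16 ≤ -(ε / 4) * τ + ((1 + ε) * τ) * (ε / 4 - (ε / 4) ^ 2) := by
          have : -(ε / 4) * τ + ((1 + ε) * τ) * (ε / 4 - (ε / 4) ^ 2) - τ * ε ^ 2 / 16 =
            τ * ε ^ 2 * (2 - ε) / 16 := by ring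
          have h3 : 0 ≤ τ * ε ^ 2 * (2 - ε) / 16 :=
            div_nonneg (mul_nonneg (by positivity) (by linarith)) (by norm_num)
          linarith
        nlinarith [mul_le_mul_of_nonneg_left h0 hε0.le])
      linarith [expMartingale_nonneg hp0 hp1 (ε / 4) x t]
  rw [badness, ENNReal.one_le_ofReal, Real.exp_neg]
  rw [inv_mul_eq_div, one_le_div (Real.exp_pos _)]
  exact key

/-- The offset `t₀` counts the trials of an earlier phase, so that the bounds for the two phases can
be chained. -/
theorem mean_badness_le {μ : PMF Bool} (hμ : μ true = ENNReal.ofReal p) (ε : ℝ) (τ k i x t₀ : ℕ) :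
    (mean (countSuccesses μ τ k i x) fun q => badness p ε τ q.2 (t₀ + q.1)) ≤
      badness p ε τ x (t₀ + i) :=
  mean_absLoop_le (Φ := fun i x => badness p ε τ x (t₀ + i))
    (fun i y _ => (badness_step hp0 hp1 hμ ε τ y (t₀ + i)).le) k i x

end stopping

/-! ## Collecting all edges -/

namespace InputGraph

variable {n : ℕ} (X : InputGraph n)

/-- The ordered pairs of adjacent vertices. -/
noncomputable def darts : Finset (ℕ × ℕ) :=
  (Finset.range n ×ˢ Finset.range n).filter fun d => (X.pairAnswer d.1 d.2).1 = 1

theorem mem_darts {d : ℕ × ℕ} : d ∈ X.darts ↔ (X.pairAnswer d.1 d.2).1 = 1 := by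
  simp only [darts, Finset.mem_filter, Finset.mem_product, Finset.mem_range, and_iff_right_iff_imp]
  intro h
  obtain ⟨h1, h2, -⟩ := X.pairAnswer_fst_eq_one.1 h
  exact ⟨h1, h2⟩

/-- Add the two darts of an edge. -/
def record (S : Finset (ℕ × ℕ)) (r : ℕ × ℕ × ℕ) : Finset (ℕ × ℕ) :=
  insert (r.2.1, r.1) (insert (r.1, r.2.1) S)

/-- The set of darts of `k` random edges. -/
noncomputable def collect (k i : ℕ) (S : Finset (ℕ × ℕ)) : PMF (ℕ × Finset (ℕ × ℕ)) :=
  absLoop (fun _ S => X.edgeSample.map (record S)) (fun _ => False) k i S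

open Classical in
/-- The edges not yet seen. -/
noncomputable def missing (S : Finset (ℕ × ℕ)) : Finset (Sym2 (Fin n)) :=
  X.graph.edgeFinset.filter fun e => ((e.inf : ℕ), (e.sup : ℕ)) ∉ S

variable (hX : X.graph.edgeSet.Nonempty)
include hX

open Classical in
theorem mem_support_edgeSample {r : ℕ × ℕ × ℕ} (hr : r ∈ X.edgeSample.support) :
    ∃ e ∈ X.graph.edgeFinset, r = ((e.inf : ℕ), (e.sup : ℕ), X.color e) := by
  have h : X.graph.edgeFinset.Nonempty := by simpa using hX
  rw [edgeSample, dif_pos (by convert h), PMF.mem_support_map_iff] at hr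
  obtain ⟨e, he, rfl⟩ := hr
  rw [PMF.mem_support_uniformOfFinset_iff] at he
  exact ⟨e, by convert he, rfl⟩

theorem edgeSample_adj {r : ℕ × ℕ × ℕ} (hr : r ∈ X.edgeSample.support) :
    X.pairAnswer r.1 r.2.1 = (1, r.2.2) ∧ X.pairAnswer r.2.1 r.1 = (1, r.2.2) := by
  classical
  obtain ⟨e, he, rfl⟩ := X.mem_support_edgeSample hX hr
  have hadj : X.graph.Adj e.inf e.sup ∧ s(e.inf, e.sup) = e := by
    rw [SimpleGraph.mem_edgeFinset] at he
    induction e with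
    | _ x y =>
      have hxy : X.graph.Adj x y := he
      simp only [Sym2.inf_mk, Sym2.sup_mk]
      rcases le_total x y with h | h
      · simp [h, hxy]
      · simp [h, hxy.symm, Sym2.eq_swap]
  refine ⟨?_, ?_⟩
  · rw [pairAnswer_of_lt, if_pos hadj.1, hadj.2]
  · rw [pairAnswer_of_lt, if_pos hadj.1.symm, Sym2.eq_swap, hadj.2]

theorem mem_support_collect {k i : ℕ} {S : Finset (ℕ × ℕ)}
    (hS : S ⊆ X.darts ∧ ∀ d ∈ S, (d.2, d.1) ∈ S) {q : ℕ × Finset (ℕ × ℕ)}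
    (hq : q ∈ (X.collect k i S).support) :
    q.2 ⊆ X.darts ∧ ∀ d ∈ q.2, (d.2, d.1) ∈ q.2 := by
  refine (mem_support_absLoop (R := fun _ S => S ⊆ X.darts ∧ ∀ d ∈ S, (d.2, d.1) ∈ S)
    (fun i S _ hS S' h' => ?_) hS hq).1
  rw [PMF.mem_support_map_iff] at h'
  obtain ⟨r, hr, rfl⟩ := h'
  obtain ⟨h1, h2⟩ := X.edgeSample_adj hX hr
  constructor
  · refine Finset.insert_subset ?_ (Finset.insert_subset ?_ hS.1)
    · rw [mem_darts, h2]
    · rw [mem_darts, h1]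
  · intro d hd
    simp only [record, Finset.mem_insert] at hd ⊢
    rcases hd with rfl | rfl | hd
    · simp
    · simp
    · exact Or.inr (Or.inr (hS.2 d hd))

-- `missing` looks for each edge in one orientation only; closure under reversal supplies the other
-- one.
omit hX in
theorem eq_darts_of_missing {S : Finset (ℕ × ℕ)} (hS : S ⊆ X.darts ∧ ∀ d ∈ S, (d.2, d.1) ∈ S)
    (h : X.missing S = ∅) : S = X.darts := by
  classical
  refine Finset.Subset.antisymm hS.1 ?_
  rintro ⟨u, v⟩ hd
  rw [mem_darts] at hd
  obtain ⟨hu, hv, ha⟩ := X.pairAnswer_fst_eq_one.1 hd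
  have : s(⟨u, hu⟩, ⟨v, hv⟩) ∉ X.missing S := by simp [h]
  simp only [missing, Finset.mem_filter, not_and, not_not, Sym2.inf_mk, Sym2.sup_mk] at this
  have h1 := this (by simpa using ha)
  rcases le_total u v with hle | hle
  · have hle' : (⟨u, hu⟩ : Fin n) ≤ ⟨v, hv⟩ := hle
    rwa [inf_eq_left.2 hle', sup_eq_right.2 hle'] at h1
  · have hle' : (⟨v, hv⟩ : Fin n) ≤ ⟨u, hu⟩ := hle
    rw [inf_eq_right.2 hle', sup_eq_left.2 hle'] at h1
    exact hS.2 _ h1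

/-- The next sample equals a given missing edge with probability `1 / m`, so the expected number of
missing edges shrinks by the factor `1 - 1 / m`. -/
theorem mean_missing_le (S : Finset (ℕ × ℕ)) :
    (mean (X.edgeSample.map (record S)) fun S' => ((X.missing S').card : ℝ≥0∞)) ≤
      (X.missing S).card * (1 - (X.numEdges : ℝ≥0∞)⁻¹) := by
  classical
  have hm := X.numEdges_pos hX
  rw [mean_map, mean_edgeSample X hX]
  have hsum : (∑ e ∈ X.graph.edgeFinset,
      (X.missing (record S ((e.inf : ℕ), (e.sup : ℕ), X.color e))).card) + (X.missing S).card ≤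
      X.numEdges * (X.missing S).card := by
    have h1 : (X.missing S).card = ∑ e ∈ X.graph.edgeFinset, if e ∈ X.missing S then 1 else 0 := by
      rw [← Finset.card_filter]
      congr 1
      ext e
      simp only [missing, Finset.mem_filter]
      tauto
    conv_lhs => rw [h1]
    rw [← Finset.sum_add_distrib, numEdges_eq, ← smul_eq_mul, ← Finset.sum_const]
    refine Finset.sum_le_sum fun e he => ?_
    have hsub : X.missing (record S ((e.inf : ℕ), (e.sup : ℕ), X.color e)) ⊆
        (X.missing S).erase e := by
      intro e' he'
      simp only [missing, record, Finset.mem_filter, Finset.mem_insert, not_or,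
        Finset.mem_erase] at he' ⊢
      refine ⟨?_, he'.1, he'.2.2.2⟩
      rintro rfl
      exact he'.2.2.1 rfl
    have h2 := Finset.card_le_card hsub
    split_ifs with hmem
    · rw [Finset.card_erase_of_mem hmem] at h2
      have := Finset.card_pos.2 ⟨e, hmem⟩
      omega
    · rw [Finset.erase_eq_of_notMem hmem] at h2
      simpa using h2
  rw [ENNReal.mul_sub (fun _ _ => ENNReal.natCast_ne_top _), mul_one]
  refine ENNReal.le_sub_of_add_le_right ?_ ?_
  · exact ENNReal.mul_ne_top (ENNReal.natCast_ne_top _) (by simpa using hm.ne')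
  · rw [← ENNReal.div_eq_inv_mul.trans (mul_comm _ _), ← ENNReal.add_div]
    rw [ENNReal.div_le_iff (by simpa using hm.ne') (ENNReal.natCast_ne_top _), mul_comm]
    exact_mod_cast hsum

theorem mean_missing_collect_le (k i : ℕ) (S : Finset (ℕ × ℕ)) :
    (mean (X.collect k i S) fun q => ((X.missing q.2).card : ℝ≥0∞)) ≤
      (X.missing S).card * (1 - (X.numEdges : ℝ≥0∞)⁻¹) ^ k := by
  induction k generalizing i S with
  | zero => simp [collect, absLoop]
  | succ k ih =>
    rw [collect, absLoop, if_neg (by simp), mean_bind]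
    refine (mean_mono fun S' _ => ih (i + 1) S').trans ?_
    rw [mean_mul_right, pow_succ, mul_comm _ (1 - _), ← mul_assoc]
    gcongr
    exact X.mean_missing_le hX S

-- The number of missing edges dominates the indicator of failure, and its mean is at most `m (1 - 1
-- / m) ^ k ≤ m exp (-k / m)`.
open Classical in
theorem one_le_collect (k : ℕ) :
    1 ≤ (mean (X.collect k 0 ∅) fun q => if q.2 = X.darts then 1 else 0) +
      ENNReal.ofReal (X.numEdges * Real.exp (-(k / X.numEdges))) := by
  have hm := X.numEdges_pos hX
  have h1 : (1 : ℝ≥0∞) ≤ mean (X.collect k 0 ∅) fun q =>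
      (if q.2 = X.darts then 1 else 0) + ((X.missing q.2).card : ℝ≥0∞) := by
    refine (mean_const (X.collect k 0 ∅) 1).ge.trans (mean_mono fun q hq => ?_)
    have hS := X.mem_support_collect hX (S := ∅) (by simp) hq
    by_cases h0 : X.missing q.2 = ∅
    · rw [if_pos (X.eq_darts_of_missing hS h0)]
      exact (le_self_add : (1 : ℝ≥0∞) ≤ 1 + ((X.missing q.2).card : ℝ≥0∞))
    · have h2 : 1 ≤ (X.missing q.2).card := Finset.card_pos.2 (Finset.nonempty_iff_ne_empty.2 h0)
      have h3 : (1 : ℝ≥0∞) ≤ ((X.missing q.2).card : ℝ≥0∞) := by exact_mod_cast h2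
      exact h3.trans (le_add_self : ((X.missing q.2).card : ℝ≥0∞) ≤ _ + _)
  rw [mean_add] at h1
  refine h1.trans (add_le_add le_rfl ((X.mean_missing_collect_le hX k 0 ∅).trans ?_))
  have hcard : (X.missing ∅).card = X.numEdges := by
    rw [numEdges_eq, missing]; simp
  have hreal : (1 - (X.numEdges : ℝ≥0∞)⁻¹) = ENNReal.ofReal (1 - (X.numEdges : ℝ)⁻¹) := by
    rw [ENNReal.ofReal_sub _ (by positivity), ENNReal.ofReal_one,
      ENNReal.ofReal_inv_of_pos (by exact_mod_cast hm), ENNReal.ofReal_natCast]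
  have hm1 : (X.numEdges : ℝ)⁻¹ ≤ 1 := inv_le_one_of_one_le₀ (by exact_mod_cast hm)
  rw [hcard, hreal, ← ENNReal.ofReal_pow (by linarith), ← ENNReal.ofReal_natCast,
    ← ENNReal.ofReal_mul (by positivity)]
  refine ENNReal.ofReal_le_ofReal ?_
  gcongr
  calc (1 - (X.numEdges : ℝ)⁻¹) ^ k ≤ Real.exp (-(X.numEdges : ℝ)⁻¹) ^ k := by
        refine pow_le_pow_left₀ (by linarith) ?_ _
        have := Real.add_one_le_exp (-(X.numEdges : ℝ)⁻¹)
        linarith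
    _ = Real.exp (-(k / X.numEdges)) := by
        rw [← Real.exp_nat_mul]
        congr 1
        field_simp

end InputGraph

end SubgraphCounting

namespace SubgraphCounting

open scoped ENNReal

/-! ## Evaluation without overflow -/

namespace Term

instance : Add Term := ⟨.add⟩
instance : Sub Term := ⟨.sub⟩
instance : Mul Term := ⟨.mul⟩
instance : Div Term := ⟨.div⟩

/-- The value of a term in the natural numbers. -/
def exact (s : Config) : Term → ℕ
  | lit k => k
  | reg i => s.reg i
  | add a b => a.exact s + b.exact s
  | sub a b => a.exact s - b.exact s
  | mul a b => a.exact s * b.exact s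
  | div a b => a.exact s / b.exact s
  | get a => s.mem (a.exact s)

/-- The evaluation of the term does not overflow. -/
def Fits (w : ℕ) (s : Config) : Term → Prop
  | lit k => k < 2 ^ w
  | reg _ => True
  | add a b => a.Fits w s ∧ b.Fits w s ∧ a.exact s + b.exact s < 2 ^ w
  | sub a b => a.Fits w s ∧ b.Fits w s
  | mul a b => a.Fits w s ∧ b.Fits w s ∧ a.exact s * b.exact s < 2 ^ w
  | div a b => a.Fits w s ∧ b.Fits w s
  | get a => a.Fits w s

variable {w : ℕ} {s : Config} {a b x : Term} {k : ℕ}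

/-- Separates arithmetic from overflow: values are computed in the natural numbers, and `Fits`
collects the bounds for all intermediate results. -/
theorem val_eq_exact (e : Term) (h : e.Fits w s) : e.val w s = e.exact s := by
  induction e <;> simp_all [val, exact, Fits, Nat.mod_eq_of_lt]

@[simp] theorem exact_lit : (lit k).exact s = k := rfl
@[simp] theorem exact_reg : (reg k).exact s = s.reg k := rfl
@[simp] theorem exact_get : (get a).exact s = s.mem (a.exact s) := rfl
@[simp] theorem exact_add : (a + b).exact s = a.exact s + b.exact s := rfl
@[simp] theorem exact_sub : (a - b).exact s = a.exact s - b.exact s := rfl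
@[simp] theorem exact_mul : (a * b).exact s = a.exact s * b.exact s := rfl
@[simp] theorem exact_div : (a / b).exact s = a.exact s / b.exact s := rfl
@[simp] theorem exact_le : (le a b).exact s = if a.exact s ≤ b.exact s then 1 else 0 := by
  simp only [le, exact]
  split <;> omega
@[simp] theorem exact_lt : (lt a b).exact s = if a.exact s < b.exact s then 1 else 0 := by
  simp only [lt, exact, exact_le]
  split_ifs <;> omega
@[simp] theorem exact_eq : (eq a b).exact s = if a.exact s = b.exact s then 1 else 0 := by
  simp only [eq, exact, exact_le]
  split_ifs <;> omega
@[simp] theorem exact_addr : (addr k x).exact s = s.reg 5 + (8 * x.exact s + k) := rfl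
@[simp] theorem exact_arr : (arr k x).exact s = s.mem (s.reg 5 + (8 * x.exact s + k)) := rfl

@[simp] theorem fits_lit : (lit k).Fits w s ↔ k < 2 ^ w := Iff.rfl
@[simp] theorem fits_reg : (reg k).Fits w s := trivial
@[simp] theorem fits_get : (get a).Fits w s ↔ a.Fits w s := Iff.rfl
@[simp] theorem fits_add : (a + b).Fits w s ↔
    a.Fits w s ∧ b.Fits w s ∧ a.exact s + b.exact s < 2 ^ w := Iff.rfl
@[simp] theorem fits_sub : (a - b).Fits w s ↔ a.Fits w s ∧ b.Fits w s := Iff.rfl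
@[simp] theorem fits_mul : (a * b).Fits w s ↔
    a.Fits w s ∧ b.Fits w s ∧ a.exact s * b.exact s < 2 ^ w := Iff.rfl
@[simp] theorem fits_div : (a / b).Fits w s ↔ a.Fits w s ∧ b.Fits w s := Iff.rfl
@[simp] theorem fits_le : (le a b).Fits w s ↔ 1 < 2 ^ w ∧ a.Fits w s ∧ b.Fits w s := Iff.rfl
@[simp] theorem fits_lt : (lt a b).Fits w s ↔ 1 < 2 ^ w ∧ a.Fits w s ∧ b.Fits w s := by
  simp only [lt, Fits, fits_le]; tauto
@[simp] theorem fits_eq : (eq a b).Fits w s ↔ 1 < 2 ^ w ∧ a.Fits w s ∧ b.Fits w s := by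
  simp only [eq, Fits, fits_le, exact_le]
  constructor
  · tauto
  · rintro ⟨h1, h2, h3⟩
    refine ⟨⟨h1, h2, h3⟩, ⟨h1, h3, h2⟩, ?_⟩
    split_ifs <;> omega
@[simp] theorem fits_addr : (addr k x).Fits w s ↔
    8 < 2 ^ w ∧ x.Fits w s ∧ s.reg 5 + (8 * x.exact s + k) < 2 ^ w := by
  simp only [addr, Fits, exact, true_and]
  constructor
  · tauto
  · rintro ⟨h1, h2, h3⟩
    exact ⟨⟨⟨h1, h2, by omega⟩, by omega, by omega⟩, by omega⟩
@[simp] theorem fits_arr : (arr k x).Fits w s ↔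
    8 < 2 ^ w ∧ x.Fits w s ∧ s.reg 5 + (8 * x.exact s + k) < 2 ^ w := fits_addr

end Term

/-- Write `v` into register `d`. -/
def Config.upd (s : Config) (d v : ℕ) : Config := { s with reg := Function.update s.reg d v }

namespace Config

variable {w : ℕ} {s : Config} {d v : ℕ}

@[simp] theorem reg_upd (i : ℕ) : (s.upd d v).reg i = if i = d then v else s.reg i := by
  simp [upd, Function.update_apply]
@[simp] theorem mem_upd : (s.upd d v).mem = s.mem := rfl
@[simp] theorem pc_upd : (s.upd d v).pc = s.pc := rfl
@[simp] theorem queries_upd : (s.upd d v).queries = s.queries := rfl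

theorem set_eq_upd (hv : v < 2 ^ w) : s.set w d v = s.upd d v := by
  rw [set, upd, Nat.mod_eq_of_lt hv]

theorem Bounded.upd (hs : s.Bounded w) (hv : v < 2 ^ w) : (s.upd d v).Bounded w := by
  rw [← set_eq_upd hv]; exact hs.set

end Config

namespace Stmt

/-- The statement does not write to the memory. -/
def noStore : Stmt → Bool
  | sto _ _ => false
  | seq c d => c.noStore && d.noStore
  | ite _ c d => c.noStore && d.noStore
  | loop _ _ _ c => c.noStore
  | _ => true

infixr:60 " ;; " => Stmt.seq

end Stmt

/-! ### Assignments without overflow, and what statements leave unchanged -/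

section frame

variable {n : ℕ} {X : InputGraph n} {w : ℕ}

theorem sem_mem (c : Stmt) (hc : c.noStore) (s : Config) :
    ∀ s' ∈ (sem X w c s).support, s'.mem = s.mem := by
  induction c generalizing s with
  | skip => simp [sem]
  | asg d e => simp [sem]
  | sto a e => simp [Stmt.noStore] at hc
  | rnd d e =>
    simp only [sem, PMF.mem_support_map_iff]; rintro _ ⟨k, -, rfl⟩; simp
  | dg d v => simp [sem]
  | nb d col v i => simp [sem]
  | pr d col v i => simp [sem]
  | edge a b c =>
    simp only [sem, PMF.mem_support_map_iff]; rintro _ ⟨k, -, rfl⟩; simp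
  | seq c d ihc ihd =>
    simp only [Stmt.noStore, Bool.and_eq_true] at hc
    simp only [sem, PMF.mem_support_bind_iff]
    rintro s' ⟨s₁, h₁, h₂⟩
    rw [ihd hc.2 _ _ h₂, ihc hc.1 _ _ h₁]
  | ite e c d ihc ihd =>
    simp only [Stmt.noStore, Bool.and_eq_true] at hc
    intro s' h
    simp only [sem] at h
    split at h
    · exact (ihd hc.2 _ _ h :)
    · rw [PMF.mem_support_map_iff] at h
      obtain ⟨s₁, h₁, rfl⟩ := h
      exact (ihc hc.1 _ _ h₁ :)
  | loop i b e c ih =>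
    simp only [Stmt.noStore] at hc
    exact loopSem_invariant (fun s' => s'.mem = s.mem)
      (fun s₁ k h => h) (fun s₁ h s' hs' => (ih hc _ _ hs').trans h) (fun s' v h => h) _ _ rfl

variable {c : Stmt} {s : Config} {Q : Config → Prop}

theorem always_asg_iff {a : ℕ} {e : Term} (hs : s.Bounded w) :
    Always X w (.asg a e) s Q ↔ Q ((s.upd a (e.val w s)).bump (e.size + 2)) := by
  rw [always_asg, Config.set_eq_upd (Term.val_lt hs e)]

/-- An assignment without overflow. -/
theorem always_asg_of {a : ℕ} {e : Term} (hs : s.Bounded w) (he : e.Fits w s)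
    (hQ : ∀ k, (s.upd a (e.exact s)).Bounded w → Q ((s.upd a (e.exact s)).bump k)) :
    Always X w (.asg a e) s Q := by
  rw [always_asg_iff hs, Term.val_eq_exact e he]
  exact hQ _ (by rw [← Term.val_eq_exact e he]; exact hs.upd (Term.val_lt hs e))

theorem always_sto_of {a e : Term} (hs : s.Bounded w) (ha : a.Fits w s) (he : e.Fits w s)
    (hQ : ∀ k, (s.put (a.exact s) (e.exact s)).Bounded w →
      Q ((s.put (a.exact s) (e.exact s)).bump k)) :
    Always X w (.sto a e) s Q := by
  rw [always_sto, Term.val_eq_exact e he, Term.val_eq_exact a ha]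
  exact hQ _ (by rw [← Term.val_eq_exact e he]; exact hs.put (Term.val_lt hs e))

/-- What a statement leaves unchanged. -/
def Stmt.Frame (w : ℕ) (c : Stmt) (s s' : Config) : Prop :=
  s'.Bounded w ∧ (∀ r ∉ c.writes, s'.reg r = s.reg r) ∧ (c.noStore → s'.mem = s.mem)

theorem sem_frame (hs : s.Bounded w) : ∀ s' ∈ (sem X w c s).support, c.Frame w s s' :=
  fun s' hs' => ⟨sem_bounded c s hs s' hs', fun r hr => sem_reg c s r hr s' hs',
    fun hc => sem_mem c hc s s' hs'⟩

theorem Always.frame (h : Always X w c s Q) (hs : s.Bounded w) :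
    Always X w c s fun s' => Q s' ∧ c.Frame w s s' := h.and (sem_frame hs)

theorem Refines.frame {Y : Type*} {μ : PMF Y} {Q : Y → Config → Prop}
    (h : Refines (sem X w c s) μ Q) (hs : s.Bounded w) :
    Refines (sem X w c s) μ fun y s' => Q y s' ∧ c.Frame w s s' := h.and_support (sem_frame hs)

end frame

end SubgraphCounting

namespace SubgraphCounting

open scoped ENNReal

/-! ## The program for one trial -/

/-- Programs for the basic operations on the input graph. -/
structure Access where
  /-- register 14 becomes a random endpoint of a random edge -/
  endpoint : Stmt
  /-- register 14 becomes a random neighbor of the vertex in register 15 -/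
  neighbor : Stmt
  /-- register 16 becomes the degree of the vertex in register 14 -/
  degree : Stmt
  /-- registers 16 and 17 become the answer to the pair query for registers 14 and 15 -/
  pair : Stmt

namespace Access

variable (A : Access)

/-- Choose the image of the vertex in register 33. -/
def drawStmt : Stmt :=
  .rnd 34 (.reg 3) ;;
  .ite (.get (.reg 33 * .reg 3 + .reg 34))
    (.ite (.lt (.reg 33) (.reg 34)) A.endpoint (.asg 15 (.arr 0 (.reg 34)) ;; A.neighbor))
    (.asg 14 (.lit 0)) ;;
  A.degree ;;
  .sto (.addr 0 (.reg 33)) (.reg 14) ;;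
  .sto (.addr 1 (.reg 33)) (.reg 34) ;;
  .sto (.addr 2 (.reg 33)) (.reg 16)

end Access

/-- The term for `weight`. -/
def weightTerm (i j : Term) : Term :=
  .lt i j * (.lit 2 * .reg 1) + .le j i * (.arr 2 i * .arr 2 j)

/-- Compute the acceptance probability. -/
def scoreStmt : Stmt :=
  .asg 34 (.arr 1 (.reg 33)) ;;
  .asg 37 (.reg 37 * .get (.reg 33 * .reg 3 + .reg 34)) ;;
  .asg 35 (.reg 35 * (.reg 3 * weightTerm (.reg 33) (.reg 34))) ;;
  .asg 36 (.reg 36 * .arr 2 (.reg 33))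

/-- The term for `PairCondition`. -/
def pairTerm : Term :=
  .eq (.get (.reg 40)) (.lit 0) * .le (.eq (.reg 14) (.reg 15)) (.eq (.reg 41) (.reg 42)) +
  .get (.reg 40) * (.reg 16 * (.eq (.reg 17) (.get (.reg 19 + .reg 40)) *
    .le (weightTerm (.reg 41) (.reg 34) * .reg 3 + .reg 34)
      (weightTerm (.reg 41) (.reg 42) * .reg 3 + .reg 42)))

namespace Access

variable (A : Access)

/-- Check one pair of vertices of `H`. -/
def checkStmt : Stmt :=
  .asg 41 (.reg 40 / .reg 3) ;;
  .asg 42 (.reg 40 - .reg 41 * .reg 3) ;;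
  .asg 14 (.arr 0 (.reg 41)) ;;
  .asg 15 (.arr 0 (.reg 42)) ;;
  .asg 34 (.arr 1 (.reg 41)) ;;
  A.pair ;;
  .asg 37 (.reg 37 * pairTerm)

/-- One trial, with the result in register 38. -/
def trialStmt : Stmt :=
  .loop 33 3 (.lit 1) A.drawStmt ;;
  (.asg 37 (.lit 1) ;; .asg 35 (.lit 1) ;; .asg 36 (.reg 9) ;; .loop 33 3 (.lit 1) scoreStmt) ;;
  .loop 40 19 (.lit 1) A.checkStmt ;;
  .rnd 39 (.reg 36) ;;
  .asg 38 (.reg 37 * .lt (.reg 39) (.reg 35))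

end Access

variable {n : ℕ} (X : InputGraph n) {h : ℕ} (H : SimpleGraph (Fin h)) (cH : Sym2 (Fin h) → ℕ)
  (w : ℕ)

/-- The registers and the memory that hold the input. -/
structure Env (s : Config) : Prop where
  bounded : s.Bounded w
  r0 : s.reg 0 = n
  r1 : s.reg 1 = X.numEdges
  r3 : s.reg 3 = h
  r5 : s.reg 5 = 2 * (h * h)
  r19 : s.reg 19 = h * h
  adj : ∀ i < h, ∀ j < h, s.mem (i * h + j) = adjCode H i j
  col : ∀ i < h, ∀ j < h, s.mem (h * h + (i * h + j)) = colCode H cH i j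

/-- The memory is the same, except possibly for the arrays `0`, `1` and `2`. -/
def SameTables (h : ℕ) (s s' : Config) : Prop :=
  ∀ a, (∀ x, ∀ k < 3, a ≠ 2 * (h * h) + (8 * x + k)) → s'.mem a = s.mem a

/-- The registers that access programs may use. -/
def accessRegs : List ℕ := [14, 16, 17, 18, 30, 31, 32]

/-- Correctness of access programs under the invariant `I`. -/
structure Access.Correct (A : Access) (I : Config → Prop) : Prop where
  endpoint : ∀ s, Env X H cH w s → I s →
    Refines (sem X w A.endpoint s) X.sampleEndpoint fun a s' => s'.reg 14 = a
  neighbor : ∀ s, Env X H cH w s → I s → s.reg 15 < n →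
    Refines (sem X w A.neighbor s) (X.sampleNeighbor (s.reg 15)) fun a s' => s'.reg 14 = a
  degree : ∀ s, Env X H cH w s → I s → s.reg 14 < n →
    Always X w A.degree s fun s' => s'.reg 16 = X.degreeAnswer (s.reg 14)
  pair : ∀ s, Env X H cH w s → I s → s.reg 14 < n → s.reg 15 < n →
    Always X w A.pair s fun s' => s'.reg 16 = (X.pairAnswer (s.reg 14) (s.reg 15)).1 ∧
      s'.reg 17 = (X.pairAnswer (s.reg 14) (s.reg 15)).2
  endpoint_writes : ∀ r ∈ A.endpoint.writes, r ∈ accessRegs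
  neighbor_writes : ∀ r ∈ A.neighbor.writes, r ∈ accessRegs
  degree_writes : ∀ r ∈ A.degree.writes, r ∈ accessRegs
  degree_target : 14 ∉ A.degree.writes
  pair_target : 14 ∉ A.pair.writes
  pair_writes : ∀ r ∈ A.pair.writes, r ∈ accessRegs
  endpoint_noStore : A.endpoint.noStore
  neighbor_noStore : A.neighbor.noStore
  degree_noStore : A.degree.noStore
  pair_noStore : A.pair.noStore
  invariant : ∀ s s', I s → s'.reg 0 = s.reg 0 → s'.reg 1 = s.reg 1 → s'.reg 5 = s.reg 5 →
    SameTables h s s' → I s'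

/-- Bounds that exclude overflow. -/
structure Room (n h M w : ℕ) : Prop where
  base : 2 * (h * h) + 8 * (n * n + n + h) + 16 + (n * n) * h + h < 2 ^ w
  num : (h * (n * n)) ^ h < 2 ^ w
  den : M * n ^ h < 2 ^ w

variable {X H cH w}

theorem mul_add_lt {i j a b : ℕ} (hi : i < a) (hj : j < b) : i * b + j < a * b := by
  have : (i + 1) * b ≤ a * b := Nat.mul_le_mul_right _ hi
  rw [Nat.succ_mul] at this
  omega

theorem SameTables.refl (s : Config) : SameTables h s s := fun _ _ => rfl

theorem SameTables.trans {s₁ s₂ s₃ : Config} (h₁ : SameTables h s₁ s₂) (h₂ : SameTables h s₂ s₃) :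
    SameTables h s₁ s₃ := fun a ha => (h₂ a ha).trans (h₁ a ha)

theorem SameTables.of_mem {s s' : Config} (hm : s'.mem = s.mem) : SameTables h s s' :=
  fun a _ => congrFun hm a

theorem SameTables.put {s : Config} {x k v : ℕ} (hk : k < 3) :
    SameTables h s (s.put (2 * (h * h) + (8 * x + k)) v) := by
  intro a ha
  rw [Config.mem_put, if_neg (ha x k hk)]

theorem SameTables.low {s s' : Config} (hm : SameTables h s s') {a : ℕ} (ha : a < 2 * (h * h)) :
    s'.mem a = s.mem a := hm a fun x k _ => by omega

theorem Env.congr {s s' : Config} (he : Env X H cH w s) (hb : s'.Bounded w)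
    (h0 : s'.reg 0 = s.reg 0) (h1 : s'.reg 1 = s.reg 1) (h3 : s'.reg 3 = s.reg 3)
    (h5 : s'.reg 5 = s.reg 5) (h19 : s'.reg 19 = s.reg 19) (hm : SameTables h s s') :
    Env X H cH w s' where
  bounded := hb
  r0 := h0.trans he.r0
  r1 := h1.trans he.r1
  r3 := h3.trans he.r3
  r5 := h5.trans he.r5
  r19 := h19.trans he.r19
  adj := fun i hi j hj => by
    have := mul_add_lt hi hj
    rw [hm.low (by omega), he.adj i hi j hj]
  col := fun i hi j hj => by
    have := mul_add_lt hi hj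
    rw [hm.low (by omega), he.col i hi j hj]

namespace Access.Correct

variable {A : Access} {I : Config → Prop} (hA : A.Correct X H cH w I)
include hA

theorem notMem_writes {r : ℕ} (hr : r ∉ accessRegs) : r ∉ A.endpoint.writes ∧
    r ∉ A.neighbor.writes ∧ r ∉ A.degree.writes ∧ r ∉ A.pair.writes :=
  ⟨fun h => hr (hA.endpoint_writes r h), fun h => hr (hA.neighbor_writes r h),
    fun h => hr (hA.degree_writes r h), fun h => hr (hA.pair_writes r h)⟩

theorem notMem_drawStmt {r : ℕ} (hr : r ∉ accessRegs) (h1 : r ≠ 15) (h2 : r ≠ 34) :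
    r ∉ A.drawStmt.writes := by
  obtain ⟨e1, e2, e3, e4⟩ := hA.notMem_writes hr
  simp only [accessRegs, List.mem_cons, not_or] at hr
  simp [drawStmt, Stmt.writes, e1, e2, e3, h1, h2, hr.1]

theorem notMem_checkStmt {r : ℕ} (hr : r ∉ accessRegs) (h1 : r ∉ [41, 42, 15, 34, 37]) :
    r ∉ A.checkStmt.writes := by
  obtain ⟨e1, e2, e3, e4⟩ := hA.notMem_writes hr
  simp only [accessRegs, List.mem_cons, not_or] at hr h1
  simp [checkStmt, Stmt.writes, e4, h1, hr.1]

theorem notMem_trialStmt {r : ℕ} (hr : r ∉ accessRegs)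
    (h1 : r ∉ [15, 33, 34, 35, 36, 37, 38, 39, 40, 41, 42]) : r ∉ A.trialStmt.writes := by
  have hr' := hr
  simp only [accessRegs, List.mem_cons, not_or] at hr h1
  have e1 := hA.notMem_drawStmt hr' (by tauto) (by tauto)
  have e2 := hA.notMem_checkStmt hr' (by simp; tauto)
  simp [trialStmt, scoreStmt, Stmt.writes, e1, e2, h1]

end Access.Correct

theorem refines_rnd {d k : ℕ} {e : Term} {s : Config} (hs : s.Bounded w) (he : e.val w s = k)
    (hk : 0 < k) : Refines (sem X w (.rnd d e) s) (randBelow k) fun j s' =>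
      j < k ∧ ∃ t, s' = (s.upd d j).bump t := by
  rw [sem, he]
  refine refines_map fun j hj => ?_
  rw [mem_support_randBelow hk] at hj
  have := Term.val_lt hs e
  exact ⟨hj, _, by rw [Config.set_eq_upd (by omega)]⟩

end SubgraphCounting

namespace SubgraphCounting

open scoped ENNReal

variable {n : ℕ} {X : InputGraph n} {h : ℕ} {H : SimpleGraph (Fin h)} {cH : Sym2 (Fin h) → ℕ}
  {w : ℕ}

theorem Room.facts {M : ℕ} (hR : Room n h M w) : 2 * (h * h) + 8 * h + 16 < 2 ^ w ∧ 16 < 2 ^ w ∧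
    w ≠ 0 := by
  have := hR.base
  refine ⟨by nlinarith [Nat.zero_le (n * n * h)], by nlinarith [Nat.zero_le (n * n * h)], ?_⟩
  rintro rfl
  omega

/-! ### Sampling -/

theorem InputGraph.lt_of_mem_support_sampleEndpoint (hX : X.graph.edgeSet.Nonempty) {a : ℕ}
    (ha : a ∈ X.sampleEndpoint.support) : a < n := by
  classical
  rw [sampleEndpoint, PMF.mem_support_bind_iff] at ha
  obtain ⟨r, hr, ha⟩ := ha
  rw [PMF.mem_support_map_iff] at ha
  obtain ⟨t, -, rfl⟩ := ha
  obtain ⟨e, -, rfl⟩ := X.mem_support_edgeSample hX hr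
  split_ifs
  · exact Fin.is_lt _
  · exact Fin.is_lt _

theorem InputGraph.neighborAnswer_lt (hn : 0 < n) (u k : ℕ) : (X.neighborAnswer u k).1 < n := by
  rw [neighborAnswer]
  split_ifs
  · exact Fin.is_lt _
  · exact hn
  · exact hn

theorem InputGraph.lt_of_mem_support_sampleNeighbor (hn : 0 < n) {u a : ℕ}
    (ha : a ∈ (X.sampleNeighbor u).support) : a < n := by
  rw [sampleNeighbor, PMF.mem_support_map_iff] at ha
  obtain ⟨t, -, rfl⟩ := ha
  exact neighborAnswer_lt hn _ _

theorem InputGraph.pos_of_edgeSet_nonempty (hX : X.graph.edgeSet.Nonempty) : 0 < n := by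
  obtain ⟨e, he⟩ := hX
  induction e with
  | _ x y => exact x.pos

variable (X h) in
/-- The arrays `0`, `1` and `2` hold the first `k` entries of the sample, and the degrees. -/
def Holds (y : ℕ → ℕ × ℕ) (k : ℕ) (s : Config) : Prop :=
  ∀ j < k, s.mem (2 * (h * h) + (8 * j + 0)) = (y j).2 ∧
    s.mem (2 * (h * h) + (8 * j + 1)) = (y j).1 ∧
    s.mem (2 * (h * h) + (8 * j + 2)) = X.degreeAnswer (y j).2 ∧ (y j).2 < n ∧ (y j).1 < h

variable {A : Access} {I : Config → Prop} (hA : A.Correct X H cH w I) {M : ℕ}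
  (hR : Room n h M w) (hX : X.graph.edgeSet.Nonempty)
include hA hR hX

/-- Besides the image and the chosen partner, the degree of the image is stored, so that all weights
can later be computed from memory. -/
theorem refines_drawStmt {s : Config} (he : Env X H cH w s) (hI : I s) {k : ℕ}
    (hk : s.reg 33 = k) (hkh : k < h) {y : ℕ → ℕ × ℕ} (hy : Holds X h y k s) :
    Refines (sem X w A.drawStmt s) (drawPair X H k y) fun z s' =>
      Holds X h (Function.update y k z) (k + 1) s' ∧ SameTables h s s' := by
  have hn := X.pos_of_edgeSet_nonempty hX
  obtain ⟨hw1, hw2, hw0⟩ := hR.facts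
  rw [Access.drawStmt, drawPair]
  refine refines_seq (refines_rnd he.bounded he.r3 (by omega)) ?_
  rintro j _ ⟨hj, t, rfl⟩
  have hjw : j < 2 ^ w := by nlinarith
  set s₁ := (s.upd 34 j).bump t with hs₁
  have he₁ : Env X H cH w s₁ := he.congr (he.bounded.upd hjw).bump (by simp [s₁]) (by simp [s₁])
    (by simp [s₁]) (by simp [s₁]) (by simp [s₁]) (SameTables.of_mem rfl)
  have hI₁ : I s₁ := hA.invariant s s₁ hI (by simp [s₁]) (by simp [s₁]) (by simp [s₁])
    (SameTables.of_mem rfl)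
  have h33 : s₁.reg 33 = k := by simp [s₁, hk]
  have h34 : s₁.reg 34 = j := by simp [s₁]
  have hkj := mul_add_lt hkh hj
  have hread : (Term.get (.reg 33 * .reg 3 + .reg 34)).val w s₁ = adjCode H k j := by
    rw [Term.val_eq_exact]
    · simp only [Term.exact_get, Term.exact_add, Term.exact_mul, Term.exact_reg, h33, h34, he₁.r3]
      exact he₁.adj k hkh j hj
    · simp only [Term.fits_get, Term.fits_add, Term.fits_mul, Term.fits_reg, Term.exact_mul,
        Term.exact_reg, h33, h34, he₁.r3, true_and]
      constructor <;> omega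
  have hmid : Refines (sem X w (.ite (.get (.reg 33 * .reg 3 + .reg 34))
      (.ite (.lt (.reg 33) (.reg 34)) A.endpoint (.asg 15 (.arr 0 (.reg 34)) ;; A.neighbor))
      (.asg 14 (.lit 0))) s₁) (drawVertex X H k j y) fun a s' => (s'.reg 14 = a ∧
        s'.Bounded w ∧ (∀ r ∉ 15 :: accessRegs, s'.reg r = s₁.reg r) ∧ s'.mem = s₁.mem) ∧ a < n := by
    refine Refines.and_abstract ?_ ?_
    · refine refines_ite ?_ ?_ ?_
      · intro h0
        rw [hread] at h0
        rw [drawVertex, if_pos h0]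
        refine refines_pure ?_
        refine always_asg_of (by exact he₁.bounded.bump) (by simp) ?_
        intro k' hb
        refine ⟨by simp, hb.bump, fun r hr => ?_, rfl⟩
        have : r ≠ 14 := by rintro rfl; simp [accessRegs] at hr
        simp [this]
      · intro h0
        rw [hread] at h0
        rw [drawVertex, if_neg h0]
        have hlt : ∀ t, (Term.lt (.reg 33) (.reg 34)).val w (s₁.bump t) = if k < j then 1 else 0 := by
          intro t
          rw [Term.val_eq_exact]
          · simp [h33, h34]
          · simp [hw0]
        refine refines_ite ?_ ?_ ?_
        · intro h1
          rw [hlt] at h1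
          have hkj' : ¬ k < j := fun hlt => by simp [hlt] at h1
          -- A vertex is not adjacent to itself, which excludes `j = k`. So the image of `j` has
          -- already been drawn and stored.
          have hjk : j < k := by
            rcases lt_trichotomy j k with h | h | h
            · exact h
            · subst h
              obtain ⟨_, _, ha⟩ := adjCode_eq_one.1 (adjCode_ne_zero.1 h0)
              exact absurd ha (H.loopless.irrefl _)
            · exact absurd h hkj'
          rw [if_neg hkj']
          obtain ⟨c0, -, -, c3, -⟩ := hy j hjk
          refine refines_always_seq (Q := fun s' => s'.reg 15 = (y j).2 ∧ s'.Bounded w ∧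
            (∀ r, r ≠ 15 → s'.reg r = s₁.reg r) ∧ s'.mem = s₁.mem) ?_ ?_
          · refine always_asg_of he₁.bounded.bump.bump ?_ ?_
            · simp [h34, he₁.r5]; omega
            · intro k' hb
              refine ⟨?_, hb.bump, fun r hr => by simp [hr], rfl⟩
              simpa [h34, he₁.r5, s₁] using c0
          · rintro s' ⟨h15, hb, hreg, hm⟩
            have he' : Env X H cH w s' := he₁.congr hb (hreg _ (by decide)) (hreg _ (by decide))
              (hreg _ (by decide)) (hreg _ (by decide)) (hreg _ (by decide)) (SameTables.of_mem hm)
            have hI' : I s' := hA.invariant s₁ s' hI₁ (hreg _ (by decide)) (hreg _ (by decide))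
              (hreg _ (by decide)) (SameTables.of_mem hm)
            have := (hA.neighbor s' he' hI' (by rw [h15]; exact c3)).frame hb
            rw [h15] at this
            refine this.mono fun a s₂ h2 => ⟨h2.1, h2.2.1, fun r hr => ?_, ?_⟩
            · rw [List.mem_cons, not_or] at hr
              rw [h2.2.2.1 r (hA.notMem_writes hr.2).2.1, hreg r hr.1]
            · rw [h2.2.2.2 hA.neighbor_noStore, hm]
        · intro h1
          rw [hlt] at h1
          have hkj' : k < j := by by_contra hlt; simp [hlt] at h1
          rw [if_pos hkj']
          have he' : ∀ t t', Env X H cH w ((s₁.bump t).bump t') := fun t t' =>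
            he₁.congr he₁.bounded.bump.bump rfl rfl rfl rfl rfl (SameTables.of_mem rfl)
          have hI' : ∀ t t', I ((s₁.bump t).bump t') := fun t t' =>
            hA.invariant s₁ _ hI₁ rfl rfl rfl (SameTables.of_mem rfl)
          refine ((hA.endpoint _ (he' _ _) (hI' _ _)).frame he₁.bounded.bump.bump).mono
            fun a s₂ h2 => ⟨h2.1, h2.2.1, fun r hr => ?_, ?_⟩
          · rw [List.mem_cons, not_or] at hr
            rw [h2.2.2.1 r (hA.notMem_writes hr.2).1]; rfl
          · rw [h2.2.2.2 hA.endpoint_noStore]; rfl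
        · exact fun a s' t h => h
      · exact fun a s' t h => h
    · intro a ha
      rw [drawVertex] at ha
      split_ifs at ha
      · simp only [PMF.support_pure, Set.mem_singleton_iff] at ha; omega
      · exact InputGraph.lt_of_mem_support_sampleEndpoint hX ha
      · exact InputGraph.lt_of_mem_support_sampleNeighbor hn ha
  refine (hmid.bind_always (R := fun a s' =>
    Holds X h (Function.update y k (j, a)) (k + 1) s' ∧ SameTables h s s') ?_).map
  rintro a s₂ ⟨⟨h14, hb, hreg, hm⟩, han⟩
  have he₂ : Env X H cH w s₂ := he₁.congr hb (hreg _ (by decide)) (hreg _ (by decide))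
    (hreg _ (by decide)) (hreg _ (by decide)) (hreg _ (by decide)) (SameTables.of_mem hm)
  have hI₂ : I s₂ := hA.invariant s₁ s₂ hI₁ (hreg _ (by decide)) (hreg _ (by decide))
    (hreg _ (by decide)) (SameTables.of_mem hm)
  refine always_seq.2 (((hA.degree s₂ he₂ hI₂ (by omega)).frame hb).mono ?_)
  rintro s₃ ⟨h16, hb₃, hreg₃, hm₃⟩
  replace hm₃ := hm₃ hA.degree_noStore
  have hreg₄ : ∀ r ∉ A.degree.writes, s₃.reg r = s₂.reg r := hreg₃
  replace hreg₃ : ∀ r ∉ 15 :: accessRegs, s₃.reg r = s₁.reg r := fun r hr => by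
    rw [hreg₃ r (hA.notMem_writes (fun h => hr (List.mem_cons_of_mem _ h))).2.2.1, hreg r hr]
  have f5 : s₃.reg 5 = 2 * (h * h) := (hreg₃ 5 (by decide)).trans he₁.r5
  have f33 : s₃.reg 33 = k := (hreg₃ 33 (by decide)).trans h33
  have f34 : s₃.reg 34 = j := (hreg₃ 34 (by decide)).trans h34
  have f14 : s₃.reg 14 = a := by
    rw [hreg₄ 14 hA.degree_target, h14]
  rw [h14] at h16
  have hm₀ : s₃.mem = s.mem := hm₃.trans hm
  clear hmid hread
  refine always_seq.2 (always_sto_of hb₃ (by simp [f5, f33]; omega) (by simp) fun t₁ hb₄ => ?_)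
  refine always_seq.2 (always_sto_of hb₄.bump (by simp [f5, f33]; omega) (by simp) fun t₂ hb₅ => ?_)
  refine always_sto_of hb₅.bump (by simp [f5, f33]; omega) (by simp) fun t₃ hb₆ => ?_
  simp only [Term.exact_addr, Term.exact_reg, Config.reg_bump, Config.reg_put, f5, f33, f34, f14,
    h16] at *
  constructor
  · intro l hl
    simp only [Config.mem_bump, Config.mem_put, hm₀]
    rcases (Nat.lt_succ_iff_lt_or_eq.1 hl) with hl | rfl
    · obtain ⟨c0, c1, c2, c3⟩ := hy l hl
      rw [Function.update_of_ne hl.ne]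
      rw [if_neg (by omega), if_neg (by omega), if_neg (by omega), if_neg (by omega),
        if_neg (by omega), if_neg (by omega), if_neg (by omega), if_neg (by omega),
        if_neg (by omega)]
      exact ⟨c0, c1, c2, c3⟩
    · rw [Function.update_self]
      simp [han, hj]
  · refine (SameTables.of_mem (s' := s₃) hm₀).trans ?_
    refine (SameTables.put (x := k) (k := 0) (v := a) (by omega)).trans ?_
    refine (SameTables.put (x := k) (k := 1) (v := j) (by omega)).trans ?_
    exact SameTables.put (x := k) (k := 2) (v := X.degreeAnswer a) (by omega)

end SubgraphCounting

namespace SubgraphCounting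

open scoped ENNReal

variable {n : ℕ} {X : InputGraph n} {h : ℕ} {H : SimpleGraph (Fin h)} {cH : Sym2 (Fin h) → ℕ}
  {w : ℕ}

section draw

variable {A : Access} {I : Config → Prop} (hA : A.Correct X H cH w I) {M : ℕ}
  (hR : Room n h M w) (hX : X.graph.edgeSet.Nonempty)
include hA hR hX

theorem refines_draw {s : Config} (he : Env X H cH w s) (hI : I s) :
    Refines (sem X w (.loop 33 3 (.lit 1) A.drawStmt) s)
      (sampleSeq (drawPair X H) h 0 fun _ => (0, 0)) fun q s' => Holds X h q.2 h s' ∧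
        SameTables h s s' ∧ s'.Bounded w ∧ (∀ r ∉ 15 :: 33 :: 34 :: accessRegs, s'.reg r = s.reg r) := by
  obtain ⟨hw1, hw2, hw0⟩ := hR.facts
  have hwr : ∀ r ∉ 15 :: 33 :: 34 :: accessRegs, r ∉ (Stmt.loop 33 3 (.lit 1) A.drawStmt).writes := by
    intro r hr
    simp only [List.mem_cons, not_or] at hr
    simp only [Stmt.writes, List.mem_cons, not_or]
    exact ⟨hr.2.1, hA.notMem_drawStmt hr.2.2.2 hr.1 hr.2.2.1⟩
  have key := refines_loop (X := X) (w := w) (c := A.drawStmt) (s := s) (i := 33) (b := 3)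
    (e := .lit 1) (f := fun i y => (drawPair X H i y).map (Function.update y i))
    (halt := fun _ => False) (y₀ := fun _ => (0, 0))
    (fun k y s' => Holds X h y k s' ∧ SameTables h s s') he.bounded
    (hA.notMem_drawStmt (by decide) (by decide) (by decide)) (fun _ _ _ _ h => h)
    ⟨fun j hj => by omega, SameTables.of_mem rfl⟩ (fun k y s₁ _ _ => by simp [Term.val, hw0]) ?_
  · rw [he.r3] at key
    refine (key.and_abstract fun q hq => (mem_support_sampleSeq _ hq).1).mono ?_
    rintro q s' ⟨⟨⟨h1, h2⟩, h3, h4, h5⟩, h6⟩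
    rw [h6, zero_add] at h1
    exact ⟨h1, h2, h4, fun r hr => h5 r (hwr r hr)⟩
  · intro k y s₁ hk hb hk' ⟨hy, hm⟩ hfr _
    rw [he.r3] at hk
    have he' : Env X H cH w s₁ := he.congr hb (hfr _ (hwr _ (by decide))) (hfr _ (hwr _ (by decide)))
      (hfr _ (hwr _ (by decide))) (hfr _ (hwr _ (by decide))) (hfr _ (hwr _ (by decide))) hm
    have hI' : I s₁ := hA.invariant s s₁ hI (hfr _ (hwr _ (by decide)))
      (hfr _ (hwr _ (by decide))) (hfr _ (hwr _ (by decide))) hm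
    exact ((refines_drawStmt hA hR hX he' hI' hk' hk hy).mono fun z s₂ hz =>
      ⟨hz.1, hm.trans hz.2⟩).map

end draw

/-! ### Evaluation of a sample -/

theorem Env.upd {s : Config} (he : Env X H cH w s) {d v : ℕ} (hb : (s.upd d v).Bounded w)
    (hd : d ∉ [0, 1, 3, 5, 19]) : Env X H cH w (s.upd d v) := by
  simp only [List.mem_cons, not_or, List.not_mem_nil, not_false_eq_true, and_true] at hd
  refine he.congr hb ?_ ?_ ?_ ?_ ?_ (SameTables.of_mem rfl) <;> simp [Ne.symm, hd, eq_comm]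

theorem Env.bump {s : Config} (he : Env X H cH w s) (t : ℕ) : Env X H cH w (s.bump t) :=
  he.congr he.bounded.bump rfl rfl rfl rfl rfl (SameTables.of_mem rfl)

theorem prod_range_le_pow {f : ℕ → ℕ} {B k l : ℕ} (hf : ∀ i, f i ≤ B) (hkl : k ≤ l) (hB : 0 < B) :
    ∏ i ∈ Finset.range k, f i ≤ B ^ l := by
  refine (Finset.prod_le_pow_card _ _ B fun i _ => hf i).trans ?_
  rw [Finset.card_range]
  exact Nat.pow_le_pow_right hB hkl

theorem weight_le {y : ℕ → ℕ × ℕ} (i j : ℕ) : weight X y i j ≤ n * n := by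
  rw [weight]
  split_ifs
  · exact X.two_mul_numEdges_le
  · exact Nat.mul_le_mul (X.degreeAnswer_le _) (X.degreeAnswer_le _)

variable {M : ℕ} (hR : Room n h M w)
include hR

/-- The two guards are complementary, so the sum is a case distinction. The summand with guard 0 is
evaluated too, hence the degree product has to fit into a word in either case. -/
theorem weightTerm_spec {s : Config} (he : Env X H cH w s) {y : ℕ → ℕ × ℕ} (hy : Holds X h y h s)
    {i j : Term} (hi : i.Fits w s) (hj : j.Fits w s) (hi' : i.exact s < h) (hj' : j.exact s < h) :
    (weightTerm i j).Fits w s ∧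
      (weightTerm i j).exact s = weight X y (i.exact s) (j.exact s) := by
  obtain ⟨hw1, hw2, hw0⟩ := hR.facts
  have h1 := (hy _ hi').2.2.1
  have h2 := (hy _ hj').2.2.1
  have e : (weightTerm i j).exact s = weight X y (i.exact s) (j.exact s) := by
    simp only [weightTerm, weight, Term.exact_add, Term.exact_mul, Term.exact_lt, Term.exact_le,
      Term.exact_arr, Term.exact_lit, Term.exact_reg, he.r5, he.r1, h1, h2]
    split_ifs <;> omega
  have hb : n * n < 2 ^ w := by nlinarith [hR.base, Nat.zero_le (n * n * h)]
  have hm : 2 * X.numEdges < 2 ^ w := X.two_mul_numEdges_le.trans_lt hb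
  have hd : X.degreeAnswer (y (i.exact s)).2 * X.degreeAnswer (y (j.exact s)).2 < 2 ^ w :=
    (Nat.mul_le_mul (X.degreeAnswer_le _) (X.degreeAnswer_le _)).trans_lt hb
  refine ⟨?_, e⟩
  have hs := (weight_le (X := X) (y := y) (i.exact s) (j.exact s)).trans_lt hb
  rw [← e] at hs
  simp only [weightTerm, Term.exact_add, Term.exact_mul, Term.exact_lt, Term.exact_le,
      Term.exact_arr, Term.exact_lit, Term.exact_reg, he.r5, he.r1, h1, h2, Term.fits_add,
      Term.fits_mul, Term.fits_lt, Term.fits_le, Term.fits_arr, Term.fits_lit, Term.fits_reg] at hs ⊢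
  refine ⟨⟨⟨by omega, hi, hj⟩, ⟨by omega, trivial, hm⟩, ?_⟩, ⟨⟨by omega, hj, hi⟩,
    ⟨⟨by omega, hi, by omega⟩, ⟨by omega, hj, by omega⟩, hd⟩, ?_⟩, hs⟩
  · exact (Nat.le_add_right _ _).trans_lt hs
  · exact (Nat.le_add_left _ _).trans_lt hs

/-- Register 37 is a conjunction kept as a product of zeros and ones. Registers 35 and 36 accumulate
numerator and denominator of the acceptance probability; their partial products stay below the
bounds in `Room`. -/
theorem always_score (hn : 0 < n) {s : Config} (he : Env X H cH w s) (hM : s.reg 9 = M) {y : ℕ → ℕ × ℕ}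
    (hy : Holds X h y h s) :
    Always X w (.asg 37 (.lit 1) ;; .asg 35 (.lit 1) ;; .asg 36 (.reg 9) ;;
      .loop 33 3 (.lit 1) scoreStmt) s fun s' =>
      (s'.reg 37 = 0 ∨ s'.reg 37 = 1) ∧ (s'.reg 37 = 1 ↔ ∀ i < h, adjCode H i (y i).1 = 1) ∧
      s'.reg 35 = acceptNum X h y ∧ s'.reg 36 = acceptDen X h M y := by
  classical
  obtain ⟨hw1, hw2, hw0⟩ := hR.facts
  refine always_seq.2 (always_asg_of he.bounded (by simp [hw0]) fun t₁ hb₁ => ?_)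
  refine always_seq.2 (always_asg_of hb₁.bump (by simp [hw0]) fun t₂ hb₂ => ?_)
  refine always_seq.2 (always_asg_of hb₂.bump (by simp) fun t₃ hb₃ => ?_)
  refine always_loop (fun k s' => (s'.reg 37 = 0 ∨ s'.reg 37 = 1) ∧
      (s'.reg 37 = 1 ↔ ∀ i < k, adjCode H i (y i).1 = 1) ∧
      s'.reg 35 = ∏ i ∈ Finset.range k, h * weight X y i (y i).1 ∧
      s'.reg 36 = M * ∏ i ∈ Finset.range k, X.degreeAnswer (y i).2 ∧ s'.mem = s.mem) hb₃.bump
    (by decide) (by decide) (by decide) (fun _ _ _ h => h) (by simp [hM]) ?_ ?_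
  · intro k s₁ hk hb hk' ⟨h0, h1, h2, h3, h4⟩ hfr _
    simp only [Config.reg_bump, Config.reg_upd, he.r3] at hk
    norm_num at hk
    have hreg : ∀ r ∉ [33, 34, 35, 36, 37], s₁.reg r = s.reg r := by
      intro r hr
      simp only [List.mem_cons, not_or] at hr
      rw [hfr r (by simp [Stmt.writes, scoreStmt, hr])]
      simp [hr]
    have he₁ : Env X H cH w s₁ := he.congr hb (hreg _ (by decide)) (hreg _ (by decide))
      (hreg _ (by decide)) (hreg _ (by decide)) (hreg _ (by decide)) (SameTables.of_mem h4)
    obtain ⟨c0, c1, c2, c3, c4⟩ := hy k hk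
    have hkc := mul_add_lt hk c4
    have hadj := he₁.adj k hk _ c4
    rw [h4] at hadj
    have hy₁ : Holds X h y h s₁ := by rw [Holds, h4]; exact hy
    have hprod : (∏ i ∈ Finset.range k, h * weight X y i (y i).1) * (h * weight X y k (y k).1) <
        2 ^ w := by
      rw [← Finset.prod_range_succ]
      exact (prod_range_le_pow (fun i => Nat.mul_le_mul_left _ (weight_le i _)) hk
        (Nat.mul_pos (by omega) (Nat.mul_pos hn hn))).trans_lt hR.num
    have hprod' : (M * ∏ i ∈ Finset.range k, X.degreeAnswer (y i).2) * X.degreeAnswer (y k).2 <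
        2 ^ w := by
      rw [mul_assoc, ← Finset.prod_range_succ]
      exact (Nat.mul_le_mul_left _ (prod_range_le_pow (fun i => X.degreeAnswer_le _) hk hn)).trans_lt
        hR.den
    refine always_seq.2 (always_asg_of hb (by simp [hk', he₁.r5]; omega) fun u₁ hd₁ => ?_)
    have e1 : (Term.arr 1 (.reg 33)).exact s₁ = (y k).1 := by simp [hk', he₁.r5, h4, c1]
    rw [e1] at hd₁ ⊢
    have e2 : (Term.reg 37 * .get (.reg 33 * .reg 3 + .reg 34)).exact
        ((s₁.upd 34 (y k).1).bump u₁) = s₁.reg 37 * adjCode H k (y k).1 := by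
      simp [hk', he₁.r3, h4, hadj]
    have hle : s₁.reg 37 * adjCode H k (y k).1 ≤ 1 := by
      have := adjCode_le_one (H := H) k (y k).1
      rcases h0 with h | h <;> rw [h] <;> omega
    refine always_seq.2 (always_asg_of hd₁.bump ?_ fun u₂ hd₂ => ?_)
    · simp only [Term.exact_mul, Term.exact_reg, Term.exact_get] at e2
      simp only [Term.fits_mul, Term.fits_reg, Term.fits_get, Term.fits_add, Term.exact_reg,
        Term.exact_mul, true_and, Term.exact_get, e2]
      simp only [Config.reg_bump, Config.reg_upd, hk', he₁.r3]
      norm_num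
      refine ⟨⟨?_, ?_⟩, ?_⟩ <;> omega
    rw [e2] at hd₂ ⊢
    have he₂ := ((he₁.upd hd₁ (by decide)).bump u₁).upd hd₂ (by decide)
    obtain ⟨wf, we⟩ := weightTerm_spec hR (he₂.bump u₂) (y := y) hy₁ (i := .reg 33) (j := .reg 34)
      (by simp) (by simp) (by simpa [hk'] using hk) (by simpa using c4)
    have we' : (weightTerm (.reg 33) (.reg 34)).exact ((((s₁.upd 34 (y k).1).bump u₁).upd 37
        (s₁.reg 37 * adjCode H k (y k).1)).bump u₂) = weight X y k (y k).1 := by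
      rw [we]; simp [hk']
    refine always_seq.2 (always_asg_of hd₂.bump ?_ fun u₃ hd₃ => ?_)
    · simp only [Term.fits_mul, Term.fits_reg, Term.exact_mul, we', wf, true_and, Term.exact_reg]
      simp only [Config.reg_bump, Config.reg_upd, he₁.r3, h2]
      norm_num
      refine ⟨?_, hprod⟩
      have := hR.base
      nlinarith [weight_le (X := X) (y := y) k (y k).1]
    simp only [Term.exact_mul, we', Term.exact_reg] at hd₃ ⊢
    refine always_asg_of hd₃.bump ?_ fun u₄ hd₄ => ?_
    · simp [he₁.r5, hk', h4, c2, h3, hprod']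
      omega
    · refine ⟨?_, ?_, ?_, ?_, ?_⟩
      · exact (Nat.le_one_iff_eq_zero_or_eq_one.1 hle :)
      · change s₁.reg 37 * adjCode H k (y k).1 = 1 ↔ _
        rw [mul_eq_one, h1]
        refine ⟨fun h5 i hi => ?_, fun h5 => ⟨fun i hi => h5 i (by omega), h5 k (by omega)⟩⟩
        rcases Nat.lt_succ_iff_lt_or_eq.1 hi with hi | rfl
        · exact h5.1 i hi
        · exact h5.2
      · simp [Finset.prod_range_succ, h2, he₁.r3]
      · simp [Finset.prod_range_succ, h3, he₁.r5, hk', h4, c2, mul_assoc]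
      · simp [h4]
  · intro k s₁ hk hb hk' ⟨h0, h1, h2, h3, h4⟩ hfr hdone
    simp only [Config.reg_bump, Config.reg_upd, he.r3] at hdone
    norm_num at hdone
    have : k = h := by
      rcases hdone with h | h
      · exact h
      · simp [Term.val, hw0] at h
    subst this
    exact ⟨h0, h1, h2, h3⟩

end SubgraphCounting

/-! ### Checking the pairs of vertices of a sample -/

namespace SubgraphCounting

open scoped ENNReal

variable {n : ℕ} {X : InputGraph n} {h : ℕ} {H : SimpleGraph (Fin h)} {cH : Sym2 (Fin h) → ℕ}
  {w : ℕ} {M : ℕ} (hR : Room n h M w)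
include hR

-- Logic as arithmetic: a product is a conjunction, `.le` between truth values is an implication,
-- and the sum joins the exclusive cases of non-edges and edges of `H`.
open Classical in
theorem pairTerm_spec {s : Config} (he : Env X H cH w s) {y : ℕ → ℕ × ℕ} (hy : Holds X h y h s)
    {i j : ℕ} (hi : i < h) (hj : j < h) (h40 : s.reg 40 = i * h + j) (h41 : s.reg 41 = i)
    (h42 : s.reg 42 = j) (h14 : s.reg 14 = (y i).2) (h15 : s.reg 15 = (y j).2)
    (h34 : s.reg 34 = (y i).1) (h16 : s.reg 16 = (X.pairAnswer (y i).2 (y j).2).1)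
    (h17 : s.reg 17 = (X.pairAnswer (y i).2 (y j).2).2) :
    pairTerm.Fits w s ∧ pairTerm.exact s = if PairCondition X H cH y i j then 1 else 0 := by
  obtain ⟨hw1, hw2, hw0⟩ := hR.facts
  have hij := mul_add_lt hi hj
  obtain ⟨f1, e1⟩ := weightTerm_spec hR he hy (i := .reg 41) (j := .reg 34) (by simp) (by simp)
    (by simpa [h41] using hi) (by simpa [h34] using (hy i hi).2.2.2.2)
  obtain ⟨f2, e2⟩ := weightTerm_spec hR he hy (i := .reg 41) (j := .reg 42) (by simp) (by simp)
    (by simpa [h41] using hi) (by simpa [h42] using hj)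
  simp only [Term.exact_reg, h41, h34, h42] at e1 e2
  have hadj := he.adj i hi j hj
  have hcol := he.col i hi j hj
  have hle := adjCode_le_one (H := H) i j
  have hp := X.pairAnswer_fst_le (y i).2 (y j).2
  have hb : ∀ a b c, c < h → weight X y a b * h + c < 2 ^ w := fun a b c hc => by
    nlinarith [hR.base, weight_le (X := X) (y := y) a b]
  have hb1 := hb i (y i).1 _ (hy i hi).2.2.2.2
  have hb2 := hb i j _ hj
  constructor
  · simp only [pairTerm, Term.fits_add, Term.fits_mul, Term.fits_eq, Term.fits_get, Term.fits_reg,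
      Term.fits_lit, Term.fits_le, Term.exact_add, Term.exact_mul, Term.exact_eq, Term.exact_get,
      Term.exact_reg, Term.exact_lit, Term.exact_le, h40, h41, h42, h14, h15, h34, h16, h17, f1, f2,
      e1, e2, he.r3, he.r19, hadj, hcol, true_and, and_true]
    have hp' : (X.pairAnswer (y i).2 (y j).2).1 ≤ 1 := by omega
    have hmul : ∀ {a b : ℕ}, a ≤ 1 → b ≤ 1 → a * b ≤ 1 := fun ha hb => Nat.mul_le_mul ha hb
    have hite : ∀ (p : Prop) [Decidable p], (if p then 1 else 0) ≤ 1 := fun p _ => by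
      split <;> omega
    have hone : 1 + 1 < 2 ^ w := by omega
    -- Every intermediate result is an address, a key, or a truth value, or else a sum of at most
    -- two truth values.
    and_intros
    all_goals first
      | omega
      | exact (Nat.le_succ_of_le (hmul (hite _) (hite _))).trans_lt hone
      | exact (Nat.le_succ_of_le (hmul hp' (hmul (hite _) (hite _)))).trans_lt hone
      | exact (Nat.le_succ_of_le (hmul hle (hmul hp' (hmul (hite _) (hite _))))).trans_lt hone
      | exact (Nat.add_le_add (hmul (hite _) (hite _))
          (hmul hle (hmul hp' (hmul (hite _) (hite _))))).trans_lt hone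
  · simp only [pairTerm, Term.exact_add, Term.exact_mul, Term.exact_eq, Term.exact_get,
      Term.exact_reg, Term.exact_lit, Term.exact_le, h40, h41, h42, h14, h15, h34, h16, h17,
      e1, e2, he.r3, he.r19, hadj, hcol]
    rw [PairCondition]
    by_cases h0 : adjCode H i j = 0
    · simp only [h0, if_true]
      by_cases h1 : i = j <;> by_cases h2 : (y i).2 = (y j).2 <;> simp [h1, h2]
    · rw [adjCode_ne_zero.1 h0]
      simp only [one_ne_zero, if_false, zero_mul, zero_add, one_mul]
      rcases hp with hp | hp
      · simp [hp]
      · simp only [hp, one_mul, true_and]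
        split_ifs <;> simp_all

variable {A : Access} {I : Config → Prop} (hA : A.Correct X H cH w I)
include hA

/-- A single loop runs through all pairs, the pair `(i, j)` having the number `i * h + j`; the
invariant speaks of the pairs with smaller number. -/
theorem always_check {s : Config} (he : Env X H cH w s) (hI : I s) {y : ℕ → ℕ × ℕ}
    (hy : Holds X h y h s) (h37 : s.reg 37 = 0 ∨ s.reg 37 = 1) :
    Always X w (.loop 40 19 (.lit 1) A.checkStmt) s fun s' =>
      (s'.reg 37 = 0 ∨ s'.reg 37 = 1) ∧ (s'.reg 37 = 1 ↔
        s.reg 37 = 1 ∧ ∀ i < h, ∀ j < h, PairCondition X H cH y i j) := by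
  classical
  obtain ⟨hw1, hw2, hw0⟩ := hR.facts
  refine always_loop (fun k s' => (s'.reg 37 = 0 ∨ s'.reg 37 = 1) ∧
      (s'.reg 37 = 1 ↔ s.reg 37 = 1 ∧ ∀ i < h, ∀ j < h, i * h + j < k → PairCondition X H cH y i j) ∧
      s'.mem = s.mem) he.bounded (hA.notMem_checkStmt (by decide) (by decide))
    (hA.notMem_checkStmt (by decide) (by decide)) (by decide) (fun _ _ _ h => h) (by simp [h37]) ?_ ?_
  · intro k s₁ hk hb hk' ⟨h0, h1, h4⟩ hfr _
    rw [he.r19] at hk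
    have hreg : ∀ r ∉ accessRegs, r ∉ [41, 42, 15, 34, 37, 40] → s₁.reg r = s.reg r := by
      intro r hr hr'
      refine hfr r ?_
      simp only [List.mem_cons, not_or] at hr'
      simp only [Stmt.writes, List.mem_cons, not_or]
      exact ⟨by tauto, hA.notMem_checkStmt hr (by simp; tauto)⟩
    have hm₁ : SameTables h s s₁ := SameTables.of_mem h4
    have he₁ : Env X H cH w s₁ := he.congr hb (hreg _ (by decide) (by decide))
      (hreg _ (by decide) (by decide)) (hreg _ (by decide) (by decide))
      (hreg _ (by decide) (by decide)) (hreg _ (by decide) (by decide)) hm₁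
    have hI₁ : I s₁ := hA.invariant s s₁ hI (hreg _ (by decide) (by decide))
      (hreg _ (by decide) (by decide)) (hreg _ (by decide) (by decide)) hm₁
    have hh : 0 < h := by by_contra h; simp_all
    obtain ⟨i, j, hi, hj, rfl⟩ : ∃ i j, i < h ∧ j < h ∧ k = i * h + j :=
      ⟨k / h, k % h, (Nat.div_lt_iff_lt_mul hh).2 hk, Nat.mod_lt _ hh, (Nat.div_add_mod' k h).symm⟩
    have hdiv : (i * h + j) / h = i := by
      rw [mul_comm, Nat.mul_add_div hh, Nat.div_eq_of_lt hj, add_zero]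
    have hy₁ : Holds X h y h s₁ := by rw [Holds, h4]; exact hy
    obtain ⟨ci0, ci1, -, ci3, ci4⟩ := hy₁ i hi
    obtain ⟨cj0, -, -, cj3, -⟩ := hy₁ j hj
    refine always_seq.2 (always_asg_of hb (by simp) fun u₁ hd₁ => ?_)
    have e1 : (Term.reg 40 / .reg 3).exact s₁ = i := by simp [hk', he₁.r3, hdiv]
    rw [e1] at hd₁ ⊢
    have he₂ := (he₁.upd hd₁ (by decide)).bump u₁
    refine always_seq.2 (always_asg_of hd₁.bump ?_ fun u₂ hd₂ => ?_)
    · simp [he₁.r3]; omega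
    have e2 : (Term.reg 40 - .reg 41 * .reg 3).exact ((s₁.upd 41 i).bump u₁) = j := by
      simp [hk', he₁.r3]
    rw [e2] at hd₂ ⊢
    replace he₂ := (he₂.upd hd₂ (by decide)).bump u₂
    refine always_seq.2 (always_asg_of hd₂.bump ?_ fun u₃ hd₃ => ?_)
    · simp [he₁.r5]; omega
    have e3 : (Term.arr 0 (.reg 41)).exact ((((s₁.upd 41 i).bump u₁).upd 42 j).bump u₂) = (y i).2 := by
      simpa [he₁.r5] using ci0
    rw [e3] at hd₃ ⊢
    replace he₂ := (he₂.upd hd₃ (by decide)).bump u₃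
    refine always_seq.2 (always_asg_of hd₃.bump ?_ fun u₄ hd₄ => ?_)
    · simp [he₁.r5]; omega
    rw [show (Term.arr 0 (.reg 42)).exact ((((((s₁.upd 41 i).bump u₁).upd 42 j).bump u₂).upd 14
      (y i).2).bump u₃) = (y j).2 by simpa [he₁.r5] using cj0] at hd₄ ⊢
    replace he₂ := (he₂.upd hd₄ (by decide)).bump u₄
    refine always_seq.2 (always_asg_of hd₄.bump ?_ fun u₅ hd₅ => ?_)
    · simp [he₁.r5]; omega
    rw [show (Term.arr 1 (.reg 41)).exact ((((((((s₁.upd 41 i).bump u₁).upd 42 j).bump u₂).upd 14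
      (y i).2).bump u₃).upd 15 (y j).2).bump u₄) = (y i).1 by simpa [he₁.r5] using ci1] at hd₅ ⊢
    replace he₂ := (he₂.upd hd₅ (by decide)).bump u₅
    set s₂ := ((((((((((s₁.upd 41 i).bump u₁).upd 42 j).bump u₂).upd 14
      (y i).2).bump u₃).upd 15 (y j).2).bump u₄).upd 34 (y i).1).bump u₅) with hs₂
    have hI₂ : I s₂ := hA.invariant s₁ s₂ hI₁ (by simp [s₂]) (by simp [s₂]) (by simp [s₂])
      (SameTables.of_mem rfl)
    have g14 : s₂.reg 14 = (y i).2 := by simp [s₂]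
    have g15 : s₂.reg 15 = (y j).2 := by simp [s₂]
    refine always_seq.2 (((hA.pair s₂ he₂ hI₂ (by omega) (by omega)).frame he₂.bounded).mono ?_)
    rintro s₃ ⟨⟨h16, h17⟩, hb₃, hreg₃, hm₃⟩
    have hreg₄ : ∀ r ∉ accessRegs, r ∉ [41, 42, 15, 34] → s₃.reg r = s₁.reg r := by
      intro r hr hr'
      rw [hreg₃ r (hA.notMem_writes hr).2.2.2]
      simp only [accessRegs, List.mem_cons, not_or] at hr hr'
      simp [s₂, hr, hr']
    have hreg₅ : ∀ r ∉ accessRegs, s₃.reg r = s₂.reg r := fun r hr =>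
      hreg₃ r (hA.notMem_writes hr).2.2.2
    replace hm₃ : s₃.mem = s₁.mem := hm₃ hA.pair_noStore
    have he₃ : Env X H cH w s₃ := he₁.congr hb₃ (hreg₄ _ (by decide) (by decide))
      (hreg₄ _ (by decide) (by decide)) (hreg₄ _ (by decide) (by decide))
      (hreg₄ _ (by decide) (by decide)) (hreg₄ _ (by decide) (by decide)) (SameTables.of_mem hm₃)
    have hy₃ : Holds X h y h s₃ := by rw [Holds, hm₃]; exact hy₁
    have k14 : s₃.reg 14 = (y i).2 := by rw [hreg₃ 14 hA.pair_target, g14]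
    obtain ⟨pf, pe⟩ := pairTerm_spec hR he₃ hy₃ hi hj
      ((hreg₄ 40 (by decide) (by decide)).trans hk') ((hreg₅ 41 (by decide)).trans (by simp [s₂]))
      ((hreg₅ 42 (by decide)).trans (by simp [s₂])) k14
      ((hreg₅ 15 (by decide)).trans (by simp [s₂])) ((hreg₅ 34 (by decide)).trans (by simp [s₂]))
      (by rw [h16, g14, g15]) (by rw [h17, g14, g15])
    have k37 : s₃.reg 37 = s₁.reg 37 := hreg₄ 37 (by decide) (by decide)
    have hle : s₁.reg 37 * (if PairCondition X H cH y i j then 1 else 0) ≤ 1 := by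
      rcases h0 with h0 | h0 <;> rw [h0] <;> split_ifs <;> omega
    refine always_asg_of hb₃ ?_ fun u₆ hd₆ => ?_
    · simp only [Term.fits_mul, Term.fits_reg, pf, Term.exact_reg, pe, k37, true_and]
      omega
    simp only [Term.exact_mul, Term.exact_reg, pe, k37]
    refine ⟨(Nat.le_one_iff_eq_zero_or_eq_one.1 hle :), ?_, hm₃.trans h4⟩
    change s₁.reg 37 * (if PairCondition X H cH y i j then 1 else 0) = 1 ↔ _
    rw [mul_eq_one, h1, and_assoc]
    refine and_congr_right fun _ => ⟨fun h5 i' hi' j' hj' hlt => ?_, fun h5 => ⟨fun i' hi' j' hj' hlt =>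
      h5 i' hi' j' hj' (by omega), by rw [if_pos (h5 i hi j hj (by omega))]⟩⟩
    rcases Nat.lt_succ_iff_lt_or_eq.1 hlt with hlt | heq
    · exact h5.1 i' hi' j' hj' hlt
    · obtain ⟨rfl, rfl⟩ := eq_of_key_eq hj' hj heq
      by_contra hc
      rw [if_neg hc] at h5
      omega
  · intro k s₁ hk hb hk' ⟨h0, h1, h4⟩ hfr hdone
    rw [he.r19] at hdone
    have : k = h * h := by
      rcases hdone with h | h
      · exact h
      · simp [Term.val, hw0] at h
    subst this
    refine ⟨h0, h1.trans (and_congr_right fun _ => forall₄_congr fun i hi j hj => ?_)⟩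
    simp [mul_add_lt hi hj]

end SubgraphCounting

/-! ### A complete trial, and its access to the graph by queries -/

namespace SubgraphCounting

open scoped ENNReal

variable {n : ℕ} {X : InputGraph n} {h : ℕ} {H : SimpleGraph (Fin h)} {cH : Sym2 (Fin h) → ℕ}
  {w : ℕ} {M : ℕ}

/-- Unlike `refines_rnd` this includes `k = 0`, where machine and `randBelow` both give 0. That case
occurs for a vertex of degree 0 in a sample, which makes the acceptance denominator vanish. -/
theorem refines_rnd_le {d k : ℕ} {e : Term} {s : Config} (hs : s.Bounded w) (he : e.val w s = k) :
    Refines (sem X w (.rnd d e) s) (randBelow k) fun j s' =>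
      (s.upd d j).Bounded w ∧ ∃ t, s' = (s.upd d j).bump t := by
  have hlt := he ▸ Term.val_lt hs e
  rw [sem, he]
  refine refines_map fun j hj => ?_
  have hjk : j ≤ k := by
    rcases Nat.eq_zero_or_pos k with rfl | hk
    · rw [randBelow_zero, PMF.support_pure, Set.mem_singleton_iff] at hj; omega
    · exact ((mem_support_randBelow hk).1 hj).le
  exact ⟨hs.upd (by omega), _, by rw [Config.set_eq_upd (by omega)]⟩

/-- The random number for the acceptance test is drawn for invalid samples as well, exactly as in
`trial`; validity only enters as a factor of the result. -/
theorem refines_trial {A : Access} {I : Config → Prop} (hA : A.Correct X H cH w I)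
    (hR : Room n h M w) (hX : X.graph.edgeSet.Nonempty) {s : Config} (he : Env X H cH w s) (hI : I s)
    (hM : s.reg 9 = M) :
    Refines (sem X w A.trialStmt s) (trial X H cH M) fun b s' =>
      s'.reg 38 = b.toNat ∧ SameTables h s s' := by
  classical
  obtain ⟨hw1, hw2, hw0⟩ := hR.facts
  have hn := X.pos_of_edgeSet_nonempty hX
  refine refines_seq (refines_draw hA hR hX he hI) ?_
  rintro q s₁ ⟨hy, hm₁, hb₁, hreg₁⟩
  have he₁ : Env X H cH w s₁ := he.congr hb₁ (hreg₁ _ (by decide)) (hreg₁ _ (by decide))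
    (hreg₁ _ (by decide)) (hreg₁ _ (by decide)) (hreg₁ _ (by decide)) hm₁
  have hI₁ : I s₁ := hA.invariant s s₁ hI (hreg₁ _ (by decide)) (hreg₁ _ (by decide))
    (hreg₁ _ (by decide)) hm₁
  refine refines_always_seq ((always_score hR hn he₁ ((hreg₁ 9 (by decide)).trans hM) hy).frame hb₁) ?_
  rintro s₂ ⟨⟨h37, h37', h35, h36⟩, hb₂, hreg₂, hm₂⟩
  replace hm₂ : s₂.mem = s₁.mem := hm₂ (by decide)
  have he₂ : Env X H cH w s₂ := he₁.congr hb₂ (hreg₂ _ (by decide)) (hreg₂ _ (by decide))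
    (hreg₂ _ (by decide)) (hreg₂ _ (by decide)) (hreg₂ _ (by decide)) (SameTables.of_mem hm₂)
  have hI₂ : I s₂ := hA.invariant s₁ s₂ hI₁ (hreg₂ _ (by decide)) (hreg₂ _ (by decide))
    (hreg₂ _ (by decide)) (SameTables.of_mem hm₂)
  have hy₂ : Holds X h q.2 h s₂ := by rw [Holds, hm₂]; exact hy
  refine refines_always_seq ((always_check hR hA he₂ hI₂ hy₂ h37).frame hb₂) ?_
  rintro s₃ ⟨⟨k37, k37'⟩, hb₃, hreg₃, hm₃⟩
  have hfr : ∀ r ∉ accessRegs, r ∉ [40, 41, 42, 15, 34, 37] → s₃.reg r = s₂.reg r := by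
    intro r hr hr'
    refine hreg₃ r ?_
    simp only [List.mem_cons, not_or] at hr'
    simp only [Stmt.writes, List.mem_cons, not_or]
    exact ⟨hr'.1, hA.notMem_checkStmt hr (by simp; tauto)⟩
  replace hm₃ : s₃.mem = s₂.mem := hm₃ (by simp [Stmt.noStore, Access.checkStmt, hA.pair_noStore])
  have e35 := (hfr 35 (by decide) (by decide)).trans h35
  have e36 := (hfr 36 (by decide) (by decide)).trans h36
  have hval : s₃.reg 37 = if ValidSample X H cH q.2 then 1 else 0 := by
    rw [h37'] at k37'
    split_ifs with hv
    · exact k37'.2 hv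
    · exact k37.resolve_right fun h => hv (k37'.1 h)
  refine (((refines_rnd_le (X := X) (d := 39) hb₃ (e := .reg 36) e36).bind_always
    (f := sem X w (.asg 38 (.reg 37 * .lt (.reg 39) (.reg 35))))
    (R := fun z s' => s'.reg 38 = (decide (ValidSample X H cH q.2 ∧ z < acceptNum X h q.2)).toNat ∧
      SameTables h s s') ?_)).map
  rintro z _ ⟨hb₄, t, rfl⟩
  refine always_asg_of hb₄.bump ?_ fun u hd => ?_
  · simp only [Term.fits_mul, Term.fits_reg, Term.fits_lt, Term.exact_reg,
      Term.exact_lt, Config.reg_bump, Config.reg_upd, hval, e35]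
    norm_num
    refine ⟨by omega, ?_⟩
    split_ifs <;> omega
  · refine ⟨?_, ?_⟩
    · simp only [Term.exact_mul, Term.exact_reg, Term.exact_lt, Config.reg_bump, Config.reg_upd, hval,
        e35]
      norm_num
      by_cases h1 : ValidSample X H cH q.2 <;> by_cases h2 : z < acceptNum X h q.2 <;> simp [h1, h2]
    · exact hm₁.trans (SameTables.of_mem (hm₃.trans hm₂))

/-! ### Access by queries -/

theorem InputGraph.pairAnswer_snd_lt (hc : ∀ e ∈ X.graph.edgeSet, X.color e < 2 ^ w) (u v : ℕ) :
    (X.pairAnswer u v).2 < 2 ^ w := by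
  classical
  rw [pairAnswer]
  split_ifs with h1 h2
  · exact hc _ h2
  · exact Nat.two_pow_pos w
  · exact Nat.two_pow_pos w

/-- Access by queries. -/
def onlineAccess : Access where
  endpoint := .edge 30 31 32 ;; .rnd 18 (.lit 2) ;;
    .ite (.reg 18) (.asg 14 (.reg 30)) (.asg 14 (.reg 31))
  neighbor := .dg 16 (.reg 15) ;; .rnd 18 (.reg 16) ;; .nb 14 32 (.reg 15) (.reg 18)
  degree := .dg 16 (.reg 14)
  pair := .pr 16 17 (.reg 14) (.reg 15)

/-- Writing an answer into a register loses nothing: vertices and degrees are at most `n`, a word,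
and colors are words by assumption. -/
theorem onlineAccess_correct (hR : Room n h M w) (hX : X.graph.edgeSet.Nonempty)
    (hc : ∀ e ∈ X.graph.edgeSet, X.color e < 2 ^ w) :
    onlineAccess.Correct X H cH w fun _ => True where
  endpoint := by
    intro s he _
    obtain ⟨hw1, hw2, hw0⟩ := hR.facts
    have hn : n < 2 ^ w := by rw [← he.r0]; exact he.bounded.1 0
    refine refines_seq (Q := fun r s' => s'.Bounded w ∧ s'.reg 30 = r.1 ∧ s'.reg 31 = r.2.1) ?_ ?_
    · rw [sem]
      refine refines_map fun r hr => ⟨he.bounded.set.set.set.tick.bump, ?_⟩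
      obtain ⟨e, -, rfl⟩ := X.mem_support_edgeSample hX hr
      simp [Nat.mod_eq_of_lt ((Fin.is_lt _).trans hn)]
    · rintro r s₁ ⟨hb, h30, h31⟩
      refine Refines.map ((refines_rnd hb (e := .lit 2) (k := 2)
        (Nat.mod_eq_of_lt (by omega)) (by omega)).bind_always
        (R := fun t s' => s'.reg 14 = if t = 0 then r.2.1 else r.1) ?_)
      rintro j _ ⟨hj, t, rfl⟩
      refine always_ite.2 ?_
      simp only [Term.val, Config.reg_bump, Config.reg_upd, if_true]
      have hb' : ((s₁.upd 18 j).bump t).Bounded w := (hb.upd (by omega)).bump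
      split_ifs
      · refine always_asg_of hb'.bump (by simp) fun u _ => by simp [h31]
      · refine always_asg_of hb'.bump (by simp) fun u _ => by simp [h30]
  neighbor := by
    intro s he _ h15
    obtain ⟨hw1, hw2, hw0⟩ := hR.facts
    have hn : n < 2 ^ w := by rw [← he.r0]; exact he.bounded.1 0
    refine refines_always_seq (Q := fun s' => s'.Bounded w ∧ s'.reg 15 = s.reg 15 ∧
      s'.reg 16 = X.degreeAnswer (s.reg 15)) ?_ ?_
    · simp only [Always, sem, PMF.support_pure, Set.mem_singleton_iff, forall_eq, Term.val]
      refine ⟨he.bounded.set.tick.bump, by simp, ?_⟩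
      simp [Nat.mod_eq_of_lt ((X.degreeAnswer_le _).trans_lt hn)]
    · rintro s₁ ⟨hb, k15, k16⟩
      refine Refines.map ((refines_rnd_le (X := X) (d := 18) hb (e := .reg 16) k16).bind_always
        (R := fun k s' => s'.reg 14 = (X.neighborAnswer (s.reg 15) k).1) ?_)
      rintro k _ ⟨hb', t, rfl⟩
      simp only [sem, PMF.support_pure, Set.mem_singleton_iff, forall_eq, Term.val]
      simp [k15, Nat.mod_eq_of_lt ((X.neighborAnswer_lt (X.pos_of_edgeSet_nonempty hX)
        (s.reg 15) k).trans hn)]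
  degree := by
    intro s he _ h14
    have hn : n < 2 ^ w := by rw [← he.r0]; exact he.bounded.1 0
    simp only [Always, onlineAccess, sem, PMF.support_pure, Set.mem_singleton_iff, forall_eq, Term.val]
    simp [Nat.mod_eq_of_lt ((X.degreeAnswer_le _).trans_lt hn)]
  pair := by
    intro s he _ h14 h15
    obtain ⟨hw1, hw2, hw0⟩ := hR.facts
    have h1 : (X.pairAnswer (s.reg 14) (s.reg 15)).1 < 2 ^ w := by
      rcases X.pairAnswer_fst_le (s.reg 14) (s.reg 15) with h | h <;> omega
    have h2 := X.pairAnswer_snd_lt hc (s.reg 14) (s.reg 15)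
    simp only [Always, onlineAccess, sem, PMF.support_pure, Set.mem_singleton_iff, forall_eq, Term.val]
    simp [Nat.mod_eq_of_lt h1, Nat.mod_eq_of_lt h2]
  endpoint_writes := by decide
  neighbor_writes := by decide
  degree_writes := by decide
  degree_target := by decide
  pair_target := by decide
  pair_writes := by decide
  endpoint_noStore := rfl
  neighbor_noStore := rfl
  degree_noStore := rfl
  pair_noStore := rfl
  invariant := fun _ _ _ _ _ _ _ => trivial

end SubgraphCounting

namespace SubgraphCounting

open scoped ENNReal

/-! ## Tables for the input graph -/

/-- The number of pairs in `S` with first entry `u`. -/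
def outDegree (S : Finset (ℕ × ℕ)) (u : ℕ) : ℕ := (S.filter (·.1 = u)).card

theorem outDegree_insert {S : Finset (ℕ × ℕ)} {u v : ℕ} (h : (u, v) ∉ S) (a : ℕ) :
    outDegree (insert (u, v) S) a = outDegree S a + if a = u then 1 else 0 := by
  rw [outDegree, outDegree, Finset.filter_insert]
  by_cases hau : a = u
  · subst hau
    rw [if_pos rfl, if_pos rfl, Finset.card_insert_of_notMem]
    simp [h]
  · rw [if_neg (Ne.symm hau), if_neg hau, add_zero]

variable {n : ℕ} (X : InputGraph n)

/-- The arrays `3` to `7` after the address `b` hold the adjacency matrix, the colors, the lists of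
neighbors, the degrees and the list of first entries for the set `S` of darts. -/
structure Tables (b : ℕ) (S : Finset (ℕ × ℕ)) (mem : ℕ → ℕ) : Prop where
  subset : S ⊆ X.darts
  pair : ∀ u < n, ∀ v < n, mem (b + (8 * (u * n + v) + 3)) = if (u, v) ∈ S then 1 else 0
  color : ∀ u < n, ∀ v < n, mem (b + (8 * (u * n + v) + 4)) =
    if (u, v) ∈ S then (X.pairAnswer u v).2 else 0
  row : ∀ u < n, ∀ a, ((Finset.range (outDegree S u)).filter
    fun k => mem (b + (8 * (u * n + k) + 5)) = a).card = if (u, a) ∈ S then 1 else 0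
  row_empty : ∀ u < n, outDegree S u = 0 → mem (b + (8 * (u * n + 0) + 5)) = 0
  degree : ∀ u < n, mem (b + (8 * u + 6)) = outDegree S u
  source : ∀ a, ((Finset.range S.card).filter fun k => mem (b + (8 * k + 7)) = a).card =
    outDegree S a

variable {X} {b : ℕ} {S : Finset (ℕ × ℕ)} {mem : ℕ → ℕ}

theorem lt_of_mem_darts {u v : ℕ} (h : (u, v) ∈ X.darts) : u < n ∧ v < n := by
  rw [InputGraph.mem_darts] at h
  obtain ⟨h1, h2, -⟩ := X.pairAnswer_fst_eq_one.1 h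
  exact ⟨h1, h2⟩

/-- The recorded neighbors of `u` are vertices other than `v`, so the row of `u` has a free cell for
`v`. -/
theorem outDegree_lt (hS : S ⊆ X.darts) {u v : ℕ} (hd : (u, v) ∈ X.darts) (hv : (u, v) ∉ S) :
    outDegree S u < n := by
  have hlt := lt_of_mem_darts hd
  have : outDegree S u ≤ ((Finset.range n).erase v).card := by
    refine Finset.card_le_card_of_injOn Prod.snd ?_ ?_
    · rintro ⟨a, c⟩ hac
      simp only [Finset.coe_filter, Set.mem_ofPred_eq] at hac
      obtain ⟨hac, rfl⟩ := hac
      simp only [Finset.coe_erase, Set.mem_sdiff, Set.mem_singleton_iff, Finset.coe_range,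
        Set.mem_Iio]
      refine ⟨(lt_of_mem_darts (hS hac)).2, ?_⟩
      rintro rfl
      exact hv hac
    · rintro ⟨a, c⟩ hac ⟨a', c'⟩ hac' h
      simp only [Finset.coe_filter, Set.mem_ofPred_eq] at hac hac'
      exact Prod.ext (hac.2.trans hac'.2.symm) h
  rw [Finset.card_erase_of_mem (by simpa using hlt.2), Finset.card_range] at this
  omega

theorem outDegree_le (hS : S ⊆ X.darts) (u : ℕ) : outDegree S u ≤ n := by
  rw [← Finset.card_range n]
  refine Finset.card_le_card_of_injOn Prod.snd ?_ ?_
  · rintro ⟨a, c⟩ hac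
    simp only [Finset.coe_filter, Set.mem_ofPred_eq] at hac
    simpa using (lt_of_mem_darts (hS hac.1)).2
  · rintro ⟨a, c⟩ hac ⟨a', c'⟩ hac' h
    simp only [Finset.coe_filter, Set.mem_ofPred_eq] at hac hac'
    exact Prod.ext (hac.2.trans hac'.2.symm) h

theorem card_le_of_subset_darts (hS : S ⊆ X.darts) : S.card ≤ n * n := by
  refine (Finset.card_le_card (hS.trans (Finset.filter_subset _ _))).trans ?_
  simp

theorem Tables.congr {mem' : ℕ → ℕ} (hT : Tables X b S mem)
    (h : ∀ x k, 3 ≤ k → k < 8 → mem' (b + (8 * x + k)) = mem (b + (8 * x + k))) :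
    Tables X b S mem' where
  subset := hT.subset
  pair := fun u hu v hv => by rw [h _ _ (by omega) (by omega), hT.pair u hu v hv]
  color := fun u hu v hv => by rw [h _ _ (by omega) (by omega), hT.color u hu v hv]
  row := fun u hu a => by simp only [h _ 5 (by omega) (by omega), hT.row u hu a]
  row_empty := fun u hu h0 => by rw [h _ _ (by omega) (by omega), hT.row_empty u hu h0]
  degree := fun u hu => by rw [h _ _ (by omega) (by omega), hT.degree u hu]
  source := fun a => by simp only [h _ 7 (by omega) (by omega), hT.source a]

/-- Untouched memory is zero and thereby already represents the empty set of darts; no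
initialization, which could take time of order `n²`, is necessary. -/
theorem tables_empty (h : ∀ a, b ≤ a → (∃ x k, 3 ≤ k ∧ k < 8 ∧ a = b + (8 * x + k)) → mem a = 0) :
    Tables X b ∅ mem where
  subset := by simp
  pair := fun u _ v _ => by simpa using h _ (by omega) ⟨_, 3, by omega, by omega, rfl⟩
  color := fun u _ v _ => by simpa using h _ (by omega) ⟨_, 4, by omega, by omega, rfl⟩
  row := fun u _ a => by simp [outDegree]
  row_empty := fun u _ _ => h _ (by omega) ⟨_, 5, by omega, by omega, rfl⟩
  degree := fun u _ => by simpa [outDegree] using h _ (by omega) ⟨u, 6, by omega, by omega, rfl⟩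
  source := fun a => by simp [outDegree]

theorem card_filter_range_succ (p : ℕ → Prop) [DecidablePred p] (k : ℕ) :
    ((Finset.range (k + 1)).filter p).card = ((Finset.range k).filter p).card +
      if p k then 1 else 0 := by
  rw [Finset.range_add_one, Finset.filter_insert]
  split_ifs <;> simp

/-- A new dart costs one write per array. The row of `u` and the list of first entries grow at their
ends, which are at `outDegree S u` and `S.card`; as the row is not full, the write does not spill
into the next row. -/
theorem Tables.insert (hT : Tables X b S mem) {u v : ℕ} (hd : (u, v) ∈ X.darts) (hv : (u, v) ∉ S)
    {mem' : ℕ → ℕ} (h3 : ∀ x, mem' (b + (8 * x + 3)) =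
      if x = u * n + v then 1 else mem (b + (8 * x + 3)))
    (h4 : ∀ x, mem' (b + (8 * x + 4)) =
      if x = u * n + v then (X.pairAnswer u v).2 else mem (b + (8 * x + 4)))
    (h5 : ∀ x, mem' (b + (8 * x + 5)) =
      if x = u * n + outDegree S u then v else mem (b + (8 * x + 5)))
    (h6 : ∀ x, mem' (b + (8 * x + 6)) =
      if x = u then outDegree S u + 1 else mem (b + (8 * x + 6)))
    (h7 : ∀ x, mem' (b + (8 * x + 7)) = if x = S.card then u else mem (b + (8 * x + 7))) :
    Tables X b (insert (u, v) S) mem' := by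
  obtain ⟨hun, hvn⟩ := lt_of_mem_darts hd
  have hdeg := outDegree_lt hT.subset hd hv
  have hkey : ∀ {a c : ℕ}, c < n → (a * n + c = u * n + v ↔ (a, c) = (u, v)) := by
    intro a c hc
    rw [Prod.mk.injEq]
    refine ⟨fun h => eq_of_key_eq hc hvn h, ?_⟩
    rintro ⟨rfl, rfl⟩
    rfl
  constructor
  · exact Finset.insert_subset hd hT.subset
  · intro a ha c hc
    rw [h3, hT.pair a ha c hc]
    simp only [hkey hc, Finset.mem_insert]
    split_ifs <;> simp_all
  · intro a ha c hc
    rw [h4, hT.color a ha c hc]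
    simp only [hkey hc, Finset.mem_insert]
    split_ifs <;> simp_all
  · intro a ha c
    rw [outDegree_insert hv]
    by_cases hau : a = u
    · subst hau
      have e1 : ∀ k ∈ Finset.range (outDegree S a), (mem' (b + (8 * (a * n + k) + 5)) = c ↔
          mem (b + (8 * (a * n + k) + 5)) = c) := by
        intro k hk
        rw [Finset.mem_range] at hk
        rw [h5, if_neg (by omega)]
      rw [if_pos rfl, card_filter_range_succ, Finset.filter_congr e1, hT.row a ha c, h5, if_pos rfl]
      simp only [Finset.mem_insert, Prod.mk.injEq, true_and]
      by_cases hcv : c = v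
      · subst hcv; simp [hv]
      · simp [hcv, Ne.symm hcv]
    · have hkey' : ∀ k ∈ Finset.range (outDegree S a), (mem' (b + (8 * (a * n + k) + 5)) = c ↔
          mem (b + (8 * (a * n + k) + 5)) = c) := by
        intro k hk
        rw [Finset.mem_range] at hk
        have hkn : k < n := hk.trans_le (outDegree_le hT.subset a)
        rw [h5, if_neg fun h => hau (eq_of_key_eq hkn hdeg h).1]
      rw [if_neg hau, add_zero, Finset.filter_congr hkey', hT.row a ha c]
      simp [hau]
  · intro a ha h0
    rw [outDegree_insert hv] at h0
    have hau : a ≠ u := by rintro rfl; simp at h0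
    rw [h5, if_neg fun h => hau (eq_of_key_eq (by omega) hdeg h).1]
    exact hT.row_empty a ha (by omega)
  · intro a ha
    rw [h6, outDegree_insert hv]
    split_ifs with h
    · rw [h]
    · rw [hT.degree a ha, add_zero]
  · intro a
    have e1 : ∀ k ∈ Finset.range S.card, (mem' (b + (8 * k + 7)) = a ↔
        mem (b + (8 * k + 7)) = a) := by
      intro k hk
      rw [Finset.mem_range] at hk
      rw [h7, if_neg (by omega)]
    rw [Finset.card_insert_of_notMem hv, card_filter_range_succ, Finset.filter_congr e1, hT.source,
      outDegree_insert hv, h7, if_pos rfl]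
    simp only [eq_comm]

theorem outDegree_darts (u : ℕ) : outDegree X.darts u = X.degreeAnswer u := by
  classical
  by_cases hu : u < n
  · rw [X.degreeAnswer_eq ⟨u, hu⟩, outDegree, ← SimpleGraph.card_neighborFinset_eq_degree]
    symm
    refine Finset.card_bij (fun v _ => (u, (v : ℕ))) ?_ ?_ ?_
    · intro v hv
      rw [SimpleGraph.mem_neighborFinset] at hv
      simp only [Finset.mem_filter, and_true]
      rw [InputGraph.mem_darts, X.pairAnswer_fst_eq_one]
      exact ⟨hu, v.2, hv⟩
    · intro v _ v' _ h
      exact Fin.ext (Prod.ext_iff.1 h).2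
    · rintro ⟨a, c⟩ hac
      rw [Finset.mem_filter] at hac
      obtain ⟨hac, rfl⟩ := hac
      rw [InputGraph.mem_darts] at hac
      obtain ⟨h1, h2, h3⟩ := X.pairAnswer_fst_eq_one.1 hac
      exact ⟨⟨c, h2⟩, by rwa [SimpleGraph.mem_neighborFinset], rfl⟩
  · rw [InputGraph.degreeAnswer, dif_neg hu, outDegree, Finset.card_eq_zero, Finset.filter_eq_empty_iff]
    rintro ⟨a, c⟩ hac rfl
    exact hu (lt_of_mem_darts hac).1

theorem card_darts : X.darts.card = 2 * X.numEdges := by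
  classical
  rw [X.numEdges_eq, ← SimpleGraph.sum_degrees_eq_twice_card_edges,
    Finset.card_eq_sum_card_fiberwise (f := Prod.fst) (t := Finset.range n)]
  · rw [Finset.sum_range]
    exact Finset.sum_congr rfl fun v _ => (outDegree_darts (X := X) v).trans (X.degreeAnswer_eq v)
  · rintro ⟨a, c⟩ hac
    simpa using (lt_of_mem_darts (Finset.mem_coe.1 hac)).1

/-- A uniform entry of any list of the neighbors has the same distribution, whatever the order of
the list. The assumption `h0` matches the default answer 0 for a vertex without neighbors. -/
theorem sampleNeighbor_eq {u : ℕ} (hu : u < n) {f : ℕ → ℕ}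
    (hf : ∀ a, ((Finset.range (X.degreeAnswer u)).filter fun k => f k = a).card =
      if (u, a) ∈ X.darts then 1 else 0) (h0 : X.degreeAnswer u = 0 → f 0 = 0) :
    (randBelow (X.degreeAnswer u)).map f = X.sampleNeighbor u := by
  classical
  rcases Nat.eq_zero_or_pos (X.degreeAnswer u) with h | h
  · have h' : (X.graph.neighborSet ⟨u, hu⟩).ncard = 0 := by
      rw [InputGraph.degreeAnswer, dif_pos hu] at h; exact h
    rw [InputGraph.sampleNeighbor, h, randBelow_zero, PMF.pure_map, PMF.pure_map, h0 h,
      InputGraph.neighborAnswer, dif_pos hu, dif_neg (by omega)]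
  · ext a
    rw [randBelow_map_apply h, hf]
    split_ifs with hd
    · rw [InputGraph.mem_darts] at hd
      obtain ⟨h1, h2, h3⟩ := X.pairAnswer_fst_eq_one.1 hd
      have := X.sampleNeighbor_apply h3
      simp only at this
      rw [this]
      simp
    · symm
      rw [Nat.cast_zero, ENNReal.zero_div, PMF.apply_eq_zero_iff, InputGraph.sampleNeighbor,
        PMF.mem_support_map_iff]
      rintro ⟨k, hk, rfl⟩
      rw [mem_support_randBelow h, InputGraph.degreeAnswer, dif_pos hu] at hk
      apply hd
      rw [InputGraph.mem_darts, X.pairAnswer_fst_eq_one, InputGraph.neighborAnswer, dif_pos hu,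
        dif_pos hk]
      exact ⟨hu, Fin.is_lt _, (X.nbr ⟨u, hu⟩ ⟨k, hk⟩).2⟩

/-- The list of first entries contains each vertex as often as its degree tells, so a uniform entry
is distributed like a random end of a random edge. -/
theorem sampleEndpoint_eq (hX : X.graph.edgeSet.Nonempty) {f : ℕ → ℕ}
    (hf : ∀ a, ((Finset.range (2 * X.numEdges)).filter fun k => f k = a).card = X.degreeAnswer a) :
    (randBelow (2 * X.numEdges)).map f = X.sampleEndpoint := by
  classical
  have hm := X.numEdges_pos hX
  ext a
  rw [randBelow_map_apply (by omega), hf]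
  by_cases ha : a < n
  · rw [← X.sampleEndpoint_apply hX ⟨a, ha⟩]
  · rw [InputGraph.degreeAnswer, dif_neg ha, Nat.cast_zero, ENNReal.zero_div, eq_comm,
      PMF.apply_eq_zero_iff]
    exact fun h => ha (InputGraph.lt_of_mem_support_sampleEndpoint hX h)

end SubgraphCounting

/-! ### Storing the edges, and access to the stored graph -/

namespace SubgraphCounting

open scoped ENNReal

/-- Access by tables. -/
def offlineAccess : Access where
  endpoint := .rnd 18 (.lit 2 * .reg 1) ;; .asg 14 (.arr 7 (.reg 18))
  neighbor := .rnd 18 (.arr 6 (.reg 15)) ;; .asg 14 (.arr 5 (.reg 15 * .reg 0 + .reg 18))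
  degree := .asg 16 (.arr 6 (.reg 14))
  pair := .asg 16 (.arr 3 (.reg 14 * .reg 0 + .reg 15)) ;;
    .asg 17 (.arr 4 (.reg 14 * .reg 0 + .reg 15))

variable {n : ℕ} {X : InputGraph n} {h : ℕ} {H : SimpleGraph (Fin h)} {cH : Sym2 (Fin h) → ℕ}
  {w : ℕ} {M : ℕ}

theorem InputGraph.pairAnswer_eq_zero {u v : ℕ} (h : (X.pairAnswer u v).1 ≠ 1) :
    X.pairAnswer u v = (0, 0) := by
  classical
  rw [pairAnswer] at h ⊢
  split_ifs at h ⊢ <;> simp_all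

theorem Room.cell (hR : Room n h M w) {x k : ℕ} (hx : x ≤ n * n) (hk : k < 8) :
    2 * (h * h) + (8 * x + k) < 2 ^ w := by
  have := hR.base
  nlinarith [Nat.zero_le (n * n * h)]

theorem Room.sq (hR : Room n h M w) : 8 * (n * n + n) < 2 ^ w := by
  have := hR.base
  nlinarith [Nat.zero_le (n * n * h), Nat.zero_le (h * h)]

theorem tables_of_sameTables {S : Finset (ℕ × ℕ)} {s s' : Config}
    (hT : Tables X (2 * (h * h)) S s.mem) (hm : SameTables h s s') :
    Tables X (2 * (h * h)) S s'.mem :=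
  hT.congr fun x k h3 h8 => hm _ fun x' k' hk' => by omega

/-- A trial depends only on the distributions of the sampling answers and on the degree and pair
answers. The tables may therefore list the neighbors in order of discovery instead of the order used
by the queries. -/
theorem offlineAccess_correct (hR : Room n h M w) (hX : X.graph.edgeSet.Nonempty) :
    offlineAccess.Correct X H cH w fun s => Tables X (2 * (h * h)) X.darts s.mem where
  endpoint := by
    intro s he hT
    obtain ⟨hw1, hw2, hw0⟩ := hR.facts
    have hm := X.numEdges_pos hX
    have hsq := hR.sq
    have hmn := X.two_mul_numEdges_le
    rw [← sampleEndpoint_eq hX (f := fun k => s.mem (2 * (h * h) + (8 * k + 7)))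
      (by simpa [card_darts, outDegree_darts] using hT.source)]
    have hv : (Term.lit 2 * .reg 1).val w s = 2 * X.numEdges := by
      rw [Term.val_eq_exact _ (by simp [he.r1]; omega)]
      simp [he.r1]
    refine Refines.map ((refines_rnd he.bounded hv (by omega)).bind_always ?_)
    rintro k _ ⟨hk, t, rfl⟩
    refine always_asg_of (he.bounded.upd (by omega)).bump ?_ fun u _ => ?_
    · simp [he.r5, hR.cell (x := k) (k := 7) (by omega) (by omega)]
      omega
    · simp [he.r5]
  neighbor := by
    intro s he hT h15
    obtain ⟨hw1, hw2, hw0⟩ := hR.facts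
    have hsq := hR.sq
    set u := s.reg 15 with hu
    have hdn := X.degreeAnswer_le u
    rw [← sampleNeighbor_eq h15 (f := fun k => s.mem (2 * (h * h) + (8 * (u * n + k) + 5)))
      (by simpa [outDegree_darts] using hT.row u h15)
      (by simpa [outDegree_darts] using hT.row_empty u h15)]
    have hun : u ≤ n * n := by nlinarith
    have hv : (Term.arr 6 (.reg 15)).val w s = X.degreeAnswer u := by
      rw [Term.val_eq_exact]
      · simp only [Term.exact_arr, Term.exact_reg, he.r5, ← hu, hT.degree u h15, outDegree_darts]
      · simp [he.r5, ← hu, hR.cell (x := u) (k := 6) hun (by omega)]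
        omega
    refine Refines.map ((refines_rnd_le (X := X) (d := 18) he.bounded hv).and_abstract
      (R := fun k => k < n) ?_ |>.bind_always ?_)
    · intro k hk
      rcases Nat.eq_zero_or_pos (X.degreeAnswer u) with h | h
      · rw [h, randBelow_zero, PMF.support_pure, Set.mem_singleton_iff] at hk
        omega
      · rw [mem_support_randBelow h] at hk
        omega
    · rintro k _ ⟨⟨hb, t, rfl⟩, hkn⟩
      have hun := mul_add_lt h15 hkn
      refine always_asg_of hb.bump ?_ fun t' _ => ?_
      · simp [he.r5, he.r0, ← hu, hR.cell (x := u * n + k) (k := 5) hun.le (by omega)]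
        refine ⟨?_, ?_, ?_⟩ <;> omega
      · simp [he.r5, he.r0, ← hu]
  degree := by
    intro s he hT h14
    obtain ⟨hw1, hw2, hw0⟩ := hR.facts
    have hun : s.reg 14 ≤ n * n := by nlinarith
    refine always_asg_of he.bounded ?_ fun t' _ => ?_
    · simp [he.r5, hR.cell (k := 6) hun (by omega)]
      omega
    · simp [he.r5, hT.degree _ h14, outDegree_darts]
  pair := by
    intro s he hT h14 h15
    obtain ⟨hw1, hw2, hw0⟩ := hR.facts
    have hsq := hR.sq
    have hun := mul_add_lt h14 h15
    refine always_seq.2 (always_asg_of he.bounded ?_ fun t' hb => ?_)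
    · simp [he.r5, he.r0, hR.cell (k := 3) hun.le (by omega)]
      refine ⟨?_, ?_, ?_⟩ <;> omega
    refine always_asg_of hb.bump ?_ fun t' hb => ?_
    · simp [he.r5, he.r0, hR.cell (k := 4) hun.le (by omega)]
      refine ⟨?_, ?_, ?_⟩ <;> omega
    · have h1 := hT.pair _ h14 _ h15
      have h2 := hT.color _ h14 _ h15
      simp only [InputGraph.mem_darts] at h1 h2
      simp only [Term.exact_arr, Term.exact_add, Term.exact_mul, Term.exact_reg, Config.reg_bump,
        Config.reg_upd, Config.mem_bump, Config.mem_upd, he.r5, he.r0]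
      norm_num [he.r5, he.r0, h1, h2]
      by_cases h3 : (X.pairAnswer (s.reg 14) (s.reg 15)).1 = 1
      · simp [h3]
      · simp [X.pairAnswer_eq_zero h3]
  endpoint_writes := by decide
  neighbor_writes := by decide
  degree_writes := by decide
  degree_target := by decide
  pair_target := by decide
  pair_writes := by decide
  endpoint_noStore := rfl
  neighbor_noStore := rfl
  degree_noStore := rfl
  pair_noStore := rfl
  invariant := fun _ _ hT _ _ _ hm => tables_of_sameTables hT hm

/-! ### Collecting the edges in the tables -/

/-- Insert the pair of the registers `u` and `v` with the color in register 32; register 44 holds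
the number of pairs. -/
def insertStmt (u v : ℕ) : Stmt :=
  .asg 45 (.arr 6 (.reg u)) ;;
  .sto (.addr 3 (.reg u * .reg 0 + .reg v)) (.lit 1) ;;
  .sto (.addr 4 (.reg u * .reg 0 + .reg v)) (.reg 32) ;;
  .sto (.addr 5 (.reg u * .reg 0 + .reg 45)) (.reg v) ;;
  .sto (.addr 6 (.reg u)) (.reg 45 + .lit 1) ;;
  .sto (.addr 7 (.reg 44)) (.reg u) ;;
  .asg 44 (.reg 44 + .lit 1)

/-- Sample an edge and record it. -/
def recordStmt : Stmt :=
  .edge 30 31 32 ;;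
  .ite (.arr 3 (.reg 30 * .reg 0 + .reg 31)) .skip (insertStmt 30 31 ;; insertStmt 31 30)

theorem always_insert (hR : Room n h M w) {s : Config} (hb : s.Bounded w) {u v : ℕ} (hu : u ∉ [44, 45])
    (hv : v ∉ [44, 45]) (h0 : s.reg 0 = n) (h5 : s.reg 5 = 2 * (h * h))
    {S : Finset (ℕ × ℕ)} (h44 : s.reg 44 = S.card) (hT : Tables X (2 * (h * h)) S s.mem)
    (hd : (s.reg u, s.reg v) ∈ X.darts) (hd' : (s.reg u, s.reg v) ∉ S)
    (h32 : s.reg 32 = (X.pairAnswer (s.reg u) (s.reg v)).2) :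
    Always X w (insertStmt u v) s fun s' => s'.Bounded w ∧ (∀ r ∉ [44, 45], s'.reg r = s.reg r) ∧
      (∀ a < 2 * (h * h), s'.mem a = s.mem a) ∧
      s'.reg 44 = (insert (s.reg u, s.reg v) S).card ∧
      Tables X (2 * (h * h)) (insert (s.reg u, s.reg v) S) s'.mem := by
  obtain ⟨hw1, hw2, hw0⟩ := hR.facts
  have hsq := hR.sq
  obtain ⟨hun, hvn⟩ := lt_of_mem_darts hd
  have hdeg := outDegree_lt hT.subset hd hd'
  have hcard := card_le_of_subset_darts hT.subset
  have huv := mul_add_lt hun hvn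
  have hud := mul_add_lt hun hdeg
  have huu : s.reg u ≤ n * n := by nlinarith
  have c3 := hR.cell (k := 3) huv.le (by omega)
  have c4 := hR.cell (k := 4) huv.le (by omega)
  have c5 := hR.cell (k := 5) hud.le (by omega)
  have c6 := hR.cell (k := 6) huu (by omega)
  have c7 := hR.cell (k := 7) hcard (by omega)
  simp only [List.mem_cons, List.not_mem_nil, or_false, not_or] at hu hv
  have hTu := hT.degree _ hun
  refine always_seq.2 (always_asg_of hb (by simp [h5, c6]; omega) fun t₁ hb₁ => ?_)
  have e1 : (Term.arr 6 (.reg u)).exact s = outDegree S (s.reg u) := by simp [h5, hTu]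
  rw [e1] at hb₁ ⊢
  refine always_seq.2 (always_sto_of hb₁.bump ?_ (by simp [hw0]) fun t₂ hb₂ => ?_)
  · simp [h5, h0, hu, hv, c3]; refine ⟨?_, ?_, ?_⟩ <;> omega
  refine always_seq.2 (always_sto_of hb₂.bump ?_ (by simp) fun t₃ hb₃ => ?_)
  · simp [h5, h0, hu, hv, c4]; refine ⟨?_, ?_, ?_⟩ <;> omega
  refine always_seq.2 (always_sto_of hb₃.bump ?_ (by simp) fun t₄ hb₄ => ?_)
  · simp [h5, h0, hu, hv, c5]; refine ⟨?_, ?_, ?_⟩ <;> omega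
  refine always_seq.2 (always_sto_of hb₄.bump ?_ ?_ fun t₅ hb₅ => ?_)
  · simp [h5, hu, c6]; omega
  · simp [hw0]; omega
  refine always_seq.2 (always_sto_of hb₅.bump ?_ (by simp) fun t₆ hb₆ => ?_)
  · simp [h5, h44, c7]; omega
  refine always_asg_of hb₆.bump ?_ fun t₇ hb₇ => ?_
  · simp [hw0, h44]; omega
  refine ⟨hb₇.bump, ?_, ?_, ?_, ?_⟩
  · intro r hr
    simp only [List.mem_cons, List.not_mem_nil, or_false, not_or] at hr
    simp [hr]
  · intro a ha
    simp only [Config.mem_bump, Config.mem_upd, Config.mem_put, Term.exact_addr, Config.reg_bump,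
      Config.reg_upd, Config.reg_put, h5]
    norm_num [h5]
    split_ifs <;> first | rfl | omega
  · simp [h44, Finset.card_insert_of_notMem hd']
  · simp only [Term.exact_addr, Term.exact_add, Term.exact_mul, Term.exact_reg, Term.exact_lit,
      Config.reg_bump, Config.reg_upd, Config.reg_put, hu, hv, h0, h5, h44]
    norm_num [h5, h44, h0, hu, hv]
    -- The arrays occupy different residues modulo 8 relative to the base address, so each sees only
    -- its own write.
    refine hT.insert hd hd' ?_ ?_ ?_ ?_ ?_ <;> intro x <;>
      simp only [Config.mem_bump, Config.mem_upd, Config.mem_put, ← h32] <;>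
      split_ifs <;> first | rfl | omega

/-- As `S` is closed under reversal, an edge is present in both orientations or in neither, and a
single lookup decides whether it is new. -/
theorem refines_record (hR : Room n h M w) (hX : X.graph.edgeSet.Nonempty)
    (hc : ∀ e ∈ X.graph.edgeSet, X.color e < 2 ^ w) {s : Config} (hb : s.Bounded w)
    (h0 : s.reg 0 = n) (h5 : s.reg 5 = 2 * (h * h))
    {S : Finset (ℕ × ℕ)} (h44 : s.reg 44 = S.card) (hT : Tables X (2 * (h * h)) S s.mem)
    (hS : ∀ d ∈ S, (d.2, d.1) ∈ S) :
    Refines (sem X w recordStmt s) (X.edgeSample.map (InputGraph.record S)) fun S' s' =>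
      s'.reg 44 = S'.card ∧ Tables X (2 * (h * h)) S' s'.mem ∧ (∀ d ∈ S', (d.2, d.1) ∈ S') ∧
      (∀ a < 2 * (h * h), s'.mem a = s.mem a) := by
  obtain ⟨hw1, hw2, hw0⟩ := hR.facts
  have hsq := hR.sq
  have hn : n < 2 ^ w := by rw [← h0]; exact hb.1 0
  refine Refines.map ((Refines.bind_always (Q := fun r s' => s'.Bounded w ∧ s'.reg 30 = r.1 ∧
    s'.reg 31 = r.2.1 ∧ s'.reg 32 = r.2.2 ∧ (∀ r ∉ [30, 31, 32], s'.reg r = s.reg r) ∧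
    s'.mem = s.mem ∧ X.pairAnswer r.1 r.2.1 = (1, r.2.2) ∧ X.pairAnswer r.2.1 r.1 = (1, r.2.2)) ?_ ?_))
  · rw [sem]
    refine refines_map fun r hr => ?_
    obtain ⟨a1, a2⟩ := X.edgeSample_adj hX hr
    have l1 := lt_of_mem_darts (X := X) (u := r.1) (v := r.2.1) (by rw [InputGraph.mem_darts, a1])
    have l2 : r.2.2 < 2 ^ w := by
      have := InputGraph.pairAnswer_snd_lt hc r.1 r.2.1
      rwa [a1] at this
    refine ⟨hb.set.set.set.tick.bump, ?_, ?_, ?_, fun q hq => ?_, rfl, a1, a2⟩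
    · simp [Nat.mod_eq_of_lt (l1.1.trans hn)]
    · simp [Nat.mod_eq_of_lt (l1.2.trans hn)]
    · simp [Nat.mod_eq_of_lt l2]
    · simp only [List.mem_cons, List.not_mem_nil, or_false, not_or] at hq
      simp [hq]
  · rintro ⟨u, v, c⟩ s₁ ⟨hb₁, h30, h31, h32, hreg, hm, a1, a2⟩
    simp only at h30 h31 h32 a1 a2
    have d1 : (u, v) ∈ X.darts := by rw [InputGraph.mem_darts, a1]
    have d2 : (v, u) ∈ X.darts := by rw [InputGraph.mem_darts, a2]
    obtain ⟨hun, hvn⟩ := lt_of_mem_darts d1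
    have huv := mul_add_lt hun hvn
    have g0 : s₁.reg 0 = n := (hreg 0 (by decide)).trans h0
    have g5 : s₁.reg 5 = 2 * (h * h) := (hreg 5 (by decide)).trans h5
    have g44 : s₁.reg 44 = S.card := (hreg 44 (by decide)).trans h44
    have c3 := hR.cell (k := 3) huv.le (by omega)
    have hTs := hT.pair u hun v hvn
    have hval : (Term.arr 3 (.reg 30 * .reg 0 + .reg 31)).val w s₁ = if (u, v) ∈ S then 1 else 0 := by
      rw [Term.val_eq_exact]
      · simp [g0, g5, h30, h31, hm, hTs]
      · simp [g0, g5, h30, h31, c3]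
        refine ⟨?_, ?_, ?_⟩ <;> omega
    change Always X w _ s₁ _
    refine always_ite.2 ?_
    rw [hval]
    by_cases hin : (u, v) ∈ S
    · rw [if_pos hin, if_neg one_ne_zero]
      have hrec : InputGraph.record S (u, v, c) = S := by
        rw [InputGraph.record, Finset.insert_eq_of_mem, Finset.insert_eq_of_mem hin]
        exact Finset.mem_insert_of_mem (hS _ hin)
      refine always_skip.2 ?_
      rw [hrec]
      simp only [Config.reg_bump, Config.mem_bump, hm]
      exact ⟨g44, hT, hS, fun _ _ => trivial⟩
    · rw [if_neg hin, if_pos rfl]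
      have hne : u ≠ v := by
        rintro rfl
        obtain ⟨_, _, ha⟩ := X.pairAnswer_fst_eq_one.1 (by rw [a1])
        exact ha.ne rfl
      have hin' : (v, u) ∉ Insert.insert (u, v) S := by
        rw [Finset.mem_insert, not_or]
        exact ⟨fun h => hne (Prod.ext_iff.1 h).2, fun h => hin (hS _ h)⟩
      refine always_seq.2 ((always_insert (X := X) hR hb₁.bump (u := 30) (v := 31) (by decide) (by decide) g0 g5 g44
        (by simpa [hm] using hT) (by simpa [h30, h31] using d1) (by simpa [h30, h31] using hin)
        (by simp [h30, h31, h32, a1])).mono ?_)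
      rintro s₂ ⟨hb₂, hreg₂, hlow₂, k44, hT₂⟩
      simp only [Config.reg_bump, h30, h31] at k44 hT₂
      have e30 : s₂.reg 30 = u := (hreg₂ 30 (by decide)).trans h30
      have e31 : s₂.reg 31 = v := (hreg₂ 31 (by decide)).trans h31
      have e32 : s₂.reg 32 = c := (hreg₂ 32 (by decide)).trans h32
      refine (always_insert (X := X) hR hb₂ (u := 31) (v := 30) (by decide) (by decide)
        ((hreg₂ 0 (by decide)).trans g0) ((hreg₂ 5 (by decide)).trans g5) k44 hT₂
        (by rwa [e30, e31]) (by rwa [e30, e31]) (by rw [e30, e31, e32, a2])).mono ?_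
      rintro s₃ ⟨hb₃, -, hlow₃, j44, hT₃⟩
      rw [e30, e31] at j44 hT₃
      refine ⟨j44, hT₃, ?_, fun a ha => ?_⟩
      · intro d hd
        simp only [InputGraph.record, Finset.mem_insert] at hd ⊢
        rcases hd with rfl | rfl | hd
        · simp
        · simp
        · exact Or.inr (Or.inr (hS d hd))
      · rw [hlow₃ a ha, hlow₂ a ha, Config.mem_bump, hm]

/-- Collect edges; register 27 holds the number of samples. -/
def collectStmt : Stmt := .asg 44 (.lit 0) ;; .loop 28 27 (.lit 1) recordStmt

theorem refines_collect (hR : Room n h M w) (hX : X.graph.edgeSet.Nonempty)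
    (hc : ∀ e ∈ X.graph.edgeSet, X.color e < 2 ^ w) {s : Config} (hb : s.Bounded w)
    (h0 : s.reg 0 = n) (h5 : s.reg 5 = 2 * (h * h))
    (hT : Tables X (2 * (h * h)) ∅ s.mem) :
    Refines (sem X w collectStmt s) (X.collect (s.reg 27) 0 ∅) fun q s' =>
      Tables X (2 * (h * h)) q.2 s'.mem ∧ (∀ a < 2 * (h * h), s'.mem a = s.mem a) := by
  obtain ⟨hw1, hw2, hw0⟩ := hR.facts
  refine refines_always_seq (Q := fun s' => s'.Bounded w ∧ s'.reg 44 = 0 ∧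
    (∀ r, r ≠ 44 → s'.reg r = s.reg r) ∧ s'.mem = s.mem) ?_ ?_
  · exact always_asg_of hb (by simp) fun t hb' =>
      ⟨hb'.bump, by simp, fun r hr => by simp [hr], rfl⟩
  · rintro s₁ ⟨hb₁, h44, hreg₁, hm₁⟩
    have key := refines_loop (X := X) (w := w) (c := recordStmt) (s := s₁) (i := 28) (b := 27)
      (e := .lit 1) (f := fun _ S => X.edgeSample.map (InputGraph.record S))
      (halt := fun _ => False) (y₀ := ∅)
      (fun _ S s' => s'.reg 44 = S.card ∧ Tables X (2 * (h * h)) S s'.mem ∧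
        (∀ d ∈ S, (d.2, d.1) ∈ S) ∧ (∀ a < 2 * (h * h), s'.mem a = s.mem a)) hb₁ (by decide)
      (fun _ _ _ _ h => h) ?_ ?_ ?_
    · rw [hreg₁ 27 (by decide)] at key
      exact key.mono fun q s' hq => ⟨hq.1.2.1, hq.1.2.2.2⟩
    · simp only [Config.mem_set, hm₁]
      exact ⟨by simp [h44], hT, by simp, fun _ _ => trivial⟩
    · intro k y s₂ _ _
      simp [Term.val, hw0]
    · rintro k S s₂ hk hb₂ hk' ⟨i44, hT₂, hS, hlow⟩ hfr -
      have hreg₂ : ∀ r ∉ 44 :: (Stmt.loop 28 27 (.lit 1) recordStmt).writes, s₂.reg r = s.reg r := by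
        intro r hr
        rw [List.mem_cons, not_or] at hr
        rw [hfr r hr.2, hreg₁ r hr.1]
      refine (refines_record hR hX hc hb₂ ((hreg₂ 0 (by decide)).trans h0)
        ((hreg₂ 5 (by decide)).trans h5) i44 hT₂ hS).mono ?_
      rintro S' s₃ ⟨j1, j2, j3, j4⟩
      exact ⟨by simpa using j1, j2, j3, fun a ha => (j4 a ha).trans (hlow a ha)⟩

end SubgraphCounting

namespace SubgraphCounting

open scoped ENNReal

/-! ## Enumeration of the maps from the vertices of `H` to themselves -/

/-- Split off a digit of the number in register 25. -/
def digitStmt : Stmt :=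
  .sto (.addr 0 (.reg 33)) (.reg 25 - .reg 25 / .reg 3 * .reg 3) ;;
  .asg 14 (.reg 14 + (.reg 25 - .reg 25 / .reg 3 * .reg 3)) ;;
  .asg 25 (.reg 25 / .reg 3)

/-- The term for `EmbeddingCondition`. -/
def embeddingTerm : Term :=
  .eq (.get (.reg 40)) (.lit 0) * .le (.eq (.reg 17) (.reg 18)) (.eq (.reg 41) (.reg 42)) +
  .get (.reg 40) * (.get (.reg 17 * .reg 3 + .reg 18) *
    .eq (.get (.reg 19 + (.reg 17 * .reg 3 + .reg 18))) (.get (.reg 19 + .reg 40)))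

/-- Check one pair of vertices. -/
def checkDigitsStmt : Stmt :=
  .asg 41 (.reg 40 / .reg 3) ;;
  .asg 42 (.reg 40 - .reg 41 * .reg 3) ;;
  .asg 17 (.arr 0 (.reg 41)) ;;
  .asg 18 (.arr 0 (.reg 42)) ;;
  .asg 15 (.reg 15 * embeddingTerm) ;;
  .asg 16 (.reg 16 * .le (.get (.reg 40) * (.reg 17 + .reg 18)) (.lit 2))

/-- Process the map with number `reg 23`: count the embeddings in register 8, and determine the
largest weight of a labeling in register 7. -/
def enumerateStmt : Stmt :=
  (.asg 25 (.reg 23) ;; .asg 14 (.lit 0) ;; .loop 33 3 (.lit 1) digitStmt) ;;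
  (.asg 15 (.lit 1) ;; .asg 16 (.lit 1) ;; .loop 40 19 (.lit 1) checkDigitsStmt) ;;
  .asg 8 (.reg 8 + .reg 15) ;;
  .ite (.reg 16 * .lt (.reg 7) (.reg 14)) (.asg 7 (.reg 14)) .skip

/-- Numbers below `h ^ h`, written in base `h`, enumerate the maps from the vertices of `H` to
themselves; this is the value of map number `z` at vertex `i`. -/
def digit (h z i : ℕ) : ℕ := z / h ^ i % h

variable {n : ℕ} {X : InputGraph n} {h : ℕ} {H : SimpleGraph (Fin h)} {cH : Sym2 (Fin h) → ℕ}
  {w : ℕ} {M : ℕ}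

variable (H cH) in
/-- The condition on the pair `(i, j)` for the map `f` to be an embedding of `H` into itself. -/
def EmbeddingCondition (f : ℕ → ℕ) (i j : ℕ) : Prop :=
  if adjCode H i j = 0 then i = j ∨ f i ≠ f j
  else adjCode H (f i) (f j) = 1 ∧ colCode H cH (f i) (f j) = colCode H cH i j

theorem digit_lt (hh : 0 < h) (z i : ℕ) : digit h z i < h := Nat.mod_lt _ hh

/-- Array `0` holds `f`. -/
def HoldsMap (h : ℕ) (f : ℕ → ℕ) (k : ℕ) (s : Config) : Prop :=
  ∀ j < k, s.mem (2 * (h * h) + (8 * j + 0)) = f j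

/-- The remainder is computed as the difference to the rounded multiple, for lack of a modulus
instruction. Register 14 collects the sum of the digits, the weight of the map if it is a labeling.
-/
theorem always_digits (hR : Room n h M w) (hh : 0 < h) {s : Config} (he : Env X H cH w s) :
    Always X w (.asg 25 (.reg 23) ;; .asg 14 (.lit 0) ;; .loop 33 3 (.lit 1) digitStmt) s fun s' =>
      HoldsMap h (digit h (s.reg 23)) h s' ∧
      s'.reg 14 = ∑ i ∈ Finset.range h, digit h (s.reg 23) i ∧ SameTables h s s' := by
  obtain ⟨hw1, hw2, hw0⟩ := hR.facts
  refine always_seq.2 (always_asg_of he.bounded (by simp) fun t₁ hb₁ => ?_)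
  refine always_seq.2 (always_asg_of hb₁.bump (by simp) fun t₂ hb₂ => ?_)
  refine always_loop (fun k s' => s'.reg 25 = s.reg 23 / h ^ k ∧
      s'.reg 14 = ∑ i ∈ Finset.range k, digit h (s.reg 23) i ∧
      HoldsMap h (digit h (s.reg 23)) k s' ∧ SameTables h s s') hb₂.bump
    (by decide) (by decide) (by decide) (fun _ _ _ h => h) (by simp [HoldsMap, SameTables]) ?_ ?_
  · intro k s₁ hk hb hk' ⟨h25, h14, hd, hm⟩ hfr _
    simp only [Config.reg_bump, Config.reg_upd, he.r3] at hk
    norm_num at hk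
    have g3 : s₁.reg 3 = h := (hfr 3 (by decide)).trans (by simp [he.r3])
    have g5 : s₁.reg 5 = 2 * (h * h) := (hfr 5 (by decide)).trans (by simp [he.r5])
    have hdig : s₁.reg 25 - s₁.reg 25 / h * h = digit h (s.reg 23) k := by
      rw [h25, digit, Nat.mod_eq_sub_div_mul]
    have hsum : (∑ i ∈ Finset.range k, digit h (s.reg 23) i) + digit h (s.reg 23) k ≤ h * h := by
      rw [← Finset.sum_range_succ]
      calc _ ≤ ∑ i ∈ Finset.range (k + 1), h :=
            Finset.sum_le_sum fun i _ => (digit_lt hh _ _).le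
        _ = (k + 1) * h := by simp
        _ ≤ h * h := Nat.mul_le_mul_right _ hk
    have hfit : s₁.reg 25 / h * h < 2 ^ w := (Nat.div_mul_le_self _ _).trans_lt (hb.1 25)
    refine always_seq.2 (always_sto_of hb (by simp [g5, hk']; omega) (by simp [g3, hfit])
      fun t₁ hb₁ => ?_)
    refine always_seq.2 (always_asg_of hb₁.bump ?_ fun t₂ hb₂ => ?_)
    · simp only [Term.fits_add, Term.fits_reg, Term.fits_sub, Term.fits_mul, Term.fits_div,
        Term.exact_reg, Term.exact_sub, Term.exact_mul, Term.exact_div, Config.reg_bump,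
        Config.reg_put, g3, hdig, h14, hfit]
      simp only [true_and, and_true]
      omega
    refine always_asg_of hb₂.bump (by simp) fun t₃ hb₃ => ?_
    refine ⟨?_, ?_, ?_, ?_⟩
    · simp [g3, h25, Nat.div_div_eq_div_mul, pow_succ]
    · simp [g3, h14, hdig, Finset.sum_range_succ]
    · intro j hj
      simp [g5, g3, hk', hdig]
      rcases Nat.lt_succ_iff_lt_or_eq.1 hj with hj | rfl
      · rw [if_neg (by omega)]; exact hd j hj
      · simp
    · refine hm.trans ?_
      simp only [Term.exact_addr, Term.exact_reg, g5, hk']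
      exact SameTables.put (k := 0) (by omega)
  · intro k s₁ hk hb hk' ⟨h25, h14, hd, hm⟩ hfr hdone
    simp only [Config.reg_bump, Config.reg_upd, he.r3] at hdone
    norm_num at hdone
    have : k = h := by
      rcases hdone with h | h
      · exact h
      · simp [Term.val, hw0] at h
    subst this
    exact ⟨hd, h14, hm⟩

open Classical in
theorem embeddingTerm_spec (hR : Room n h M w) {s : Config} (he : Env X H cH w s) {f : ℕ → ℕ}
    {i j : ℕ} (hi : i < h) (hj : j < h) (hfi : f i < h) (hfj : f j < h)
    (h40 : s.reg 40 = i * h + j) (h41 : s.reg 41 = i)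
    (h42 : s.reg 42 = j) (h17 : s.reg 17 = f i) (h18 : s.reg 18 = f j) :
    embeddingTerm.Fits w s ∧
      embeddingTerm.exact s = if EmbeddingCondition H cH f i j then 1 else 0 := by
  obtain ⟨hw1, hw2, hw0⟩ := hR.facts
  have hij := mul_add_lt hi hj
  have hfij := mul_add_lt hfi hfj
  have hadj := he.adj i hi j hj
  have hcol := he.col i hi j hj
  have hadj' := he.adj _ hfi _ hfj
  have hcol' := he.col _ hfi _ hfj
  have hle := adjCode_le_one (H := H) i j
  have hle' := adjCode_le_one (H := H) (f i) (f j)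
  constructor
  · simp only [embeddingTerm, Term.fits_add, Term.fits_mul, Term.fits_eq, Term.fits_get,
      Term.fits_reg, Term.fits_lit, Term.fits_le, Term.exact_add, Term.exact_mul, Term.exact_eq,
      Term.exact_get, Term.exact_reg, Term.exact_lit, Term.exact_le, h40, h41, h42, h17, h18,
      he.r3, he.r19, hadj, hcol, hadj', hcol', true_and, and_true]
    have hmul : ∀ {a b : ℕ}, a ≤ 1 → b ≤ 1 → a * b ≤ 1 := fun ha hb => Nat.mul_le_mul ha hb
    have hite : ∀ (p : Prop) [Decidable p], (if p then 1 else 0) ≤ 1 := fun p _ => by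
      split <;> omega
    have hone : 1 + 1 < 2 ^ w := by omega
    and_intros
    all_goals first
      | omega
      | exact (Nat.le_succ_of_le (hmul (hite _) (hite _))).trans_lt hone
      | exact (Nat.le_succ_of_le (hmul hle' (hite _))).trans_lt hone
      | exact (Nat.le_succ_of_le (hmul hle (hmul hle' (hite _)))).trans_lt hone
      | exact (Nat.add_le_add (hmul (hite _) (hite _))
          (hmul hle (hmul hle' (hite _)))).trans_lt hone
  · simp only [embeddingTerm, Term.exact_add, Term.exact_mul, Term.exact_eq, Term.exact_get,
      Term.exact_reg, Term.exact_lit, Term.exact_le, h40, h41, h42, h17, h18,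
      he.r3, he.r19, hadj, hcol, hadj', hcol']
    rw [EmbeddingCondition]
    by_cases h0 : adjCode H i j = 0
    · simp only [h0, if_true]
      by_cases h1 : i = j <;> by_cases h2 : f i = f j <;> simp [h1, h2]
    · rw [adjCode_ne_zero.1 h0]
      by_cases h1 : adjCode H (f i) (f j) = 0
      · simp [h1]
      · simp [adjCode_ne_zero.1 h1]

end SubgraphCounting

/-! ### Checking one map of the enumeration -/

namespace SubgraphCounting

open scoped ENNReal

variable {n : ℕ} {X : InputGraph n} {h : ℕ} {H : SimpleGraph (Fin h)} {cH : Sym2 (Fin h) → ℕ}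
  {w : ℕ} {M : ℕ}

theorem ite_mul_ite_of_iff {p q r : Prop} [Decidable p] [Decidable q] [Decidable r]
    (h : r ↔ p ∧ q) :
    (if p then 1 else 0) * (if q then 1 else 0) = if r then 1 else 0 := by
  simp only [h]
  split_ifs <;> simp_all

theorem forall_pair_succ {i j k : ℕ} (hi : i < k) (hj : j < k) (P : ℕ → ℕ → Prop) :
    (∀ a < k, ∀ b < k, a * k + b < i * k + j + 1 → P a b) ↔
      (∀ a < k, ∀ b < k, a * k + b < i * k + j → P a b) ∧ P i j := by
  refine ⟨fun hP => ⟨fun a ha b hb hlt => hP a ha b hb (by omega), hP i hi j hj (by omega)⟩, ?_⟩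
  rintro ⟨hP, hij⟩ a ha b hb hlt
  rcases Nat.lt_succ_iff_lt_or_eq.1 hlt with hlt | heq
  · exact hP a ha b hb hlt
  · obtain ⟨rfl, rfl⟩ := eq_of_key_eq hb hj heq
    exact hij

open Classical in
theorem always_checkDigits (hR : Room n h M w) (hh : 0 < h) {s : Config} (he : Env X H cH w s)
    {f : ℕ → ℕ} (hf : ∀ i, f i < h) (hm : HoldsMap h f h s) :
    Always X w (.asg 15 (.lit 1) ;; .asg 16 (.lit 1) ;; .loop 40 19 (.lit 1) checkDigitsStmt) s
      fun s' =>
      (s'.reg 15 = if ∀ i < h, ∀ j < h, EmbeddingCondition H cH f i j then 1 else 0) ∧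
      (s'.reg 16 = if ∀ i < h, ∀ j < h, adjCode H i j * (f i + f j) ≤ 2 then 1 else 0) := by
  obtain ⟨hw1, hw2, hw0⟩ := hR.facts
  refine always_seq.2 (always_asg_of he.bounded (by simp [hw0]) fun t₁ hb₁ => ?_)
  refine always_seq.2 (always_asg_of hb₁.bump (by simp [hw0]) fun t₂ hb₂ => ?_)
  refine always_loop (fun k s' =>
      (s'.reg 15 = if ∀ i < h, ∀ j < h, i * h + j < k → EmbeddingCondition H cH f i j then 1 else 0) ∧
      (s'.reg 16 = if ∀ i < h, ∀ j < h, i * h + j < k → adjCode H i j * (f i + f j) ≤ 2 then 1 else 0) ∧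
      s'.mem = s.mem) hb₂.bump
    (by decide) (by decide) (by decide) (fun _ _ _ h => h) (by simp) ?_ ?_
  · intro k s₁ hk hb hk' ⟨h15, h16, h4⟩ hfr _
    simp only [Config.reg_bump, Config.reg_upd, he.r19] at hk
    norm_num at hk
    have hreg : ∀ r ∉ [15, 16, 17, 18, 40, 41, 42], s₁.reg r = s.reg r := by
      intro r hr
      simp only [List.mem_cons, not_or] at hr
      rw [hfr r (by simp [Stmt.writes, checkDigitsStmt, hr])]
      simp [hr]
    have hm₁ : SameTables h s s₁ := SameTables.of_mem h4
    have he₁ : Env X H cH w s₁ := he.congr hb (hreg _ (by decide))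
      (hreg _ (by decide)) (hreg _ (by decide))
      (hreg _ (by decide)) (hreg _ (by decide)) hm₁
    obtain ⟨i, j, hi, hj, rfl⟩ : ∃ i j, i < h ∧ j < h ∧ k = i * h + j :=
      ⟨k / h, k % h, (Nat.div_lt_iff_lt_mul hh).2 hk, Nat.mod_lt _ hh, (Nat.div_add_mod' k h).symm⟩
    have hdiv : (i * h + j) / h = i := by
      rw [mul_comm, Nat.mul_add_div hh, Nat.div_eq_of_lt hj, add_zero]
    have ci0 : s₁.mem (2 * (h * h) + (8 * i + 0)) = f i := by rw [h4]; exact hm i hi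
    have cj0 : s₁.mem (2 * (h * h) + (8 * j + 0)) = f j := by rw [h4]; exact hm j hj
    refine always_seq.2 (always_asg_of hb (by simp) fun u₁ hd₁ => ?_)
    have e1 : (Term.reg 40 / .reg 3).exact s₁ = i := by simp [hk', he₁.r3, hdiv]
    rw [e1] at hd₁ ⊢
    have he₂ := (he₁.upd hd₁ (by decide)).bump u₁
    refine always_seq.2 (always_asg_of hd₁.bump ?_ fun u₂ hd₂ => ?_)
    · simp [he₁.r3]; omega
    have e2 : (Term.reg 40 - .reg 41 * .reg 3).exact ((s₁.upd 41 i).bump u₁) = j := by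
      simp [hk', he₁.r3]
    rw [e2] at hd₂ ⊢
    replace he₂ := (he₂.upd hd₂ (by decide)).bump u₂
    refine always_seq.2 (always_asg_of hd₂.bump ?_ fun u₃ hd₃ => ?_)
    · simp [he₁.r5]; omega
    rw [show (Term.arr 0 (.reg 41)).exact ((((s₁.upd 41 i).bump u₁).upd 42 j).bump u₂) = f i by
      simpa [he₁.r5] using ci0] at hd₃ ⊢
    replace he₂ := (he₂.upd hd₃ (by decide)).bump u₃
    refine always_seq.2 (always_asg_of hd₃.bump ?_ fun u₄ hd₄ => ?_)
    · simp [he₁.r5]; omega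
    rw [show (Term.arr 0 (.reg 42)).exact ((((((s₁.upd 41 i).bump u₁).upd 42 j).bump u₂).upd 17
      (f i)).bump u₃) = f j by simpa [he₁.r5] using cj0] at hd₄ ⊢
    replace he₂ := (he₂.upd hd₄ (by decide)).bump u₄
    obtain ⟨pf, pe⟩ := embeddingTerm_spec (f := f) hR he₂ hi hj (hf i) (hf j) (by simp [hk'])
      (by simp) (by simp) (by simp) (by simp)
    set s₂ := ((((((((s₁.upd 41 i).bump u₁).upd 42 j).bump u₂).upd 17
      (f i)).bump u₃).upd 18 (f j)).bump u₄) with hs₂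
    have e15 : (Term.reg 15 * embeddingTerm).exact s₂ = if ∀ a < h, ∀ b < h, a * h + b < i * h + j + 1 →
        EmbeddingCondition H cH f a b then 1 else 0 := by
      rw [Term.exact_mul, pe, Term.exact_reg, show s₂.reg 15 = s₁.reg 15 by simp [s₂], h15]
      exact ite_mul_ite_of_iff (forall_pair_succ hi hj _)
    refine always_seq.2 (always_asg_of hd₄.bump ?_ fun u₅ hd₅ => ?_)
    · rw [Term.exact_mul] at e15
      simp only [Term.fits_mul, Term.fits_reg, pf, true_and, e15]
      split_ifs <;> omega
    rw [e15] at hd₅ ⊢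
    have g40 : s₂.reg 40 = i * h + j := by simp [s₂, hk']
    have g16 : s₂.reg 16 = s₁.reg 16 := by simp [s₂]
    have gm : s₂.mem (i * h + j) = adjCode H i j := he₂.adj i hi j hj
    have g17 : s₂.reg 17 = f i := by simp [s₂]
    have g18 : s₂.reg 18 = f j := by simp [s₂]
    have hle := adjCode_le_one (H := H) i j
    have hfi := hf i
    have hfj := hf j
    have hmul : adjCode H i j * (f i + f j) ≤ 1 * (f i + f j) := Nat.mul_le_mul_right _ hle
    set v := if ∀ a < h, ∀ b < h, a * h + b < i * h + j + 1 → EmbeddingCondition H cH f a b then 1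
      else 0 with hv
    have k16 : ((s₂.upd 15 v).bump u₅).reg 16 = s₁.reg 16 := by simp [g16]
    have k40 : ((s₂.upd 15 v).bump u₅).reg 40 = i * h + j := by simp [g40]
    have k17 : ((s₂.upd 15 v).bump u₅).reg 17 = f i := by simp [g17]
    have k18 : ((s₂.upd 15 v).bump u₅).reg 18 = f j := by simp [g18]
    have e16 : (Term.reg 16 * .le (.get (.reg 40) * (.reg 17 + .reg 18)) (.lit 2)).exact
        ((s₂.upd 15 v).bump u₅) =
        if ∀ a < h, ∀ b < h, a * h + b < i * h + j + 1 → adjCode H a b * (f a + f b) ≤ 2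
          then 1 else 0 := by
      simp only [Term.exact_mul, Term.exact_reg, Term.exact_le, Term.exact_add, Term.exact_get,
        Term.exact_lit, k16, k40, k17, k18, Config.mem_bump, Config.mem_upd, gm, h16]
      exact ite_mul_ite_of_iff (forall_pair_succ hi hj fun a b => adjCode H a b * (f a + f b) ≤ 2)
    refine always_asg_of hd₅.bump ?_ fun u₆ hd₆ => ?_
    · rw [Term.exact_mul] at e16
      refine Term.fits_mul.2 ⟨trivial, ?_, by rw [e16]; split_ifs <;> omega⟩
      simp only [Term.fits_mul, Term.fits_reg, true_and, Term.fits_le, Term.fits_get,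
        Term.fits_add, Term.fits_lit, Term.exact_reg, Term.exact_add, Term.exact_get,
        Config.mem_bump, Config.mem_upd, k40, gm, k17, k18]
      refine ⟨?_, ⟨?_, ?_⟩, ?_⟩ <;> omega
    rw [e16]
    refine ⟨?_, ?_, ?_⟩
    · simp [hv]
    · simp
    · simp [s₂, h4]
  · intro k s₁ hk hb hk' ⟨h0, h1, h4⟩ hfr hdone
    simp only [Config.reg_bump, Config.reg_upd, he.r19] at hdone
    norm_num at hdone
    have : k = h * h := by
      rcases hdone with h | h
      · exact h
      · simp [Term.val, hw0] at h
    subst this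
    have hall : ∀ P : ℕ → ℕ → Prop, (∀ i < h, ∀ j < h, i * h + j < h * h → P i j) ↔
        ∀ i < h, ∀ j < h, P i j := fun P => forall₄_congr fun i hi j hj => by simp [mul_add_lt hi hj]
    exact ⟨h0.trans (if_congr (hall _) rfl rfl), h1.trans (if_congr (hall _) rfl rfl)⟩

end SubgraphCounting

/-! ### Automorphisms and labelings by exhaustive search -/

namespace SubgraphCounting

open scoped ENNReal

variable {n : ℕ} {X : InputGraph n} {h : ℕ} {H : SimpleGraph (Fin h)} {cH : Sym2 (Fin h) → ℕ}
  {w : ℕ} {M : ℕ}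

variable (H cH) in
/-- The map with number `z` is an embedding of `H` into itself. -/
def EncodesEmbedding (z : ℕ) : Prop :=
  ∀ i < h, ∀ j < h, EmbeddingCondition H cH (digit h z) i j

variable (H) in
/-- The map with number `z` is a labeling. -/
def EncodesLabeling (z : ℕ) : Prop :=
  ∀ i < h, ∀ j < h, adjCode H i j * (digit h z i + digit h z j) ≤ 2

variable (H) in
open Classical in
/-- The weight of the labeling with number `z`. -/
noncomputable def encodedWeight (z : ℕ) : ℕ :=
  if EncodesLabeling H z then ∑ i ∈ Finset.range h, digit h z i else 0

/-- Injectivity needs an explicit test only at pairs that are not adjacent: adjacent vertices have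
adjacent, hence distinct, images. -/
theorem embeddingCondition_coe (f : Fin h → Fin h) {g : ℕ → ℕ} (hg : ∀ i : Fin h, g i = f i) :
    (∀ i < h, ∀ j < h, EmbeddingCondition H cH g i j) ↔ IsColorEmbedding H cH H cH f := by
  classical
  have key : ∀ i j : Fin h, EmbeddingCondition H cH g i j ↔
      if H.Adj i j then H.Adj (f i) (f j) ∧ cH s(f i, f j) = cH s(i, j) else i = j ∨ f i ≠ f j := by
    intro i j
    rw [EmbeddingCondition, adjCode_coe, hg, hg, adjCode_coe]
    by_cases hij : H.Adj i j
    · simp only [hij, if_true, one_ne_zero, if_false]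
      by_cases hf : H.Adj (f i) (f j)
      · rw [colCode_coe hij, colCode_coe hf]; simp [hf]
      · simp [hf]
    · simp [hij, Fin.ext_iff]
  constructor
  · intro hE
    have hE' := fun i j : Fin h => (key i j).1 (hE i i.2 j j.2)
    refine ⟨fun i j hij => ?_, fun i j hij => by simpa [hij] using hE' i j⟩
    by_contra hne
    have := hE' i j
    by_cases hadj : H.Adj i j
    · rw [if_pos hadj, hij] at this
      exact this.1.ne rfl
    · rw [if_neg hadj] at this
      tauto
  · intro hf i hi j hj
    refine (key ⟨i, hi⟩ ⟨j, hj⟩).2 ?_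
    split_ifs with hij
    · exact hf.2 _ _ hij
    · by_cases h1 : (⟨i, hi⟩ : Fin h) = ⟨j, hj⟩
      · exact Or.inl h1
      · exact Or.inr fun h2 => h1 (hf.1 h2)

theorem digit_eq (z : Fin (h ^ h)) (i : Fin h) :
    digit h z i = (finFunctionFinEquiv.symm z i : ℕ) := by
  rw [finFunctionFinEquiv_symm_apply_val]
  rfl

open Classical in
theorem card_encodesEmbedding : ((Finset.range (h ^ h)).filter (EncodesEmbedding H cH)).card =
    (colorEmbeddings H cH H cH).card := by
  symm
  refine Finset.card_bij (fun f _ => (finFunctionFinEquiv f : ℕ)) ?_ ?_ ?_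
  · intro f hf
    simp only [colorEmbeddings, Finset.mem_filter, Finset.mem_univ, true_and] at hf
    rw [Finset.mem_filter, Finset.mem_range]
    refine ⟨Fin.is_lt _, (embeddingCondition_coe f fun i => ?_).2 hf⟩
    rw [digit_eq, Equiv.symm_apply_apply]
  · intro f _ f' _ hff
    exact finFunctionFinEquiv.injective (Fin.ext hff)
  · intro z hz
    rw [Finset.mem_filter, Finset.mem_range] at hz
    refine ⟨finFunctionFinEquiv.symm ⟨z, hz.1⟩, ?_, by simp⟩
    simp only [colorEmbeddings, Finset.mem_filter, Finset.mem_univ, true_and]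
    exact (embeddingCondition_coe _ fun i => digit_eq ⟨z, hz.1⟩ i).1 hz.2

theorem encodesLabeling_iff (f : Fin h → Fin h) {z : ℕ} (hg : ∀ i : Fin h, digit h z i = f i) :
    EncodesLabeling H z ↔ IsLabeling H fun a => (f a : ℕ) := by
  classical
  constructor
  · intro hE i j hij
    have := hE i i.2 j j.2
    rw [adjCode_coe, if_pos hij, hg, hg] at this
    simpa using this
  · intro hf i hi j hj
    have := hf ⟨i, hi⟩ ⟨j, hj⟩
    have e1 := adjCode_coe (H := H) ⟨i, hi⟩ ⟨j, hj⟩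
    simp only at e1
    rw [e1, hg ⟨i, hi⟩, hg ⟨j, hj⟩]
    split_ifs with hij
    · simpa using this hij
    · simp

theorem sup_encodedWeight : (Finset.range (h ^ h)).sup (encodedWeight H) = labelWeight H := by
  classical
  refine le_antisymm (Finset.sup_le fun z hz => ?_) (Finset.sup_le fun f hf => ?_)
  · rw [Finset.mem_range] at hz
    rw [encodedWeight]
    split_ifs with hl
    · have hg := digit_eq (h := h) ⟨z, hz⟩
      rw [Finset.sum_range, labelWeight]
      simp only at hg
      simp only [hg]
      refine Finset.le_sup (f := fun f : Fin h → Fin h => ∑ a, (f a : ℕ)) ?_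
      rw [Finset.mem_filter]
      exact ⟨Finset.mem_univ _, (encodesLabeling_iff _ hg).1 hl⟩
    · exact Nat.zero_le _
  · rw [Finset.mem_filter] at hf
    have hg : ∀ i : Fin h, digit h (finFunctionFinEquiv f : ℕ) i = f i := fun i => by
      rw [digit_eq, Equiv.symm_apply_apply]
    refine le_trans ?_ (Finset.le_sup (f := encodedWeight H)
      (Finset.mem_range.2 (finFunctionFinEquiv f).2))
    rw [encodedWeight, if_pos ((encodesLabeling_iff f hg).2 hf.2), Finset.sum_range]
    simp only [hg, le_refl]

open Classical in
theorem always_enumerate (hR : Room n h M w) (hh : 0 < h) {s : Config} (he : Env X H cH w s)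
    (h8 : s.reg 8 + 1 < 2 ^ w) :
    Always X w enumerateStmt s fun s' =>
      (s'.reg 8 = s.reg 8 + if EncodesEmbedding H cH (s.reg 23) then 1 else 0) ∧
      s'.reg 7 = max (s.reg 7) (encodedWeight H (s.reg 23)) ∧ SameTables h s s' := by
  obtain ⟨hw1, hw2, hw0⟩ := hR.facts
  refine always_seq.2 (((always_digits hR hh he).frame he.bounded).mono ?_)
  rintro s₁ ⟨⟨hm, h14, hs₁⟩, hb₁, hreg₁, -⟩
  have he₁ : Env X H cH w s₁ := he.congr hb₁ (hreg₁ _ (by decide)) (hreg₁ _ (by decide))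
    (hreg₁ _ (by decide)) (hreg₁ _ (by decide)) (hreg₁ _ (by decide)) hs₁
  refine always_seq.2 (((always_checkDigits hR hh he₁ (digit_lt hh _) hm).frame hb₁).mono ?_)
  rintro s₂ ⟨⟨h15, h16⟩, hb₂, hreg₂, hmem₂⟩
  have e8 : s₂.reg 8 = s.reg 8 := (hreg₂ 8 (by decide)).trans (hreg₁ 8 (by decide))
  have e7 : s₂.reg 7 = s.reg 7 := (hreg₂ 7 (by decide)).trans (hreg₁ 7 (by decide))
  have e14 : s₂.reg 14 = _ := (hreg₂ 14 (by decide)).trans h14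
  have hs₂ : SameTables h s s₂ := hs₁.trans (SameTables.of_mem (hmem₂ (by decide)))
  refine always_seq.2 (always_asg_of hb₂ ?_ fun t hb₃ => ?_)
  · simp only [Term.fits_add, Term.fits_reg, Term.exact_reg, e8, h15, true_and]
    split_ifs <;> omega
  replace h15 : s₂.reg 15 = if EncodesEmbedding H cH (s.reg 23) then 1 else 0 :=
    h15.trans (if_congr Iff.rfl rfl rfl)
  replace h16 : s₂.reg 16 = if EncodesLabeling H (s.reg 23) then 1 else 0 :=
    h16.trans (if_congr Iff.rfl rfl rfl)
  set s₃ := (s₂.upd 8 ((Term.reg 8 + .reg 15).exact s₂)).bump t with hs₃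
  have g8 : s₃.reg 8 = s.reg 8 + if EncodesEmbedding H cH (s.reg 23) then 1 else 0 := by
    simp [s₃, e8, h15]
  have g7 : s₃.reg 7 = s.reg 7 := by simp [s₃, e7]
  have g14 : s₃.reg 14 = ∑ i ∈ Finset.range h, digit h (s.reg 23) i := by simp [s₃, e14]
  have g16 : s₃.reg 16 = if EncodesLabeling H (s.reg 23) then 1 else 0 := by simp [s₃, h16]
  have hv : (Term.reg 16 * .lt (.reg 7) (.reg 14)).val w s₃ =
      if EncodesLabeling H (s.reg 23) ∧ s.reg 7 < ∑ i ∈ Finset.range h, digit h (s.reg 23) i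
        then 1 else 0 := by
    have e : (Term.reg 16 * .lt (.reg 7) (.reg 14)).exact s₃ =
        if EncodesLabeling H (s.reg 23) ∧ s.reg 7 < ∑ i ∈ Finset.range h, digit h (s.reg 23) i
          then 1 else 0 := by
      simp only [Term.exact_mul, Term.exact_reg, Term.exact_lt, g16, g7, g14]
      exact ite_mul_ite_of_iff Iff.rfl
    rw [Term.val_eq_exact, e]
    refine Term.fits_mul.2 ⟨trivial, Term.fits_lt.2 ⟨by omega, trivial, trivial⟩, ?_⟩
    rw [Term.exact_mul] at e
    rw [e]
    split_ifs <;> omega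
  refine always_ite.2 ?_
  rw [hv]
  by_cases hc : EncodesLabeling H (s.reg 23) ∧ s.reg 7 < ∑ i ∈ Finset.range h, digit h (s.reg 23) i
  · rw [if_pos hc, if_neg one_ne_zero]
    refine always_asg_of hb₃.bump.bump (by simp) fun t' _ => ⟨?_, ?_, ?_⟩
    · simpa using g8
    · rw [encodedWeight, if_pos hc.1, max_eq_right hc.2.le]
      simpa using g14
    · exact hs₂
  · rw [if_neg hc, if_pos rfl]
    refine always_skip.2 ⟨g8, ?_, hs₂⟩
    rw [Config.reg_bump, g7, encodedWeight]
    split_ifs with hl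
    · rw [max_eq_left]
      by_contra hlt
      exact hc ⟨hl, by omega⟩
    · simp

/-- Exhaustive search takes time that depends on `h` only. It lets one program serve all `H`: the
number of automorphisms and the exponent in the rejection constant are computed, not supplied. -/
theorem always_enumerateAll (hR : Room n h M w) (hh : 0 < h) {s : Config} (he : Env X H cH w s)
    (h20 : s.reg 20 = h ^ h) :
    Always X w (.asg 8 (.lit 0) ;; .asg 7 (.lit 0) ;; .loop 23 20 (.lit 1) enumerateStmt) s
      fun s' => s'.reg 8 = (colorEmbeddings H cH H cH).card ∧ s'.reg 7 = labelWeight H ∧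
        SameTables h s s' := by
  classical
  obtain ⟨hw1, hw2, hw0⟩ := hR.facts
  have hlt := he.bounded.1 20
  refine always_seq.2 (always_asg_of he.bounded (by simp) fun t₁ hb₁ => ?_)
  refine always_seq.2 (always_asg_of hb₁.bump (by simp) fun t₂ hb₂ => ?_)
  refine always_loop (fun k s' =>
      s'.reg 8 = ((Finset.range k).filter (EncodesEmbedding H cH)).card ∧
      s'.reg 7 = (Finset.range k).sup (encodedWeight H) ∧ SameTables h s s') hb₂.bump
    (by decide) (by decide) (by decide) (fun _ _ _ h => h) (by simp [SameTables]) ?_ ?_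
  · intro k s₁ hk hb hk' ⟨h8, h7, hm⟩ hfr _
    simp only [Config.reg_bump, Config.reg_upd] at hk
    norm_num [h20] at hk
    have he₁ : Env X H cH w s₁ := he.congr hb ((hfr _ (by decide)).trans (by simp))
      ((hfr _ (by decide)).trans (by simp)) ((hfr _ (by decide)).trans (by simp))
      ((hfr _ (by decide)).trans (by simp)) ((hfr _ (by decide)).trans (by simp)) hm
    have hcard : s₁.reg 8 ≤ k := by
      rw [h8]; exact (Finset.card_filter_le _ _).trans (by simp)
    refine (always_enumerate hR hh he₁ (by omega)).mono ?_
    rintro s₂ ⟨j8, j7, jm⟩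
    rw [hk'] at j8 j7
    refine ⟨?_, ?_, hm.trans jm⟩
    · simp [j8, h8, card_filter_range_succ]
    · simp [j7, h7, Finset.range_add_one, max_comm]
  · intro k s₁ hk hb hk' ⟨h8, h7, hm⟩ hfr hdone
    simp only [Config.reg_bump, Config.reg_upd] at hdone
    norm_num [h20] at hdone
    have : k = h ^ h := by
      rcases hdone with h | h
      · exact h
      · simp [Term.val, hw0] at h
    subst this
    exact ⟨by rw [h8, card_encodesEmbedding], by rw [h7, sup_encodedWeight], hm⟩

end SubgraphCounting

/-! ### Logarithms and powers on the machine -/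

namespace SubgraphCounting

open scoped ENNReal

variable {n : ℕ} {X : InputGraph n} {h : ℕ} {H : SimpleGraph (Fin h)} {cH : Sym2 (Fin h) → ℕ}
  {w : ℕ} {M : ℕ}

theorem Always.cost {c : Stmt} {s : Config} {Q : Config → Prop} (hA : Always X w c s Q) (β : ℕ → ℕ)
    (hb : ∀ b ∈ c.bounds, b ∉ c.writes) (hβ : ∀ b ∈ c.bounds, s.reg b ≤ β b) :
    Always X w c s fun s' => Q s' ∧ s'.pc ≤ s.pc + c.cost β := hA.and (sem_cost c s hb hβ)

/-- Double register `d` as long as `e` is nonzero, and count in register `i`. -/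
def doublingStmt (i b d : ℕ) (e : Term) : Stmt :=
  .asg d (.lit 1) ;; .loop i b e (.asg d (.reg d + .reg d))

/-- The register that formally bounds the loop may be as large as `n`, but the guard ends the loop
after `N` rounds. Therefore the time is read off the final counter by `loop_clock`; `sem_cost` would
charge the full bound. -/
theorem always_doubling {i b d : ℕ} {e : Term} {s : Config} {N : ℕ} (hs : s.Bounded w)
    (hid : i ≠ d) (hbd : b ≠ d) (hib : i ≠ b) (hN : N ≤ s.reg b) (hw : 2 ^ N < 2 ^ w)
    (he : ∀ (k : ℕ) (s₁ : Config), k ≤ N → s₁.reg d = 2 ^ k →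
      (∀ r, r ≠ i → r ≠ d → s₁.reg r = s.reg r) → (e.val w s₁ = 0 ↔ k = N)) :
    Always X w (doublingStmt i b d e) s fun s' => (s'.reg i = N ∧ s'.reg d = 2 ^ N) ∧
      s'.pc ≤ s.pc + (N + 1) * (e.size + 30) := by
  have h1 : 1 < 2 ^ w := lt_of_le_of_lt Nat.one_le_two_pow hw
  refine always_seq.2 (always_asg_iff hs |>.2 ?_)
  have hv : (Term.lit 1).val w s = 1 := Nat.mod_eq_of_lt h1
  rw [hv]
  have hb₁ : (s.upd d 1).Bounded w := hs.upd h1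
  have hcl := loop_clock (X := X) (i := i) (b := b) (e := e) (c := .asg d (.reg d + .reg d))
    (hb₁.bump (k := (Term.lit 1).size + 2)) 7
    (by simpa [Stmt.writes] using hid) (by simpa [Stmt.writes] using hbd) hib
    (fun s₁ _ s' hs' => by
      simp only [sem, PMF.support_pure, Set.mem_singleton_iff] at hs'
      subst hs'
      exact Nat.le_refl _)
  refine Always.mono (Always.and (Q := fun s' => s'.reg i = N ∧ s'.reg d = 2 ^ N) ?_ hcl) ?_
  · refine always_loop (fun k s' => k ≤ N ∧ s'.reg d = 2 ^ k) hb₁.bump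
      (by simpa [Stmt.writes] using hid) (by simpa [Stmt.writes] using hbd) hib
      (fun _ _ _ h => h) (by simp [hid.symm]) ?_ ?_
    · rintro k s₁ hk hb hk' ⟨hkN, hd⟩ hfr hne
      have hlt : k < N := lt_of_le_of_ne hkN fun hc => hne <| (he k s₁ hkN hd (fun r h1 h2 => by
        rw [hfr r (by simp [Stmt.writes, h1, h2])]; simp [h2])).2 hc
      have hpow : 2 ^ k + 2 ^ k ≤ 2 ^ N := by
        rw [← two_mul, ← pow_succ']
        exact Nat.pow_le_pow_right (by norm_num) hlt
      refine always_asg_of hb (by simp [hd]; omega) fun t _ => ⟨hlt, ?_⟩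
      rw [Config.reg_set, if_neg hid.symm]
      simp [hd, pow_succ, mul_two]
    · rintro k s₁ hk hb hk' ⟨hkN, hd⟩ hfr hdone
      have : k = N := by
        rcases hdone with h | h
        · refine le_antisymm hkN ?_
          rw [h, Config.reg_bump, Config.reg_upd, if_neg hbd]
          exact hN
        · exact (he k s₁ hkN hd (fun r h1 h2 => by
            rw [hfr r (by simp [Stmt.writes, h1, h2])]; simp [h2])).1 h
      subst this
      exact ⟨hk', hd⟩
  · rintro s' ⟨⟨h2, h3⟩, h4⟩
    refine ⟨⟨h2, h3⟩, h4.trans ?_⟩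
    rw [h2]
    simp only [Config.pc_bump, Config.pc_upd, Term.size]
    nlinarith

theorem always_mulPow {i b d x : ℕ} {s : Config} (hs : s.Bounded w)
    (hid : i ≠ d) (hbd : b ≠ d) (hib : i ≠ b) (hxi : x ≠ i) (hxd : x ≠ d) (hx : 0 < s.reg x)
    (hw : s.reg d * s.reg x ^ s.reg b < 2 ^ w) (hw1 : 1 < 2 ^ w) :
    Always X w (.loop i b (.lit 1) (.asg d (.reg d * .reg x))) s fun s' =>
      s'.reg d = s.reg d * s.reg x ^ s.reg b := by
  refine always_loop (fun k s' => s'.reg d = s.reg d * s.reg x ^ k) hs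
    (by simpa [Stmt.writes] using hid) (by simpa [Stmt.writes] using hbd) hib
    (fun _ _ _ h => h) (by simp [hid.symm]) ?_ ?_
  · rintro k s₁ hk hb hk' hd hfr hne
    have hxs : s₁.reg x = s.reg x := hfr x (by simp [Stmt.writes, hxi, hxd])
    have hle : s₁.reg d * s₁.reg x ≤ s.reg d * s.reg x ^ s.reg b := by
      rw [hd, hxs, mul_assoc, ← pow_succ]
      exact Nat.mul_le_mul_left _ (Nat.pow_le_pow_right hx hk)
    refine always_asg_of hb (by simpa using lt_of_le_of_lt hle hw) fun t _ => ?_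
    rw [Config.reg_set, if_neg hid.symm]
    simp [hd, hxs, pow_succ, mul_assoc]
  · rintro k s₁ hk hb hk' hd hfr hdone
    have : k = s.reg b := by
      rcases hdone with h | h
      · exact h
      · rw [Term.val_one hw1] at h; omega
    rw [hd, this]

end SubgraphCounting

/-! ### The parameters of the estimator and their computation -/

namespace SubgraphCounting

open scoped ENNReal

/-- The side of the square in which the darts are embedded. -/
def side (m : ℕ) : ℕ := 2 ^ Nat.clog 4 (2 * m)

/-- The denominator of the acceptance probability of a trial. -/
noncomputable def denominator {h : ℕ} (H : SimpleGraph (Fin h)) (m : ℕ) : ℕ :=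
  h ^ h * side m ^ labelWeight H

/-- The number of successes at which the trials end. -/
def target (A ℓ r : ℕ) : ℕ := A * (ℓ * (r * r))

/-- Compute the parameters. -/
def setupStmt (A : ℕ) : Stmt :=
  doublingStmt 4 0 21 (.reg 0 - .reg 21) ;;
  doublingStmt 22 1 6 (.lit 2 * .reg 1 - .reg 6 * .reg 6) ;;
  (.asg 19 (.reg 3 * .reg 3) ;; .asg 5 (.lit 2 * .reg 19) ;; .asg 20 (.lit 1) ;;
    .loop 24 3 (.lit 1) (.asg 20 (.reg 20 * .reg 3))) ;;
  (.asg 8 (.lit 0) ;; .asg 7 (.lit 0) ;; .loop 23 20 (.lit 1) enumerateStmt) ;;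
  (.asg 9 (.reg 20) ;; .loop 24 7 (.lit 1) (.asg 9 (.reg 9 * .reg 6))) ;;
  .asg 10 (.lit A * (.reg 4 * (.reg 2 * .reg 2))) ;;
  .asg 11 (.lit 2 * (.reg 10 * .reg 9)) ;;
  .asg 27 (.reg 1 * (.lit A * .reg 4))

section log

theorem two_mul_le_side_mul_side (m : ℕ) : 2 * m ≤ side m * side m := by
  rw [side, ← mul_pow]
  exact Nat.le_pow_clog (by norm_num) _

/-- The square of `side m` is the first power of 4 that reaches `2m`, so a quarter of it is still
below `2m`. -/
theorem side_mul_side_lt {m : ℕ} (hm : 0 < m) : side m * side m < 8 * m := by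
  rw [side, ← mul_pow]
  have h1 := Nat.pow_pred_clog_lt_self (b := 4) (by norm_num) (x := 2 * m) (by omega)
  have h2 : 0 < Nat.clog 4 (2 * m) := Nat.clog_pos (by norm_num) (by omega)
  obtain ⟨k, hk⟩ := Nat.exists_eq_add_one.2 h2
  rw [hk] at h1 ⊢
  simp only [Nat.pred_eq_sub_one, Nat.add_sub_cancel] at h1
  norm_num [pow_succ] at h1 ⊢
  omega

theorem clog_two_le {n : ℕ} : Nat.clog 2 n ≤ n :=
  (Nat.clog_le_iff_le_pow (by norm_num)).2 Nat.lt_two_pow_self.le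

theorem clog_four_le {m : ℕ} (hm : 0 < m) : Nat.clog 4 (2 * m) ≤ m := by
  rw [Nat.clog_le_iff_le_pow (by norm_num)]
  obtain ⟨k, rfl⟩ := Nat.exists_eq_add_one.2 hm
  induction k with
  | zero => norm_num
  | succ k ih => have := ih (by omega); rw [pow_succ]; omega

theorem clog_four_le_clog_two {n m : ℕ} (hm : 2 * m ≤ n * n) :
    Nat.clog 4 (2 * m) ≤ Nat.clog 2 n := by
  rw [Nat.clog_le_iff_le_pow (by norm_num)]
  refine hm.trans ?_
  rw [show (4 : ℕ) = 2 * 2 by norm_num, mul_pow]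
  have := Nat.le_pow_clog (b := 2) (by norm_num) n
  exact Nat.mul_le_mul this this

theorem two_pow_clog_lt {n : ℕ} (hn : 2 ≤ n) : 2 ^ Nat.clog 2 n < 2 * n := by
  have h1 := Nat.pow_pred_clog_lt_self (b := 2) (by norm_num) (x := n) (by omega)
  have h2 : 0 < Nat.clog 2 n := Nat.clog_pos (by norm_num) (by omega)
  obtain ⟨k, hk⟩ := Nat.exists_eq_add_one.2 h2
  rw [hk] at h1 ⊢
  simp only [Nat.pred_eq_sub_one, Nat.add_sub_cancel] at h1
  rw [pow_succ]
  omega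

end log

variable {n : ℕ} {X : InputGraph n} {h : ℕ} {H : SimpleGraph (Fin h)} {cH : Sym2 (Fin h) → ℕ}
  {w : ℕ} {A r : ℕ}

theorem InputGraph.two_le_of_edgeSet_nonempty (X : InputGraph n)
    (hX : X.graph.edgeSet.Nonempty) : 2 ≤ n := by
  have hm := X.numEdges_pos hX
  have hmn := X.two_mul_numEdges_le
  by_contra hc
  have : n ≤ 1 := by omega
  have : n * n ≤ 1 * 1 := Nat.mul_le_mul this this
  omega

variable (X H w A r) in
/-- The words are long enough for the computation of the parameters. -/
structure Capacity : Prop where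
  trials : 2 * (target A (Nat.clog 2 n) r * denominator H X.numEdges) * h ^ h < 2 ^ w
  probes : X.numEdges * (A * Nat.clog 2 n) < 2 ^ w
  room : Room n h (denominator H X.numEdges) w

variable (X H cH w A r) in
/-- The parameters have been computed. -/
structure Ready (s₀ s : Config) : Prop where
  env : Env X H cH w s
  automorphisms : s.reg 8 = (colorEmbeddings H cH H cH).card
  denom : s.reg 9 = denominator H X.numEdges
  target : s.reg 10 = target A (Nat.clog 2 n) r
  trials : s.reg 11 = 2 * (SubgraphCounting.target A (Nat.clog 2 n) r * denominator H X.numEdges)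
  probes : s.reg 27 = X.numEdges * (A * Nat.clog 2 n)
  tables : SameTables h s₀ s

variable (X H cH w r) in
/-- The machine is in an initial configuration. -/
structure Initial (s : Config) : Prop where
  bounded : s.Bounded w
  r0 : s.reg 0 = n
  r1 : s.reg 1 = X.numEdges
  r2 : s.reg 2 = r
  r3 : s.reg 3 = h
  adj : ∀ i < h, ∀ j < h, s.mem (i * h + j) = adjCode H i j
  col : ∀ i < h, ∀ j < h, s.mem (h * h + (i * h + j)) = colCode H cH i j

theorem denominator_pos {m : ℕ} (hh : 0 < h) : 0 < denominator H m :=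
  Nat.mul_pos (pow_pos hh _) (pow_pos (pow_pos two_pos _) _)

theorem Capacity.facts (hC : Capacity X H w A r) (hA : 0 < A) (hh : 0 < h) (hr : 0 < r)
    (hn : 2 ≤ n) (hm : 0 < X.numEdges) :
    A < 2 ^ w ∧ r * r < 2 ^ w ∧ Nat.clog 2 n * (r * r) < 2 ^ w ∧
    target A (Nat.clog 2 n) r < 2 ^ w ∧
    target A (Nat.clog 2 n) r * denominator H X.numEdges < 2 ^ w ∧
    2 * (target A (Nat.clog 2 n) r * denominator H X.numEdges) < 2 ^ w ∧
    A * Nat.clog 2 n < 2 ^ w ∧ h ^ h < 2 ^ w ∧ denominator H X.numEdges < 2 ^ w := by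
  have hl : 0 < Nat.clog 2 n := Nat.clog_pos (by norm_num) hn
  have hD := denominator_pos (H := H) (m := X.numEdges) hh
  have hp : 0 < h ^ h := pow_pos hh _
  have hrr : 0 < r * r := Nat.mul_pos hr hr
  have t1 := hC.trials
  have t0 := hC.probes
  have htp : 0 < target A (Nat.clog 2 n) r := Nat.mul_pos hA (Nat.mul_pos hl hrr)
  have htd := Nat.mul_pos htp hD
  have e1 := Nat.le_mul_of_pos_right
    (2 * (target A (Nat.clog 2 n) r * denominator H X.numEdges)) hp
  have e2 := Nat.le_mul_of_pos_right (target A (Nat.clog 2 n) r) hD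
  have e2' := Nat.le_mul_of_pos_left (denominator H X.numEdges) htp
  have e3 : Nat.clog 2 n * (r * r) ≤ target A (Nat.clog 2 n) r := Nat.le_mul_of_pos_left _ hA
  have e4 : r * r ≤ Nat.clog 2 n * (r * r) := Nat.le_mul_of_pos_left _ hl
  have e5 : A ≤ target A (Nat.clog 2 n) r := Nat.le_mul_of_pos_right _ (Nat.mul_pos hl hrr)
  have e6 : A * Nat.clog 2 n ≤ X.numEdges * (A * Nat.clog 2 n) := Nat.le_mul_of_pos_left _ hm
  have e7 : h ^ h ≤ denominator H X.numEdges :=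
    Nat.le_mul_of_pos_right _ (pow_pos (pow_pos two_pos _) _)
  refine ⟨?_, ?_, ?_, ?_, ?_, ?_, ?_, ?_, ?_⟩ <;> omega

/-- The constant in the running time of `setupStmt`. -/
def setupCost (A h : ℕ) : ℕ :=
  (setupStmt A).cost (fun b => if b = 3 then h else if b = 19 ∨ b = 7 then h * h else
    if b = 20 then h ^ h else 0) + 200

/-- The two doubling loops take time linear in `log n`; everything else takes time that depends on
`H` and `A` only. -/
theorem always_setup (hC : Capacity X H w A r) (hA : 0 < A) (hh : 0 < h) (hr : 0 < r)
    (hX : X.graph.edgeSet.Nonempty) {s : Config}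
    (hs : Initial X H cH w r s) :
    Always X w (setupStmt A) s fun s' => Ready X H cH w A r s s' ∧
      s'.pc ≤ s.pc + setupCost A h * (Nat.clog 2 n + 1) := by
  obtain ⟨hw1, hw2, hw0⟩ := hC.room.facts
  have hm := X.numEdges_pos hX
  have hmn := X.two_mul_numEdges_le
  have hn := X.two_le_of_edgeSet_nonempty hX
  obtain ⟨f1, f2, f3, f4, f5, f6, f7, f8, f9⟩ := hC.facts hA hh hr hn hm
  have hsq := hC.room.sq
  have f10 := hC.probes
  set β : ℕ → ℕ := fun b => if b = 3 then h else if b = 19 ∨ b = 7 then h * h else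
    if b = 20 then h ^ h else 0 with hβ
  set ℓ := Nat.clog 2 n with hℓ
  have hpl : 2 ^ ℓ < 2 * n := two_pow_clog_lt hn
  have hnn : n ≤ n * n := Nat.le_mul_of_pos_left _ (by omega)
  -- the two logarithms
  refine always_seq.2 (((always_doubling hs.bounded (i := 4) (b := 0) (d := 21) (N := ℓ)
    (by decide) (by decide) (by decide) (by rw [hs.r0]; exact clog_two_le) (by omega)
    fun k s₁ hk hd hfr => ?_).frame hs.bounded).mono ?_)
  · have e0 : s₁.reg 0 = n := (hfr 0 (by decide) (by decide)).trans hs.r0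
    rw [Term.val_eq_exact _ (by simp)]
    simp only [Term.exact_sub, Term.exact_reg, hd, e0]
    -- The truncated difference vanishes exactly from `2 ^ k ≥ n` on, and for `k ≤ ℓ` this means `k
    -- = ℓ`.
    rw [Nat.sub_eq_zero_iff_le, ← Nat.clog_le_iff_le_pow (by norm_num)]
    omega
  rintro s₁ ⟨⟨⟨g4, -⟩, p₁⟩, hb₁, fr₁, hm₁⟩
  replace hm₁ := hm₁ rfl
  have hss := two_mul_le_side_mul_side X.numEdges
  have hss' := side_mul_side_lt hm
  have hsp : 0 < side X.numEdges := pow_pos two_pos _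
  refine always_seq.2 (((always_doubling hb₁ (i := 22) (b := 1) (d := 6)
    (N := Nat.clog 4 (2 * X.numEdges))
    (by decide) (by decide) (by decide) ?_ ?_
    fun k s₂ hk hd hfr => ?_).frame hb₁).mono ?_)
  · rw [fr₁ 1 (by decide), hs.r1]; exact clog_four_le hm
  · have : side X.numEdges ≤ side X.numEdges * side X.numEdges := Nat.le_mul_of_pos_left _ hsp
    rw [← side]
    omega
  · have e1 : s₂.reg 1 = X.numEdges :=
      (hfr 1 (by decide) (by decide)).trans ((fr₁ 1 (by decide)).trans hs.r1)
    have hle : 2 ^ k * 2 ^ k ≤ side X.numEdges * side X.numEdges := by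
      have : 2 ^ k ≤ side X.numEdges := Nat.pow_le_pow_right (by norm_num) hk
      exact Nat.mul_le_mul this this
    rw [Term.val_eq_exact _ (by simp [hd, e1]; omega)]
    simp only [Term.exact_sub, Term.exact_reg, Term.exact_mul, Term.exact_lit, hd, e1]
    rw [Nat.sub_eq_zero_iff_le, ← mul_pow, show 2 * 2 = 4 by norm_num,
      ← Nat.clog_le_iff_le_pow (by norm_num)]
    omega
  rintro s₂ ⟨⟨⟨-, g6⟩, p₂⟩, hb₂, fr₂, hm₂⟩
  replace hm₂ := hm₂ rfl
  rw [← side] at g6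
  have r3₂ : s₂.reg 3 = h := (fr₂ 3 (by decide)).trans ((fr₁ 3 (by decide)).trans hs.r3)
  -- `h ^ 2` and `h ^ h`
  refine always_seq.2 ((Always.frame (Always.cost
    (Q := fun s' => s'.reg 19 = h * h ∧ s'.reg 5 = 2 * (h * h) ∧ s'.reg 20 = h ^ h)
    ?_ β (by decide) (by simp [Stmt.bounds, β, r3₂])) hb₂).mono ?_)
  · refine always_seq.2 (always_asg_of hb₂ (by simp [r3₂]; omega) fun t₁ hb₃ => ?_)
    refine always_seq.2 (always_asg_of hb₃.bump (by simp [r3₂]; omega) fun t₂ hb₄ => ?_)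
    refine always_seq.2 (always_asg_of hb₄.bump (by simp [hw0]) fun t₃ hb₅ => ?_)
    refine ((always_mulPow hb₅.bump (by decide) (by decide) (by decide) (by decide) (by decide)
      (by simpa [r3₂] using hh) (by simpa [r3₂] using f8) (by omega)).frame hb₅.bump).mono ?_
    rintro s' ⟨h1, -, h2, -⟩
    refine ⟨?_, ?_, ?_⟩
    · rw [h2 19 (by decide)]; simp [r3₂]
    · rw [h2 5 (by decide)]; simp [r3₂]
    · rw [h1]; simp [r3₂]
  rintro s₃ ⟨⟨⟨g19, g5, g20⟩, p₃⟩, hb₃, fr₃, hm₃⟩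
  replace hm₃ := hm₃ rfl
  have he₃ : Env X H cH w s₃ := by
    have hmem : s₃.mem = s.mem := hm₃.trans (hm₂.trans hm₁)
    exact
      { bounded := hb₃
        r0 := by rw [fr₃ 0 (by decide), fr₂ 0 (by decide), fr₁ 0 (by decide), hs.r0]
        r1 := by rw [fr₃ 1 (by decide), fr₂ 1 (by decide), fr₁ 1 (by decide), hs.r1]
        r3 := by rw [fr₃ 3 (by decide), r3₂]
        r5 := g5
        r19 := g19
        adj := by rw [hmem]; exact hs.adj
        col := by rw [hmem]; exact hs.col }
  -- enumeration
  refine always_seq.2 ((((always_enumerateAll hC.room hh he₃ g20).cost β (by decide)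
    (by simp [Stmt.bounds, enumerateStmt, digitStmt, checkDigitsStmt, β, g20, g19, he₃.r3])).frame
      hb₃).mono ?_)
  rintro s₄ ⟨⟨⟨g8, g7, ht₄⟩, p₄⟩, hb₄, fr₄, -⟩
  have he₄ : Env X H cH w s₄ := he₃.congr hb₄ (fr₄ _ (by decide)) (fr₄ _ (by decide))
    (fr₄ _ (by decide)) (fr₄ _ (by decide)) (fr₄ _ (by decide)) ht₄
  have g6₄ : s₄.reg 6 = side X.numEdges := by rw [fr₄ 6 (by decide), fr₃ 6 (by decide), g6]
  have g20₄ : s₄.reg 20 = h ^ h := by rw [fr₄ 20 (by decide), g20]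
  have g4₄ : s₄.reg 4 = ℓ := by
    rw [fr₄ 4 (by decide), fr₃ 4 (by decide), fr₂ 4 (by decide), g4]
  have g2₄ : s₄.reg 2 = r := by
    rw [fr₄ 2 (by decide), fr₃ 2 (by decide), fr₂ 2 (by decide), fr₁ 2 (by decide), hs.r2]
  -- the denominator
  refine always_seq.2 ((Always.frame (Always.cost
    (Q := fun s' => s'.reg 9 = denominator H X.numEdges)
    ?_ β (by decide) (by simpa [Stmt.bounds, β, g7] using labelWeight_le_sq)) hb₄).mono ?_)
  · refine always_seq.2 (always_asg_of hb₄ (by simp) fun t₁ hb₅ => ?_)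
    refine (always_mulPow hb₅.bump (by decide) (by decide) (by decide) (by decide) (by decide)
      (by simpa [g6₄] using hsp) (by simpa [g6₄, g7, g20₄, denominator] using f9) (by omega)).mono ?_
    intro s' h1
    rw [h1]
    simp [g6₄, g7, g20₄, denominator]
  rintro s₅ ⟨⟨g9, p₅⟩, hb₅, fr₅, hm₅⟩
  replace hm₅ := hm₅ rfl
  have g4₅ : s₅.reg 4 = ℓ := by rw [fr₅ 4 (by decide), g4₄]
  have g2₅ : s₅.reg 2 = r := by rw [fr₅ 2 (by decide), g2₄]
  have g1₅ : s₅.reg 1 = X.numEdges := by rw [fr₅ 1 (by decide), he₄.r1]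
  -- the remaining parameters
  refine ((Always.frame (Always.cost
    (Q := fun s' => s'.reg 10 = target A ℓ r ∧
      s'.reg 11 = 2 * (target A ℓ r * denominator H X.numEdges) ∧
      s'.reg 27 = X.numEdges * (A * ℓ))
    ?_ β (by simp [Stmt.bounds]) (by simp [Stmt.bounds])) hb₅).mono ?_)
  · refine always_seq.2 (always_asg_of hb₅ ?_ fun t₁ hb₆ => ?_)
    · simp only [Term.fits_mul, Term.fits_lit, Term.fits_reg, Term.exact_mul, Term.exact_lit,
        Term.exact_reg, g4₅, g2₅, true_and]
      exact ⟨f1, ⟨f2, f3⟩, f4⟩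
    refine always_seq.2 (always_asg_of hb₆.bump ?_ fun t₂ hb₇ => ?_)
    · simp only [Term.fits_mul, Term.fits_lit, Term.fits_reg, Term.exact_mul, Term.exact_lit,
        Term.exact_reg, true_and, Config.reg_bump, Config.reg_upd, g4₅, g2₅, g9]
      exact ⟨by omega, f5, f6⟩
    refine always_asg_of hb₇.bump ?_ fun t₃ hb₈ => ?_
    · simp only [Term.fits_mul, Term.fits_lit, Term.fits_reg, Term.exact_mul, Term.exact_lit,
        Term.exact_reg, true_and, Config.reg_bump, Config.reg_upd, g4₅, g1₅]
      exact ⟨⟨f1, f7⟩, f10⟩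
    simp [g4₅, g2₅, g9, g1₅, target]
  rintro s₆ ⟨⟨⟨g10, g11, g27⟩, p₆⟩, hb₆, fr₆, hm₆⟩
  replace hm₆ := hm₆ rfl
  refine ⟨⟨?_, ?_, ?_, g10, g11, g27, ?_⟩, ?_⟩
  · have hf : ∀ q ∈ [0, 1, 3, 5, 19], s₆.reg q = s₄.reg q := fun q hq => by
      rw [fr₆ q (by revert q; simp [Stmt.writes]), fr₅ q (by revert q; decide)]
    exact he₄.congr hb₆ (hf _ (by decide)) (hf _ (by decide)) (hf _ (by decide))
      (hf _ (by decide)) (hf _ (by decide)) (SameTables.of_mem (hm₆.trans hm₅))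
  · rw [fr₆ 8 (by simp [Stmt.writes]), fr₅ 8 (by decide), g8]
  · rw [fr₆ 9 (by simp [Stmt.writes]), g9]
  · exact (SameTables.of_mem (hm₃.trans (hm₂.trans hm₁))).trans
      (ht₄.trans (SameTables.of_mem (hm₆.trans hm₅)))
  · have hle := clog_four_le_clog_two hmn
    have p₂' : s₂.pc ≤ s₁.pc + (ℓ + 1) * ((Term.lit 2 * .reg 1 - .reg 6 * .reg 6).size + 30) :=
      p₂.trans (Nat.add_le_add_left (Nat.mul_le_mul_right _ (by omega)) _)
    rw [show (Term.lit 2 * .reg 1 - .reg 6 * .reg 6).size = 10 from rfl] at p₂'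
    rw [show (Term.reg 0 - Term.reg 21).size = 5 from rfl] at p₁
    have key : ∀ u : ℕ, u ≤ u * (ℓ + 1) := fun u => Nat.le_mul_of_pos_right _ (by omega)
    have e : setupCost A h * (ℓ + 1) = (setupStmt A).cost β * (ℓ + 1) + 200 * (ℓ + 1) := by
      rw [setupCost, add_mul]
    have e2 := key ((setupStmt A).cost β)
    rw [e]
    refine le_trans ?_ (Nat.add_le_add_left (Nat.add_le_add_right e2 _) _)
    rw [setupStmt]
    simp only [Stmt.cost] at p₃ p₄ p₅ p₆ ⊢
    omega

end SubgraphCounting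

/-! ### Repeated trials -/

namespace SubgraphCounting

open scoped ENNReal

variable {n : ℕ} {X : InputGraph n} {h : ℕ} {H : SimpleGraph (Fin h)} {cH : Sym2 (Fin h) → ℕ}
  {w : ℕ} {A r M : ℕ}

theorem refines_branch {Y : Type*} {μ : PMF Y} {Q : Y → Config → Prop} {e : Term} {c d : Stmt}
    {s : Config} (h0 : e.val w s = 0 → Refines (sem X w d (s.bump (e.size + 1))) μ Q)
    (h1 : e.val w s ≠ 0 → Refines (sem X w c (s.bump (e.size + 1))) μ fun y s' => Q y (s'.bump 2)) :
    Refines (sem X w (.ite e c d) s) μ Q := by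
  rw [sem]
  split
  · exact h0 ‹_›
  · exact (h1 ‹_›).map_config fun _ _ hy => hy

/-- One trial, counting the successes in register 12. -/
def Access.roundStmt (𝒜 : Access) : Stmt := 𝒜.trialStmt ;; .asg 12 (.reg 12 + .reg 38)

/-- Trials until the target in register 10 is reached, at most as many as register `b` tells. -/
def Access.roundsStmt (𝒜 : Access) (i b : ℕ) : Stmt :=
  .loop i b (.reg 10 - .reg 12) 𝒜.roundStmt

/-- Bounds of the loops that depend on `H` only. -/
def smallBounds (h b : ℕ) : ℕ := if b = 3 then h else if b = 19 then h * h else 0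

/-- The time for one trial. -/
def Access.roundCost (𝒜 : Access) (h : ℕ) : ℕ := 𝒜.roundStmt.cost (smallBounds h) + 30

/-- The guard vanishes exactly when the target is reached. Time must be proportional to the trials
actually made and not to the limit in register `b`, so it is bounded through the final counter. -/
theorem refines_rounds {𝒜 : Access} {I : Config → Prop} (hA : 𝒜.Correct X H cH w I)
    (hR : Room n h M w) (hX : X.graph.edgeSet.Nonempty) {s : Config} (he : Env X H cH w s)
    (hI : I s) (hM : s.reg 9 = M) {i b : ℕ} (hi : i ∉ accessRegs)
    (hi' : i ∉ [0, 1, 5, 3, 19, 9, 10, 12, 15, 33, 34, 35, 36, 37, 38, 39, 40, 41, 42])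
    (hb : b ∉ accessRegs)
    (hb' : b ∉ [12, 15, 33, 34, 35, 36, 37, 38, 39, 40, 41, 42]) (hib : i ≠ b)
    (hbd : ∀ a ∈ 𝒜.roundStmt.bounds, a = 3 ∨ a = 19) :
    Refines (sem X w (𝒜.roundsStmt i b) s)
      (countSuccesses (trial X H cH M) (s.reg 10) (s.reg b) 0 (s.reg 12)) fun q s' =>
      s'.reg 12 = q.2 ∧ SameTables h s s' ∧ s'.reg i = q.1 ∧ s'.Bounded w ∧
      (∀ a ∉ accessRegs, a ∉ [12, 15, 33, 34, 35, 36, 37, 38, 39, 40, 41, 42] → a ≠ i →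
        s'.reg a = s.reg a) ∧ s'.pc ≤ s.pc + (q.1 + 1) * 𝒜.roundCost h := by
  obtain ⟨hw1, hw2, hw0⟩ := hR.facts
  have hwr : ∀ a ∉ accessRegs, a ∉ [12, 15, 33, 34, 35, 36, 37, 38, 39, 40, 41, 42] →
      a ∉ 𝒜.roundStmt.writes := by
    intro a h1 h2
    rw [List.mem_cons, not_or] at h2
    have := hA.notMem_trialStmt h1 h2.2
    simp [Access.roundStmt, Stmt.writes, this, h2.1]
  have hsub : ∀ a, a ∉ [0, 1, 5, 3, 19, 9, 10, 12, 15, 33, 34, 35, 36, 37, 38, 39, 40, 41, 42] →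
      a ∉ [12, 15, 33, 34, 35, 36, 37, 38, 39, 40, 41, 42] := by
    intro a h1 h2
    exact h1 (by simp only [List.mem_cons] at h2 ⊢; tauto)
  have hiw := hwr i hi (hsub i hi')
  have hbw := hwr b hb hb'
  have hfix : ∀ a ∉ accessRegs, a ∉ [12, 15, 33, 34, 35, 36, 37, 38, 39, 40, 41, 42] → a ≠ i →
      a ∉ (𝒜.roundsStmt i b).writes := by
    intro a h1 h2 h3
    have := hwr a h1 h2
    simp [Access.roundsStmt, Stmt.writes, this, h3]
  have hne : ∀ a ∈ [0, 1, 5, 3, 19, 9, 10], a ≠ i := by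
    rintro a ha rfl
    exact hi' (by simp only [List.mem_cons] at ha ⊢; tauto)
  have hfix' : ∀ a ∈ [0, 1, 5, 3, 19, 9, 10], a ∉ (𝒜.roundsStmt i b).writes := fun a ha =>
    hfix a (by revert a; decide) (by revert a; decide) (hne a ha)
  have hbds : ∀ a ∈ 𝒜.roundStmt.bounds, a ∉ 𝒜.roundStmt.writes := by
    intro a ha
    rcases hbd a ha with rfl | rfl
    · exact hwr 3 (by decide) (by decide)
    · exact hwr 19 (by decide) (by decide)
  have hclock := loop_clock (X := X) (e := .reg 10 - .reg 12) he.bounded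
    (𝒜.roundStmt.cost (smallBounds h)) hiw hbw hib fun s₁ hfr s' hs' => by
      refine sem_cost (β := smallBounds h) _ s₁ hbds (fun a ha => ?_) s' hs'
      rcases hbd a ha with rfl | rfl
      · rw [hfr 3 (hfix' 3 (by decide)), he.r3]; exact le_refl _
      · rw [hfr 19 (hfix' 19 (by decide)), he.r19]; exact le_refl _
  have hloop := refines_loop (X := X) (w := w) (c := 𝒜.roundStmt) (s := s) (i := i) (b := b)
    (e := .reg 10 - .reg 12) (f := fun _ x => (trial X H cH M).map fun b => x + b.toNat)
    (halt := fun x => s.reg 10 ≤ x) (y₀ := s.reg 12)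
    (fun _ x s' => s'.reg 12 = x ∧ SameTables h s s') he.bounded hiw
    (fun _ _ _ _ h => h) ?_ ?_ ?_
  · refine (hloop.and_support hclock).mono ?_
    rintro q s' ⟨⟨⟨h1, h2⟩, h3, h4, h5⟩, h6⟩
    refine ⟨h1, h2, h3, h4, fun a k1 k2 k3 => h5 a (hfix a k1 k2 k3), h6.trans ?_⟩
    rw [h3, Access.roundCost, show (Term.reg 10 - Term.reg 12).size = 5 from rfl]
    nlinarith
  · refine ⟨?_, SameTables.of_mem rfl⟩
    rw [Config.reg_set, if_neg]
    rintro rfl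
    simp at hi'
  · rintro k y s₁ ⟨h1, -⟩ hfr
    rw [Term.val_eq_exact _ (by simp)]
    simp only [Term.exact_sub, Term.exact_reg, h1, hfr 10 (hfix' 10 (by decide))]
    rw [Nat.sub_eq_zero_iff_le]
  · rintro k y s₁ hk hb₁ hk' ⟨h1, hm⟩ hfr hst
    have he₁ : Env X H cH w s₁ := he.congr hb₁ (hfr _ (hfix' _ (by decide)))
      (hfr _ (hfix' _ (by decide))) (hfr _ (hfix' _ (by decide))) (hfr _ (hfix' _ (by decide)))
      (hfr _ (hfix' _ (by decide))) hm
    have hI₁ : I s₁ := hA.invariant s s₁ hI (hfr _ (hfix' _ (by decide)))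
      (hfr _ (hfix' _ (by decide))) (hfr _ (hfix' _ (by decide))) hm
    have hM₁ : s₁.reg 9 = M := (hfr _ (hfix' _ (by decide))).trans hM
    refine Refines.map (refines_seq_always ((refines_trial hA hR hX he₁ hI₁ hM₁).frame hb₁) ?_)
    rintro t s₂ ⟨⟨h38, hm₂⟩, hb₂, hfr₂, -⟩
    have h12 : s₂.reg 12 = y := by
      rw [hfr₂ 12 (hA.notMem_trialStmt (by decide) (by decide)), h1]
    have hlt := hb₁.1 10
    rw [hfr 10 (hfix' 10 (by decide))] at hlt
    have ht := t.toNat_le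
    refine always_asg_of hb₂ (by simp [h12, h38]; omega) fun u _ => ⟨?_, hm.trans hm₂⟩
    have : 12 ≠ i := by rintro rfl; simp at hi'
    rw [Config.reg_set, if_neg this]
    simp [h12, h38]

end SubgraphCounting

/-! ### Two phases: trials with queries, then trials on the stored graph -/

namespace SubgraphCounting

open scoped ENNReal

variable {n : ℕ} {X : InputGraph n} {h : ℕ} {H : SimpleGraph (Fin h)} {cH : Sym2 (Fin h) → ℕ}
  {w : ℕ} {A r M : ℕ}

variable (X) in
open Classical in
/-- The second phase: collect all edges, then continue the trials without queries. The outcome is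
the number of trials and of successes, or `none` if an edge was missed. -/
noncomputable def continueOffline (μ : PMF Bool) (τ k t t₁ x : ℕ) : PMF (Option (ℕ × ℕ)) :=
  (X.collect k 0 ∅).bind fun q => if q.2 = X.darts then
    (countSuccesses μ τ t 0 x).map fun p => some (t₁ + p.1, p.2) else PMF.pure none

variable (X) in
open Classical in
/-- The number of trials and of successes, or `none` if an edge was missed. -/
noncomputable def estimate (μ : PMF Bool) (τ m k t : ℕ) : PMF (Option (ℕ × ℕ)) :=
  (countSuccesses μ τ m 0 0).bind fun q => if τ ≤ q.2 then PMF.pure (some q) else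
    continueOffline X μ τ k (t - q.1) q.1 q.2

/-- The second phase. -/
def continueStmt : Stmt :=
  collectStmt ;; .asg 29 (.reg 11 - .reg 13) ;; offlineAccess.roundsStmt 26 29

/-- The trials. -/
def searchStmt : Stmt :=
  .asg 12 (.lit 0) ;; onlineAccess.roundsStmt 13 1 ;;
  .ite (.reg 10 - .reg 12) continueStmt (.asg 26 (.lit 0))

/-- The whole program. -/
def mainStmt (A : ℕ) : Stmt :=
  setupStmt A ;; searchStmt ;; .asg 0 (.reg 12 * .reg 9) ;; .asg 1 ((.reg 13 + .reg 26) * .reg 8)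

theorem tables_empty_of_sameTables {s₀ s : Config} (hm : SameTables h s₀ s)
    (h0 : ∀ a, 2 * (h * h) ≤ a → s₀.mem a = 0) : Tables X (2 * (h * h)) ∅ s.mem := by
  refine tables_empty fun a ha ⟨x, k, h3, h8, hk⟩ => ?_
  rw [hm a fun x' k' hk' => by omega, h0 a ha]

theorem Env.of_low {s s' : Config} (he : Env X H cH w s) (hb : s'.Bounded w)
    (h0 : s'.reg 0 = s.reg 0) (h1 : s'.reg 1 = s.reg 1) (h3 : s'.reg 3 = s.reg 3)
    (h5 : s'.reg 5 = s.reg 5) (h19 : s'.reg 19 = s.reg 19)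
    (hm : ∀ a < 2 * (h * h), s'.mem a = s.mem a) : Env X H cH w s' where
  bounded := hb
  r0 := h0.trans he.r0
  r1 := h1.trans he.r1
  r3 := h3.trans he.r3
  r5 := h5.trans he.r5
  r19 := h19.trans he.r19
  adj := fun i hi j hj => by
    have := mul_add_lt hi hj
    rw [hm _ (by omega), he.adj i hi j hj]
  col := fun i hi j hj => by
    have := mul_add_lt hi hj
    rw [hm _ (by omega), he.col i hi j hj]

/-- The time for one sample. -/
def sampleCost : ℕ := recordStmt.cost (fun _ => 0) + 30

theorem collectStmt_clock {s : Config} :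
    ∀ s' ∈ (sem X w collectStmt s).support, s'.pc ≤ s.pc + (s.reg 27 + 1) * sampleCost := by
  intro s' hs'
  refine (sem_cost (β := fun a => if a = 27 then s.reg 27 else 0) collectStmt s (by decide)
    (by
      intro b hb
      rw [show collectStmt.bounds = [27] from rfl, List.mem_singleton] at hb
      rw [hb, if_pos rfl]) s' hs').trans ?_
  have : recordStmt.cost (fun a => if a = 27 then s.reg 27 else 0) = recordStmt.cost fun _ => 0 :=
    rfl
  simp only [collectStmt, Stmt.cost, Stmt.size, this, sampleCost, if_true, Term.size]
  nlinarith

/-- If an edge was missed the abstract outcome is `none`, about which nothing is claimed. Otherwise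
the trials make no queries, so the queries are bounded by the time of the collection alone. -/
theorem refines_continue (hR : Room n h M w) (hX : X.graph.edgeSet.Nonempty)
    (hc : ∀ e ∈ X.graph.edgeSet, X.color e < 2 ^ w) {s : Config} (he : Env X H cH w s)
    (hT : Tables X (2 * (h * h)) ∅ s.mem) (hM : s.reg 9 = M) :
    Refines (sem X w continueStmt s)
      (continueOffline X (trial X H cH M) (s.reg 10) (s.reg 27) (s.reg 11 - s.reg 13) (s.reg 13)
        (s.reg 12)) fun y s' => ∀ t x, y = some (t, x) →
      s'.Bounded w ∧ s'.reg 12 = x ∧ s'.reg 13 = s.reg 13 ∧ s.reg 13 + s'.reg 26 = t ∧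
      s'.reg 9 = M ∧ s'.reg 8 = s.reg 8 ∧
      s'.pc ≤ s.pc + (s.reg 27 + 1) * sampleCost + 10 +
        (s'.reg 26 + 1) * offlineAccess.roundCost h ∧
      s'.queries ≤ s.queries + (s.reg 27 + 1) * sampleCost := by
  classical
  refine refines_seq (((((refines_collect hR hX hc he.bounded he.r0 he.r5 hT).frame
    he.bounded).and_support collectStmt_clock).and_support (sem_queries_le collectStmt s))) ?_
  rintro q s₁ ⟨⟨⟨⟨hT₁, hlow⟩, hb₁, hfr₁, -⟩, hp₁⟩, hq₁⟩
  by_cases hd : q.2 = X.darts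
  swap
  · rw [if_neg hd]
    exact refines_pure fun s' _ t x hy => by simp at hy
  rw [if_pos hd]
  rw [hd] at hT₁
  refine refines_always_seq (Q := fun s₂ => s₂.Bounded w ∧
    s₂.reg 29 = s.reg 11 - s.reg 13 ∧ (∀ a ∉ 29 :: collectStmt.writes, s₂.reg a = s.reg a) ∧
    s₂.mem = s₁.mem ∧ s₂.queries = s₁.queries ∧ s₂.pc = s₁.pc + 7) ?_ ?_
  · rw [always_asg_iff hb₁, Term.val_eq_exact _ (by simp)]
    have e11 := hfr₁ 11 (by decide)
    have e13 := hfr₁ 13 (by decide)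
    refine ⟨(hb₁.upd ?_).bump, by simp [e11, e13], fun a ha => ?_, rfl, rfl, rfl⟩
    · exact lt_of_le_of_lt (Nat.sub_le _ _) (hb₁.1 11)
    · rw [List.mem_cons, not_or] at ha
      simp [ha.1, hfr₁ a ha.2]
  rintro s₂ ⟨hb₂, h29, hfr₂, hm₂, hq₂, hp₂⟩
  have he₂ : Env X H cH w s₂ := he.of_low hb₂ (hfr₂ _ (by decide)) (hfr₂ _ (by decide))
    (hfr₂ _ (by decide)) (hfr₂ _ (by decide)) (hfr₂ _ (by decide)) (by rw [hm₂]; exact hlow)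
  have key := refines_rounds (i := 26) (b := 29) (offlineAccess_correct (cH := cH) hR hX) hR hX he₂
    (by rw [hm₂]; exact hT₁) ((hfr₂ 9 (by decide)).trans hM) (by decide) (by decide) (by decide)
    (by decide) (by decide) (by decide)
  rw [hfr₂ 10 (by decide), h29, hfr₂ 12 (by decide)] at key
  refine Refines.map ((key.and_support (sem_queryFree (X := X) _ rfl s₂)).mono ?_)
  rintro p s₃ ⟨⟨h12, -, h26, hb₃, hfr₃, hp₃⟩, hq₃⟩ t x hy
  simp only [Option.some.injEq, Prod.mk.injEq] at hy
  have hfr : ∀ a ∈ [8, 9, 13], s₃.reg a = s.reg a := fun a ha => by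
    rw [hfr₃ a (by revert a; decide) (by revert a; decide) (by revert a; decide),
      hfr₂ a (by revert a; decide)]
  refine ⟨hb₃, h12.trans hy.2, hfr _ (by decide), h26 ▸ hy.1, (hfr 9 (by decide)).trans hM,
    hfr _ (by decide), ?_, ?_⟩
  · rw [h26]; omega
  · omega

/-- The constant in the running time of the trials. -/
def searchCost (A h : ℕ) : ℕ :=
  onlineAccess.roundCost h + (A + 1) * sampleCost + offlineAccess.roundCost h + 30

/-- If the first phase reaches the target, there were at most `m` trials, and their time bounds the
queries. Otherwise `m` trials were made, so `t ≥ m`, and sampling `m * A * ℓ` edges costs time `O(ℓ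
t)` and `O(ℓ m)` queries. In both cases the queries are of order `ℓ * min m (t + 1)`. -/
theorem refines_search (hR : Room n h (denominator H X.numEdges) w) (hX : X.graph.edgeSet.Nonempty)
    (hc : ∀ e ∈ X.graph.edgeSet, X.color e < 2 ^ w) {s₀ s : Config}
    (hs : Ready X H cH w A r s₀ s) (h0 : ∀ a, 2 * (h * h) ≤ a → s₀.mem a = 0) :
    Refines (sem X w searchStmt s)
      (estimate X (trial X H cH (denominator H X.numEdges)) (target A (Nat.clog 2 n) r) X.numEdges
        (X.numEdges * (A * Nat.clog 2 n))
        (2 * (target A (Nat.clog 2 n) r * denominator H X.numEdges))) fun y s' =>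
      ∀ t x, y = some (t, x) →
      s'.Bounded w ∧ s'.reg 12 = x ∧ s'.reg 13 + s'.reg 26 = t ∧
      s'.reg 9 = denominator H X.numEdges ∧ s'.reg 8 = (colorEmbeddings H cH H cH).card ∧
      s'.pc ≤ s.pc + searchCost A h * ((Nat.clog 2 n + 1) * (t + 1)) ∧
      s'.queries ≤ s.queries + searchCost A h * ((Nat.clog 2 n + 1) * (2 * min X.numEdges (t + 1))) := by
  classical
  have hm := X.numEdges_pos hX
  set ℓ := Nat.clog 2 n with hℓ
  set m := X.numEdges with hmdef
  have hb := hs.env.bounded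
  have htgt : s.reg 10 = target A ℓ r := hs.target
  have hprobes : s.reg 27 = m * (A * ℓ) := hs.probes
  have htrials : s.reg 11 = 2 * (target A ℓ r * denominator H m) := hs.trials
  refine refines_always_seq (Q := fun s₁ => s₁.Bounded w ∧ s₁.reg 12 = 0 ∧
    (∀ a ≠ 12, s₁.reg a = s.reg a) ∧ s₁.mem = s.mem ∧ s₁.queries = s.queries ∧
    s₁.pc = s.pc + 3) ?_ ?_
  · rw [always_asg_iff hb, Term.val_eq_exact _ (by simp)]
    exact ⟨(hb.upd (by simp)).bump, by simp, fun a ha => by simp [ha], rfl, rfl, rfl⟩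
  rintro s₁ ⟨hb₁, h12, hfr₁, hm₁, hq₁, hp₁⟩
  have he₁ : Env X H cH w s₁ := hs.env.congr hb₁ (hfr₁ _ (by decide)) (hfr₁ _ (by decide))
    (hfr₁ _ (by decide)) (hfr₁ _ (by decide)) (hfr₁ _ (by decide)) (SameTables.of_mem hm₁)
  have key := refines_rounds (i := 13) (b := 1) (onlineAccess_correct (cH := cH) hR hX hc) hR hX he₁
    trivial ((hfr₁ 9 (by decide)).trans hs.denom) (by decide) (by decide) (by decide)
    (by decide) (by decide) (by decide)
  rw [hfr₁ 10 (by decide), he₁.r1, h12, htgt] at key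
  refine refines_seq ((key.and_support (sem_queries_le _ s₁)).and_abstract
    (R := fun q => q.2 ≤ target A ℓ r ∧ q.1 ≤ m ∧ (q.1 = m ∨ target A ℓ r ≤ q.2))
    fun q hq => ?_) ?_
  · obtain ⟨a1, a2, a3, a4⟩ := mem_support_countSuccesses (Nat.zero_le _) hq
    refine ⟨a1, by omega, by omega⟩
  rintro q s₂ ⟨⟨⟨g12, hs₂, g13, hb₂, hfr₂, hp₂⟩, hq₂⟩, a1, a2, a3⟩
  have hfr : ∀ a ∈ [0, 1, 3, 5, 19, 8, 9, 10, 11, 27], s₂.reg a = s.reg a := fun a ha => by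
    rw [hfr₂ a (by revert a; decide) (by revert a; decide) (by revert a; decide),
      hfr₁ a (by revert a; decide)]
  have hms : SameTables h s s₂ := (SameTables.of_mem hm₁).trans hs₂
  have he₂ : Env X H cH w s₂ := hs.env.congr hb₂ (hfr _ (by decide)) (hfr _ (by decide))
    (hfr _ (by decide)) (hfr _ (by decide)) (hfr _ (by decide)) hms
  have hv : (Term.reg 10 - .reg 12).val w s₂ = target A ℓ r - q.2 := by
    rw [Term.val_eq_exact _ (by simp)]
    simp [hfr 10 (by decide), htgt, g12]
  have hsz : (Term.reg 10 - .reg 12).size = 5 := rfl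
  have hK : ∀ u : ℕ, u ≤ (ℓ + 1) * u := fun u => Nat.le_mul_of_pos_left _ (by omega)
  have hsc : searchCost A h = onlineAccess.roundCost h + (A + 1) * sampleCost +
    offlineAccess.roundCost h + 30 := rfl
  have hon : (q.1 + 1) * onlineAccess.roundCost h + 20 ≤ (onlineAccess.roundCost h + 30) *
      (q.1 + 1) := by nlinarith
  have hon' : 30 ≤ onlineAccess.roundCost h := by rw [Access.roundCost]; omega
  by_cases hst : target A ℓ r ≤ q.2
  · rw [if_pos hst]
    refine refines_branch (fun _ => refines_pure ?_) fun hne => absurd (by rw [hv]; omega) hne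
    intro s₃ hs₃ t x hy
    simp only [Option.some.injEq, Prod.ext_iff] at hy
    simp only [sem, PMF.support_pure, Set.mem_singleton_iff] at hs₃
    have hb' := hb₂.bump (k := (Term.reg 10 - Term.reg 12).size + 1)
    rw [Term.val_eq_exact _ (by simp), Config.set_eq_upd (by simp)] at hs₃
    subst hs₃
    refine ⟨(hb'.upd (by simp)).bump, by simp [g12, hy], by simp [g13, hy], ?_, ?_, ?_, ?_⟩
    · simpa using (hfr 9 (by decide)).trans hs.denom
    · simpa using (hfr 8 (by decide)).trans hs.automorphisms
    · simp only [Config.pc_bump, Config.pc_upd, hsz, Term.size]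
      rw [← hy.1]
      have := hK (q.1 + 1)
      calc _ ≤ s.pc + (onlineAccess.roundCost h + 30) * (q.1 + 1) := by omega
        _ ≤ _ := Nat.add_le_add_left (Nat.mul_le_mul (by rw [hsc]; omega) this) _
    · simp only [Config.queries_bump, Config.queries_upd]
      rw [← hy.1]
      -- The factor 2 absorbs the additional 1 when all `m` trials of the first phase were used.
      have h1 : q.1 + 1 ≤ 2 * min m (q.1 + 1) := by omega
      have := hK (2 * min m (q.1 + 1))
      calc _ ≤ s.queries + (onlineAccess.roundCost h + 30) * (q.1 + 1) := by omega
        _ ≤ _ := Nat.add_le_add_left (Nat.mul_le_mul (by rw [hsc]; omega) (h1.trans this)) _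
  · rw [if_neg hst]
    have hqm : q.1 = m := by omega
    refine refines_branch (fun h0' => absurd h0' (by rw [hv]; omega)) fun _ => ?_
    have key₂ := refines_continue (s := s₂.bump ((Term.reg 10 - Term.reg 12).size + 1)) hR hX hc
      (he₂.congr he₂.bounded.bump rfl rfl rfl rfl rfl (SameTables.refl _))
      (tables_empty_of_sameTables (hs.tables.trans hms) h0)
      ((hfr 9 (by decide)).trans hs.denom)
    simp only [Config.reg_bump, hfr 10 (by decide), htgt, hfr 27 (by decide), hprobes,
      hfr 11 (by decide), htrials, g12, g13] at key₂
    refine key₂.mono fun y s₃ hQ t x hy => ?_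
    obtain ⟨k0, k1, k2, k3, k4, k5, k6, k7⟩ := hQ t x hy
    refine ⟨k0.bump, k1, by rw [Config.reg_bump, k2]; exact k3, k4,
      k5.trans ((hfr 8 (by decide)).trans hs.automorphisms), ?_, ?_⟩
    · have hU := hK (t + 1)
      have hl : m * ℓ ≤ (ℓ + 1) * (t + 1) := by
        rw [mul_comm]; exact Nat.mul_le_mul (by omega) (by omega)
      refine le_trans (b := s.pc + (((ℓ + 1) * (t + 1)) * onlineAccess.roundCost h +
        (((A + 1) * ((ℓ + 1) * (t + 1))) * sampleCost +
        ((ℓ + 1) * (t + 1)) * offlineAccess.roundCost h + 30 * ((ℓ + 1) * (t + 1))))) ?_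
        (by rw [hsc]; exact (by ring_nf; exact le_rfl))
      have b1 : (q.1 + 1) * onlineAccess.roundCost h ≤
        ((ℓ + 1) * (t + 1)) * onlineAccess.roundCost h := Nat.mul_le_mul_right _ (by omega)
      have b2 : (m * (A * ℓ) + 1) * sampleCost ≤ ((A + 1) * ((ℓ + 1) * (t + 1))) * sampleCost := by
        refine Nat.mul_le_mul_right _ ?_
        have := Nat.mul_le_mul_left A hl
        rw [add_mul, mul_left_comm]
        omega
      have b3 : (s₃.reg 26 + 1) * offlineAccess.roundCost h ≤
        ((ℓ + 1) * (t + 1)) * offlineAccess.roundCost h := Nat.mul_le_mul_right _ (by omega)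
      simp only [Config.pc_bump, hsz] at k6 ⊢
      omega
    · have hmin : min m (t + 1) = m := by omega
      rw [hmin]
      have hU := hK (2 * m)
      have hl : m * ℓ ≤ (ℓ + 1) * (2 * m) := by
        rw [mul_comm]; exact Nat.mul_le_mul (by omega) (by omega)
      refine le_trans (b := s.queries + (((ℓ + 1) * (2 * m)) * onlineAccess.roundCost h +
        (((A + 1) * ((ℓ + 1) * (2 * m))) * sampleCost + (30 * ((ℓ + 1) * (2 * m)) +
        ((ℓ + 1) * (2 * m)) * offlineAccess.roundCost h)))) ?_
        (by rw [hsc]; exact (by ring_nf; exact le_rfl))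
      have b1 : (q.1 + 1) * onlineAccess.roundCost h ≤
        ((ℓ + 1) * (2 * m)) * onlineAccess.roundCost h := Nat.mul_le_mul_right _ (by omega)
      have b2 : (m * (A * ℓ) + 1) * sampleCost ≤ ((A + 1) * ((ℓ + 1) * (2 * m))) * sampleCost := by
        refine Nat.mul_le_mul_right _ ?_
        have := Nat.mul_le_mul_left A hl
        rw [add_mul, mul_left_comm]
        omega
      simp only [Config.queries_bump] at k7 ⊢
      omega

/-- The constant in the running time of the whole program. -/
def mainCost (A h : ℕ) : ℕ := setupCost A h + searchCost A h + 30

/-- The output is `(x * M) / (t * a)` with `a` the number of automorphisms. That its two parts fit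
into a word is an assumption on the outcome, to be verified for good outcomes. -/
theorem refines_main (hC : Capacity X H w A r) (hA : 0 < A) (hh : 0 < h) (hr : 0 < r)
    (hX : X.graph.edgeSet.Nonempty) (hc : ∀ e ∈ X.graph.edgeSet, X.color e < 2 ^ w) {s : Config}
    (hs : Initial X H cH w r s) (h0 : ∀ a, 2 * (h * h) ≤ a → s.mem a = 0) :
    Refines (sem X w (mainStmt A) s)
      (estimate X (trial X H cH (denominator H X.numEdges)) (target A (Nat.clog 2 n) r) X.numEdges
        (X.numEdges * (A * Nat.clog 2 n))
        (2 * (target A (Nat.clog 2 n) r * denominator H X.numEdges))) fun y s' =>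
      ∀ t x, y = some (t, x) → x * denominator H X.numEdges < 2 ^ w →
      t * (colorEmbeddings H cH H cH).card < 2 ^ w →
      s'.reg 0 = x * denominator H X.numEdges ∧ s'.reg 1 = t * (colorEmbeddings H cH H cH).card ∧
      s'.pc ≤ s.pc + mainCost A h * ((Nat.clog 2 n + 1) * (t + 1)) ∧
      s'.queries ≤ s.queries +
        mainCost A h * ((Nat.clog 2 n + 1) * (2 * min X.numEdges (t + 1))) := by
  refine refines_always_seq ((always_setup hC hA hh hr hX hs).and
    (sem_queryFree (setupStmt A) rfl s)) ?_
  rintro s₁ ⟨⟨hs₁, hp₁⟩, hq₁⟩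
  refine refines_seq_always (refines_search hC.room hX hc hs₁ h0) ?_
  intro y s₂ hQ
  cases y with
  | none => intro s' _ t x hy; simp at hy
  | some p =>
  obtain ⟨t, x⟩ := p
  obtain ⟨hb₂, k12, kt, k9, k8, kp, kq⟩ := hQ t x rfl
  by_cases hov : x * denominator H X.numEdges < 2 ^ w ∧
      t * (colorEmbeddings H cH H cH).card < 2 ^ w
  swap
  · intro s' _ t' x' hy hx ht
    simp only [Option.some.injEq, Prod.mk.injEq] at hy
    rw [hy.1, hy.2] at hov
    exact absurd ⟨hx, ht⟩ hov
  obtain ⟨ho1, ho2⟩ := hov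
  refine Always.mono (Q := fun s' => s'.reg 0 = x * denominator H X.numEdges ∧
    s'.reg 1 = t * (colorEmbeddings H cH H cH).card ∧ s'.pc ≤ s₂.pc + 20 ∧
    s'.queries = s₂.queries) ?_ ?_
  · have haut : 0 < (colorEmbeddings H cH H cH).card := card_colorEmbeddings_self_pos
    have ht : t < 2 ^ w := lt_of_le_of_lt (Nat.le_mul_of_pos_right _ haut) ho2
    refine always_seq.2 ((always_asg_iff hb₂).2 ?_)
    have e1 : (Term.reg 12 * .reg 9).val w s₂ = x * denominator H X.numEdges := by
      rw [Term.val_eq_exact _ (by simp [k12, k9, ho1])]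
      simp [k12, k9]
    rw [e1]
    have hb₃ : (s₂.upd 0 (x * denominator H X.numEdges)).Bounded w := hb₂.upd ho1
    refine (always_asg_iff hb₃.bump).2 ?_
    rw [Term.val_eq_exact _ (by simp [kt, k8, ho2, ht])]
    refine ⟨by simp, by simp [kt, k8], ?_, rfl⟩
    simp only [Config.pc_bump, Config.pc_upd]
    rw [show (Term.reg 12 * .reg 9).size = 5 from rfl,
      show ((Term.reg 13 + .reg 26) * .reg 8).size = 8 from rfl]
    omega
  · rintro s' ⟨j0, j1, jp, jq⟩ t' x' hy - -
    simp only [Option.some.injEq, Prod.mk.injEq] at hy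
    obtain ⟨rfl, rfl⟩ := hy
    have hmc : mainCost A h = setupCost A h + searchCost A h + 30 := rfl
    refine ⟨j0, j1, ?_, ?_⟩
    · have h1 : setupCost A h * (Nat.clog 2 n + 1) ≤
          setupCost A h * ((Nat.clog 2 n + 1) * (t + 1)) :=
        Nat.mul_le_mul_left _ (Nat.le_mul_of_pos_right _ (by omega))
      have h2 : 1 ≤ (Nat.clog 2 n + 1) * (t + 1) := Nat.mul_pos (by omega) (by omega)
      rw [hmc, add_mul, add_mul]
      omega
    · rw [jq]
      refine kq.trans ?_
      rw [hq₁]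
      exact Nat.add_le_add_left (Nat.mul_le_mul_right _ (by omega)) _

end SubgraphCounting

/-! ### Accuracy and failure probability of the estimate -/

namespace SubgraphCounting

open scoped ENNReal

variable {n : ℕ} {X : InputGraph n}

/-- The number `t` of trials and the number `x` of successes give a good approximation to the
number `N`, where `N / M` is the probability of success. -/
structure GoodOutcome (ε : ℝ) (τ M N t x : ℕ) : Prop where
  pos : 0 < t
  successes : x ≤ τ
  trials : t * max N 1 ≤ 2 * (τ * M)
  approx : IsApprox ε ((x * M : ℝ) / t) N

section outcome

variable {ε : ℝ} {τ M N t x : ℕ}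

theorem goodOutcome_zero (ht : t = 2 * (τ * M)) (hτ : 0 < τ) (hM : 0 < M) :
    GoodOutcome ε τ M 0 t 0 where
  pos := by rw [ht]; positivity
  successes := Nat.zero_le _
  trials := by simp [ht]
  approx := by simp [IsApprox]

/-- The output is `N * τ / (p * t)` with `p = N / M`. The asymmetric bounds are what inversion
needs: `1 / (1 + ε) ≥ 1 - ε` and `1 / (1 - ε / 2) ≤ 1 + ε`. The upper bound also limits the trials,
because `1 + ε ≤ 2`. -/
theorem goodOutcome_of_pos (hε0 : 0 < ε) (hε1 : ε < 1) (hτ : 0 < τ) (hM : 0 < M) (hN : 0 < N)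
    (h1 : (1 - ε / 2) * τ ≤ N / M * t) (h2 : (N / M * t : ℝ) ≤ (1 + ε) * τ) :
    GoodOutcome ε τ M N t τ := by
  have hM' : (0 : ℝ) < M := by exact_mod_cast hM
  have hN' : (0 : ℝ) < N := by exact_mod_cast hN
  have hτ' : (0 : ℝ) < τ := by exact_mod_cast hτ
  have ht : 0 < t := by
    refine Nat.pos_of_ne_zero ?_
    rintro rfl
    have := mul_pos (show 0 < 1 - ε / 2 by linarith) hτ'
    simp at h1
    linarith
  have ht' : (0 : ℝ) < t := by exact_mod_cast ht
  rw [div_mul_eq_mul_div, le_div_iff₀ hM'] at h1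
  rw [div_mul_eq_mul_div, div_le_iff₀ hM'] at h2
  have hτM := mul_pos hτ' hM'
  refine ⟨ht, le_rfl, ?_, ?_, ?_⟩
  · have : (t * N : ℝ) ≤ 2 * (τ * M) := by nlinarith
    rw [max_eq_left (by omega)]
    exact_mod_cast this
  · rw [le_div_iff₀ ht']
    have h3 : (1 - ε) * (N * t) ≤ (1 - ε) * ((1 + ε) * τ * M) :=
      mul_le_mul_of_nonneg_left h2 (by linarith)
    nlinarith [mul_pos hτM (mul_pos hε0 hε0)]
  · rw [div_le_iff₀ ht']
    have h3 : (1 + ε) * ((1 - ε / 2) * τ * M) ≤ (1 + ε) * (N * t) :=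
      mul_le_mul_of_nonneg_left h1 (by linarith)
    nlinarith [mul_pos hτM (mul_pos hε0 (show 0 < 1 - ε by linarith))]

end outcome

theorem mean_collect_missing_le (hX : X.graph.edgeSet.Nonempty) (k : ℕ)
    [∀ q : ℕ × Finset (ℕ × ℕ), Decidable (q.2 = X.darts)] :
    (mean (X.collect k 0 ∅) fun q => if q.2 = X.darts then 0 else 1) ≤
      ENNReal.ofReal (X.numEdges * Real.exp (-(k / X.numEdges))) := by
  classical
  have h1 := X.one_le_collect hX k
  have h2 : (mean (X.collect k 0 ∅) fun q => if q.2 = X.darts then (1 : ℝ≥0∞) else 0) +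
      (mean (X.collect k 0 ∅) fun q => if q.2 = X.darts then 0 else 1) = 1 := by
    rw [← mean_add, ← mean_const (X.collect k 0 ∅) 1]
    refine mean_congr fun q _ => ?_
    split_ifs <;> simp
  have h3 : (mean (X.collect k 0 ∅) fun q => if q.2 = X.darts then (1 : ℝ≥0∞) else 0) ≠ ⊤ := by
    intro h
    rw [h, top_add] at h2
    exact ENNReal.top_ne_one h2
  refine (ENNReal.add_le_add_iff_left h3).1 ?_
  rw [h2]
  convert h1

section estimate

variable {μ : PMF Bool} {τ k t m : ℕ}

/-- The potential passes from the first phase to the second with the trials already made carried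
over. Collecting edges in between does not affect it, and a missed edge counts as badness 0. -/
theorem mean_estimate_badness_le {p : ℝ} (hp0 : 0 ≤ p) (hp1 : p ≤ 1)
    (hμ : μ true = ENNReal.ofReal p) (ε : ℝ) :
    (mean (estimate X μ τ m k t) fun y => y.elim 0 fun q => badness p ε τ q.2 q.1) ≤
      ENNReal.ofReal (2 * Real.exp (-(τ * ε ^ 2 / 16))) := by
  rw [estimate, mean_bind, ← badness_zero (p := p)]
  refine le_trans (mean_mono fun q _ => ?_)
    (by simpa using mean_badness_le hp0 hp1 hμ ε τ m 0 0 0)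
  split_ifs with h
  · simp
  · rw [continueOffline, mean_bind]
    refine le_trans (mean_mono (g' := fun _ => badness p ε τ q.2 q.1) fun c _ => ?_)
      (mean_const _ _).le
    split_ifs
    · rw [mean_map]
      exact mean_badness_le hp0 hp1 hμ ε τ _ 0 q.2 q.1
    · simp

theorem mean_estimate_none_le (hX : X.graph.edgeSet.Nonempty) :
    (mean (estimate X μ τ m k t) fun y => y.elim 1 fun _ => 0) ≤
      ENNReal.ofReal (X.numEdges * Real.exp (-(k / X.numEdges))) := by
  classical
  rw [estimate, mean_bind]
  refine le_trans (mean_mono fun q _ => ?_) (mean_const _ _).le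
  split_ifs with h
  · simp
  · refine le_trans ?_ (mean_collect_missing_le hX k)
    rw [continueOffline, mean_bind]
    refine mean_mono fun c _ => ?_
    split_ifs
    · rw [mean_map]; simp
    · simp

theorem mem_support_estimate (hmt : m ≤ t) {y : Option (ℕ × ℕ)}
    (hy : y ∈ (estimate X μ τ m k t).support) {T x : ℕ} (hyt : y = some (T, x)) :
    x ≤ τ ∧ (T = t ∨ x = τ) ∧ (μ true = 0 → x = 0) := by
  subst hyt
  rw [estimate, PMF.mem_support_bind_iff] at hy
  obtain ⟨q, hq, hy⟩ := hy
  obtain ⟨a1, a2, a3, a4⟩ := mem_support_countSuccesses (Nat.zero_le _) hq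
  have a5 : μ true = 0 → q.2 = 0 := fun h => eq_of_mem_support_countSuccesses h hq
  split_ifs at hy with h
  · simp only [PMF.support_pure, Set.mem_singleton_iff, Option.some.injEq] at hy
    subst hy
    exact ⟨a1, Or.inr (by simp at h ⊢; omega), a5⟩
  · rw [continueOffline, PMF.mem_support_bind_iff] at hy
    obtain ⟨c, -, hy⟩ := hy
    split_ifs at hy with hc
    · rw [PMF.mem_support_map_iff] at hy
      obtain ⟨p, hp, he⟩ := hy
      obtain ⟨b1, b2, b3, b4⟩ := mem_support_countSuccesses a1 hp
      have b5 : μ true = 0 → p.2 = q.2 := fun h => eq_of_mem_support_countSuccesses h hp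
      simp only [Option.some.injEq, Prod.mk.injEq] at he
      refine ⟨by omega, by omega, fun h => ?_⟩
      rw [← he.2, b5 h, a5 h]
    · simp at hy

-- A union bound in terms of means: for every outcome, the indicator of a good outcome, the badness
-- and the indicator of a missed edge add up to at least 1.
open Classical in
theorem one_le_mean_estimate (hX : X.graph.edgeSet.Nonempty) {N M : ℕ} (hM : 0 < M) (hτ : 0 < τ)
    (hμ : μ true = (N : ℝ≥0∞) / M) (ht : t = 2 * (τ * M)) (hmt : m ≤ t) {ε : ℝ} (hε0 : 0 < ε)
    (hε1 : ε < 1) :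
    1 ≤ (mean (estimate X μ τ m k t) fun y =>
        if ∃ T x, y = some (T, x) ∧ GoodOutcome ε τ M N T x then 1 else 0) +
      (ENNReal.ofReal (2 * Real.exp (-(τ * ε ^ 2 / 16))) +
      ENNReal.ofReal (X.numEdges * Real.exp (-(k / X.numEdges)))) := by
  have hM' : (0 : ℝ) < M := by exact_mod_cast hM
  have hτ' : (0 : ℝ) < τ := by exact_mod_cast hτ
  have hμ' : μ true = ENNReal.ofReal (N / M) := by
    rw [hμ, ENNReal.ofReal_div_of_pos hM', ENNReal.ofReal_natCast, ENNReal.ofReal_natCast]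
  have hp0 : (0 : ℝ) ≤ N / M := by positivity
  have hp1 : (N / M : ℝ) ≤ 1 := by
    have := μ.coe_le_one true
    rwa [hμ', ENNReal.ofReal_le_one] at this
  refine le_trans ?_ (add_le_add_right (add_le_add
    (mean_estimate_badness_le (X := X) (τ := τ) (k := k) (t := t) (m := m) hp0 hp1 hμ' ε)
    (mean_estimate_none_le (μ := μ) (τ := τ) (t := t) (m := m) hX)) _)
  rw [← mean_add, ← mean_add]
  refine (mean_const _ 1).ge.trans (mean_mono fun y hy => ?_)
  cases y with
  | none => simp
  | some q =>
  obtain ⟨T, x⟩ := q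
  obtain ⟨hx, hTx, h0⟩ := mem_support_estimate hmt hy rfl
  simp only [Option.elim_some, add_zero]
  by_cases hg : GoodOutcome ε τ M N T x
  · rw [if_pos ⟨T, x, rfl, hg⟩]
    exact le_self_add
  · refine le_trans (one_le_badness hp0 hp1 hε0 hε1 hx ?_) le_add_self
    by_contra hcon
    rw [not_or, not_and, not_lt, not_lt] at hcon
    rcases Nat.eq_zero_or_pos N with rfl | hN
    · have hx0 := h0 (by rw [hμ]; simp)
      subst hx0
      exact hg (goodOutcome_zero (by omega) hτ hM)
    · have hN' : (1 : ℝ) ≤ N := by exact_mod_cast hN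
      -- Running into the limit of `2τM` trials would mean `p * t = 2Nτ`, which exceeds `(1 + ε) τ`
      -- as soon as `N ≥ 1`. So an outcome that is not bad stops by reaching the target.
      have hxτ : x = τ := by
        refine hTx.resolve_left fun hT => ?_
        have h2 := hcon.2
        rw [hT, ht] at h2
        push_cast at h2
        rw [show (N / M * (2 * (τ * M)) : ℝ) = 2 * (N * τ) by field_simp] at h2
        nlinarith
      subst hxτ
      exact hg (goodOutcome_of_pos hε0 hε1 hτ hM hN (hcon.1 rfl) hcon.2)

end estimate

end SubgraphCounting

/-! ### The initial configuration and the word size -/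

namespace SubgraphCounting

open scoped ENNReal

variable {n : ℕ} {X : InputGraph n} {h : ℕ} {H : SimpleGraph (Fin h)} {cH : Sym2 (Fin h) → ℕ}
  {w : ℕ} {A r : ℕ}

theorem card_colorEmbeddings_self_le : (colorEmbeddings H cH H cH).card ≤ h ^ h := by
  classical
  refine (Finset.card_le_univ _).trans ?_
  simp

theorem initConfig_mem_adj {m : ℕ} {i j : ℕ} (hi : i < h) (hj : j < h) :
    (initConfig n m r h H cH).mem (i * h + j) = adjCode H i j := by
  classical
  have hij := mul_add_lt hi hj
  have e : finProdFinEquiv.symm (⟨i * h + j, hij⟩ : Fin (h * h)) = (⟨i, hi⟩, ⟨j, hj⟩) := by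
    rw [Equiv.symm_apply_eq]
    ext
    simp [finProdFinEquiv]
    ring
  have := adjCode_coe (H := H) ⟨i, hi⟩ ⟨j, hj⟩
  simp only [initConfig, dif_pos hij, e]
  exact this.symm

theorem initConfig_mem_col {m : ℕ} {i j : ℕ} (hi : i < h) (hj : j < h) :
    (initConfig n m r h H cH).mem (h * h + (i * h + j)) = colCode H cH i j := by
  classical
  have hij := mul_add_lt hi hj
  have e : finProdFinEquiv.symm (⟨i * h + j, hij⟩ : Fin (h * h)) = (⟨i, hi⟩, ⟨j, hj⟩) := by
    rw [Equiv.symm_apply_eq]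
    ext
    simp [finProdFinEquiv]
    ring
  have h1 : ¬ h * h + (i * h + j) < h * h := by omega
  simp only [initConfig, dif_neg h1, Nat.add_sub_cancel_left, dif_pos hij, e]
  rw [colCode, dif_pos ⟨hi, hj⟩]

theorem initConfig_mem_zero {m a : ℕ} (ha : 2 * (h * h) ≤ a) :
    (initConfig n m r h H cH).mem a = 0 := by
  have h1 : ¬ a < h * h := by
    have := Nat.zero_le (h * h)
    omega
  have h2 : ¬ a - h * h < h * h := by omega
  simp only [initConfig, dif_neg h1, dif_neg h2]

theorem initial_initConfig (hn : n < 2 ^ w) (hm : X.numEdges < 2 ^ w) (hr : r < 2 ^ w)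
    (hh : h < 2 ^ w) (hw : 1 < 2 ^ w) (hc : ∀ e ∈ H.edgeSet, cH e < 2 ^ w) :
    Initial X H cH w r (initConfig n X.numEdges r h H cH) where
  bounded := by
    classical
    constructor
    · intro i
      simp only [initConfig]
      split_ifs <;> omega
    · intro i
      simp only [initConfig]
      split_ifs with h1 h2 h3 h4
      · exact hw
      · omega
      · exact hc _ h4
      · omega
      · omega
  r0 := rfl
  r1 := rfl
  r2 := rfl
  r3 := rfl
  adj := fun _ hi _ hj => initConfig_mem_adj hi hj
  col := fun _ hi _ hj => initConfig_mem_col hi hj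

/-- The exponent in the bound on the word size. -/
def wordExponent (A h : ℕ) : ℕ := A + 10 * (h * h) + 20 * h + 50

/-- With `B = n * r ≥ 2`, a constant `a` is at most `B ^ a`, and all quantities are bounded by
powers of `B` whose exponents add up under multiplication. `wordExponent` exceeds every exponent
that arises. -/
theorem capacity_of_le (hh : 0 < h) (hr : 0 < r) (hX : X.graph.edgeSet.Nonempty)
    (hw : (n * r) ^ wordExponent A h ≤ 2 ^ w) : Capacity X H w A r := by
  have hn := X.two_le_of_edgeSet_nonempty hX
  have hm := X.numEdges_pos hX
  have hmn := X.two_mul_numEdges_le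
  obtain ⟨B, hB⟩ : ∃ B, B = n * r := ⟨_, rfl⟩
  rw [← hB] at hw
  have hnB : n ≤ B := hB ▸ Nat.le_mul_of_pos_right _ hr
  have hrB : r ≤ B := hB ▸ Nat.le_mul_of_pos_left _ (by omega)
  have hB2 : 2 ≤ B := hn.trans hnB
  have hfin : ∀ {a e : ℕ}, a ≤ B ^ e → e < wordExponent A h → a < 2 ^ w := fun ha he =>
    lt_of_lt_of_le (ha.trans_lt (Nat.pow_lt_pow_right (by omega) he)) hw
  have hconst : ∀ a : ℕ, a ≤ B ^ a := fun a =>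
    Nat.lt_two_pow_self.le.trans (Nat.pow_le_pow_left hB2 a)
  have hmul : ∀ {a b e f : ℕ}, a ≤ B ^ e → b ≤ B ^ f → a * b ≤ B ^ (e + f) := fun h1 h2 => by
    rw [pow_add]; exact Nat.mul_le_mul h1 h2
  have hpow : ∀ {a e : ℕ} (k : ℕ), a ≤ B ^ e → a ^ k ≤ B ^ (e * k) := fun k h1 => by
    rw [pow_mul]; exact Nat.pow_le_pow_left h1 k
  have hn1 : n ≤ B ^ 1 := by simpa using hnB
  have hr1 : r ≤ B ^ 1 := by simpa using hrB
  have hnn : n * n ≤ B ^ 2 := hmul hn1 hn1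
  have hhh : h ^ h ≤ B ^ (h * h) := hpow h (hconst h)
  have hl : Nat.clog 2 n ≤ B ^ 1 := clog_two_le.trans hn1
  have hside : side X.numEdges ≤ B ^ 2 := by
    have h1 := side_mul_side_lt hm
    have h2 : side X.numEdges ≤ 2 * n := by
      by_contra hcon
      have : (2 * n) * (2 * n) ≤ side X.numEdges * side X.numEdges :=
        Nat.mul_le_mul (by omega) (by omega)
      have e : (2 * n) * (2 * n) = 4 * (n * n) := by ring
      omega
    exact h2.trans (hmul (show 2 ≤ B ^ 1 by simpa using hB2) hn1)
  have hD : side X.numEdges ^ labelWeight H ≤ B ^ (2 * (h * h)) :=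
    (hpow _ hside).trans (Nat.pow_le_pow_right (by omega)
      (Nat.mul_le_mul_left _ labelWeight_le_sq))
  have hM : denominator H X.numEdges ≤ B ^ (h * h + 2 * (h * h)) := hmul hhh hD
  have hτ : target A (Nat.clog 2 n) r ≤ B ^ (A + (1 + (1 + 1))) :=
    hmul (hconst A) (hmul hl (hmul hr1 hr1))
  refine ⟨?_, ?_, ?_, ?_, ?_⟩
  · refine hfin (hmul (hmul (show 2 ≤ B ^ 1 by simpa using hB2) (hmul hτ hM)) hhh) ?_
    rw [wordExponent]; omega
  · refine hfin (hmul (show X.numEdges ≤ B ^ 2 by omega) (hmul (hconst A) hl)) ?_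
    rw [wordExponent]; omega
  · refine hfin (a := _) (e := (2 * (h * h) + 10 * h + 32) + 2) (le_trans ?_
      (hmul (hconst (2 * (h * h) + 10 * h + 32)) hnn)) ?_
    · have h1 : 1 ≤ n * n := Nat.mul_pos (by omega) (by omega)
      have h2 : n ≤ n * n := Nat.le_mul_of_pos_left _ (by omega)
      have h3 := Nat.le_mul_of_pos_right (2 * (h * h) + 9 * h + 16) h1
      rw [show (2 * (h * h) + 10 * h + 32) * (n * n) =
        (2 * (h * h) + 9 * h + 16) * (n * n) + 16 * (n * n) + (n * n) * h by ring]
      omega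
    · rw [wordExponent]; omega
  · refine hfin (hpow h (hmul (hconst h) hnn)) ?_
    rw [wordExponent, add_mul]; omega
  · refine hfin (hmul hM (hpow h hn1)) ?_
    rw [wordExponent]; omega

end SubgraphCounting

/-! ### Real estimates for failure probability, time and queries -/

namespace SubgraphCounting

open scoped ENNReal

variable {n : ℕ} {X : InputGraph n} {h : ℕ} {H : SimpleGraph (Fin h)} {cH : Sym2 (Fin h) → ℕ}
  {w : ℕ} {A r : ℕ}

theorem ratio_nonneg {m N : ℕ} : 0 ≤ ratio m H N := by
  rw [ratio]; positivity

/-- Write the power of `side m` as a power of its square with half the exponent: the square is at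
most `8m`, and half of `labelWeight` is at most `ρ`. -/
theorem denominator_le (h0 : 0 < h) (hH : ∀ a, ∃ b, H.Adj a b) {m : ℕ} (hm : 0 < m) :
    (denominator H m : ℝ) ≤
      h ^ h * 8 ^ fractionalEdgeCoverNumber H * (m : ℝ) ^ fractionalEdgeCoverNumber H := by
  have hm1 : (1 : ℝ) ≤ m := by exact_mod_cast hm
  have hs : ((side m : ℝ)) ^ 2 ≤ 8 * m := by
    have := (side_mul_side_lt hm).le
    rw [sq]
    exact_mod_cast this
  have hs0 : (0 : ℝ) ≤ side m := Nat.cast_nonneg _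
  rw [denominator]
  push_cast
  rw [mul_assoc, ← Real.mul_rpow (by norm_num) (by linarith)]
  refine mul_le_mul_of_nonneg_left ?_ (by positivity)
  calc (side m : ℝ) ^ labelWeight H = ((side m : ℝ) ^ 2) ^ ((labelWeight H : ℝ) / 2) := by
        rw [← Real.rpow_natCast, ← Real.rpow_natCast, ← Real.rpow_mul hs0]
        congr 1
        push_cast
        ring
    _ ≤ (8 * m : ℝ) ^ ((labelWeight H : ℝ) / 2) :=
        Real.rpow_le_rpow (by positivity) hs (by positivity)
    _ ≤ _ := by
        refine Real.rpow_le_rpow_of_exponent_le (by linarith) ?_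
        linarith [labelWeight_le h0 hH]

/-- Guarantees that the `m` trials of the first phase stay within the limit on all trials. -/
theorem numEdges_le_denominator (h0 : 0 < h) (hH : ∀ a, ∃ b, H.Adj a b) {m : ℕ} :
    m ≤ denominator H m := by
  have h1 := two_mul_le_side_mul_side m
  have h2 : side m * side m ≤ side m ^ labelWeight H := by
    rw [← sq]
    exact Nat.pow_le_pow_right (pow_pos two_pos _) (two_le_labelWeight h0 hH)
  have h3 : side m ^ labelWeight H ≤ denominator H m :=
    Nat.le_mul_of_pos_left _ (pow_pos h0 _)
  omega

theorem clog_le_log (hn : 2 ≤ n) : ((Nat.clog 2 n : ℕ) : ℝ) + 1 ≤ 6 * Real.log n := by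
  have hn' : (2 : ℝ) ≤ n := by exact_mod_cast hn
  have h2 := Real.log_two_gt_d9
  have hl : Real.log 2 ≤ Real.log n := Real.log_le_log (by norm_num) hn'
  have h1 : ((2 : ℝ)) ^ Nat.clog 2 n ≤ 2 * n := by exact_mod_cast (two_pow_clog_lt hn).le
  have h3 := Real.log_le_log (by positivity) h1
  rw [Real.log_pow, Real.log_mul (by norm_num) (by positivity)] at h3
  have h4 : (0 : ℝ) ≤ Nat.clog 2 n := Nat.cast_nonneg _
  nlinarith

theorem half_le_log (hn : 2 ≤ n) : 1 / 2 ≤ Real.log n := by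
  have hn' : (2 : ℝ) ≤ n := by exact_mod_cast hn
  have h2 := Real.log_two_gt_d9
  have hl : Real.log 2 ≤ Real.log n := Real.log_le_log (by norm_num) hn'
  linarith

theorem exp_neg_mul_clog_le (hn : 0 < n) (a : ℕ) :
    Real.exp (-(a * Nat.clog 2 n : ℕ)) ≤ 1 / (n : ℝ) ^ a := by
  have hn' : (0 : ℝ) < n := by exact_mod_cast hn
  rw [Real.exp_neg, one_div]
  refine inv_anti₀ (by positivity) ?_
  have h1 : (n : ℝ) ≤ Real.exp (Nat.clog 2 n) := by
    calc (n : ℝ) ≤ 2 ^ Nat.clog 2 n := by exact_mod_cast Nat.le_pow_clog (by norm_num) n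
      _ ≤ Real.exp 1 ^ Nat.clog 2 n := by
        gcongr
        have := Real.add_one_le_exp 1
        linarith
      _ = _ := by rw [← Real.exp_nat_mul, mul_one]
  calc (n : ℝ) ^ a ≤ Real.exp (Nat.clog 2 n) ^ a := by gcongr
    _ = _ := by rw [← Real.exp_nat_mul]; push_cast; rfl

/-- The factor `16 * (c + 2)` makes both exponents at least `(c + 2) ℓ`, so both exponentials are at
most `n ^ -(c + 2)`. From `n ≥ 2` and `m ≤ n² / 2` one gets `2 + m ≤ n²`, so the sum is at most `n ^
-c`. -/
theorem failure_le (c : ℕ) (hX : X.graph.edgeSet.Nonempty) {ε : ℝ} (hε : 0 < ε) (hr : 1 / ε ≤ r) :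
    2 * Real.exp (-((target (16 * (c + 2)) (Nat.clog 2 n) r : ℕ) * ε ^ 2 / 16)) +
      X.numEdges * Real.exp (-((X.numEdges * (16 * (c + 2) * Nat.clog 2 n) : ℕ) / X.numEdges)) ≤
      1 / (n : ℝ) ^ c := by
  have hn := X.two_le_of_edgeSet_nonempty hX
  have hm := X.numEdges_pos hX
  have hmn := X.two_mul_numEdges_le
  have hn' : (2 : ℝ) ≤ n := by exact_mod_cast hn
  have hm' : (0 : ℝ) < X.numEdges := by exact_mod_cast hm
  have hmn' : (2 * X.numEdges : ℝ) ≤ n ^ 2 := by rw [sq]; exact_mod_cast hmn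
  have hnc : (0 : ℝ) < (n : ℝ) ^ c := by positivity
  have e1 := exp_neg_mul_clog_le (n := n) (by omega) (c + 2)
  have h1 : Real.exp (-((target (16 * (c + 2)) (Nat.clog 2 n) r : ℕ) * ε ^ 2 / 16)) ≤
      1 / (n : ℝ) ^ (c + 2) := by
    refine le_trans (Real.exp_le_exp.2 ?_) e1
    have h2 : 1 ≤ r * ε := by rwa [div_le_iff₀ hε] at hr
    have h3 : 1 ≤ (r * ε) ^ 2 := one_le_pow₀ h2
    have h4 : (0 : ℝ) ≤ (c + 2) * Nat.clog 2 n := by positivity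
    rw [target]
    push_cast
    rw [show (16 * ((c : ℝ) + 2) * (Nat.clog 2 n * (r * r)) * ε ^ 2 / 16) =
      ((c + 2) * Nat.clog 2 n) * (r * ε) ^ 2 by ring]
    nlinarith
  have h2 : Real.exp (-((X.numEdges * (16 * (c + 2) * Nat.clog 2 n) : ℕ) / X.numEdges)) ≤
      1 / (n : ℝ) ^ (c + 2) := by
    refine le_trans (Real.exp_le_exp.2 ?_) e1
    have h4 : (0 : ℝ) ≤ (c + 2) * Nat.clog 2 n := by positivity
    push_cast
    rw [mul_div_cancel_left₀ _ hm'.ne']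
    nlinarith
  have h3 : 1 / (n : ℝ) ^ (c + 2) = 1 / (n : ℝ) ^ c * (1 / (n : ℝ) ^ 2) := by
    rw [pow_add, one_div_mul_one_div]
  rw [h3] at h1 h2
  have hn2 : (0 : ℝ) < (n : ℝ) ^ 2 := by positivity
  set u := 1 / (n : ℝ) ^ c with hu
  have hu0 : 0 < u := by positivity
  set v := 1 / (n : ℝ) ^ 2 with hv
  have hv0 : 0 < v := by positivity
  have hv4 : v ≤ 1 / 4 := by
    rw [hv]
    exact one_div_le_one_div_of_le (by norm_num) (by nlinarith)
  have hmv : X.numEdges * v ≤ 1 / 2 := by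
    rw [hv, mul_one_div, div_le_iff₀ hn2]
    linarith
  calc _ ≤ 2 * (u * v) + X.numEdges * (u * v) := by gcongr
    _ = u * (2 * v + X.numEdges * v) := by ring
    _ ≤ u * 1 := by gcongr; linarith
    _ = u := mul_one u

/-- This is where the exponent 2 of `log n / ε` comes from: the number of trials contains `L / ε²`
through the target, and `l + 1` contributes the second logarithm. -/
theorem scaled_bounds {K U L l ε m R T : ℝ} (hK : 0 ≤ K) (hU : 0 ≤ U) (hL : 1 / 2 ≤ L)
    (hl0 : 0 ≤ l) (hl : l + 1 ≤ 6 * L) (hε0 : 0 < ε) (hε1 : ε < 1) (hm : 0 ≤ m) (hR : 0 ≤ R)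
    (hT0 : 0 ≤ T) (hT : T ≤ U * (L / ε ^ 2) * R) :
    K * ((l + 1) * T) ≤ 24 * K * (U + 1) * (L / ε) ^ 2 * R ∧
    K * ((l + 1) * (2 * min m T)) ≤ 24 * K * (U + 1) * (L / ε) ^ 2 * min m R := by
  have hL0 : 0 ≤ L := by linarith
  obtain ⟨Q, hQ⟩ : ∃ Q, Q = (L / ε) ^ 2 := ⟨_, rfl⟩
  have hQ0 : 0 ≤ Q := hQ ▸ sq_nonneg _
  have hLQ : L ≤ 2 * Q := by
    have h1 : ε ^ 2 ≤ 1 := by nlinarith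
    rw [hQ, div_pow, ← mul_div_assoc, le_div_iff₀ (by positivity)]
    nlinarith
  have hT' : (l + 1) * T ≤ 6 * (U * Q * R) := by
    calc (l + 1) * T ≤ 6 * L * (U * (L / ε ^ 2) * R) := mul_le_mul hl hT hT0 (by positivity)
      _ = 6 * (U * Q * R) := by rw [hQ]; field_simp
  rw [← hQ]
  have hC : 0 ≤ 24 * K * (U + 1) * Q := by positivity
  have h1 : 0 ≤ K * Q * R := by positivity
  have h2 : 0 ≤ K * Q * R * U := by positivity
  have hKT := mul_le_mul_of_nonneg_left hT' hK
  constructor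
  · linarith
  · rw [mul_min_of_nonneg m R hC]
    refine le_min ?_ ?_
    · have h3 : (l + 1) * (2 * min m T) ≤ 12 * Q * (2 * m) :=
        mul_le_mul (by linarith) (by linarith [min_le_left m T])
          (by linarith [le_min hm hT0]) (by positivity)
      have h4 := mul_le_mul_of_nonneg_left h3 hK
      have h5 : 0 ≤ K * Q * m * U := by positivity
      linarith
    · have h3 : (l + 1) * (2 * min m T) ≤ (l + 1) * (2 * T) :=
        mul_le_mul_of_nonneg_left (by linarith [min_le_right m T]) (by linarith)
      have h4 := mul_le_mul_of_nonneg_left h3 hK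
      linarith

/-- The constant in the bounds on time and queries. -/
noncomputable def boundConstant (A : ℕ) (H : SimpleGraph (Fin h)) : ℝ :=
  24 * mainCost A h * (96 * A * (h ^ h * 8 ^ fractionalEdgeCoverNumber H) + 1)

/-- The unknown `N` enters only through `t * max N 1 ≤ 2τM`. With `τ = O(log n / ε²)` and `M = O(m ^
ρ)` this bounds `t` by the required ratio. -/
theorem resources_le (h0 : 0 < h) (hH : ∀ a, ∃ b, H.Adj a b) (hn : 2 ≤ n) {m : ℕ} (hm : 0 < m)
    {ε : ℝ} (hε0 : 0 < ε) (hε1 : ε < 1) (hr : (r : ℝ) ≤ 2 / ε) {N t : ℕ} (ht0 : 0 < t)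
    (ht : t * max N 1 ≤ 2 * (target A (Nat.clog 2 n) r * denominator H m)) :
    (mainCost A h * ((Nat.clog 2 n + 1) * (t + 1)) : ℝ) ≤
      boundConstant A H * (Real.log n / ε) ^ 2 * ratio m H N ∧
    (mainCost A h * ((Nat.clog 2 n + 1) * (2 * min (m : ℝ) (t + 1))) : ℝ) ≤
      boundConstant A H * (Real.log n / ε) ^ 2 * min (m : ℝ) (ratio m H N) := by
  have hm' : (0 : ℝ) < m := by exact_mod_cast hm
  have hL := half_le_log hn
  have hl := clog_le_log hn
  set L := Real.log n with hLdef
  set ℓ : ℝ := ((Nat.clog 2 n : ℕ) : ℝ) with hℓ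
  have hℓ0 : 0 ≤ ℓ := Nat.cast_nonneg _
  set ρ := fractionalEdgeCoverNumber H
  set W : ℝ := h ^ h * 8 ^ ρ with hW
  have hW0 : 0 ≤ W := by positivity
  have hD := denominator_le h0 hH hm
  have hN1 : (0 : ℝ) < (max N 1 : ℕ) := by
    have : 0 < max N 1 := by omega
    exact_mod_cast this
  have hR : ratio m H N = (m : ℝ) ^ ρ / (max N 1 : ℕ) := rfl
  have hR0 : 0 ≤ ratio m H N := ratio_nonneg
  have hτ : ((target A (Nat.clog 2 n) r : ℕ) : ℝ) ≤ A * (6 * L * (2 / ε) ^ 2) := by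
    rw [target]
    push_cast
    gcongr
    · linarith
    · rw [sq]; gcongr
  have htr : (t + 1 : ℝ) ≤ 96 * A * W * (L / ε ^ 2) * ratio m H N := by
    have h1 : (t * (max N 1 : ℕ) : ℝ) ≤
        2 * ((target A (Nat.clog 2 n) r : ℕ) * denominator H m) := by exact_mod_cast ht
    have h2 : (t : ℝ) ≤ 2 * ((A * (6 * L * (2 / ε) ^ 2)) * (W * (m : ℝ) ^ ρ)) / (max N 1 : ℕ) := by
      rw [le_div_iff₀ hN1]
      refine h1.trans ?_
      gcongr
    have h3 : (1 : ℝ) ≤ t := by exact_mod_cast ht0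
    calc (t + 1 : ℝ) ≤ 2 * t := by linarith
      _ ≤ 2 * (2 * ((A * (6 * L * (2 / ε) ^ 2)) * (W * (m : ℝ) ^ ρ)) / (max N 1 : ℕ)) := by gcongr
      _ = _ := by rw [hR]; field_simp; ring
  exact scaled_bounds (Nat.cast_nonneg _) (by positivity) hL hℓ0 hl hε0 hε1 hm'.le hR0
    (by positivity) htr

end SubgraphCounting

/-! ### Assembly -/

namespace SubgraphCounting

open scoped ENNReal

variable {n : ℕ} {X : InputGraph n} {h : ℕ} {H : SimpleGraph (Fin h)} {cH : Sym2 (Fin h) → ℕ}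
  {w : ℕ} {A r : ℕ}

/-- The approximation to the number of embeddings gives one to the number of copies. -/
theorem isApprox_div {ε a N B : ℝ} (hB : 0 < B) (h : IsApprox ε a (N * B)) :
    IsApprox ε (a / B) N := by
  obtain ⟨h1, h2⟩ := h
  exact ⟨by rw [le_div_iff₀ hB]; linarith, by rw [div_le_iff₀ hB]; linarith⟩

theorem ceil_one_div_le {ε : ℝ} (hε0 : 0 < ε) (hε1 : ε < 1) : (⌈1 / ε⌉₊ : ℝ) ≤ 2 / ε := by
  have h1 : 1 ≤ 1 / ε := by rw [le_div_iff₀ hε0]; linarith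
  have h2 := (Nat.ceil_lt_add_one (a := 1 / ε) (by positivity)).le
  have h3 : 2 / ε = 1 / ε + 1 / ε := by ring
  linarith

/-- The success probability is passed along from `estimate` to the structured program by
`refines_main`, and from there to the machine by `run_compiled`. -/
theorem one_sub_le_successProb (c : ℕ) (h0 : 0 < h) (hH : ∀ a, ∃ b, H.Adj a b)
    (hX : X.graph.edgeSet.Nonempty) {ε : ℝ} (hε0 : 0 < ε) (hε1 : ε < 1)
    (hw : (n * ⌈1 / ε⌉₊) ^ wordExponent (16 * (c + 2)) h ≤ 2 ^ w)
    (hcH : ∀ e ∈ H.edgeSet, cH e < 2 ^ w) (hcX : ∀ e ∈ X.graph.edgeSet, X.color e < 2 ^ w) :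
    ENNReal.ofReal (1 - 1 / (n : ℝ) ^ c) ≤
      successProb ((mainStmt (16 * (c + 2))).code 0) w ε H cH X
        (boundConstant (16 * (c + 2)) H * (Real.log n / ε) ^ 2 *
          ratio X.numEdges H (colorfulCopyCount X.graph X.color H cH))
        (boundConstant (16 * (c + 2)) H * (Real.log n / ε) ^ 2 *
          min (X.numEdges : ℝ)
            (ratio X.numEdges H (colorfulCopyCount X.graph X.color H cH)))
        (colorfulCopyCount X.graph X.color H cH) := by
  classical
  set A := 16 * (c + 2) with hAdef
  set r := ⌈1 / ε⌉₊ with hrdef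
  set N := colorfulCopyCount X.graph X.color H cH with hNdef
  have hn := X.two_le_of_edgeSet_nonempty hX
  have hm := X.numEdges_pos hX
  have hr : 0 < r := Nat.ceil_pos.2 (by positivity)
  have hA : 0 < A := by omega
  have hl : 0 < Nat.clog 2 n := Nat.clog_pos (by norm_num) hn
  have hC : Capacity X H w A r := capacity_of_le h0 hr hX hw
  obtain ⟨f1, f2, f3, f4, f5, f6, f7, f8, f9⟩ := hC.facts hA h0 hr hn hm
  obtain ⟨hw1, hw2, hw0⟩ := hC.room.facts
  have hsq := hC.room.sq
  have hnn : n ≤ n * n := Nat.le_mul_of_pos_left _ (by omega)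
  have hmn := X.two_mul_numEdges_le
  have hrr : r ≤ r * r := Nat.le_mul_of_pos_left _ hr
  have hM : 0 < denominator H X.numEdges := denominator_pos h0
  have hτ : 0 < target A (Nat.clog 2 n) r := Nat.mul_pos hA (Nat.mul_pos hl (Nat.mul_pos hr hr))
  have haut : 0 < (colorEmbeddings H cH H cH).card := card_colorEmbeddings_self_pos
  have hcount : (colorEmbeddings X.graph X.color H cH).card =
      N * (colorEmbeddings H cH H cH).card := card_colorEmbeddings
  set s₀ := initConfig n X.numEdges r h H cH with hs₀
  have hinit : Initial X H cH w r s₀ :=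
    initial_initConfig (by omega) (by omega) (by omega) (by omega) (by omega) hcH
  have hmt : X.numEdges ≤ 2 * (target A (Nat.clog 2 n) r * denominator H X.numEdges) := by
    have h1 := numEdges_le_denominator h0 hH (m := X.numEdges)
    have h2 := Nat.le_mul_of_pos_left (denominator H X.numEdges) hτ
    omega
  have hest := one_le_mean_estimate (k := X.numEdges * (A * Nat.clog 2 n)) hX hM hτ
    (trial_apply_true (cH := cH) hX h0 hH (two_mul_le_side_mul_side _) rfl) rfl hmt hε0 hε1
  have hfail := failure_le c hX hε0 (Nat.le_ceil (1 / ε))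
  rw [← ENNReal.ofReal_add (by positivity) (by positivity)] at hest
  have hprob := hest.trans (add_le_add_right (ENNReal.ofReal_le_ofReal hfail) _)
  rw [ENNReal.ofReal_sub _ (by positivity), ENNReal.ofReal_one]
  refine (tsub_le_iff_right.2 hprob).trans ?_
  refine ((refines_main hC hA h0 hr hX hcX hinit fun a ha => initConfig_mem_zero ha)
    (Set.indicator _ 1) _ ?_).trans ((mean_indicator _ _).le.trans
    (run_compiled (mainStmt A) rfl s₀ hinit.bounded rfl ?_))
  · intro y s' hQ
    split_ifs with hy
    swap
    · exact zero_le
    obtain ⟨t, x, rfl, hg⟩ := hy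
    -- The trials are bounded in terms of the number of embeddings, which is at least the number of
    -- copies.
    have ht : t * max N 1 ≤ 2 * (target A (Nat.clog 2 n) r * denominator H X.numEdges) := by
      refine le_trans (Nat.mul_le_mul_left _ ?_) hg.trials
      rw [hcount]
      exact max_le_max_right _ (Nat.le_mul_of_pos_right _ haut)
    have hx : x * denominator H X.numEdges < 2 ^ w :=
      (Nat.mul_le_mul_right _ hg.successes).trans_lt f5
    have hta : t * (colorEmbeddings H cH H cH).card < 2 ^ w := by
      refine lt_of_le_of_lt (Nat.mul_le_mul ?_ card_colorEmbeddings_self_le) hC.trials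
      exact (Nat.le_mul_of_pos_right _ (by omega)).trans ht
    obtain ⟨k0, k1, kp, kq⟩ := hQ t x rfl hx hta
    obtain ⟨res1, res2⟩ := resources_le h0 hH hn hm hε0 hε1 (ceil_one_div_le hε0 hε1) hg.pos ht
    rw [Set.indicator_of_mem]
    · rfl
    refine ⟨Nat.le_floor (le_trans ?_ res1), ?_⟩
    · have : s'.pc ≤ mainCost A h * ((Nat.clog 2 n + 1) * (t + 1)) := by
        simpa [s₀, initConfig] using kp
      exact_mod_cast this
    · refine ⟨(Stmt.length_code _ _).le, le_trans ?_ res2, ?_, ?_⟩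
      · have : s'.queries ≤
            mainCost A h * ((Nat.clog 2 n + 1) * (2 * min X.numEdges (t + 1))) := by
          simpa [s₀, initConfig] using kq
        exact_mod_cast this
      · change s'.reg 1 ≠ 0
        rw [k1]
        exact (Nat.mul_pos hg.pos haut).ne'
      · change IsApprox ε ((s'.reg 0 : ℝ) / (s'.reg 1 : ℝ)) N
        have := hg.approx
        rw [hcount] at this
        push_cast at this
        rw [k0, k1]
        push_cast
        rw [← div_div]
        exact isApprox_div (by exact_mod_cast haut) this
  · rintro s s' ⟨e1, e2, e3, e4⟩ ⟨j1, j2, j3, j4⟩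
    refine ⟨j1, ?_, ?_, ?_⟩
    · change (s'.queries : ℝ) ≤ _
      rw [e3]; exact j2
    · change s'.reg 1 ≠ 0
      rw [e1 1 (by norm_num)]; exact j3
    · change IsApprox ε ((s'.reg 0 : ℝ) / (s'.reg 1 : ℝ)) N
      rw [e1 0 (by norm_num), e1 1 (by norm_num)]; exact j4

end SubgraphCounting


open SubgraphCounting in
/-- For every exponent `c` there are a single program and a single exponent `k` such that for every
`H` without isolated vertices (and with at least one edge) there are constants `C`, `K` depending
only on `c` and `H` for which the guarantee holds on all inputs, with words of `O(log (n / ε))` bits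
(that are also long enough to hold the colors). -/
theorem theorem1 (c : ℕ) :
    -- counting copies of `H` in an uncolored graph
    (∃ (P : Program) (k : ℕ), ∀ (h : ℕ) (H : SimpleGraph (Fin h)),
      0 < h → (∀ a, ∃ b, H.Adj a b) →
      ∃ (C : ℝ) (K : ℕ), ∀ (n : ℕ) (X : InputGraph n),
        X.graph.edgeSet.Nonempty → (X.color = fun _ => 0) →
        ∀ (ε : ℝ), 0 < ε → ε < 1 →
        ∀ (w : ℕ), (n * ⌈1 / ε⌉₊) ^ K ≤ 2 ^ w →
        ENNReal.ofReal (1 - 1 / (n : ℝ) ^ c) ≤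
          successProb P w ε H (fun _ => 0) X
            (C * (Real.log n / ε) ^ k * ratio X.numEdges H (X.graph.copyCount H))
            (C * (Real.log n / ε) ^ k *
              min (X.numEdges : ℝ) (ratio X.numEdges H (X.graph.copyCount H)))
            (X.graph.copyCount H)) ∧
    -- counting colorful copies of `H` in an edge-colored graph
    (∃ (P : Program) (k : ℕ), ∀ (h : ℕ) (H : SimpleGraph (Fin h)),
      0 < h → (∀ a, ∃ b, H.Adj a b) →
      ∃ (C : ℝ) (K : ℕ), ∀ (cH : Sym2 (Fin h) → ℕ) (n : ℕ) (X : InputGraph n),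
        X.graph.edgeSet.Nonempty →
        ∀ (ε : ℝ), 0 < ε → ε < 1 →
        ∀ (w : ℕ), (n * ⌈1 / ε⌉₊) ^ K ≤ 2 ^ w →
        (∀ e ∈ H.edgeSet, cH e < 2 ^ w) → (∀ e ∈ X.graph.edgeSet, X.color e < 2 ^ w) →
        ENNReal.ofReal (1 - 1 / (n : ℝ) ^ c) ≤
          successProb P w ε H cH X
            (C * (Real.log n / ε) ^ k *
              ratio X.numEdges H (colorfulCopyCount X.graph X.color H cH))
            (C * (Real.log n / ε) ^ k *
              min (X.numEdges : ℝ)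
                (ratio X.numEdges H (colorfulCopyCount X.graph X.color H cH)))
            (colorfulCopyCount X.graph X.color H cH)) := by
  constructor
  -- The uncolored statement is the colored one for constant colors, with the same program and
  -- constants.
  · refine ⟨(mainStmt (16 * (c + 2))).code 0, 2, fun h H h0 hH =>
      ⟨boundConstant (16 * (c + 2)) H, wordExponent (16 * (c + 2)) h,
        fun n X hX hcol ε hε0 hε1 w hw => ?_⟩⟩
    have := one_sub_le_successProb (cH := fun _ => 0) c h0 hH hX hε0 hε1 hw
      (fun _ _ => Nat.two_pow_pos w) (fun e _ => by rw [hcol]; exact Nat.two_pow_pos w)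
    rwa [hcol, ← copyCount_eq_colorfulCopyCount] at this
  · exact ⟨(mainStmt (16 * (c + 2))).code 0, 2, fun h H h0 hH =>
      ⟨boundConstant (16 * (c + 2)) H, wordExponent (16 * (c + 2)) h,
        fun cH n X hX ε hε0 hε1 w hw hcH hcX =>
          one_sub_le_successProb c h0 hH hX hε0 hε1 hw hcH hcX⟩⟩
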